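/- **Setting.** Let $\lambda(v)=e^{|v|}$ and $\tilde\lambda(v)=e^{|v|}/(1+|v|)$ on $\mathbb R^3$. For $\nu\in\{\lambda,\tilde\lambda\}$ let $H^n_\nu$ be the closure of $C_c^\infty(\mathbb R^3)$ in the norm $\|u\|^2_{H^n_\nu}=\sum_{|\alpha|\le n}\|\nu^{1/2}D^\alpha u\|_{L^2}^2$, and for $A\ge1$ let $V^n_{A,\nu}$ be the closure of $C_c^\infty([0,\infty)\times\mathbb R^3)$ in the norm $\|f\|^2_{V^n_{A,\nu}}=\int_0^\infty e^{-At}\|f(t,\cdot)\|^2_{H^n_\nu}\,dt$ (all functions real-valued). Write $\mathcal L(g)(z,v)=\int_0^\infty e^{-zt}g(t,v)\,dt$ for the Laplace transform in time; on the line $\operatorname{Re}z=a$, for $g\in L^2(e^{-2at}dt\,dv)$, it is understood as the $L^2$-limit of $\int_0^T$ as $T\to\infty$. Let $\phi$ be the potential with $\hat\phi(k)=(2\pi)^{-3/2}\int\phi(x)e^{-ik\cdot x}dx=(1+|k|^2)^{-3/2}$, and $$K[\nu](\tau,v)=\int\!\!\int\nabla\phi(x)\otimes\nabla\phi(x-\tau(v-v'))\,\nu(v')\,dv'\,dx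 .$$ Fix $\varphi\in C_c^\infty(\mathbb R^3)$ with $\varphi\ge0$, $\operatorname{supp}\varphi\subset \overline{B_1(0)}$, $\int\varphi=1$; for $\gamma\in(0,1]$ put $\varphi_\gamma(v)=\gamma^{-3}\varphi(v/\gamma)$ and ${}^\gamma\nabla g=\nabla(\varphi_\gamma*g)$. For $\varepsilon>0$, multi-indices $\beta\le\alpha$ and $u$, $\nu$ depending on $(t,v)$, define $$Q^{\alpha,\beta}_{\varepsilon,A}[\nu](u)=\int_0^\infty\!\!\int\frac{e^{-At}}{\varepsilon}\,{}^\gamma\nabla(D^\alpha u(t)\lambda)\cdot\int_0^t D^{\alpha-\beta}K[\nu(s)]\big(\tfrac{t-s}\varepsilon,v\big)\,{}^\gamma\nabla D^\beta u(s)\,ds\,dv\,dt-\int_0^\infty\!\!\int\frac{e^{-At}}{\varepsilon}\,{}^\gamma\nabla(D^\alpha u(t)\lambda)\cdot\int_0^t D^{\alpha-\beta}\,{}^\gamma\nabla\!\cdot\! K[\nu(s)]\big(\tfrac{t-s}\varepsilon,v\big)\,D^\beta u(s)\,ds\,dv\,dt .$$ A function $u_0=u_0(v)$ is regarded as constant in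 time in the first argument. With $a=A/2$, $z=a+i\omega$, let $$D^\alpha_{\varepsilon,A}(u)=\int_{\mathbb R}\int_{\mathbb R^3}B_1(\varepsilon z,v)\big[{}^\gamma\nabla D^\alpha\mathcal L(u)(z,v),{}^\gamma\nabla D^\alpha\mathcal L(u)(z,v)\big]\lambda(v)\,dv\,d\omega,$$ where, with $P_v$ the orthogonal projection onto the line of $v$, $P_v^\perp=1-P_v$, $|W|_v=|P_v^\perp W|+\frac{|P_vW|}{1+|v|}$, $\mathsf a(z,v)=\frac{|\operatorname{Im}z|}{1+|v|}$, $\mathsf b(z,v)=\frac{|\operatorname{Re}z|}{1+|v|}$, $$B_1(z,v)[V,W]=\frac{|V|_v|W|_v}{(1+|v|)(1+\mathsf a)^2}+\frac{\mathsf b+\mathsf a^2}{(1+|v|)(1+\mathsf a)^4}|P_vV||P_vW| .$$ For $A,\delta,\tilde R,\delta_1,R,\varepsilon$ let $\Omega=\Omega^{A,\delta}_{\tilde R,\delta_1,R,\varepsilon}$ be the set of $f\in V^n_{A,\tilde\lambda}$ with $\int f(t,v)\,dv=0$ for a.e. $t$, $\operatorname{supp}f\subset[0,2\delta_1]\times\mathbb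 R^3$, $\partial_tf\in V^{n-2}_{A,\tilde\lambda}$, $\|f\|_{V^n_{A,\tilde\lambda}}+\|\partial_tf\|_{V^{n-2}_{A,\tilde\lambda}}\le1$, $\operatorname{ess\,sup}_{t\in[0,1]}\|\partial_tf(t)\|_{H^{n-4}_{\tilde\lambda}}\le\tilde R$, $\|f\|_{G}\le R$, and $f=f_1+f_2$ for some $f_1,f_2$ with $\|f_1\|_{E}\le\delta$, $\|f_2\|_{F}\le R$. Here each of the norms $E,F,G$ is $\sup|D_v^\beta\mathcal L(g)(z,v)|\,w(z)\,e^{|v|/2}$ over $v\in\mathbb R^3$, $\operatorname{Re}z=A/2$, $|\beta|\le n-6$, with $w=1+|z|^2$ for $E$, $w=\frac{(1+|z|^2)(1+\varepsilon|z|)}{\varepsilon|z|}$ for $F$, and $w=(1+|z|^2)(1+\varepsilon|z|)$ for $G$. **Statement.** Let $n\ge12$, $c>0$ and $M>0$. There is $C>0$ such that for all $A\ge1$ there is $\delta_0>0$ such that for all $\delta,\delta_1\in(0,\delta_0]$ and all $\tilde R,R>0$ there is $\varepsilon_0>0$ such that for all $\varepsilon\in(0,\varepsilon_0]$, $\gamma\in(0,1]$,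 all multi-indices $\alpha\in\mathbb N^3$ with $|\alpha|\le n$, all $u_0\in H^n_\lambda$ with $\|u_0\|_{H^n_\lambda}\le M$, all $f\in\Omega^{A,\delta}_{\tilde R,\delta_1,R,\varepsilon}$ and all $u\in V^n_{A,\lambda}$, the integrals over $s$ and over $(t,v)$ defining $Q^{\alpha,\beta}_{\varepsilon,A}[u_0](u)$ and $Q^{\alpha,\beta}_{\varepsilon,A}[f](u)$, $\beta<\alpha$, converge absolutely and $$\sum_{\beta<\alpha}\binom\alpha\beta\big|Q^{\alpha,\beta}_{\varepsilon,A}[u_0](u)\big|\le c\,D^\alpha_{\varepsilon,A}(u)+C\|u\|^2_{V^n_{A,\lambda}},\qquad \sum_{\beta<\alpha}\binom\alpha\beta\big|Q^{\alpha,\beta}_{\varepsilon,A}[f](u)\big|\le c\,D^\alpha_{\varepsilon,A}(u)+C\|u\|^2_{V^n_{A,\lambda}} .$$ -/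

import Mathlib

open MeasureTheory Set Filter Topology
open scoped ENNReal ContDiff

noncomputable section

namespace WeakCoupling

/-- Velocity space `ℝ³`. -/
abbrev E : Type := EuclideanSpace ℝ (Fin 3)

/-- Multi-indices in `ℕ³`, with the componentwise order. -/
abbrev MIdx : Type := Fin 3 → ℕ

/-- `|α| = α₁ + α₂ + α₃`. -/
def MIdx.abs (α : MIdx) : ℕ := ∑ i, α i

/-- The multi-index binomial coefficient. -/
def MIdx.binom (α β : MIdx) : ℕ := ∏ i, (α i).choose (β i)

/-- The finite set of multi-indices with `|α| ≤ n`. -/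
def midxLE (n : ℕ) : Finset MIdx :=
  (Finset.Iic (fun _ => n : MIdx)).filter (fun α => α.abs ≤ n)

/-- The `i`-th standard basis vector of `ℝ³`. -/
def basisVec (i : Fin 3) : E := EuclideanSpace.single i (1 : ℝ)

/-- The classical partial derivative `∂_i g`. -/
def pd {F : Type*} [NormedAddCommGroup F] [NormedSpace ℝ F] (i : Fin 3) (g : E → F) : E → F :=
  fun v => fderiv ℝ g v (basisVec i)

/-- The classical derivative `D^α g`. -/
def mderiv {F : Type*} [NormedAddCommGroup F] [NormedSpace ℝ F] (α : MIdx) (g : E → F) : E → F :=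
  (pd 0)^[α 0] ((pd 1)^[α 1] ((pd 2)^[α 2] g))

/-! ### Weights and function spaces -/

/-- `λ(v) = e^{|v|}`. -/
def lam (v : E) : ℝ := Real.exp ‖v‖

/-- `λ̃(v) = e^{|v|} / (1 + |v|)`. -/
def lamT (v : E) : ℝ := Real.exp ‖v‖ / (1 + ‖v‖)

/-- The `H^n_ν` norm of a function given together with its derivatives `U α = D^α u`. -/
def hNorm (n : ℕ) (ν : E → ℝ) (U : MIdx → E → ℝ) : ℝ≥0∞ :=
  (∑ α ∈ midxLE n, ∫⁻ v, ENNReal.ofReal (ν v) * ‖U α v‖ₑ ^ 2) ^ (1 / 2 : ℝ)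

/-- The `V^n_{A,ν}` norm of a function of `(t, v)` given together with its `v`-derivatives. -/
def vNorm (n : ℕ) (A : ℝ) (ν : E → ℝ) (U : MIdx → ℝ → E → ℝ) : ℝ≥0∞ :=
  (∫⁻ t in Ioi (0 : ℝ), ENNReal.ofReal (Real.exp (-A * t)) *
    hNorm n ν (fun α => U α t) ^ 2) ^ (1 / 2 : ℝ)

/-- Elements of `H^n_ν`, the closure of `C_c^∞(ℝ³)` in the `H^n_ν` norm. An element is recorded as
`D 0` with its derivatives `D α`, `|α| ≤ n`, the limits of the derivatives of the
approximating test functions; these are determined almost everywhere by `D 0`. -/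
structure SobH (n : ℕ) (ν : E → ℝ) where
  D : MIdx → E → ℝ
  measurable : ∀ α : MIdx, α.abs ≤ n → AEStronglyMeasurable (D α) volume
  approx : ∃ ψ : ℕ → E → ℝ, (∀ k, ContDiff ℝ ∞ (ψ k) ∧ HasCompactSupport (ψ k)) ∧
    Tendsto (fun k => hNorm n ν (fun α v => D α v - mderiv α (ψ k) v)) atTop (𝓝 0)

/-- Lebesgue measure on `(0, ∞) × ℝ³`. -/
def timeSpace : Measure (ℝ × E) := (volume.restrict (Ioi (0 : ℝ))).prod volume

/-- Elements of `V^n_{A,ν}`, the closure of `C_c^∞([0,∞) × ℝ³)` in the `V^n_{A,ν}` norm, recorded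
as `D 0` with its derivatives `D α = D_v^α u`, `|α| ≤ n`. Only times `t > 0` matter. -/
structure SobV (n : ℕ) (A : ℝ) (ν : E → ℝ) where
  D : MIdx → ℝ → E → ℝ
  measurable : ∀ α : MIdx, α.abs ≤ n → AEStronglyMeasurable (Function.uncurry (D α)) timeSpace
  approx : ∃ ψ : ℕ → ℝ × E → ℝ, (∀ k, ContDiff ℝ ∞ (ψ k) ∧ HasCompactSupport (ψ k)) ∧
    Tendsto (fun k => vNorm n A ν
      (fun α t v => D α t v - mderiv α (fun w => ψ k (t, w)) v)) atTop (𝓝 0)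

/-- `g` is the weak time derivative of `f` on `(0, ∞) × ℝ³`. -/
def IsTimeDeriv (f g : ℝ → E → ℝ) : Prop :=
  ∀ ψ : ℝ × E → ℝ, ContDiff ℝ ∞ ψ → HasCompactSupport ψ → tsupport ψ ⊆ Ioi (0 : ℝ) ×ˢ univ →
    ∫ p, f p.1 p.2 * fderiv ℝ ψ p ((1 : ℝ), (0 : E)) ∂timeSpace
      = - ∫ p, g p.1 p.2 * ψ p ∂timeSpace

/-! ### Laplace transform in time -/

/-- `G(ϖ, v) = 𝓛(g)(a + iϖ, v)` on the line `Re z = a`, for `g` with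
`∫₀^∞ ∫ e^{-2at} |g|² dv dt < ∞`: the Laplace integral is the `L²(dϖ dv)`-limit of
`∫₀^T e^{-(a+iϖ)t} g(t, v) dt` as `T → ∞` (it need not converge absolutely on this line).
`G` is unique up to null sets. -/
def IsLaplace (a : ℝ) (g : ℝ → E → ℝ) (G : ℝ → E → ℂ) : Prop :=
  AEStronglyMeasurable (Function.uncurry g) timeSpace ∧
  (∫⁻ p, ENNReal.ofReal (Real.exp (-(2 * a) * p.1)) * ‖g p.1 p.2‖ₑ ^ 2 ∂timeSpace) < ⊤ ∧
  AEStronglyMeasurable (Function.uncurry G) (volume : Measure (ℝ × E)) ∧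
  Tendsto (fun T : ℝ => ∫⁻ q : ℝ × E,
    ‖G q.1 q.2 - ∫ t in (0 : ℝ)..T,
      Complex.exp (-((a : ℂ) + q.1 * Complex.I) * t) * (g t q.2 : ℂ)‖ₑ ^ 2) atTop (𝓝 0)

open Classical in
/-- The Laplace transform `(ϖ, v) ↦ 𝓛(g)(a + iϖ, v)` on the line `Re z = a`. -/
def laplace (a : ℝ) (g : ℝ → E → ℝ) : ℝ → E → ℂ :=
  if h : ∃ G, IsLaplace a g G then h.choose else 0

/-- The bound `sup |D_v^β 𝓛(g)(z, v)| w(z) e^{|v|/2} ≤ M` over `v ∈ ℝ³`, `Re z = A/2`, `|β| ≤ m`. -/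
def LaplaceBound (m : ℕ) (A : ℝ) (w : ℂ → ℝ) (g : ℝ → E → ℝ) (M : ℝ) : Prop :=
  ∃ G : ℝ → E → ℂ, IsLaplace (A / 2) g G ∧
    ∀ ϖ : ℝ, ContDiff ℝ m (G ϖ) ∧ ∀ β : MIdx, β.abs ≤ m → ∀ v : E,
      ‖mderiv β (G ϖ) v‖ * w (((A / 2 : ℝ) : ℂ) + ϖ * Complex.I) * Real.exp (‖v‖ / 2) ≤ M

/-- `‖g‖_{E_A} ≤ M`. -/
def ENormLE (n : ℕ) (A : ℝ) (g : ℝ → E → ℝ) (M : ℝ) : Prop :=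
  LaplaceBound (n - 6) A (fun z => 1 + ‖z‖ ^ 2) g M

/-- `‖g‖_{F_{ε,A}} ≤ M`. -/
def FNormLE (n : ℕ) (ε A : ℝ) (g : ℝ → E → ℝ) (M : ℝ) : Prop :=
  LaplaceBound (n - 6) A (fun z => (1 + ‖z‖ ^ 2) * (1 + ε * ‖z‖) / (ε * ‖z‖)) g M

/-- `‖g‖_{G_{ε,A}} ≤ M`. -/
def GNormLE (n : ℕ) (ε A : ℝ) (g : ℝ → E → ℝ) (M : ℝ) : Prop :=
  LaplaceBound (n - 6) A (fun z => (1 + ‖z‖ ^ 2) * (1 + ε * ‖z‖)) g M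

/-- The set `Γ^n_{A,δ₁}`: mean zero in `v`, supported in `[0, 2δ₁] × ℝ³`. -/
def Gam (n : ℕ) (A δ₁ : ℝ) : Set (SobV n A lamT) :=
  {f | (∀ᵐ t ∂(volume.restrict (Ioi (0 : ℝ))), ∫ v, f.D 0 t v = 0) ∧
    ∀ᵐ p ∂timeSpace, 2 * δ₁ < p.1 → f.D 0 p.1 p.2 = 0}

/-- The domain `Ω^{A,δ}_{R̃,δ₁,R,ε}`, where `Rt` is `R̃`. Here `g` is `∂_t f`. -/
def Omega (n : ℕ) (A δ Rt δ₁ R ε : ℝ) : Set (SobV n A lamT) :=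
  {f | f ∈ Gam n A δ₁ ∧
    (∃ g : SobV (n - 2) A lamT, IsTimeDeriv (f.D 0) (g.D 0) ∧
      vNorm n A lamT f.D + vNorm (n - 2) A lamT g.D ≤ 1 ∧
      ∀ᵐ t ∂(volume.restrict (Icc (0 : ℝ) 1)),
        hNorm (n - 4) lamT (fun α => g.D α t) ≤ ENNReal.ofReal Rt) ∧
    GNormLE n ε A (f.D 0) R ∧
    ∃ f₁ f₂ : ℝ → E → ℝ, (∀ᵐ p ∂timeSpace, f.D 0 p.1 p.2 = f₁ p.1 p.2 + f₂ p.1 p.2) ∧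
      FNormLE n ε A f₂ R ∧ ENormLE n A f₁ δ}

/-! ### The potential and the kernel -/

/-- The potential `φ` with Fourier transform `(1 + |k|²)^{-3/2}`; see `potential_fourier`. -/
def potential (x : E) : ℝ :=
  ((2 : ℝ) ^ (3 / 2 : ℝ) * Real.Gamma (3 / 2))⁻¹ *
    ∫ s in Ioi (0 : ℝ), Real.exp (-s - ‖x‖ ^ 2 / (4 * s)) / s

lemma potential_aux (s : ℝ) (hs : 0 < s) :
    Integrable (fun x : E => Real.exp (-s - ‖x‖ ^ 2 / (4 * s)) / s) ∧
    ∫ x : E, Real.exp (-s - ‖x‖ ^ 2 / (4 * s)) / s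
      = (4 * Real.pi) ^ (3 / 2 : ℝ) * (s ^ ((3 / 2 : ℝ) - 1) * Real.exp (-(1 * s))) := by
  have hb : 0 < (4 * s)⁻¹ := by positivity
  have hE : ∀ x : E, Real.exp (-s - ‖x‖ ^ 2 / (4 * s)) / s
      = Real.exp (-s) / s * Real.exp (-(4 * s)⁻¹ * ‖x‖ ^ 2) := by
    intro x
    rw [show -s - ‖x‖ ^ 2 / (4 * s) = -s + -(4 * s)⁻¹ * ‖x‖ ^ 2 by
      rw [div_eq_inv_mul]; ring, Real.exp_add]
    ring
  have h1 : Integrable (fun x : E => Real.exp (-(4 * s)⁻¹ * ‖x‖ ^ 2)) := by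
    have h := GaussianFourier.integrable_cexp_neg_mul_sq_norm_add (V := E) (b := ((4 * s)⁻¹ : ℝ))
      (by simpa using hb) 0 0
    refine h.re.congr (Eventually.of_forall fun x => ?_)
    simp only [zero_mul, add_zero]
    have : (-(((4 * s)⁻¹ : ℝ) : ℂ) * (‖x‖ : ℂ) ^ 2) = ((-(4 * s)⁻¹ * ‖x‖ ^ 2 : ℝ) : ℂ) := by
      push_cast; ring
    rw [this, ← Complex.ofReal_exp]
    exact Complex.ofReal_re _
  constructor
  · simp_rw [hE]
    exact h1.const_mul _
  · simp_rw [hE]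
    rw [integral_const_mul, GaussianFourier.integral_rexp_neg_mul_sq_norm hb]
    simp only [finrank_euclideanSpace, Fintype.card_fin]
    rw [show Real.pi / (4 * s)⁻¹ = (4 * Real.pi) * s by rw [div_inv_eq_mul]; ring,
      Real.mul_rpow (by positivity) hs.le, Real.rpow_sub_one hs.ne', one_mul]
    push_cast
    ring

lemma potential_integrable_prod :
    Integrable (fun p : E × ℝ => Real.exp (-p.2 - ‖p.1‖ ^ 2 / (4 * p.2)) / p.2)
      ((volume : Measure E).prod (volume.restrict (Ioi (0 : ℝ)))) := by
  rw [integrable_prod_iff']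
  · constructor
    · filter_upwards [ae_restrict_mem measurableSet_Ioi] with s hs
      exact (potential_aux s hs).1
    · have h : IntegrableOn (fun s : ℝ => (4 * Real.pi) ^ (3 / 2 : ℝ) *
          (Real.exp (-s) * s ^ ((3 / 2 : ℝ) - 1))) (Ioi 0) :=
        (Real.GammaIntegral_convergent (by norm_num)).const_mul _
      refine Integrable.congr h ?_
      filter_upwards [ae_restrict_mem measurableSet_Ioi] with s hs
      have h2 : ∀ x : E, ‖Real.exp (-s - ‖x‖ ^ 2 / (4 * s)) / s‖
          = Real.exp (-s - ‖x‖ ^ 2 / (4 * s)) / s := fun x =>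
        Real.norm_of_nonneg (div_nonneg (Real.exp_pos _).le (le_of_lt hs))
      simp_rw [h2]
      rw [(potential_aux s hs).2, one_mul]
      ring
  · exact Measurable.aestronglyMeasurable (by fun_prop)

/-- The potential is integrable and
`(2π)^{-3/2} ∫ φ(x) e^{-i k·x} dx = (1 + |k|²)^{-3/2}`. -/
theorem potential_fourier : Integrable potential ∧ ∀ k : E,
    (((2 * Real.pi) ^ (-(3 / 2) : ℝ) : ℝ) : ℂ) *
      ∫ x : E, (potential x : ℂ) * Complex.exp (-Complex.I * (inner ℝ k x : ℝ))
      = (((1 + ‖k‖ ^ 2) ^ (-(3 / 2) : ℝ) : ℝ) : ℂ) := by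
  refine ⟨potential_integrable_prod.integral_prod_left.const_mul _, fun k => ?_⟩
  have hk : 0 < 1 + ‖k‖ ^ 2 := by positivity
  have hG : 0 < Real.Gamma (3 / 2) := Real.Gamma_pos_of_pos (by norm_num)
  have hint : Integrable (Function.uncurry fun (x : E) (s : ℝ) =>
      ((Real.exp (-s - ‖x‖ ^ 2 / (4 * s)) / s : ℝ) : ℂ) *
        Complex.exp (-Complex.I * (inner ℝ k x : ℝ)))
      ((volume : Measure E).prod (volume.restrict (Ioi (0 : ℝ)))) := by
    refine (potential_integrable_prod.ofReal (𝕜 := ℂ)).mul_bdd (c := 1) ?_ ?_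
    · exact Continuous.aestronglyMeasurable (by fun_prop)
    · refine Eventually.of_forall fun p => le_of_eq ?_
      rw [show -Complex.I * ((inner ℝ k p.1 : ℝ) : ℂ) = ((-(inner ℝ k p.1) : ℝ) : ℂ) * Complex.I by
        push_cast; ring]
      exact Complex.norm_exp_ofReal_mul_I _
  have hx : ∀ x : E, (potential x : ℂ) * Complex.exp (-Complex.I * (inner ℝ k x : ℝ))
      = ((((2 : ℝ) ^ (3 / 2 : ℝ) * Real.Gamma (3 / 2))⁻¹ : ℝ) : ℂ) *
        ∫ s in Ioi (0 : ℝ), ((Real.exp (-s - ‖x‖ ^ 2 / (4 * s)) / s : ℝ) : ℂ) *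
          Complex.exp (-Complex.I * (inner ℝ k x : ℝ)) := by
    intro x
    rw [integral_mul_const, integral_complex_ofReal, potential, Complex.ofReal_mul]
    ring
  have hs : ∀ s ∈ Ioi (0 : ℝ),
      ∫ x : E, ((Real.exp (-s - ‖x‖ ^ 2 / (4 * s)) / s : ℝ) : ℂ) *
          Complex.exp (-Complex.I * (inner ℝ k x : ℝ))
        = (((4 * Real.pi) ^ (3 / 2 : ℝ) *
          (s ^ ((3 / 2 : ℝ) - 1) * Real.exp (-((1 + ‖k‖ ^ 2) * s))) : ℝ) : ℂ) := by
    intro s hs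
    have hs : 0 < s := hs
    have hb : 0 < (4 * s)⁻¹ := by positivity
    have hE : ∀ x : E, ((Real.exp (-s - ‖x‖ ^ 2 / (4 * s)) / s : ℝ) : ℂ) *
          Complex.exp (-Complex.I * (inner ℝ k x : ℝ))
        = ((Real.exp (-s) / s : ℝ) : ℂ) * Complex.exp (-(((4 * s)⁻¹ : ℝ) : ℂ) * (‖x‖ : ℂ) ^ 2
          + (-Complex.I) * (inner ℝ k x : ℝ)) := by
      intro x
      rw [Complex.exp_add, show (-(((4 * s)⁻¹ : ℝ) : ℂ) * (‖x‖ : ℂ) ^ 2)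
        = ((-(4 * s)⁻¹ * ‖x‖ ^ 2 : ℝ) : ℂ) by push_cast; ring, ← Complex.ofReal_exp, ← mul_assoc,
        ← Complex.ofReal_mul]
      congr 2
      rw [show -s - ‖x‖ ^ 2 / (4 * s) = -s + -(4 * s)⁻¹ * ‖x‖ ^ 2 by
        rw [div_eq_inv_mul]; ring, Real.exp_add]
      ring
    simp_rw [hE]
    rw [integral_const_mul, GaussianFourier.integral_cexp_neg_mul_sq_norm_add
      (by simpa using hb)]
    simp only [finrank_euclideanSpace, Fintype.card_fin]
    rw [show (Real.pi : ℂ) / (((4 * s)⁻¹ : ℝ) : ℂ) = (((4 * Real.pi) * s : ℝ) : ℂ) by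
        push_cast; rw [div_inv_eq_mul]; ring,
      show (((3 : ℕ) : ℂ) / 2) = (((3 / 2 : ℝ)) : ℂ) by push_cast; ring,
      ← Complex.ofReal_cpow (by positivity),
      show (-Complex.I) ^ 2 * (‖k‖ : ℂ) ^ 2 / (4 * (((4 * s)⁻¹ : ℝ) : ℂ))
        = ((-(‖k‖ ^ 2 * s) : ℝ) : ℂ) by
        have : (s : ℂ) ≠ 0 := by exact_mod_cast hs.ne'
        push_cast; rw [neg_sq, Complex.I_sq]; field_simp,
      ← Complex.ofReal_exp, ← Complex.ofReal_mul, ← Complex.ofReal_mul]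
    congr 1
    rw [Real.mul_rpow (by positivity) hs.le, Real.rpow_sub_one hs.ne',
      show -((1 + ‖k‖ ^ 2) * s) = -s + -(‖k‖ ^ 2 * s) by ring, Real.exp_add]
    ring
  simp_rw [hx]
  rw [integral_const_mul, integral_integral_swap hint,
    setIntegral_congr_fun measurableSet_Ioi hs, integral_complex_ofReal, integral_const_mul,
    Real.integral_rpow_mul_exp_neg_mul_Ioi (by norm_num) hk,
    ← Complex.ofReal_mul, ← Complex.ofReal_mul]
  congr 1
  rw [Real.rpow_neg (by positivity), Real.rpow_neg hk.le, one_div (1 + ‖k‖ ^ 2),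
    Real.inv_rpow hk.le, show (4 * Real.pi) = 2 * (2 * Real.pi) by ring,
    Real.mul_rpow (by norm_num) (by positivity : (0:ℝ) ≤ 2 * Real.pi)]
  have h1 : (0:ℝ) < (2 * Real.pi) ^ (3 / 2 : ℝ) := by positivity
  have h2 : (0:ℝ) < 2 ^ (3 / 2 : ℝ) := by positivity
  have h3 : (0:ℝ) < (1 + ‖k‖ ^ 2) ^ (3 / 2 : ℝ) := by positivity
  field_simp

/-- `K[ν](τ, v)_{ij} = ∫∫ ∂_iφ(x) ∂_jφ(x - τ(v - v')) ν(v') dv' dx`. -/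
def kernelK (ν : E → ℝ) (τ : ℝ) (i j : Fin 3) (v : E) : ℝ :=
  ∫ x : E, ∫ v' : E, pd i potential x * pd j potential (x - τ • (v - v')) * ν v'

/-- A standard mollifier profile. -/
structure IsMollifier (η : E → ℝ) : Prop where
  smooth : ContDiff ℝ ∞ η
  nonneg : ∀ x, 0 ≤ η x
  support : tsupport η ⊆ Metric.closedBall 0 1
  mass : ∫ x, η x = 1

/-- The `i`-th component of the mollified gradient `∇(η_γ * g)`, `η_γ(x) = γ^{-3} η(x/γ)`. -/
def mgrad (η : E → ℝ) (γ : ℝ) (i : Fin 3) (g : E → ℝ) : E → ℝ :=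
  pd i (fun v => ∫ w : E, γ⁻¹ ^ 3 * η (γ⁻¹ • (v - w)) * g w)

/-- The `j`-th component of `P_γ[ν] = ∇(η_γ * ·) · K[ν]`. -/
def kernelP (η : E → ℝ) (γ : ℝ) (ν : E → ℝ) (τ : ℝ) (j : Fin 3) (v : E) : ℝ :=
  ∑ i, mgrad η γ i (kernelK ν τ i j) v

/-! ### The functionals `Q^{α,β}_{ε,A}` -/

/-- Integrand in `s` of the first part of `Q^{α,β}`. -/
def kInner (η : E → ℝ) (γ ε : ℝ) (α β : MIdx) (ν : ℝ → E → ℝ) (u : MIdx → ℝ → E → ℝ)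
    (i j : Fin 3) (t : ℝ) (v : E) (s : ℝ) : ℝ :=
  mderiv (α - β) (kernelK (ν s) ((t - s) / ε) i j) v * mgrad η γ j (u β s) v

/-- Integrand in `s` of the second part of `Q^{α,β}`. -/
def pInner (η : E → ℝ) (γ ε : ℝ) (α β : MIdx) (ν : ℝ → E → ℝ) (u : MIdx → ℝ → E → ℝ)
    (j : Fin 3) (t : ℝ) (v : E) (s : ℝ) : ℝ :=
  mderiv (α - β) (kernelP η γ (ν s) ((t - s) / ε) j) v * u β s v

/-- Integrand in `(t, v)` of the first part of `Q^{α,β}`. -/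
def kTerm (η : E → ℝ) (γ ε A : ℝ) (α β : MIdx) (ν : ℝ → E → ℝ) (u : MIdx → ℝ → E → ℝ)
    (p : ℝ × E) : ℝ :=
  Real.exp (-A * p.1) / ε * ∑ i, mgrad η γ i (fun w => u α p.1 w * lam w) p.2 *
    ∑ j, ∫ s in (0 : ℝ)..p.1, kInner η γ ε α β ν u i j p.1 p.2 s

/-- Integrand in `(t, v)` of the second part of `Q^{α,β}`. -/
def pTerm (η : E → ℝ) (γ ε A : ℝ) (α β : MIdx) (ν : ℝ → E → ℝ) (u : MIdx → ℝ → E → ℝ)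
    (p : ℝ × E) : ℝ :=
  Real.exp (-A * p.1) / ε * ∑ j, mgrad η γ j (fun w => u α p.1 w * lam w) p.2 *
    ∫ s in (0 : ℝ)..p.1, pInner η γ ε α β ν u j p.1 p.2 s

/-- `Q^{α,β}_{ε,A}[ν](u)`. -/
def Q (η : E → ℝ) (γ ε A : ℝ) (α β : MIdx) (ν : ℝ → E → ℝ) (u : MIdx → ℝ → E → ℝ) : ℝ :=
  (∫ p, kTerm η γ ε A α β ν u p ∂timeSpace) - ∫ p, pTerm η γ ε A α β ν u p ∂timeSpace

/-- The integrals that define `Q^{α,β}_{ε,A}[ν](u)` converge absolutely. -/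
def QConverges (η : E → ℝ) (γ ε A : ℝ) (α β : MIdx) (ν : ℝ → E → ℝ)
    (u : MIdx → ℝ → E → ℝ) : Prop :=
  (∀ᵐ p ∂timeSpace, ∀ i j, IntervalIntegrable (kInner η γ ε α β ν u i j p.1 p.2) volume 0 p.1) ∧
  (∀ᵐ p ∂timeSpace, ∀ j, IntervalIntegrable (pInner η γ ε α β ν u j p.1 p.2) volume 0 p.1) ∧
  Integrable (kTerm η γ ε A α β ν u) timeSpace ∧
  Integrable (pTerm η γ ε A α β ν u) timeSpace

/-! ### The dissipation `D^α_{ε,A}` -/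

/-- `α(z, v) = |Im z| / (1 + |v|)`. -/
def wα (z : ℂ) (v : E) : ℝ := |z.im| / (1 + ‖v‖)

/-- `β(z, v) = |Re z| / (1 + |v|)`. -/
def wβ (z : ℂ) (v : E) : ℝ := |z.re| / (1 + ‖v‖)

/-- The weight `C₁(z, v)`. -/
def C₁ (z : ℂ) (v : E) : ℝ := 1 / ((1 + ‖v‖) * (1 + wα z v) ^ 2)

/-- The weight `C₂(z, v)`. -/
def C₂ (z : ℂ) (v : E) : ℝ := (wβ z v + wα z v ^ 2) / ((1 + ‖v‖) * (1 + wα z v) ^ 4)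

/-- `P_v W`, the orthogonal projection of `W ∈ ℂ³` onto the line of `v ∈ ℝ³ ∖ {0}`. -/
def proj (v : E) (W : EuclideanSpace ℂ (Fin 3)) : EuclideanSpace ℂ (Fin 3) :=
  WithLp.toLp 2 (fun i => (∑ j, (v j : ℂ) * W j) / ((‖v‖ ^ 2 : ℝ) : ℂ) * (v i : ℂ))

/-- The anisotropic norm `|W|_v = |P_v^⊥ W| + |P_v W| / (1 + |v|)`. -/
def aniso (v : E) (W : EuclideanSpace ℂ (Fin 3)) : ℝ :=
  ‖W - proj v W‖ + ‖proj v W‖ / (1 + ‖v‖)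

/-- `B₁(z, v)[V, W]`. -/
def B₁ (z : ℂ) (v : E) (V W : EuclideanSpace ℂ (Fin 3)) : ℝ :=
  C₁ z v * aniso v V * aniso v W + C₂ z v * ‖proj v V‖ * ‖proj v W‖

/-- The Laplace transform of the mollified gradient of `D^α u` on the line `Re z = A/2`. -/
def gradLaplace (η : E → ℝ) (γ A : ℝ) (α : MIdx) (u : MIdx → ℝ → E → ℝ) (ϖ : ℝ) (v : E) :
    EuclideanSpace ℂ (Fin 3) :=
  WithLp.toLp 2 (fun i => laplace (A / 2) (fun t => mgrad η γ i (u α t)) ϖ v)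

/-- The dissipation functional `D^α_{ε,A}(u)`. -/
def dissipation (η : E → ℝ) (γ ε A : ℝ) (α : MIdx) (u : MIdx → ℝ → E → ℝ) : ℝ :=
  ∫ ϖ : ℝ, ∫ v : E, B₁ ((ε : ℂ) * (((A / 2 : ℝ) : ℂ) + ϖ * Complex.I)) v
    (gradLaplace η γ A α u ϖ v) (gradLaplace η γ A α u ϖ v) * lam v

end WeakCoupling

end

open WeakCoupling

noncomputable section

namespace WeakCoupling

open scoped FourierTransform SchwartzMap LineDeriv
open ENNReal (ofReal add_lt_top add_ne_top continuous_pow mul_lt_top mul_ne_top ofReal_add ofReal_le_ofReal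
  ofReal_le_one ofReal_lt_top ofReal_mul ofReal_ne_top ofReal_one ofReal_pow ofReal_toReal one_le_ofReal one_lt_top
  pow_le_pow_left_iff pow_lt_top rpow_le_rpow rpow_lt_top_of_nonneg rpow_ofNat sum_lt_top sum_ne_top toReal_mono
  toReal_nonneg toReal_ofNat)
open Real (exp enorm_eq_ofReal enorm_of_nonneg exp_add exp_le_exp exp_le_one_iff exp_nat_mul exp_neg exp_pos mul_rpow
  norm_eq_abs norm_of_nonneg one_le_sqrt pi_pos rpow_add rpow_add_one rpow_le_one_of_one_le_of_nonpos rpow_mul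
  rpow_natCast rpow_neg rpow_nonneg rpow_one_add' sq_sqrt sqrt_eq_rpow sqrt_le_left sqrt_mul sqrt_nonneg sqrt_pos)
open MeasureTheory.Measure (ae_ae_of_ae_prod integral_comp_smul measurePreserving_swap prod_restrict
  quasiMeasurePreserving_fst restrict_congr_set restrict_restrict volume_eq_prod)
open Finset (mul_sum single_le_sum sum_congr sum_le_sum sum_mul)
open Complex (I I_im I_re norm_exp_ofReal_mul_I norm_real ofRealCLM real_smul)
open Filter.Eventually (of_forall)
open Function (uncurry)
variable {n a : ℕ} {A τ γ ε r T c s b θ K : ℝ} {w x v : E} {ν g η ρ ψ k f q p : E → ℝ} {κ α : MIdx}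
  {V N G : MIdx → E → ℝ} {X h U : ℝ → E → ℝ} {y : ℝ → ℝ≥0∞} {C B : ℝ≥0∞} {Y : ℝ → E → ℝ≥0∞} {m : Measure ℝ}
  {S : 𝓢(E, ℝ)}

/-- Lebesgue measure on the positive times. -/
notation "μ₊" => Measure.restrict (volume : Measure ℝ) (Ioi (0 : ℝ))

/-! ### Plancherel for integrable, square integrable functions -/

section Plancherel
open scoped FourierTransform SchwartzMap

variable {V : Type*} [NormedAddCommGroup V] [InnerProductSpace ℝ V] [FiniteDimensional ℝ V]
  [MeasurableSpace V] [BorelSpace V]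

lemma fourier_toLp_ae_eq {f : V → ℂ} (h1 : Integrable f) (h2 : MemLp f 2) :
    (𝓕 (h2.toLp f) : Lp ℂ 2 (volume : Measure V)) =ᵐ[volume] 𝓕 f := by
  have hcont : Continuous (𝓕 f) :=
    VectorFourier.fourierIntegral_continuous Real.continuous_fourierChar
      (by exact continuous_inner) h1
  refine ae_eq_of_integral_contDiff_smul_eq
    ((Lp.memLp _).locallyIntegrable (by norm_num)) hcont.locallyIntegrable ?_
  intro g hg hgc
  have hg' : ContDiff ℝ ∞ (fun x => (g x : ℂ)) := ofRealCLM.contDiff.comp hg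
  have hgc' : HasCompactSupport (fun x => (g x : ℂ)) := hgc.comp_left Complex.ofReal_zero
  let G : 𝓢(V, ℂ) := hgc'.toSchwartzMap hg'
  have hG : ∀ x, G x = (g x : ℂ) := fun _ => rfl
  have key := congrArg (fun T => T G) (Lp.fourier_toTemperedDistribution_eq (h2.toLp f))
  simp only [TemperedDistribution.fourier_apply, Lp.toTemperedDistribution_apply] at key
  have flip : ∫ ξ, (𝓕 (G : V → ℂ)) ξ • f ξ = ∫ x, G x • (𝓕 f) x :=
    by simpa using! (VectorFourier.integral_fourierIntegral_smul_eq_flip (L := innerₗ V)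
      (μ := volume) (ν := volume)
      Real.continuous_fourierChar (by exact continuous_inner) G.integrable h1)
  have e1 : ∫ x, (𝓕 G) x • (h2.toLp f) x = ∫ ξ, (𝓕 (G : V → ℂ)) ξ • f ξ := by
    refine integral_congr_ae ?_
    filter_upwards [h2.coeFn_toLp] with x hx
    rw [hx, SchwartzMap.fourier_coe]
  calc ∫ x, g x • (𝓕 (h2.toLp f) : Lp ℂ 2 (volume : Measure V)) x
      = ∫ x, G x • (𝓕 (h2.toLp f) : Lp ℂ 2 (volume : Measure V)) x := by
        simp only [hG, real_smul, smul_eq_mul]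
    _ = ∫ x, G x • (𝓕 f) x := by rw [← key, e1, flip]
    _ = _ := by simp only [hG, real_smul, smul_eq_mul]

lemma plancherel {f : V → ℂ} (h1 : Integrable f) (h2 : MemLp f 2) :
    ∫⁻ ξ, ‖(𝓕 f) ξ‖ₑ ^ 2 = ∫⁻ x, ‖f x‖ₑ ^ 2 := by
  have h := Lp.norm_fourier_eq (h2.toLp f)
  rw [Lp.norm_def, Lp.norm_def, ENNReal.toReal_eq_toReal_iff' (Lp.eLpNorm_ne_top _)
    (Lp.eLpNorm_ne_top _), eLpNorm_congr_ae (fourier_toLp_ae_eq h1 h2),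
    eLpNorm_congr_ae h2.coeFn_toLp, eLpNorm_eq_lintegral_rpow_enorm_toReal (by norm_num) (by norm_num),
    eLpNorm_eq_lintegral_rpow_enorm_toReal (by norm_num) (by norm_num)] at h
  have h3 := congrArg (fun y : ℝ≥0∞ => y ^ (2 : ℝ)) h
  simp only [toReal_ofNat, one_div, ← ENNReal.rpow_mul] at h3
  norm_num at h3
  exact h3

end Plancherel

/-! ### Cauchy–Schwarz and Young inequalities for nonnegative functions -/

/-- The `L²` norm of a nonnegative function. -/
def l2 {X : Type*} [MeasurableSpace X] (μ : Measure X) (f : X → ℝ≥0∞) : ℝ≥0∞ :=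
  (∫⁻ x, f x ^ 2 ∂μ) ^ (1 / 2 : ℝ)

section L2
variable {X Y : Type*} [MeasurableSpace X] [MeasurableSpace Y] {μ : Measure X} {ν : Measure Y}

lemma rpow_half_sq (a : ℝ≥0∞) : (a ^ (1 / 2 : ℝ)) ^ 2 = a := by
  rw [← ENNReal.rpow_natCast, ← ENNReal.rpow_mul]; norm_num

lemma sq_rpow_half (a : ℝ≥0∞) : (a ^ 2) ^ (1 / 2 : ℝ) = a := by
  rw [← ENNReal.rpow_natCast, ← ENNReal.rpow_mul]; norm_num

lemma l2_sq (f : X → ℝ≥0∞) : l2 μ f ^ 2 = ∫⁻ x, f x ^ 2 ∂μ := rpow_half_sq _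

lemma le_l2_iff {a : ℝ≥0∞} {f : X → ℝ≥0∞} : l2 μ f ≤ a ↔ ∫⁻ x, f x ^ 2 ∂μ ≤ a ^ 2 := by
  rw [← l2_sq]
  exact (pow_le_pow_left_iff (by norm_num : (2 : ℕ) ≠ 0)).symm

lemma l2_mono {f g : X → ℝ≥0∞} (h : ∀ x, f x ≤ g x) : l2 μ f ≤ l2 μ g :=
  rpow_le_rpow (lintegral_mono fun x => pow_le_pow_left' (h x) 2) (by norm_num)

lemma l2_mono_ae {f g : X → ℝ≥0∞} (h : ∀ᵐ x ∂μ, f x ≤ g x) : l2 μ f ≤ l2 μ g :=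
  rpow_le_rpow (lintegral_mono_ae (h.mono fun x hx => pow_le_pow_left' hx 2)) (by norm_num)

lemma l2_congr {f g : X → ℝ≥0∞} (h : f =ᵐ[μ] g) : l2 μ f = l2 μ g := by
  unfold l2
  congr 1
  exact lintegral_congr_ae (h.mono fun x hx => by simp only [hx])

lemma l2_const_mul {f : X → ℝ≥0∞} (hf : AEMeasurable f μ) (c : ℝ≥0∞) :
    l2 μ (fun x => c * f x) = c * l2 μ f := by
  unfold l2
  simp_rw [mul_pow]
  rw [lintegral_const_mul'' _ (by fun_prop), ENNReal.mul_rpow_of_nonneg _ _ (by norm_num),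
    sq_rpow_half]

lemma lintegral_mul_le_l2 {f g : X → ℝ≥0∞} (hf : AEMeasurable f μ) (hg : AEMeasurable g μ) :
    ∫⁻ x, f x * g x ∂μ ≤ l2 μ f * l2 μ g := by
  have h := ENNReal.lintegral_mul_le_Lp_mul_Lq μ Real.HolderConjugate.two_two hf hg
  simpa [l2] using h

lemma l2_add_le {f g : X → ℝ≥0∞} (hf : AEMeasurable f μ) (hg : AEMeasurable g μ) :
    l2 μ (fun x => f x + g x) ≤ l2 μ f + l2 μ g := by
  have h := ENNReal.lintegral_Lp_add_le hf hg (p := 2) (by norm_num)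
  simpa [l2] using h

lemma l2_prod [SFinite ν] [SFinite μ] {f : X → Y → ℝ≥0∞}
    (hf : AEMeasurable (uncurry f) (μ.prod ν)) :
    l2 μ (fun x => l2 ν (f x)) = l2 (μ.prod ν) (uncurry f) := by
  unfold l2
  congr 1
  rw [lintegral_prod _ (by fun_prop)]
  exact lintegral_congr fun x => rpow_half_sq _

lemma measurable_l2_right [SFinite ν] {f : X → Y → ℝ≥0∞}
    (hf : Measurable (uncurry f)) : Measurable (fun x => l2 ν (f x)) :=
  (Measurable.lintegral_prod_right' (f := fun p => uncurry f p ^ 2)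
    (by fun_prop)).pow_const _

/-- Translations act isometrically: a bilinear form of Young's inequality `L¹ * L² → L²`. -/
lemma lintegral_conv_le {G : Type*} [NormedAddCommGroup G] [MeasurableSpace G] [BorelSpace G]
    [SecondCountableTopology G]
    {m : Measure G} [SFinite m] [m.IsAddLeftInvariant] [m.IsNegInvariant] {κ w h : G → ℝ≥0∞}
    (hκ : Measurable κ) (hw : Measurable w) (hh : Measurable h) :
    ∫⁻ v, w v * ∫⁻ v', κ (v - v') * h v' ∂m ∂m ≤ (∫⁻ x, κ x ∂m) * (l2 m w * l2 m h) := by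
  have h1 : ∀ v, ∫⁻ v', κ (v - v') * h v' ∂m = ∫⁻ x, κ x * h (v - x) ∂m := by
    intro v
    rw [← lintegral_sub_left_eq_self (fun x => κ x * h (v - x)) v]
    simp
  have hm : ∀ x : G, Measurable (fun v => h (v - x)) := by fun_prop
  have hm2 : Measurable (fun p : G × G => κ p.2 * h (p.1 - p.2)) := by fun_prop
  calc ∫⁻ v, w v * ∫⁻ v', κ (v - v') * h v' ∂m ∂m
      = ∫⁻ v, ∫⁻ x, w v * (κ x * h (v - x)) ∂m ∂m := by
        refine lintegral_congr fun v => ?_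
        rw [h1, lintegral_const_mul]
        fun_prop
    _ = ∫⁻ x, ∫⁻ v, w v * (κ x * h (v - x)) ∂m ∂m := by
        rw [lintegral_lintegral_swap]
        fun_prop
    _ ≤ ∫⁻ x, κ x * (l2 m w * l2 m h) ∂m := by
        refine lintegral_mono fun x => ?_
        have : ∀ v, w v * (κ x * h (v - x)) = κ x * (w v * h (v - x)) := by grind
        simp_rw [this]
        have hwm : Measurable fun v => w v * h (v - x) := by fun_prop
        rw [lintegral_const_mul _ hwm]
        gcongr
        refine (lintegral_mul_le_l2 hw.aemeasurable (hm x).aemeasurable).trans (le_of_eq ?_)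
        congr 1
        unfold l2
        congr 1
        exact lintegral_sub_right_eq_self (fun v => h v ^ 2) x
    _ = _ := by rw [lintegral_mul_const _ hκ]

/-- Young's inequality `L¹ * L² → L²`. -/
lemma l2_conv_le {G : Type*} [NormedAddCommGroup G] [MeasurableSpace G] [BorelSpace G]
    [SecondCountableTopology G]
    {m : Measure G} [SFinite m] [m.IsAddLeftInvariant] [m.IsNegInvariant] {κ h : G → ℝ≥0∞}
    (hκ : Measurable κ) (hh : Measurable h) :
    l2 m (fun v => ∫⁻ v', κ (v - v') * h v' ∂m) ≤ (∫⁻ x, κ x ∂m) * l2 m h := by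
  set F : G → ℝ≥0∞ := fun v => ∫⁻ v', κ (v - v') * h v' ∂m with hF
  have hm2 : Measurable (fun p : G × G => κ (p.1 - p.2) * h p.2) := by fun_prop
  have hFm : Measurable F := by fun_prop
  -- Cauchy–Schwarz with respect to the weight `κ (v - ·)`
  rw [le_l2_iff, mul_pow, l2_sq]
  have hpt : ∀ v, F v ^ 2 ≤ (∫⁻ x, κ x ∂m) * ∫⁻ v', κ (v - v') * h v' ^ 2 ∂m := by
    intro v
    have hκv : Measurable (fun v' => κ (v - v')) := by fun_prop
    have e : F v = ∫⁻ v', κ (v - v') ^ (1 / 2 : ℝ) * (κ (v - v') ^ (1 / 2 : ℝ) * h v') ∂m := by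
      refine lintegral_congr fun v' => ?_
      rw [← mul_assoc, ← pow_two, rpow_half_sq]
    have := lintegral_mul_le_l2 (μ := m) (f := fun v' => κ (v - v') ^ (1 / 2 : ℝ))
      (g := fun v' => κ (v - v') ^ (1 / 2 : ℝ) * h v') (hκv.pow_const (1 / 2 : ℝ)).aemeasurable
      ((hκv.pow_const (1 / 2 : ℝ)).mul hh).aemeasurable
    rw [← e] at this
    refine (pow_le_pow_left' this 2).trans (le_of_eq ?_)
    rw [mul_pow, l2_sq, l2_sq]
    simp_rw [mul_pow, rpow_half_sq]
    rw [lintegral_sub_left_eq_self κ v]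
  calc ∫⁻ v, F v ^ 2 ∂m ≤ ∫⁻ v, (∫⁻ x, κ x ∂m) * ∫⁻ v', κ (v - v') * h v' ^ 2 ∂m ∂m :=
        lintegral_mono hpt
    _ = (∫⁻ x, κ x ∂m) * ∫⁻ v, ∫⁻ v', κ (v - v') * h v' ^ 2 ∂m ∂m := by
        rw [lintegral_const_mul]
        fun_prop
    _ = (∫⁻ x, κ x ∂m) * ∫⁻ v', ∫⁻ v, κ (v - v') * h v' ^ 2 ∂m ∂m := by
        rw [lintegral_lintegral_swap]
        fun_prop
    _ = (∫⁻ x, κ x ∂m) * ∫⁻ v', (∫⁻ x, κ x ∂m) * h v' ^ 2 ∂m := by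
        congr 1
        refine lintegral_congr fun v' => ?_
        have hκv : Measurable fun v => κ (v - v') := by fun_prop
        rw [lintegral_mul_const _ hκv,
          lintegral_sub_right_eq_self κ v']
    _ = _ := by rw [lintegral_const_mul _ (by fun_prop), ← mul_assoc, pow_two]

end L2

/-- Young's inequality for the time convolutions with kernel `ε⁻¹ n(·/ε)`. -/
lemma young_time (hε : 0 < ε) {n w u : ℝ → ℝ≥0∞} (hn : Measurable n)
    (hw : Measurable w) (hu : Measurable u) :
    ∫⁻ t in Ioi (0 : ℝ), ∫⁻ s in Ioo 0 t,
      ofReal ε⁻¹ * (n ((t - s) / ε) * (w t * u s)) ≤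
      (∫⁻ τ in Ioi (0 : ℝ), n τ) *
        (l2 μ₊ w * l2 μ₊ u) := by
  set κ : ℝ → ℝ≥0∞ := (Ioi 0).indicator fun r => ofReal ε⁻¹ * n (r / ε) with hκ
  have hnε : Measurable fun r => ofReal ε⁻¹ * n (r / ε) := by fun_prop
  have hκm : Measurable κ := hnε.indicator measurableSet_Ioi
  have h := lintegral_conv_le (m := (volume : Measure ℝ)) hκm (hw.indicator (measurableSet_Ioi (a := (0:ℝ))))
    (hu.indicator (measurableSet_Ioi (a := (0:ℝ))))
  have hl2 : ∀ f : ℝ → ℝ≥0∞, l2 volume ((Ioi (0:ℝ)).indicator f) = l2 μ₊ f := by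
    intro f
    unfold l2
    congr 1
    rw [← lintegral_indicator measurableSet_Ioi]
    refine lintegral_congr fun x => ?_
    by_cases hx : x ∈ Ioi (0:ℝ) <;> simp [hx, indicator]
  have hκi : ∫⁻ x, κ x = ∫⁻ τ in Ioi (0 : ℝ), n τ := by
    rw [hκ, lintegral_indicator measurableSet_Ioi, lintegral_const_mul' _ _ ofReal_ne_top]
    have := lintegral_image_eq_lintegral_abs_deriv_mul (s := Ioi (0:ℝ)) measurableSet_Ioi
      (f := fun r => r / ε) (f' := fun _ => ε⁻¹)
      (fun x _ => ((hasDerivAt_id x).div_const ε).hasDerivWithinAt.congr_deriv (by simp))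
      (fun x _ y _ hxy => by simpa [hε.ne'] using hxy) n
    have him : (fun r => r / ε) '' Ioi (0:ℝ) = Ioi 0 := by
      ext y; constructor
      · rintro ⟨x, hx, rfl⟩; exact div_pos hx hε
      · intro hy; exact ⟨y * ε, mul_pos hy hε, by field_simp⟩
    rw [him] at this
    rw [this, lintegral_const_mul' _ _ ofReal_ne_top, abs_of_pos (inv_pos.2 hε)]
  rw [hl2, hl2, hκi] at h
  refine le_trans (le_of_eq ?_) h
  rw [← lintegral_indicator measurableSet_Ioi]
  refine lintegral_congr fun t => ?_
  by_cases ht : t ∈ Ioi (0:ℝ)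
  · rw [indicator_of_mem ht, indicator_of_mem ht, ← lintegral_const_mul]
    · rw [← lintegral_indicator measurableSet_Ioo]
      refine lintegral_congr fun s => ?_
      by_cases hs : s ∈ Ioo 0 t
      · rw [indicator_of_mem hs, indicator_of_mem (show s ∈ Ioi (0:ℝ) from hs.1), hκ,
          indicator_of_mem (show t - s ∈ Ioi (0:ℝ) from sub_pos.2 hs.2)]
        ring
      · rw [indicator_of_notMem hs]
        by_cases hs0 : 0 < s
        · have : ¬ s < t := fun h => hs ⟨hs0, h⟩
          rw [hκ, indicator_of_notMem (s := Ioi (0:ℝ)) (a := t - s)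
            (by simpa using not_lt.1 this)]
          simp
        · rw [indicator_of_notMem (s := Ioi (0:ℝ)) (a := s) (by simpa using hs0)]
          simp
    · exact (hκm.comp (by fun_prop)).mul (hu.indicator measurableSet_Ioi)
  · rw [indicator_of_notMem ht, indicator_of_notMem ht, zero_mul]

/-! ### The Gaussian and its derivatives -/

lemma norm_iteratedFDeriv_norm_sq_le (x : E) (i : ℕ) (hi : 1 ≤ i) :
    ‖iteratedFDeriv ℝ i (fun x : E => ‖x‖ ^ 2) x‖ ≤ (2 * (1 + ‖x‖)) ^ i := by
  have hx := norm_nonneg x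
  let M : E →L[ℝ] E →L[ℝ] ℝ := innerSL ℝ
  have hL : (fderiv ℝ fun x : E => ‖x‖ ^ 2) = ⇑(M + M) := by
    rw [fderiv_norm_sq]; ext x y; simp only [Pi.smul_apply, two_smul]; rfl
  have hLn : ‖M + M‖ ≤ 2 := by
    have h1 : ‖M‖ ≤ 1 := norm_innerSL_le ℝ (E := E)
    have h2 := norm_add_le M M
    linarith
  obtain ⟨j, rfl⟩ : ∃ j, i = j + 1 := ⟨i - 1, by omega⟩
  rw [← norm_iteratedFDeriv_fderiv, hL]
  rcases j with _ | j
  · rw [norm_iteratedFDeriv_zero]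
    refine (ContinuousLinearMap.le_opNorm _ x).trans ?_
    rw [pow_one]
    exact (mul_le_mul_of_nonneg_right hLn hx).trans (by linarith)
  · rw [← norm_iteratedFDeriv_fderiv]
    have : fderiv ℝ ⇑(M + M) = fun _ => M + M := by
      ext1 x; exact ContinuousLinearMap.fderiv _
    rw [this]
    rcases j with _ | j
    · rw [norm_iteratedFDeriv_zero]
      refine hLn.trans ?_
      rw [zero_add, one_add_one_eq_two]
      nlinarith [mul_nonneg hx hx]
    · rw [iteratedFDeriv_const_of_ne (by omega)]
      simp only [Pi.zero_apply, norm_zero]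
      positivity

lemma iteratedDeriv_exp_neg (i : ℕ) (y : ℝ) :
    iteratedDeriv i (fun y : ℝ => exp (-y)) y = (-1) ^ i * exp (-y) := by
  have h := iteratedDeriv_comp_neg i exp y
  rw [h, iteratedDeriv_eq_iterate, Real.iter_deriv_exp, smul_eq_mul]

/-- The Gaussian `e^{-|x|²}` as a Schwartz function. -/
def gauss : 𝓢(E, ℝ) where
  toFun := fun x => exp (-‖x‖ ^ 2)
  smooth' := (contDiff_norm_sq ℝ).neg.exp
  decay' := by
    intro k n
    refine ⟨(n.factorial : ℝ) * ((2 : ℝ) ^ n * (exp 2 * (k + n).factorial)), fun x => ?_⟩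
    have hx := norm_nonneg x
    have h := norm_iteratedFDeriv_comp_le (𝕜 := ℝ) (g := fun y : ℝ => exp (-y))
      (f := fun x : E => ‖x‖ ^ 2) (n := n) (N := ∞) (by fun_prop) (contDiff_norm_sq ℝ)
      (by exact_mod_cast le_top) x (C := exp (-‖x‖ ^ 2)) (D := 2 * (1 + ‖x‖))
      (fun i _ => by
        rw [norm_iteratedFDeriv_eq_norm_iteratedDeriv, iteratedDeriv_exp_neg, norm_mul]
        simp)
      (fun i hi _ => norm_iteratedFDeriv_norm_sq_le x i hi)
    have h2 : (1 + ‖x‖) ^ (k + n) ≤ (k + n).factorial * exp (1 + ‖x‖) := by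
      have := Real.pow_div_factorial_le_exp (1 + ‖x‖) (by positivity) (k + n)
      rwa [div_le_iff₀ (by positivity), mul_comm] at this
    have h3 : exp (-‖x‖ ^ 2) * exp (1 + ‖x‖) ≤ exp 2 := by
      rw [← exp_add]
      exact exp_le_exp.2 (by nlinarith [sq_nonneg (‖x‖ - 1 / 2)])
    have h4 : ‖x‖ ^ k ≤ (1 + ‖x‖) ^ k := pow_le_pow_left₀ hx (by linarith) k
    calc ‖x‖ ^ k * ‖iteratedFDeriv ℝ n (fun x : E => exp (-‖x‖ ^ 2)) x‖
        ≤ (1 + ‖x‖) ^ k * (n.factorial * exp (-‖x‖ ^ 2) * (2 * (1 + ‖x‖)) ^ n) := by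
          gcongr; exact h
      _ = n.factorial * 2 ^ n * (exp (-‖x‖ ^ 2) * (1 + ‖x‖) ^ (k + n)) := by
          rw [mul_pow, pow_add]; ring
      _ ≤ n.factorial * 2 ^ n * (exp (-‖x‖ ^ 2) *
            ((k + n).factorial * exp (1 + ‖x‖))) := by gcongr
      _ = n.factorial * 2 ^ n * ((k + n).factorial *
            (exp (-‖x‖ ^ 2) * exp (1 + ‖x‖))) := by ring
      _ ≤ n.factorial * 2 ^ n * ((k + n).factorial * exp 2) := by gcongr
      _ = _ := by ring

@[simp] theorem gauss_apply (x : E) : gauss x = exp (-‖x‖ ^ 2) := rfl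

/-- The Schwartz function `-(1/4) ∂_i ∂_j e^{-|x|²}`. -/
def hessG (i j : Fin 3) : 𝓢(E, ℝ) :=
  (-(1 / 4) : ℝ) • ∂_{basisVec i} (∂_{basisVec j} gauss)

lemma inner_basisVec (x : E) (i : Fin 3) : inner ℝ x (basisVec i) = x i := by
  simp [basisVec, EuclideanSpace.inner_single_right]

lemma hasFDerivAt_coord (j : Fin 3) (x : E) :
    HasFDerivAt (fun x : E => x j) (EuclideanSpace.proj j : E →L[ℝ] ℝ) x :=
  (EuclideanSpace.proj j : E →L[ℝ] ℝ).hasFDerivAt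

lemma hasFDerivAt_exp_neg_norm_sq (x : E) :
    HasFDerivAt (fun x : E => exp (-‖x‖ ^ 2))
      (exp (-‖x‖ ^ 2) • (-((2 : ℕ) • (innerSL ℝ x : E →L[ℝ] ℝ)))) x :=
  HasFDerivAt.exp (f := fun x : E => -‖x‖ ^ 2) (hasStrictFDerivAt_norm_sq x).hasFDerivAt.neg

lemma basisVec_apply (i j : Fin 3) : (basisVec i) j = if j = i then (1 : ℝ) else 0 := by
  simp [basisVec]

lemma hessG_apply (i j : Fin 3) (x : E) :
    hessG i j x = ((if i = j then 1 / 2 else 0) - x i * x j) * exp (-‖x‖ ^ 2) := by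
  have h1 : ∀ y : E, (∂_{basisVec j} gauss) y = -2 * y j * exp (-‖y‖ ^ 2) := by
    intro y
    rw [SchwartzMap.lineDerivOp_apply_eq_fderiv]
    have : fderiv ℝ (⇑gauss) y = _ := (hasFDerivAt_exp_neg_norm_sq y).fderiv
    rw [this]
    simp [inner_basisVec]
    ring
  have h2 : HasFDerivAt (fun y : E => -2 * y j * exp (-‖y‖ ^ 2)) _ x :=
    ((hasFDerivAt_coord j x).const_mul (-2)).mul (hasFDerivAt_exp_neg_norm_sq x)
  have h3 : (⇑(∂_{basisVec j} gauss : 𝓢(E, ℝ)) : E → ℝ) = fun y => -2 * y j * exp (-‖y‖ ^ 2) := funext h1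
  change (-(1 / 4) : ℝ) • (∂_{basisVec i} (∂_{basisVec j} gauss)) x = _
  rw [SchwartzMap.lineDerivOp_apply_eq_fderiv, h3, h2.fderiv]
  simp only [add_apply, smul_apply,
    neg_apply, innerSL_apply_apply, inner_basisVec, smul_eq_mul,
    nsmul_eq_mul]
  have hp : (EuclideanSpace.proj j : E →L[ℝ] ℝ) (basisVec i) = if j = i then (1 : ℝ) else 0 :=
    basisVec_apply i j
  rw [hp]
  by_cases h : i = j
  · subst h; simp; ring
  · simp [h, Ne.symm h]; ring

/-! ### Decay of Schwartz functions in real powers -/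

lemma rpow_le_one_add_pow (hr : 0 ≤ r) (hθ : 0 ≤ θ) {k : ℕ} (hk : θ ≤ k) :
    r ^ θ ≤ 1 + r ^ k := by
  rcases le_total r 1 with h | h
  · have := Real.rpow_le_one hr h hθ
    have := pow_nonneg hr k
    linarith
  · have := Real.rpow_le_rpow_of_exponent_le h hk
    rw [rpow_natCast] at this
    linarith

lemma schwartz_decay_rpow (S : 𝓢(E, ℝ)) (hθ : 0 ≤ θ) :
    ∃ C : ℝ, 0 ≤ C ∧ ∀ x : E, x ≠ 0 → |S x| ≤ C * ‖x‖ ^ (-θ) := by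
  obtain ⟨k, hk⟩ := exists_nat_ge θ
  refine ⟨SchwartzMap.seminorm ℝ 0 0 S + SchwartzMap.seminorm ℝ k 0 S, by positivity, fun x hx => ?_⟩
  have hx0 : 0 < ‖x‖ := by positivity
  have h0 := SchwartzMap.norm_le_seminorm ℝ S x
  have h1 := SchwartzMap.norm_pow_mul_le_seminorm ℝ S k x
  rw [rpow_neg hx0.le, ← div_eq_mul_inv, le_div_iff₀ (by positivity)]
  calc |S x| * ‖x‖ ^ θ ≤ |S x| * (1 + ‖x‖ ^ k) := by
        gcongr; exact rpow_le_one_add_pow hx0.le hθ hk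
    _ = ‖S x‖ + ‖x‖ ^ k * ‖S x‖ := by rw [norm_eq_abs]; ring
    _ ≤ _ := add_le_add h0 h1

/-- The Schwartz function `a S + x · ∇ S`. -/
def eulerS (a : ℕ) (S : 𝓢(E, ℝ)) : 𝓢(E, ℝ) :=
  (a : ℝ) • S + ∑ i, SchwartzMap.smulLeftCLM ℝ (fun x : E => inner ℝ x (basisVec i))
    (∂_{basisVec i} S)

lemma sum_coord_smul_basisVec (x : E) : ∑ i, x i • basisVec i = x := by
  ext j
  simp [basisVec, Finset.sum_apply, Pi.single_apply]

lemma eulerS_apply (a : ℕ) (S : 𝓢(E, ℝ)) (x : E) :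
    eulerS a S x = a * S x + fderiv ℝ S x x := by
  have ht : ∀ i, Function.HasTemperateGrowth (fun x : E => inner ℝ x (basisVec i)) := by fun_prop
  have h1 : eulerS a S x = a * S x + ∑ i, x i * fderiv ℝ S x (basisVec i) := by
    change ((a : ℝ) • S) x + (∑ i, SchwartzMap.smulLeftCLM ℝ
      (fun x : E => inner ℝ x (basisVec i)) (∂_{basisVec i} S)) x = _
    rw [sum_apply]
    congr 1
    refine sum_congr rfl fun i _ => ?_
    rw [SchwartzMap.smulLeftCLM_apply_apply (ht i), SchwartzMap.lineDerivOp_apply_eq_fderiv,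
      inner_basisVec, smul_eq_mul]
  have h2 := congrArg (fderiv ℝ S x) (sum_coord_smul_basisVec x)
  rw [map_sum] at h2
  simp only [map_smul, smul_eq_mul] at h2
  rw [h1, h2]

/-! ### Kernels that are mixtures of rescaled Schwartz functions -/

/-- A measure on `(0, ∞)` all of whose moments of order less than one are finite. -/
structure IsMix (m : Measure ℝ) : Prop where
  pos : ∀ᵐ b ∂m, 0 < b
  moment : ∀ q : ℝ, q < 1 → Integrable (fun b => b ^ q) m

lemma IsMix.finite (hm : IsMix m) : IsFiniteMeasure m := by
  have := hm.moment 0 one_pos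
  simp only [Real.rpow_zero] at this
  exact (integrable_const_iff_isFiniteMeasure one_ne_zero).1 this

/-- The kernel `∫ (bτ)^a S(bτ w) dm(b)`. -/
def mixK (m : Measure ℝ) (S : 𝓢(E, ℝ)) (a : ℕ) (τ : ℝ) (w : E) : ℝ :=
  ∫ b, (b * τ) ^ a * S ((b * τ) • w) ∂m

lemma continuous_mixK_integrand (S : 𝓢(E, ℝ)) (a : ℕ) :
    Continuous fun p : (ℝ × E) × ℝ => (p.2 * p.1.1) ^ a * S ((p.2 * p.1.1) • p.1.2) := by fun_prop

lemma measurable_mixK [SFinite m] (S : 𝓢(E, ℝ)) (a : ℕ) :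
    Measurable (uncurry (mixK m S a)) :=
  ((continuous_mixK_integrand S a).stronglyMeasurable.integral_prod_right
    (ν := m) (f := fun (p : ℝ × E) b => (b * p.1) ^ a * S ((b * p.1) • p.2))).measurable

/-- The profile `r^{-(a - 3/4)} (1 + r)^{-6}`. -/
def mixProfile (a : ℕ) (r : ℝ) : ℝ := r ^ (-((a : ℝ) - 3 / 4)) * ((1 + r) ^ 6)⁻¹

lemma lintegral_mixK_le (hm : IsMix m) (S : 𝓢(E, ℝ)) (ha : 1 ≤ a) :
    ∃ C : ℝ, 0 ≤ C ∧ ∀ τ : ℝ, 0 < τ → ∀ w : E, w ≠ 0 →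
      ∫⁻ b, ‖(b * τ) ^ a * S ((b * τ) • w)‖ₑ ∂m ≤
        ofReal (C * (τ ^ a * mixProfile a (τ * ‖w‖))) := by
  have ha' : (1 : ℝ) ≤ a := by exact_mod_cast ha
  set θ : ℝ := (a : ℝ) - 3 / 4 with hθ
  have hθ0 : 0 ≤ θ := by rw [hθ]; linarith
  obtain ⟨C₁, hC₁, h₁⟩ := schwartz_decay_rpow S hθ0
  obtain ⟨C₂, hC₂, h₂⟩ := schwartz_decay_rpow S (show (0 : ℝ) ≤ θ + 6 by linarith)
  have hM : ∀ q : ℝ, q < 1 → ∫⁻ b, ofReal (b ^ q) ∂m = ofReal (∫ b, b ^ q ∂m) := by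
    intro q hq
    rw [ofReal_integral_eq_lintegral_ofReal (hm.moment q hq)]
    filter_upwards [hm.pos] with b hb using rpow_nonneg hb.le _
  have hpos : ∀ q : ℝ, 0 ≤ ∫ b, b ^ q ∂m := fun q => integral_nonneg_of_ae (by
    filter_upwards [hm.pos] with b hb using rpow_nonneg hb.le _)
  -- the two elementary bounds
  have bound : ∀ (κ C : ℝ), 0 ≤ C → 0 ≤ κ → (∀ x : E, x ≠ 0 → |S x| ≤ C * ‖x‖ ^ (-(θ + κ))) →
      ∀ τ : ℝ, 0 < τ → ∀ w : E, w ≠ 0 → ∫⁻ b, ‖(b * τ) ^ a * S ((b * τ) • w)‖ₑ ∂m ≤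
        ofReal ((C * ∫ b, b ^ (3 / 4 - κ) ∂m) * (τ ^ a * (τ * ‖w‖) ^ (-(θ + κ)))) := by
    intro κ C hC hκ hS τ hτ w hw
    have hw0 : 0 < ‖w‖ := norm_pos_iff.2 hw
    calc ∫⁻ b, ‖(b * τ) ^ a * S ((b * τ) • w)‖ₑ ∂m
        ≤ ∫⁻ b, ofReal (C * (τ ^ a * (τ * ‖w‖) ^ (-(θ + κ)))) *
            ofReal (b ^ (3 / 4 - κ)) ∂m := by
          refine lintegral_mono_ae ?_
          filter_upwards [hm.pos] with b hb
          rw [← ofReal_norm, ← ofReal_mul (by positivity)]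
          refine ofReal_le_ofReal ?_
          have hne : (b * τ) • w ≠ 0 := smul_ne_zero (by positivity) hw
          have e1 : ‖(b * τ) • w‖ = b * (τ * ‖w‖) := by
            rw [norm_smul, norm_of_nonneg (by positivity)]; ring
          have e2 : b ^ (3 / 4 - κ) = b ^ a * b ^ (-(θ + κ)) := by
            rw [← rpow_natCast, ← rpow_add hb, hθ]; ring_nf
          rw [norm_mul, norm_of_nonneg (by positivity), norm_eq_abs]
          calc (b * τ) ^ a * |S ((b * τ) • w)|
              ≤ (b * τ) ^ a * (C * (b * (τ * ‖w‖)) ^ (-(θ + κ))) := by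
                gcongr; rw [← e1]; exact hS _ hne
            _ = _ := by rw [mul_rpow hb.le (by positivity), e2, mul_pow]; ring
      _ = _ := by
          rw [lintegral_const_mul' _ _ ofReal_ne_top, hM _ (by linarith),
            ← ofReal_mul (by positivity)]
          congr 1; ring
  set D₁ : ℝ := C₁ * ∫ b, b ^ (3 / 4 - 0 : ℝ) ∂m
  set D₂ : ℝ := C₂ * ∫ b, b ^ (3 / 4 - 6 : ℝ) ∂m
  have hD₁ : 0 ≤ D₁ := mul_nonneg hC₁ (hpos _)
  have hD₂ : 0 ≤ D₂ := mul_nonneg hC₂ (hpos _)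
  refine ⟨64 * (D₁ + D₂), by positivity, fun τ hτ w hw => ?_⟩
  have hr : 0 < τ * ‖w‖ := by simp_all
  set r := τ * ‖w‖ with hr_def
  have b₁ := bound 0 C₁ hC₁ le_rfl (by simpa using h₁) τ hτ w hw
  have b₂ := bound 6 C₂ hC₂ (by norm_num) h₂ τ hτ w hw
  rcases le_total r 1 with h | h
  · refine b₁.trans (ofReal_le_ofReal ?_)
    rw [mixProfile, ← hθ, add_zero]
    have : (1 : ℝ) ≤ 64 * ((1 + r) ^ 6)⁻¹ := by
      rw [← div_eq_mul_inv, one_le_div (by positivity)]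
      calc (1 + r) ^ 6 ≤ 2 ^ 6 := pow_le_pow_left₀ (by positivity) (by linarith) 6
        _ = 64 := by norm_num
    calc D₁ * (τ ^ a * r ^ (-θ)) ≤ (D₁ + D₂) * (τ ^ a * r ^ (-θ)) * (64 * ((1 + r) ^ 6)⁻¹) := by
          refine le_trans ?_ (le_mul_of_one_le_right (by positivity) this)
          gcongr; linarith
      _ = _ := by ring
  · refine b₂.trans (ofReal_le_ofReal ?_)
    rw [mixProfile, ← hθ, neg_add, rpow_add hr]
    have : r ^ (-6 : ℝ) ≤ 64 * ((1 + r) ^ 6)⁻¹ := by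
      rw [rpow_neg hr.le, ← div_eq_mul_inv, inv_le_comm₀ (by positivity) (by positivity), inv_div]
      have e : r ^ (6 : ℝ) = r ^ 6 := by exact_mod_cast rpow_natCast r 6
      rw [e]
      calc (1 + r) ^ 6 / 64 ≤ (2 * r) ^ 6 / 64 := by gcongr; linarith
        _ = r ^ 6 := by ring
    calc D₂ * (τ ^ a * (r ^ (-θ) * r ^ (-6 : ℝ)))
        ≤ (D₁ + D₂) * (τ ^ a * (r ^ (-θ) * (64 * ((1 + r) ^ 6)⁻¹))) := by
          gcongr; linarith
      _ = _ := by ring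

lemma enorm_mixK_le (hm : IsMix m) (S : 𝓢(E, ℝ)) (ha : 1 ≤ a) :
    ∃ C : ℝ, 0 ≤ C ∧ ∀ τ : ℝ, 0 < τ → ∀ w : E, w ≠ 0 →
      ‖mixK m S a τ w‖ₑ ≤ ofReal (C * (τ ^ a * mixProfile a (τ * ‖w‖))) := by
  obtain ⟨C, hC, h⟩ := lintegral_mixK_le hm S ha
  exact ⟨C, hC, fun τ hτ w hw => (enorm_integral_le_lintegral_enorm _).trans (h τ hτ w hw)⟩

lemma integrable_mixK (hm : IsMix m) (S : 𝓢(E, ℝ)) (ha : 1 ≤ a)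
    (hτ : 0 < τ) (hw : w ≠ 0) :
    Integrable (fun b => (b * τ) ^ a * S ((b * τ) • w)) m := by
  obtain ⟨C, -, h⟩ := lintegral_mixK_le hm S ha
  have hc : Continuous fun b : ℝ => (b * τ) ^ a * S ((b * τ) • w) := by fun_prop
  exact ⟨hc.aestronglyMeasurable, (h τ hτ w hw).trans_lt ofReal_lt_top⟩

/-- The derivative of `τ ↦ (bτ)^a S(bτw)`. -/
lemma hasDerivAt_mix (S : 𝓢(E, ℝ)) (a : ℕ) (b : ℝ) (w : E) (hr : r ≠ 0) :
    HasDerivAt (fun r : ℝ => (b * r) ^ a * S ((b * r) • w))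
      (r⁻¹ * ((b * r) ^ a * eulerS a S ((b * r) • w))) r := by
  have h1 : HasDerivAt (fun r : ℝ => (b * r) ^ a) _ r := (((hasDerivAt_id r).const_mul b).pow a)
  have h2 : HasDerivAt (fun r : ℝ => (b * r) • w) _ r := ((hasDerivAt_id r).const_mul b).smul_const w
  have h3 : HasDerivAt (fun r : ℝ => S ((b * r) • w)) _ r :=
    (S.differentiable ((b * r) • w)).hasFDerivAt.comp_hasDerivAt r h2
  refine (h1.mul h3).congr_deriv ?_
  rw [eulerS_apply]
  simp only [mul_one, id_eq, map_smul, smul_eq_mul]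
  rcases a with _ | a
  · simp; field_simp
  · simp only [add_tsub_cancel_right]
    push_cast
    field_simp
    ring

/-- The kernel is recovered from itself and its `τ`-derivative by an exponential average. -/
lemma mixK_eq_integral (hm : IsMix m) (S : 𝓢(E, ℝ)) (ha : 1 ≤ a)
    (hθ : 0 < θ) (hτ : 0 < τ) (hw : w ≠ 0) :
    mixK m S a τ w = ∫ r in (0 : ℝ)..τ, θ⁻¹ * exp (-(τ - r) / θ) *
      (mixK m S a r w + θ * (r⁻¹ * mixK m (eulerS a S) a r w)) := by
  have := hm.finite
  have hw0 : 0 < ‖w‖ := by positivity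
  have hJ : ∀ S : 𝓢(E, ℝ), Integrable (fun p : ℝ × ℝ => p.2⁻¹ * ((p.1 * p.2) ^ a * S ((p.1 * p.2) • w)))
      (m.prod (volume.restrict (Ioc 0 τ))) := fun S => by
    obtain ⟨C, hC, h⟩ := lintegral_mixK_le hm S ha
    have hS := S.continuous
    have hm1 : Measurable fun p : ℝ × ℝ => p.2⁻¹ * ((p.1 * p.2) ^ a * S ((p.1 * p.2) • w)) := by fun_prop
    have hi := (intervalIntegral.intervalIntegrable_rpow' (a := 0) (b := τ) (r := -(1 / 4)) (by norm_num)).const_mul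
      (C * ‖w‖ ^ (-((a : ℝ) - 3 / 4)))
    rw [intervalIntegrable_iff_integrableOn_Ioc_of_le hτ.le] at hi
    refine ⟨hm1.aestronglyMeasurable, ?_⟩
    rw [HasFiniteIntegral, lintegral_prod_symm' _ (by fun_prop)]
    refine (setLIntegral_mono' measurableSet_Ioc fun r hr => ?_).trans_lt hi.lintegral_lt_top
    have hr0 : 0 < r := hr.1
    simp only [enorm_mul r⁻¹]
    rw [lintegral_const_mul' _ _ enorm_ne_top, enorm_of_nonneg (by positivity)]
    refine (mul_le_mul_right (h r hr0 w hw) _).trans ?_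
    rw [← ofReal_mul (by positivity)]
    refine ofReal_le_ofReal ?_
    have e : r ^ (-(1 / 4) : ℝ) = r⁻¹ * (r ^ a * r ^ (-((a : ℝ) - 3 / 4))) := by
      rw [← rpow_natCast, ← rpow_add hr0, ← Real.rpow_neg_one, ← rpow_add hr0]; ring_nf
    have : ((1 + r * ‖w‖) ^ 6)⁻¹ ≤ 1 := inv_le_one_of_one_le₀ (one_le_pow₀ (by have := mul_pos hr0 hw0; linarith))
    rw [mixProfile, mul_rpow hr0.le hw0.le, e]
    calc _ = C * ‖w‖ ^ (-((a : ℝ) - 3 / 4)) * (r⁻¹ * (r ^ a * r ^ (-((a : ℝ) - 3 / 4)))) * ((1 + r * ‖w‖) ^ 6)⁻¹ := by ring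
      _ ≤ _ := mul_le_of_le_one_right (by positivity) this
  set F' : ℝ → ℝ → ℝ := fun b r => θ⁻¹ * exp (-(τ - r) / θ) *
    ((b * r) ^ a * S ((b * r) • w) + θ * (r⁻¹ * ((b * r) ^ a * eulerS a S ((b * r) • w)))) with hF'
  have hmem : ∀ᵐ p : ℝ × ℝ ∂m.prod (volume.restrict (Ioc 0 τ)), p.2 ∈ Ioc 0 τ :=
    Measure.quasiMeasurePreserving_snd.ae (ae_restrict_mem measurableSet_Ioc)
  have hint : Integrable (uncurry F') (m.prod (volume.restrict (Ioc 0 τ))) := by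
    refine ((((hJ S).bdd_mul (f := Prod.snd) (c := τ) (by fun_prop) ?_).add ((hJ (eulerS a S)).const_mul θ)).bdd_mul
      (f := fun p => θ⁻¹ * exp (-(τ - p.2) / θ)) (c := θ⁻¹) (by fun_prop) ?_).congr ?_
    · filter_upwards [hmem] with p hp using (norm_of_nonneg hp.1.le).trans_le hp.2
    · filter_upwards [hmem] with p hp
      rw [norm_of_nonneg (by positivity)]
      exact mul_le_of_le_one_right (by positivity) (exp_le_one_iff.2 (div_nonpos_of_nonpos_of_nonneg (by linarith [hp.2]) hθ.le))
    · filter_upwards [hmem] with p hp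
      have := hp.1.ne'
      simp only [hF', uncurry, Pi.add_apply]; field_simp
  have hftc : ∀ᵐ b ∂m, ∫ r in Ioc 0 τ, F' b r = (b * τ) ^ a * S ((b * τ) • w) := by
    filter_upwards [hint.prod_right_ae] with b hb
    have hder : ∀ r ∈ Ioo 0 τ, HasDerivAt (fun r => exp (-(τ - r) / θ) * ((b * r) ^ a * S ((b * r) • w))) (F' b r) r := fun r hr => by
      have e1 : HasDerivAt (fun r : ℝ => -(τ - r) / θ) θ⁻¹ r := by
        simpa using (((hasDerivAt_id r).const_sub τ).neg).div_const θ
      refine (e1.exp.mul (hasDerivAt_mix S a b w hr.1.ne')).congr_deriv ?_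
      simp only [hF']; field_simp
    rw [← intervalIntegral.integral_of_le hτ.le, intervalIntegral.integral_eq_sub_of_hasDerivAt_of_le hτ.le (by fun_prop) hder
      ((intervalIntegrable_iff_integrableOn_Ioc_of_le hτ.le).2 hb)]
    simp [show a ≠ 0 by omega]
  rw [intervalIntegral.integral_of_le hτ.le, mixK, ← integral_congr_ae hftc, integral_integral_swap hint]
  refine setIntegral_congr_fun measurableSet_Ioc fun r hr => ?_
  simp only [hF', mixK]
  rw [integral_const_mul, integral_add (integrable_mixK hm S ha hr.1 hw)
    (((integrable_mixK hm (eulerS a S) ha hr.1 hw).const_mul _).const_mul _), integral_const_mul, integral_const_mul]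

/-! ### Fourier side estimates for the kernels -/

/-- A real Schwartz function viewed as a complex valued one. -/
def toC (S : 𝓢(E, ℝ)) : 𝓢(E, ℂ) := S.postcompCLM ofRealCLM

@[simp] theorem toC_apply (S : 𝓢(E, ℝ)) (x : E) : toC S x = (S x : ℂ) := rfl

/-- The Fourier transform of a real function. -/
def fourierR (f : E → ℝ) : E → ℂ := 𝓕 (fun x => (f x : ℂ))

lemma fourierR_eq (f : E → ℝ) (ξ : E) :
    fourierR f ξ = ∫ v, Complex.exp (((-2 * Real.pi * inner ℝ v ξ : ℝ) : ℂ) * I) * (f v : ℂ) := by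
  rw [fourierR, Real.fourier_eq']
  rfl

lemma enorm_fourierR_neg (f : E → ℝ) (ξ : E) : ‖fourierR f (-ξ)‖ₑ = ‖fourierR f ξ‖ₑ := by
  have : fourierR f (-ξ) = (starRingEnd ℂ) (fourierR f ξ) := by
    rw [fourierR_eq, fourierR_eq, ← integral_conj]
    refine integral_congr_ae (of_forall fun v => ?_)
    simp only [map_mul, Complex.conj_ofReal, ← Complex.exp_conj, Complex.conj_I, inner_neg_right]
    congr 2
    push_cast; ring
  rw [this, ← ofReal_norm, ← ofReal_norm, RCLike.norm_conj]

lemma schwartz_inversion (S : 𝓢(E, ℝ)) (x : E) :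
    (S x : ℂ) = ∫ η, Complex.exp (((2 * Real.pi * inner ℝ η x : ℝ) : ℂ) * I) * (𝓕 (toC S)) η := by
  have h : (𝓕⁻ (𝓕 (toC S)) : 𝓢(E, ℂ)) x = toC S x := by simp
  rw [SchwartzMap.fourierInv_coe, Real.fourierInv_eq'] at h
  rw [← toC_apply, ← h]
  rfl

lemma lintegral_comp_smul_E (f : E → ℝ≥0∞) (hf : Measurable f) (hc : 0 < c) :
    ∫⁻ x, f (c • x) = ofReal ((c ^ 3)⁻¹) * ∫⁻ x, f x := by
  have h := Measure.map_addHaar_smul (volume : Measure E) hc.ne'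
  rw [← lintegral_map hf (by fun_prop), h, lintegral_smul_measure]
  simp [abs_of_pos hc]

lemma enorm_pairing_schwartz_le (S : 𝓢(E, ℝ)) {c : ℝ} (hc : 0 < c) {Z h : E → ℝ} (hZ : Integrable Z) (hh : Integrable h) :
    ‖∫ v, Z v * ∫ v', S (c • (v - v')) * h v'‖ₑ ≤
      ofReal ((c ^ 3)⁻¹) * ∫⁻ ξ, ‖(𝓕 (toC S)) (c⁻¹ • ξ)‖ₑ * (‖fourierR Z ξ‖ₑ * ‖fourierR h ξ‖ₑ) := by
  set SF : 𝓢(E, ℂ) := 𝓕 (toC S) with hSF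
  set Φ : E × E → E → ℂ := fun p η => Complex.exp (((2 * Real.pi * inner ℝ η (c • (p.1 - p.2)) : ℝ) : ℂ) * I) *
    ((Z p.1 : ℂ) * (h p.2 : ℂ) * SF η) with hΦ
  have hZh : Integrable (fun p : E × E => Z p.1 * h p.2) (volume.prod volume) := hZ.mul_prod hh
  have hS : Integrable (fun p : E × E => Z p.1 * (S (c • (p.1 - p.2)) * h p.2)) (volume.prod volume) :=
    (hZh.bdd_mul (f := fun p => S (c • (p.1 - p.2))) (c := SchwartzMap.seminorm ℝ 0 0 S)
      (S.continuous.comp (by fun_prop)).aestronglyMeasurable (.of_forall fun p => S.norm_le_seminorm ℝ _)).congr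
      (.of_forall fun p => by ring)
  have hi : Integrable (uncurry Φ) ((volume.prod volume).prod volume) := by
    have h0 : Integrable (fun q : (E × E) × E => (Z q.1.1 : ℂ) * (h q.1.2 : ℂ) * SF q.2) ((volume.prod volume).prod volume) :=
      ((hZ.ofReal (𝕜 := ℂ)).mul_prod (hh.ofReal (𝕜 := ℂ))).mul_prod SF.integrable
    exact h0.bdd_mul (c := 1) (by fun_prop) (.of_forall fun q => (norm_exp_ofReal_mul_I _).le)
  have hout : ((∫ v, Z v * ∫ v', S (c • (v - v')) * h v' : ℝ) : ℂ) =
      ∫ η, (SF η * fourierR h (c • η)) * fourierR Z (-(c • η)) := by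
    have e1 : ∫ v, Z v * ∫ v', S (c • (v - v')) * h v' = ∫ p, Z p.1 * (S (c • (p.1 - p.2)) * h p.2) ∂(volume.prod volume) := by
      rw [integral_prod _ hS]; simp_rw [integral_const_mul]
    rw [e1, ← integral_complex_ofReal, integral_congr_ae (g := fun p => ∫ η, Φ p η) (.of_forall fun p => ?_), integral_integral_swap hi]
    · refine integral_congr_ae (.of_forall fun η => ?_)
      beta_reduce
      rw [fourierR_eq, fourierR_eq, mul_assoc, mul_comm (∫ v, _) (∫ v, _), ← integral_prod_mul, ← integral_const_mul]
      refine integral_congr_ae (.of_forall fun p => ?_)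
      simp only [hΦ]
      have : (((2 * Real.pi * inner ℝ η (c • (p.1 - p.2)) : ℝ) : ℂ) * I) = ((-2 * Real.pi * inner ℝ p.1 (-(c • η)) : ℝ) : ℂ) * I +
          ((-2 * Real.pi * inner ℝ p.2 (c • η) : ℝ) : ℂ) * I := by
        simp only [inner_smul_right, inner_sub_right, inner_neg_right, real_inner_comm η]
        push_cast; ring
      rw [this, Complex.exp_add]; ring
    · simp only [hΦ, Complex.ofReal_mul, schwartz_inversion S, ← integral_mul_const, ← integral_const_mul]
      congr 1 with η; ring
  have hnorm : ‖∫ v, Z v * ∫ v', S (c • (v - v')) * h v'‖ₑ = ‖((∫ v, Z v * ∫ v', S (c • (v - v')) * h v' : ℝ) : ℂ)‖ₑ := by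
    rw [← ofReal_norm, ← ofReal_norm, norm_real]
  have hF : ∀ {f : E → ℝ}, Integrable f → Continuous (fourierR f) := fun {f} hf =>
    VectorFourier.fourierIntegral_continuous Real.continuous_fourierChar (by exact continuous_inner) hf.ofReal
  have hm : Measurable fun ξ => ‖SF (c⁻¹ • ξ)‖ₑ * (‖fourierR Z ξ‖ₑ * ‖fourierR h ξ‖ₑ) :=
    (by fun_prop : Continuous fun ξ => SF (c⁻¹ • ξ)).enorm.measurable.mul ((hF hZ).enorm.measurable.mul (hF hh).enorm.measurable)
  rw [hnorm, hout, ← lintegral_comp_smul_E _ hm hc]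
  refine (enorm_integral_le_lintegral_enorm _).trans (lintegral_mono fun η => ?_)
  rw [enorm_mul, enorm_mul, enorm_fourierR_neg, inv_smul_smul₀ hc.ne', mul_assoc, mul_comm ‖fourierR h _‖ₑ]

/-- The bound for the symbol of the kernel `mixK m S 2`. -/
def symb (m : Measure ℝ) (S : 𝓢(E, ℝ)) (τ : ℝ) (ξ : E) : ℝ≥0∞ :=
  ∫⁻ b, ofReal ((b * τ)⁻¹) * ‖(𝓕 (toC S)) ((b * τ)⁻¹ • ξ)‖ₑ ∂m

lemma measurable_symb_integrand (S : 𝓢(E, ℝ)) :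
    Measurable fun p : (ℝ × E) × ℝ => ofReal ((p.2 * p.1.1)⁻¹) *
      ‖(𝓕 (toC S)) ((p.2 * p.1.1)⁻¹ • p.1.2)‖ₑ := by
  have h : Measurable fun p : (ℝ × E) × ℝ => (p.2 * p.1.1)⁻¹ := by fun_prop
  exact (ENNReal.measurable_ofReal.comp h).mul
    (((𝓕 (toC S)).continuous.measurable.comp (h.smul (by fun_prop))).enorm)

lemma measurable_symb (m : Measure ℝ) [SFinite m] (S : 𝓢(E, ℝ)) :
    Measurable (uncurry (symb m S)) :=
  (measurable_symb_integrand S).lintegral_prod_right'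

lemma toC_lineDeriv (S : 𝓢(E, ℝ)) (l : Fin 3) :
    toC (∂_{basisVec l} S) = ∂_{basisVec l} (toC S) := by
  ext x
  rw [toC_apply, SchwartzMap.lineDerivOp_apply_eq_fderiv, SchwartzMap.lineDerivOp_apply_eq_fderiv]
  have h : HasFDerivAt (⇑(toC S)) (ofRealCLM.comp (fderiv ℝ S x)) x :=
    ofRealCLM.hasFDerivAt.comp x (S.differentiable x).hasFDerivAt
  rw [h.fderiv]
  rfl

lemma exists_fourier_bound (S : 𝓢(E, ℝ)) (l : Fin 3) :
    ∃ C : ℝ, 0 ≤ C ∧ ∀ η : E, ‖(𝓕 (toC (∂_{basisVec l} S))) η‖ ≤ C * (2 * ‖η‖ / (1 + ‖η‖ ^ 2)) := by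
  set T : 𝓢(E, ℂ) := 𝓕 (toC (∂_{basisVec l} S))
  set T0 : 𝓢(E, ℂ) := 𝓕 (toC S)
  have h1 : ∀ η, ‖T η‖ ≤ 2 * Real.pi * (SchwartzMap.seminorm ℝ 0 0 T0) * ‖η‖ := by
    intro η
    have e : T = (2 * Real.pi * I) •
        (SchwartzMap.smulLeftCLM ℂ fun x : E => inner ℝ x (basisVec l)) T0 := by
      simp only [T, T0]
      rw [toC_lineDeriv, SchwartzMap.fourier_lineDerivOp_eq]
    rw [e]
    change ‖(2 * Real.pi * I) • ((SchwartzMap.smulLeftCLM ℂ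
      fun x : E => inner ℝ x (basisVec l)) T0) η‖ ≤ _
    rw [SchwartzMap.smulLeftCLM_apply_apply (by fun_prop), norm_smul, norm_smul, inner_basisVec]
    have h0 := SchwartzMap.norm_le_seminorm ℝ T0 η
    have h2 : ‖η l‖ ≤ ‖η‖ := PiLp.norm_apply_le η l
    have h3 : ‖(2 * Real.pi * I : ℂ)‖ = 2 * Real.pi := by
      simp [abs_of_pos pi_pos]
    rw [h3]
    calc 2 * Real.pi * (‖η l‖ * ‖T0 η‖) ≤ 2 * Real.pi * (‖η‖ * SchwartzMap.seminorm ℝ 0 0 T0) := by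
          gcongr
      _ = _ := by ring
  have h2 : ∀ η, ‖η‖ * ‖T η‖ ≤ SchwartzMap.seminorm ℝ 1 0 T := fun η => by
    simpa using SchwartzMap.norm_pow_mul_le_seminorm ℝ T 1 η
  set A := 2 * Real.pi * (SchwartzMap.seminorm ℝ 0 0 T0)
  set B := SchwartzMap.seminorm ℝ 1 0 T
  have hA : 0 ≤ A := by positivity
  have hB : 0 ≤ B := by positivity
  refine ⟨A + B, by positivity, fun η => ?_⟩
  have hη := norm_nonneg η
  rw [mul_div_assoc', le_div_iff₀ (by positivity)]
  have e1 := h1 η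
  have e2 := mul_le_mul_of_nonneg_right (h2 η) hη
  nlinarith [mul_nonneg hA hη, mul_nonneg hB hη]

lemma lintegral_kernel_pi {k : ℝ} (hk : 0 < k) :
    ∫⁻ τ in Ioi (0 : ℝ), ofReal (2 * k / (τ ^ 2 + k ^ 2)) ≤ ofReal (2 * Real.pi) := by
  refine (lintegral_mono' Measure.restrict_le_self le_rfl).trans ?_
  have hi : Integrable fun τ : ℝ => (1 + (τ / k) ^ 2)⁻¹ := integrable_inv_one_add_sq.comp_div hk.ne'
  have e : ∀ τ : ℝ, 2 * k / (τ ^ 2 + k ^ 2) = 2 / k * (1 + (τ / k) ^ 2)⁻¹ := fun τ => by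
    field_simp; ring
  simp_rw [e]
  rw [← ofReal_integral_eq_lintegral_ofReal (by fun_prop) (of_forall fun τ => by positivity),
    integral_const_mul, Measure.integral_comp_div (fun x : ℝ => (1 + x ^ 2)⁻¹) k,
    integral_univ_inv_one_add_sq, abs_of_pos hk, smul_eq_mul]
  refine ofReal_le_ofReal (le_of_eq ?_)
  field_simp

lemma lintegral_symb_le (hm : IsMix m) (S : 𝓢(E, ℝ)) (l : Fin 3) :
    ∃ C : ℝ, 0 ≤ C ∧ ∀ ξ : E, ∫⁻ τ in Ioi (0 : ℝ), symb m (∂_{basisVec l} S) τ ξ ≤ ofReal C := by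
  have := hm.finite
  obtain ⟨C, hC, h⟩ := exists_fourier_bound S l
  have hpos : 0 ≤ ∫ b, b ^ (-1 : ℝ) ∂m := integral_nonneg_of_ae (by
    filter_upwards [hm.pos] with b hb using rpow_nonneg hb.le _)
  refine ⟨2 * Real.pi * C * ∫ b, b ^ (-1 : ℝ) ∂m, by positivity, fun ξ => ?_⟩
  have hmeas : Measurable fun p : ℝ × ℝ => ofReal ((p.2 * p.1)⁻¹) *
      ‖(𝓕 (toC (∂_{basisVec l} S))) ((p.2 * p.1)⁻¹ • ξ)‖ₑ :=
    (measurable_symb_integrand (∂_{basisVec l} S)).comp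
      (f := fun p : ℝ × ℝ => (((p.1, ξ), p.2) : (ℝ × E) × ℝ)) (by fun_prop)
  unfold symb
  rw [lintegral_lintegral_swap hmeas.aemeasurable]
  calc ∫⁻ b, (∫⁻ τ in Ioi (0 : ℝ), ofReal ((b * τ)⁻¹) *
        ‖(𝓕 (toC (∂_{basisVec l} S))) ((b * τ)⁻¹ • ξ)‖ₑ) ∂m
      ≤ ∫⁻ b, ofReal (2 * Real.pi * C) * ofReal (b ^ (-1 : ℝ)) ∂m := by
        refine lintegral_mono_ae ?_
        filter_upwards [hm.pos] with b hb
        rcases eq_or_ne ξ 0 with rfl | hξ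
        · have h0 := h 0
          simp only [norm_zero, mul_zero, zero_div] at h0
          have h00 : (𝓕 (toC (∂_{basisVec l} S))) 0 = 0 := norm_le_zero_iff.1 h0
          simp [h00]
        have hξ0 : 0 < ‖ξ‖ := by positivity
        calc ∫⁻ τ in Ioi (0 : ℝ), ofReal ((b * τ)⁻¹) *
              ‖(𝓕 (toC (∂_{basisVec l} S))) ((b * τ)⁻¹ • ξ)‖ₑ
            ≤ ∫⁻ τ in Ioi (0 : ℝ), ofReal (C * b⁻¹) *
                ofReal (2 * (‖ξ‖ / b) / (τ ^ 2 + (‖ξ‖ / b) ^ 2)) := by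
              refine setLIntegral_mono' measurableSet_Ioi fun τ hτ => ?_
              have hτ0 : 0 < τ := hτ
              rw [← ofReal_norm, ← ofReal_mul (by positivity), ← ofReal_mul (by positivity)]
              refine ofReal_le_ofReal ?_
              refine (mul_le_mul_of_nonneg_left (h _) (by positivity)).trans (le_of_eq ?_)
              rw [norm_smul, norm_of_nonneg (by positivity)]
              field_simp
          _ ≤ ofReal (C * b⁻¹) * ofReal (2 * Real.pi) := by
              rw [lintegral_const_mul' _ _ ofReal_ne_top]
              gcongr
              exact lintegral_kernel_pi (by positivity)
          _ = _ := by
              rw [← ofReal_mul (by positivity), ← ofReal_mul (by positivity),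
                Real.rpow_neg_one]
              congr 1; ring
    _ = _ := by
        rw [lintegral_const_mul' _ _ ofReal_ne_top, ← ofReal_integral_eq_lintegral_ofReal
          (hm.moment (-1) (by norm_num)) (by
            filter_upwards [hm.pos] with b hb using rpow_nonneg hb.le _),
          ← ofReal_mul (by positivity)]

attribute [irreducible] fourierR symb

/-! ### The gradient of the potential -/

lemma integral_hessG (i j : Fin 3) : ∫ x, hessG i j x = 0 := by
  have h := integral_mul_fderiv_eq_neg_fderiv_mul_of_integrable (μ := (volume : Measure E))
    (f := fun _ : E => (1 : ℝ)) (g := ⇑(∂_{basisVec j} gauss : 𝓢(E, ℝ))) (v := basisVec i) (by simp)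
    (by
      simp only [one_mul]
      change Integrable ⇑(∂_{basisVec i} (∂_{basisVec j} gauss) : 𝓢(E, ℝ))
      exact SchwartzMap.integrable _)
    (by simpa using (∂_{basisVec j} gauss : 𝓢(E, ℝ)).integrable) (fun x _ => by fun_prop)
    (fun x _ => SchwartzMap.differentiable _ x)
  simp only [one_mul, fderiv_fun_const, Pi.zero_apply, zero_apply, zero_mul, integral_zero,
    neg_zero] at h
  have e : ∀ x, hessG i j x = (-(1 / 4) : ℝ) * fderiv ℝ (⇑(∂_{basisVec j} gauss : 𝓢(E, ℝ))) x (basisVec i) :=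
    fun x => rfl
  simp_rw [e]
  rw [integral_const_mul, h, mul_zero]

lemma integrable_coord_mul_gauss (i j : Fin 3) :
    Integrable (fun x : E => x i * x j * exp (-‖x‖ ^ 2)) := by
  have h := ((gauss.integrable (μ := volume)).const_mul (if i = j then (1 / 2 : ℝ) else 0)).sub (hessG i j).integrable
  refine h.congr (of_forall fun x => ?_)
  simp only [Pi.sub_apply, hessG_apply, gauss_apply]
  ring

lemma integrable_gauss_exp : Integrable (fun x : E => exp (-‖x‖ ^ 2)) := gauss.integrable

lemma integral_coord_mul_gauss (i j : Fin 3) :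
    ∫ x : E, x i * x j * exp (-‖x‖ ^ 2) =
      (if i = j then 1 / 2 else 0) * Real.pi ^ (3 / 2 : ℝ) := by
  have h := integral_hessG i j
  simp_rw [hessG_apply, sub_mul] at h
  rw [integral_sub (integrable_gauss_exp.const_mul _) (integrable_coord_mul_gauss i j),
    integral_const_mul, sub_eq_zero] at h
  rw [← h]
  have := GaussianFourier.integral_rexp_neg_mul_sq_norm (V := E) (b := 1) one_pos
  simp only [finrank_euclideanSpace, Fintype.card_fin, neg_mul, one_mul, div_one] at this
  rw [this]; norm_num

lemma integral_coord_gauss (i : Fin 3) : ∫ x : E, x i * exp (-‖x‖ ^ 2) = 0 := by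
  have h := integral_neg_eq_self (fun x : E => x i * exp (-‖x‖ ^ 2)) volume
  simp only [norm_neg, PiLp.neg_apply, neg_mul, integral_neg] at h
  linarith

lemma integrable_coord_gauss (i : Fin 3) : Integrable fun x : E => x i * exp (-‖x‖ ^ 2) := by
  refine Integrable.mono' (integrable_gauss_exp.add (integrable_coord_mul_gauss i i))
    (by fun_prop) (of_forall fun x => ?_)
  rw [norm_mul, norm_of_nonneg (exp_pos _).le, norm_eq_abs, Pi.add_apply]
  have : |x i| ≤ 1 + x i * x i := by
    rcases abs_cases (x i) with ⟨h, _⟩ | ⟨h, _⟩ <;> rw [h] <;> nlinarith [sq_nonneg (x i - 1), sq_nonneg (x i + 1)]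
  nlinarith [exp_pos (-‖x‖ ^ 2)]

lemma integral_four {X : Type*} [MeasurableSpace X] {μ : Measure X} {f₁ f₂ f₃ f₄ : X → ℝ}
    (h₁ : Integrable f₁ μ) (h₂ : Integrable f₂ μ) (h₃ : Integrable f₃ μ) (h₄ : Integrable f₄ μ) :
    ∫ x, f₁ x - f₂ x + f₃ x - f₄ x ∂μ =
      ∫ x, f₁ x ∂μ - ∫ x, f₂ x ∂μ + ∫ x, f₃ x ∂μ - ∫ x, f₄ x ∂μ :=
  (integral_sub ((h₁.sub h₂).add h₃) h₄).trans (by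
    congr 1
    exact (integral_add (h₁.sub h₂) h₃).trans (by rw [← integral_sub h₁ h₂]; rfl))

/-- The time slice of `-∂_i φ`. -/
def slice (i : Fin 3) (s : ℝ) (x : E) : ℝ := x i / (2 * s ^ 2) * exp (-s - ‖x‖ ^ 2 / (4 * s))

/-- Completing the square. -/
lemma integral_slice_mul (i j : Fin 3) {s' : ℝ} (hs : 0 < s) (hs' : 0 < s') (y : E) :
    ∫ x, slice i s x * slice j s' (x - y) =
      exp (-(s + s')) / (4 * s ^ 2 * s' ^ 2) * (Real.pi ^ (3 / 2 : ℝ) *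
        (4 * s * s' / (s + s')) ^ (5 / 2 : ℝ)) * hessG i j ((2 * √(s + s'))⁻¹ • y) := by
  set T := s + s' with hT
  have hT0 : 0 < T := by positivity
  set ρ := √(4 * s * s' / T) with hρ
  have hρ0 : 0 < ρ := by positivity
  have hρ2 : ρ ^ 2 = 4 * s * s' / T := sq_sqrt (by positivity)
  -- substitute `x = ρ z + (s / T) y`
  have e1 : ∫ x, slice i s x * slice j s' (x - y) =
      ρ ^ 3 * ∫ z : E, slice i s (ρ • z + (s / T) • y) * slice j s' (ρ • z + (s / T) • y - y) := by
    have h1 := integral_comp_smul (volume : Measure E)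
      (fun z => slice i s (z + (s / T) • y) * slice j s' (z + (s / T) • y - y)) ρ
    rw [h1, integral_add_right_eq_self (fun z => slice i s z * slice j s' (z - y))]
    simp only [finrank_euclideanSpace, Fintype.card_fin, smul_eq_mul]
    rw [abs_of_pos (by positivity)]
    field_simp
  have e2 : ∀ z : E, slice i s (ρ • z + (s / T) • y) * slice j s' (ρ • z + (s / T) • y - y) =
      (exp (-T) / (4 * s ^ 2 * s' ^ 2) * exp (-(‖y‖ ^ 2 / (4 * T)))) *
      (ρ ^ 2 * (z i * z j * exp (-‖z‖ ^ 2)) - (ρ * (s' / T) * y j) * (z i * exp (-‖z‖ ^ 2))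
        + (ρ * (s / T) * y i) * (z j * exp (-‖z‖ ^ 2)) -
          (s * s' / T ^ 2 * (y i * y j)) * exp (-‖z‖ ^ 2)) := by
    intro z
    have hz : ρ • z + (s / T) • y - y = ρ • z - (s' / T) • y := by
      have : (s / T) • y - y = - ((s' / T) • y) := by
        rw [← neg_smul, ← sub_eq_zero, ← one_smul ℝ y, smul_smul, smul_smul, ← sub_smul, ← sub_smul]
        have : s / T * 1 - 1 - -(s' / T) * 1 = 0 := by field_simp; rw [hT]; ring
        rw [this, zero_smul]
      rw [add_sub_assoc, this, sub_eq_add_neg]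
    have hexp : exp (-s - ‖ρ • z + (s / T) • y‖ ^ 2 / (4 * s)) *
        exp (-s' - ‖ρ • z - (s' / T) • y‖ ^ 2 / (4 * s')) =
        exp (-T) * exp (-(‖y‖ ^ 2 / (4 * T))) * exp (-‖z‖ ^ 2) := by
      rw [← exp_add, ← exp_add, ← exp_add]
      congr 1
      rw [norm_add_sq_real, norm_sub_sq_real, norm_smul, norm_smul, norm_smul, inner_smul_left,
        inner_smul_left, inner_smul_right, inner_smul_right, mul_pow, mul_pow, mul_pow,
        norm_eq_abs, norm_eq_abs, norm_eq_abs, sq_abs, sq_abs, sq_abs, hρ2]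
      simp only [conj_trivial]
      field_simp
      rw [hT]; ring
    rw [hz, slice, slice]
    simp only [PiLp.add_apply, PiLp.sub_apply, PiLp.smul_apply, smul_eq_mul]
    calc _ = (ρ * z i + s / T * y i) * (ρ * z j - s' / T * y j) / (4 * s ^ 2 * s' ^ 2) *
        (exp (-s - ‖ρ • z + (s / T) • y‖ ^ 2 / (4 * s)) *
        exp (-s' - ‖ρ • z - (s' / T) • y‖ ^ 2 / (4 * s'))) := by
          field_simp; ring
      _ = _ := by rw [hexp]; field_simp; ring
  have hF : (4 * s * s' / T) ^ (5 / 2 : ℝ) = ρ ^ 5 := by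
    rw [hρ, sqrt_eq_rpow, ← rpow_natCast, ← rpow_mul (by positivity)]
    norm_num
  rw [e1]
  simp_rw [e2]
  have i1 := (integrable_coord_mul_gauss i j).const_mul (ρ ^ 2)
  have i2 := (integrable_coord_gauss i).const_mul (ρ * (s' / T) * y j)
  have i3 := (integrable_coord_gauss j).const_mul (ρ * (s / T) * y i)
  have i4 := integrable_gauss_exp.const_mul (s * s' / T ^ 2 * (y i * y j))
  have hg := GaussianFourier.integral_rexp_neg_mul_sq_norm (V := E) (b := 1) one_pos
  simp only [finrank_euclideanSpace, Fintype.card_fin, neg_mul, one_mul, div_one] at hg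
  rw [integral_const_mul, integral_four i1 i2 i3 i4]
  simp only [integral_const_mul]
  rw [integral_coord_gauss, integral_coord_gauss, integral_coord_mul_gauss, hg, hessG_apply, hF,
    norm_smul, mul_pow]
  have hsq : (‖(2 * √T)⁻¹‖) ^ 2 = 1 / (4 * T) := by
    rw [norm_eq_abs, sq_abs, inv_pow, mul_pow, sq_sqrt hT0.le]; norm_num
  have hsq' : (√T) ^ 2 = T := sq_sqrt hT0.le
  rw [hsq]
  simp only [PiLp.smul_apply, smul_eq_mul]
  have e5 : ((2 * √T)⁻¹ * y i) * ((2 * √T)⁻¹ * y j) = y i * y j / (4 * T) := by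
    calc _ = y i * y j / (4 * (√T) ^ 2) := by field_simp; ring
      _ = _ := by rw [hsq']
  rw [e5, show -(1 / (4 * T) * ‖y‖ ^ 2) = -(‖y‖ ^ 2 / (4 * T)) by ring]
  norm_num
  have e6 : s * s' / T ^ 2 = ρ ^ 2 / (4 * T) := by rw [hρ2]; field_simp
  rw [e6]
  field_simp
  split_ifs <;> ring

/-- The constant in front of the potential. -/
def potC : ℝ := ((2 : ℝ) ^ (3 / 2 : ℝ) * Real.Gamma (3 / 2))⁻¹

lemma pd_potential (i : Fin 3) (hx : x ≠ 0) :
    pd i potential x = -(potC * ∫ s in Ioi (0 : ℝ), slice i s x) := by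
  set F' : E → ℝ → E →L[ℝ] ℝ := fun x s =>
    (exp (-s - ‖x‖ ^ 2 / (4 * s)) * s⁻¹) • (-((4 * s)⁻¹ • (2 • (innerSL ℝ x : E →L[ℝ] ℝ)))) with hF'
  have hx0 : 0 < ‖x‖ := by positivity
  set d := ‖x‖ ^ 2 / 16 with hd
  have hd0 : 0 < d := by positivity
  have hder : ∀ s : ℝ, ∀ y : E, HasFDerivAt (fun y : E => exp (-s - ‖y‖ ^ 2 / (4 * s)) / s) (F' y s) y := by
    intro s y
    have h1 : HasFDerivAt (fun y : E => -s - ‖y‖ ^ 2 * (4 * s)⁻¹)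
        (-((4 * s)⁻¹ • (2 • (innerSL ℝ y : E →L[ℝ] ℝ)))) y :=
      ((hasStrictFDerivAt_norm_sq y).hasFDerivAt.mul_const (4 * s)⁻¹).const_sub (-s)
    have h2 := (h1.exp).mul_const s⁻¹
    refine (h2.congr_fderiv ?_)
    simp only [hF', smul_smul, div_eq_mul_inv]
    rw [mul_comm]
  have hb : ∀ s : ℝ, 0 < s → ∀ y ∈ Metric.ball x (‖x‖ / 2), ‖F' y s‖ ≤ (2 / d ^ 2 * ‖x‖) * exp (-s) := by
    intro s hs y hy
    have hy' : ‖y - x‖ < ‖x‖ / 2 := by simpa [dist_eq_norm] using hy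
    have l1 : ‖x‖ / 2 ≤ ‖y‖ := by
      have := norm_sub_norm_le x y; rw [norm_sub_rev] at this; linarith
    have l2 : ‖y‖ ≤ 2 * ‖x‖ := by have := norm_sub_norm_le y x; linarith
    have hn : ‖F' y s‖ = exp (-s - ‖y‖ ^ 2 / (4 * s)) * s⁻¹ * ((4 * s)⁻¹ * (2 * ‖y‖)) := by
      simp only [hF']
      rw [norm_smul, norm_neg, norm_smul, norm_of_nonneg (by positivity),
        norm_of_nonneg (by positivity), ← Nat.cast_smul_eq_nsmul ℝ, norm_smul, innerSL_apply_norm]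
      simp
    rw [hn]
    have e1 : exp (-s - ‖y‖ ^ 2 / (4 * s)) ≤ exp (-s) * (2 * s ^ 2 / d ^ 2) := by
      rw [sub_eq_add_neg, exp_add]
      gcongr
      have h3 : d / s ≤ ‖y‖ ^ 2 / (4 * s) := by
        rw [hd, div_div, div_le_div_iff₀ (by positivity) (by positivity)]
        nlinarith [mul_le_mul l1 l1 (by positivity) (norm_nonneg y)]
      have h4 : (d / s) ^ 2 / 2 ≤ exp (‖y‖ ^ 2 / (4 * s)) := by
        refine le_trans ?_ (exp_le_exp.2 h3)
        have := Real.quadratic_le_exp_of_nonneg (show 0 ≤ d / s by positivity)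
        have : 0 ≤ d / s := by positivity
        linarith
      rw [exp_neg, inv_le_comm₀ (by positivity) (by positivity)]
      refine le_trans (le_of_eq ?_) h4
      field_simp
    calc exp (-s - ‖y‖ ^ 2 / (4 * s)) * s⁻¹ * ((4 * s)⁻¹ * (2 * ‖y‖))
        ≤ exp (-s) * (2 * s ^ 2 / d ^ 2) * s⁻¹ * ((4 * s)⁻¹ * (2 * (2 * ‖x‖))) := by gcongr
      _ = _ := by field_simp; ring
  have hcont : ∀ y : E, AEStronglyMeasurable (fun s : ℝ => exp (-s - ‖y‖ ^ 2 / (4 * s)) / s)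
      μ₊ := fun y => Measurable.aestronglyMeasurable (by fun_prop)
  have hF0 : Integrable (fun s : ℝ => exp (-s - ‖x‖ ^ 2 / (4 * s)) / s) μ₊ := by
    refine Integrable.mono' ((exp_neg_integrableOn_Ioi 0 one_pos).const_mul (4 / ‖x‖ ^ 2)) (hcont x) ?_
    filter_upwards [ae_restrict_mem measurableSet_Ioi] with s hs
    have hs0 : 0 < s := hs
    rw [norm_of_nonneg (by positivity), sub_eq_add_neg, exp_add, neg_one_mul]
    have := Real.add_one_le_exp (‖x‖ ^ 2 / (4 * s))
    have h5 : exp (-(‖x‖ ^ 2 / (4 * s))) ≤ 4 * s / ‖x‖ ^ 2 := by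
      rw [exp_neg, inv_le_comm₀ (by positivity) (by positivity), inv_div]; linarith
    calc exp (-s) * exp (-(‖x‖ ^ 2 / (4 * s))) / s ≤ exp (-s) * (4 * s / ‖x‖ ^ 2) / s := by gcongr
      _ = _ := by field_simp
  have key := hasFDerivAt_integral_of_dominated_of_fderiv_le (μ := volume.restrict (Ioi (0:ℝ)))
    (F := fun (y : E) s => exp (-s - ‖y‖ ^ 2 / (4 * s)) / s) (F' := F') (x₀ := x)
    (Metric.ball_mem_nhds x (by positivity : 0 < ‖x‖ / 2)) (of_forall hcont) hF0
    (by fun_prop)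
    (by filter_upwards [ae_restrict_mem measurableSet_Ioi] with s hs using hb s hs)
    (by
      have := (exp_neg_integrableOn_Ioi 0 one_pos).const_mul (2 / d ^ 2 * ‖x‖)
      simpa using this)
    (of_forall fun s y _ => hder s y)
  have hpot : potential = fun y => potC * ∫ s in Ioi (0 : ℝ), exp (-s - ‖y‖ ^ 2 / (4 * s)) / s := rfl
  have hFi : Integrable (F' x) (volume.restrict (Ioi (0:ℝ))) := by
    refine Integrable.mono' ((exp_neg_integrableOn_Ioi 0 one_pos).const_mul (2 / d ^ 2 * ‖x‖))
      (by fun_prop) ?_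
    filter_upwards [ae_restrict_mem measurableSet_Ioi] with s hs
    rw [neg_one_mul]
    exact hb s hs x (Metric.mem_ball_self (by positivity))
  rw [pd, hpot, (key.const_mul potC).fderiv, smul_apply, ContinuousLinearMap.integral_apply hFi,
    smul_eq_mul, ← mul_neg, ← integral_neg]
  congr 1
  refine integral_congr_ae (of_forall fun s => ?_)
  simp only [hF', slice, smul_apply, neg_apply, innerSL_apply_apply, inner_basisVec, smul_eq_mul, nsmul_eq_mul]
  push_cast
  rcases eq_or_ne s 0 with rfl | hs
  · simp
  · field_simp; ring

lemma slice_sq_le (i : Fin 3) (hs : 0 < s) (x : E) :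
    slice i s x ^ 2 ≤ (s ^ 2)⁻¹ * exp (-s) * (exp (-s - ‖x‖ ^ 2 / (4 * s)) / s) := by
  have h1 : x i ^ 2 ≤ ‖x‖ ^ 2 := by
    have := PiLp.norm_apply_le x i
    rw [norm_eq_abs] at this
    exact sq_le_sq' (by linarith [neg_abs_le (x i)]) ((le_abs_self _).trans this)
  have h2 : ‖x‖ ^ 2 / (4 * s) ≤ exp (‖x‖ ^ 2 / (4 * s)) := by
    linarith [Real.add_one_le_exp (‖x‖ ^ 2 / (4 * s))]
  set y := ‖x‖ ^ 2 / (4 * s) with hy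
  have h3 : ‖x‖ ^ 2 = 4 * s * y := by rw [hy]; field_simp
  have h4 : y * exp (-y) ≤ 1 := by
    rw [exp_neg, ← div_eq_mul_inv, div_le_one (by positivity)]; exact h2
  rw [slice, ← hy]
  have e : exp (-s - y) = exp (-s) * exp (-y) := by rw [← exp_add, sub_eq_add_neg]
  rw [e, mul_pow, div_pow]
  have hE := exp_pos (-s)
  have hY := exp_pos (-y)
  calc x i ^ 2 / (2 * s ^ 2) ^ 2 * (exp (-s) * exp (-y)) ^ 2
      ≤ (4 * s * y) / (2 * s ^ 2) ^ 2 * (exp (-s) * exp (-y)) ^ 2 := by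
        rw [← h3]; gcongr
    _ = (s ^ 2)⁻¹ * exp (-s) * (exp (-s) * exp (-y) / s) * (y * exp (-y)) := by
        field_simp; ring
    _ ≤ _ := mul_le_of_le_one_right (by positivity) h4

lemma measurable_slice (i : Fin 3) : Measurable fun p : E × ℝ => slice i p.2 p.1 := by
  unfold slice
  fun_prop

/-- The modulus of the slices, integrated. -/
def sliceE (i : Fin 3) (x : E) : ℝ≥0∞ := ∫⁻ s in Ioi (0 : ℝ), ‖slice i s x‖ₑ

lemma measurable_sliceE (i : Fin 3) : Measurable (sliceE i) :=
  (measurable_slice i).enorm.lintegral_prod_right'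

/-- A bound for the `L²` norm of a slice. -/
def sliceN (s : ℝ) : ℝ := (4 * Real.pi) ^ (3 / 4 : ℝ) * (exp (-s) * s ^ ((1 / 4 : ℝ) - 1))

lemma l2_slice_le (i : Fin 3) (hs : 0 < s) (y : E) :
    l2 volume (fun x : E => ‖slice i s (x - y)‖ₑ) ≤ ofReal (sliceN s) := by
  rw [le_l2_iff]
  have h0 := lintegral_sub_right_eq_self (μ := (volume : Measure E)) (fun x => ‖slice i s x‖ₑ ^ 2) y
  rw [h0]
  obtain ⟨hi, he⟩ := potential_aux s hs
  calc ∫⁻ x, ‖slice i s x‖ₑ ^ 2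
      ≤ ∫⁻ x : E, ofReal ((s ^ 2)⁻¹ * exp (-s) * (exp (-s - ‖x‖ ^ 2 / (4 * s)) / s)) := by
        refine lintegral_mono fun x => ?_
        rw [← ofReal_norm, ← ofReal_pow (norm_nonneg _), norm_eq_abs, sq_abs]
        exact ofReal_le_ofReal (slice_sq_le i hs x)
    _ = ofReal ((s ^ 2)⁻¹ * exp (-s) * ((4 * Real.pi) ^ (3 / 2 : ℝ) *
          (s ^ ((3 / 2 : ℝ) - 1) * exp (-(1 * s))))) := by
        rw [← ofReal_integral_eq_lintegral_ofReal (by fun_prop) (of_forall fun x => by positivity),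
          integral_const_mul, he]
    _ = _ := by
        rw [← ofReal_pow (by unfold sliceN; positivity), sliceN]
        congr 1
        rw [mul_pow, mul_pow, ← rpow_natCast ((4 * Real.pi) ^ (3 / 4 : ℝ)), ← rpow_mul (by positivity),
          ← rpow_natCast (s ^ ((1 / 4 : ℝ) - 1)), ← rpow_mul hs.le, one_mul]
        have : (s ^ 2)⁻¹ = s ^ (-2 : ℝ) := by simp
        have e2 : s ^ (((1 / 4 : ℝ) - 1) * (2 : ℕ)) = s ^ (-2 : ℝ) * s ^ ((3 / 2 : ℝ) - 1) := by
          rw [← rpow_add hs]; norm_num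
        rw [this, e2]
        norm_num
        ring

lemma lintegral_sliceN : ∫⁻ s in Ioi (0 : ℝ), ofReal (sliceN s) < ⊤ := by
  have h : IntegrableOn sliceN (Ioi 0) :=
    (Real.GammaIntegral_convergent (by norm_num : (0 : ℝ) < 1 / 4)).const_mul _
  exact h.lintegral_lt_top

lemma lintegral_sliceE_mul_le (i j : Fin 3) (y : E) :
    ∫⁻ x, sliceE i x * sliceE j (x - y) ≤ (∫⁻ s in Ioi (0 : ℝ), ofReal (sliceN s)) ^ 2 := by
  set ρ := μ₊
  have m1 : Measurable fun p : E × (ℝ × ℝ) => ‖slice i p.2.1 p.1‖ₑ :=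
    ((measurable_slice i).comp (measurable_fst.prodMk measurable_snd.fst)).enorm
  have m2 : Measurable fun p : E × (ℝ × ℝ) => ‖slice j p.2.2 (p.1 - y)‖ₑ :=
    ((measurable_slice j).comp ((measurable_fst.sub_const y).prodMk measurable_snd.snd)).enorm
  have hN : Measurable fun s => ofReal (sliceN s) := by unfold sliceN; fun_prop
  have e1 : ∀ x, sliceE i x * sliceE j (x - y) =
      ∫⁻ p : ℝ × ℝ, ‖slice i p.1 x‖ₑ * ‖slice j p.2 (x - y)‖ₑ ∂(ρ.prod ρ) := fun x => by
    rw [lintegral_prod_mul (f := fun s => ‖slice i s x‖ₑ) (g := fun s => ‖slice j s (x - y)‖ₑ)]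
    · rfl
    · exact ((measurable_slice i).comp (measurable_const.prodMk measurable_id)).enorm.aemeasurable
    · exact ((measurable_slice j).comp (measurable_const.prodMk measurable_id)).enorm.aemeasurable
  simp_rw [e1]
  rw [lintegral_lintegral_swap (m1.mul m2).aemeasurable]
  calc ∫⁻ p : ℝ × ℝ, (∫⁻ x, ‖slice i p.1 x‖ₑ * ‖slice j p.2 (x - y)‖ₑ) ∂(ρ.prod ρ)
      ≤ ∫⁻ p : ℝ × ℝ, ofReal (sliceN p.1) * ofReal (sliceN p.2) ∂(ρ.prod ρ) := by
        have hae : ∀ᵐ p : ℝ × ℝ ∂(ρ.prod ρ), p ∈ Ioi (0 : ℝ) ×ˢ Ioi (0 : ℝ) := by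
          rw [prod_restrict]
          exact ae_restrict_mem (measurableSet_Ioi.prod measurableSet_Ioi)
        refine lintegral_mono_ae ?_
        filter_upwards [hae] with p hp
        refine (lintegral_mul_le_l2 ?_ ?_).trans (mul_le_mul' ?_ (l2_slice_le j hp.2 y))
        · exact ((measurable_slice i).comp (measurable_id.prodMk measurable_const)).enorm.aemeasurable
        · exact ((measurable_slice j).comp ((measurable_id.sub_const y).prodMk measurable_const)).enorm.aemeasurable
        · simpa using l2_slice_le i hp.1 0
    _ = _ := by rw [lintegral_prod_mul hN.aemeasurable hN.aemeasurable, sq]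

/-- The density of the mixing measure in the two time parameters of the slices. -/
def mixDensity (p : ℝ × ℝ) : ℝ :=
  potC ^ 2 * (exp (-(p.1 + p.2)) / (4 * p.1 ^ 2 * p.2 ^ 2) * (Real.pi ^ (3 / 2 : ℝ) *
    (4 * p.1 * p.2 / (p.1 + p.2)) ^ (5 / 2 : ℝ)))

/-- The measure mixing the rescaled Hessians of Gaussians. -/
def mixM : Measure ℝ :=
  Measure.map (fun p : ℝ × ℝ => (2 * √(p.1 + p.2))⁻¹)
    ((μ₊.prod μ₊).withDensity
      fun p => ofReal (mixDensity p))

@[fun_prop]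
lemma measurable_mixDensity : Measurable mixDensity := by unfold mixDensity; fun_prop

lemma ae_pos_prod : ∀ᵐ p : ℝ × ℝ ∂(μ₊.prod μ₊),
    0 < p.1 ∧ 0 < p.2 := by
  rw [prod_restrict]
  exact ae_restrict_mem (measurableSet_Ioi.prod measurableSet_Ioi)

lemma mixDensity_nonneg {p : ℝ × ℝ} (hp : 0 < p.1 ∧ 0 < p.2) : 0 ≤ mixDensity p := by
  obtain ⟨h1, h2⟩ := hp
  unfold mixDensity; positivity

lemma exists_rpow_mul_exp_le (hr : 0 ≤ r) :
    ∃ C : ℝ, 0 ≤ C ∧ ∀ T : ℝ, 0 ≤ T → T ^ r * exp (-T / 2) ≤ C := by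
  obtain ⟨k, hk⟩ := exists_nat_ge r
  refine ⟨1 + 2 ^ k * k.factorial, by positivity, fun T hT => ?_⟩
  have h1 := rpow_le_one_add_pow hT hr hk
  have h2 := Real.pow_div_factorial_le_exp (T / 2) (by positivity) k
  rw [div_le_iff₀ (by positivity), div_pow, div_le_iff₀ (by positivity)] at h2
  have h3 : exp (-T / 2) * exp (T / 2) = 1 := by rw [← exp_add]; norm_num; ring
  have h4 : exp (-T / 2) ≤ 1 := exp_le_one_iff.2 (by linarith)
  have h5 := exp_pos (-T / 2)
  calc T ^ r * exp (-T / 2) ≤ (1 + T ^ k) * exp (-T / 2) := by gcongr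
    _ ≤ (1 + exp (T / 2) * k.factorial * 2 ^ k) * exp (-T / 2) := by gcongr
    _ = exp (-T / 2) + (exp (-T / 2) * exp (T / 2)) * (2 ^ k * k.factorial) := by ring
    _ ≤ _ := by rw [h3]; linarith

lemma isMix_mixM : IsMix mixM := by
  have hb : Measurable fun p : ℝ × ℝ => (2 * √(p.1 + p.2))⁻¹ := by fun_prop
  constructor
  · rw [mixM, ae_map_iff hb.aemeasurable measurableSet_Ioi]
    refine (withDensity_absolutelyContinuous _ _).ae_le ?_
    filter_upwards [ae_pos_prod] with p hp
    have := hp.1; have := hp.2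
    positivity
  · intro q hq
    rw [mixM, integrable_map_measure (by fun_prop) hb.aemeasurable,
      integrable_withDensity_iff_integrable_smul' (by exact measurable_mixDensity.ennreal_ofReal)
        (of_forall fun _ => ofReal_lt_top)]
    set P : ℝ := max (5 / 2 + q / 2) 1 with hP
    have hP3 : P < 3 := by rw [hP]; exact max_lt (by linarith) (by norm_num)
    have hP1 : 1 ≤ P := le_max_right _ _
    have hPp : 0 ≤ P - (5 / 2 + q / 2) := by linarith [le_max_left (5 / 2 + q / 2) 1]
    obtain ⟨C, hC, hCb⟩ := exists_rpow_mul_exp_le hPp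
    have hG : Integrable (fun s : ℝ => s ^ ((1 - P) / 2) * exp (-(1 / 2) * s ^ (1 : ℝ)))
        μ₊ :=
      integrableOn_rpow_mul_exp_neg_mul_rpow (by linarith) one_pos (by norm_num)
    set D : ℝ := potC ^ 2 / 4 * Real.pi ^ (3 / 2 : ℝ) * 4 ^ (5 / 2 : ℝ) * 2 ^ (-q) * C with hD
    refine Integrable.mono' ((hG.mul_prod hG).const_mul D) (Measurable.aestronglyMeasurable (by
      have := measurable_mixDensity
      simp only [Function.comp]
      fun_prop)) ?_
    filter_upwards [ae_pos_prod] with p hp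
    have hd := mixDensity_nonneg hp
    obtain ⟨s, s'⟩ := p
    obtain ⟨hs, hs'⟩ : 0 < s ∧ 0 < s' := hp
    simp only [Function.comp, smul_eq_mul, Real.rpow_one] at hd ⊢
    rw [ENNReal.toReal_ofReal hd, norm_of_nonneg (by positivity)]
    set T := s + s' with hT
    have hT0 : 0 < T := by positivity
    have e1 : ((2 * √T)⁻¹) ^ q = 2 ^ (-q) * T ^ (-(q / 2)) := by
      rw [← Real.rpow_neg_eq_inv_rpow, mul_rpow (by norm_num) (by positivity), sqrt_eq_rpow,
        ← rpow_mul hT0.le]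
      congr 2; ring
    have e2 : mixDensity (s, s') = (potC ^ 2 / 4 * Real.pi ^ (3 / 2 : ℝ) * 4 ^ (5 / 2 : ℝ)) *
        ((s * s') ^ (1 / 2 : ℝ) * T ^ (-(5 / 2) : ℝ) * exp (-T)) := by
      have : (s * s') ^ (5 / 2 : ℝ) = (s * s') ^ (1 / 2 : ℝ) * (s * s') ^ 2 := by
        rw [← rpow_natCast, ← rpow_add (by positivity)]; norm_num
      simp only [mixDensity]
      rw [← hT, show 4 * s * s' = 4 * (s * s') by ring, Real.div_rpow (by positivity) hT0.le, mul_rpow (by norm_num) (by positivity),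
        rpow_neg hT0.le, this]
      field_simp
    have e3 : T ^ (-(5 / 2) : ℝ) * T ^ (-(q / 2)) = T ^ (P - (5 / 2 + q / 2)) * T ^ (-P) := by
      rw [← rpow_add hT0, ← rpow_add hT0]; congr 1; ring
    have e4 : exp (-T) = exp (-T / 2) * (exp (-(1 / 2) * s) * exp (-(1 / 2) * s')) := by
      rw [← exp_add, ← exp_add]; congr 1; rw [hT]; ring
    have e5 : T ^ (-P) ≤ (s * s') ^ (-(P / 2)) := by
      have h6 : (s * s') ^ (-(P / 2)) = (√(s * s')) ^ (-P) := by
        rw [sqrt_eq_rpow, ← rpow_mul (by positivity)]; congr 1; ring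
      rw [h6]
      refine Real.rpow_le_rpow_of_nonpos (by positivity) ?_ (by linarith)
      refine Real.sqrt_le_iff.2 ⟨hT0.le, ?_⟩
      rw [hT]; nlinarith
    have e6 : (s * s') ^ (1 / 2 : ℝ) * (s * s') ^ (-(P / 2)) = s ^ ((1 - P) / 2) * s' ^ ((1 - P) / 2) := by
      rw [← rpow_add (by positivity), ← mul_rpow hs.le hs'.le]; congr 1; ring
    set c0 := potC ^ 2 / 4 * Real.pi ^ (3 / 2 : ℝ) * 4 ^ (5 / 2 : ℝ) with hc0
    have hc00 : 0 ≤ c0 := by positivity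
    rw [e1, e2]
    calc c0 * ((s * s') ^ (1 / 2 : ℝ) * T ^ (-(5 / 2) : ℝ) * exp (-T)) * (2 ^ (-q) * T ^ (-(q / 2)))
        = c0 * 2 ^ (-q) * (s * s') ^ (1 / 2 : ℝ) * (T ^ (-(5 / 2) : ℝ) * T ^ (-(q / 2))) * exp (-T) := by ring
      _ = c0 * 2 ^ (-q) * (s * s') ^ (1 / 2 : ℝ) * T ^ (-P) * (T ^ (P - (5 / 2 + q / 2)) * exp (-T / 2)) *
          (exp (-(1 / 2) * s) * exp (-(1 / 2) * s')) := by rw [e3, e4]; ring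
      _ ≤ c0 * 2 ^ (-q) * (s * s') ^ (1 / 2 : ℝ) * (s * s') ^ (-(P / 2)) * C *
          (exp (-(1 / 2) * s) * exp (-(1 / 2) * s')) := by
          have := hCb T hT0.le
          gcongr
      _ = c0 * 2 ^ (-q) * ((s * s') ^ (1 / 2 : ℝ) * (s * s') ^ (-(P / 2))) * C *
          (exp (-(1 / 2) * s) * exp (-(1 / 2) * s')) := by ring
      _ = _ := by rw [e6, hD]; ring

lemma measurable_basis : MeasurableSet ({0} : Set E) := measurableSet_singleton 0

lemma ae_ne_zero : ∀ᵐ x : E, x ≠ 0 := by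
  rw [ae_iff]
  simp

/-- The autocorrelation of `∇φ` is a mixture of rescaled Hessians of Gaussians. -/
lemma integral_pd_potential_mul (i j : Fin 3) (y : E) :
    ∫ x, pd i potential x * pd j potential (x - y) = ∫ b, hessG i j (b • y) ∂mixM := by
  set ρ := μ₊ with hρ
  have hb : Measurable fun p : ℝ × ℝ => (2 * √(p.1 + p.2))⁻¹ := by fun_prop
  have m1 : Measurable fun p : E × (ℝ × ℝ) => slice i p.2.1 p.1 * slice j p.2.2 (p.1 - y) :=
    ((measurable_slice i).comp (measurable_fst.prodMk measurable_snd.fst)).mul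
    ((measurable_slice j).comp ((measurable_fst.sub_const y).prodMk measurable_snd.snd))
  have hint : Integrable (uncurry fun (x : E) (p : ℝ × ℝ) => slice i p.1 x * slice j p.2 (x - y))
      ((volume : Measure E).prod (ρ.prod ρ)) := by
    refine ⟨m1.aestronglyMeasurable, ?_⟩
    have e0 := lintegral_prod (μ := (volume : Measure E)) (ν := ρ.prod ρ) _ m1.enorm.aemeasurable
    refine lt_of_le_of_lt (le_of_eq e0) ?_
    refine lt_of_le_of_lt (le_of_eq ?_) ((lintegral_sliceE_mul_le i j y).trans_lt
      (pow_lt_top lintegral_sliceN))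
    refine lintegral_congr fun x => ?_
    simp only [enorm_mul]
    rw [lintegral_prod_mul (f := fun s => ‖slice i s x‖ₑ) (g := fun s => ‖slice j s (x - y)‖ₑ)]
    · rfl
    · exact ((measurable_slice i).comp (measurable_const.prodMk measurable_id)).enorm.aemeasurable
    · exact ((measurable_slice j).comp (measurable_const.prodMk measurable_id)).enorm.aemeasurable
  have hy : ∀ᵐ x : E, x - y ≠ 0 := by
    rw [ae_iff]
    simp [sub_eq_zero]
  have e1 : ∫ x, pd i potential x * pd j potential (x - y) =
      ∫ x, potC ^ 2 * ∫ p : ℝ × ℝ, slice i p.1 x * slice j p.2 (x - y) ∂(ρ.prod ρ) := by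
    refine integral_congr_ae ?_
    filter_upwards [ae_ne_zero, hy] with x hx hxy
    rw [pd_potential i hx, pd_potential j hxy, integral_prod_mul (fun s => slice i s x) (fun s => slice j s (x - y))]
    ring
  rw [e1, integral_const_mul, integral_integral_swap hint, mixM, integral_map hb.aemeasurable
    (Continuous.aestronglyMeasurable (by have := (hessG i j).continuous; fun_prop)),
    integral_withDensity_eq_integral_toReal_smul measurable_mixDensity.ennreal_ofReal
      (of_forall fun _ => ofReal_lt_top), ← integral_const_mul]
  refine integral_congr_ae ?_
  filter_upwards [ae_pos_prod] with p hp
  rw [integral_slice_mul i j hp.1 hp.2, ENNReal.toReal_ofReal (mixDensity_nonneg hp), mixDensity, smul_eq_mul]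
  ring

lemma pd_potential_ae (i : Fin 3) :
    pd i potential =ᵐ[volume] fun x => -(potC * ∫ s in Ioi (0 : ℝ), slice i s x) := by
  filter_upwards [ae_ne_zero] with x hx using pd_potential i hx

lemma aestronglyMeasurable_pd_potential (i : Fin 3) : AEStronglyMeasurable (pd i potential) volume := by
  refine AEStronglyMeasurable.congr ?_ (pd_potential_ae i).symm
  exact ((measurable_slice i).stronglyMeasurable.integral_prod_right'
    (ν := volume.restrict (Ioi (0:ℝ)))).aestronglyMeasurable.const_mul potC |>.neg

lemma l2_pd_potential_lt_top (i : Fin 3) : l2 volume (fun x => ‖pd i potential x‖ₑ) < ⊤ := by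
  have h : l2 volume (fun x => ‖pd i potential x‖ₑ) ≤ l2 volume (fun x => ‖potC‖ₑ * sliceE i x) := by
    refine l2_mono_ae ?_
    filter_upwards [pd_potential_ae i] with x hx
    rw [hx, enorm_neg, enorm_mul]
    gcongr
    exact enorm_integral_le_lintegral_enorm _
  refine h.trans_lt ?_
  rw [l2_const_mul (measurable_sliceE i).aemeasurable]
  refine mul_lt_top enorm_lt_top ?_
  have h2 := lintegral_sliceE_mul_le i i 0
  simp only [sub_zero] at h2
  refine lt_of_le_of_lt (le_l2_iff.2 ?_) lintegral_sliceN
  simpa only [sq] using h2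

lemma measurable_mixK₀ (i j : Fin 3) (τ : ℝ) : Measurable (mixK mixM (hessG i j) 0 τ) := by
  have := isMix_mixM.finite
  have h := (measurable_mixK (m := mixM) (hessG i j) 0).comp
    (measurable_prodMk_left (x := τ) : Measurable fun w : E => (τ, w))
  exact h

/-- The kernel `K[ν]` is a convolution with a mixture of Hessians of Gaussians. -/
lemma kernelK_eq (hν : Integrable ν) (τ : ℝ) (i j : Fin 3) (v : E) :
    kernelK ν τ i j v = ∫ v', mixK mixM (hessG i j) 0 τ (v - v') * ν v' := by
  have hm := aestronglyMeasurable_pd_potential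
  obtain ⟨g, hg, hgj⟩ : ∃ g : E → ℝ, StronglyMeasurable g ∧ pd j potential =ᵐ[volume] g := hm j
  have hqmp : ∀ y : E, ∀ᵐ x : E, pd j potential (x - y) = g (x - y) := fun y =>
    (measurePreserving_sub_right volume y).quasiMeasurePreserving.ae hgj
  have hgl : l2 volume (fun x => ‖g x‖ₑ) < ⊤ := by
    rw [← l2_congr (μ := (volume : Measure E)) (f := fun x => ‖pd j potential x‖ₑ) (g := fun x => ‖g x‖ₑ)
      (hgj.mono fun x hx => by change ‖_‖ₑ = _; rw [hx])]; exact l2_pd_potential_lt_top j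
  have hswap : kernelK ν τ i j v = ∫ x : E, ∫ v' : E, pd i potential x * g (x - τ • (v - v')) * ν v' := by
    have hmp : ∀ᵐ p : E × E, pd j potential (p.1 - τ • (v - p.2)) = g (p.1 - τ • (v - p.2)) := by
      have hsh : MeasurePreserving (fun p : E × E => (p.2, p.1 - τ • (v - p.2)))
          ((volume : Measure E).prod volume) ((volume : Measure E).prod volume) :=
        (MeasurePreserving.skew_product (MeasurePreserving.id volume) (g := fun v' x => x - τ • (v - v'))
          (by fun_prop) (of_forall fun v' => (measurePreserving_sub_right volume _).map_eq)).comp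
          measurePreserving_swap
      have h0 : ∀ᵐ p : E × E ∂((volume : Measure E).prod volume), pd j potential p.2 = g p.2 :=
        Measure.quasiMeasurePreserving_snd.ae hgj
      exact hsh.quasiMeasurePreserving.ae h0
    refine integral_congr_ae ?_
    filter_upwards [ae_ae_of_ae_prod hmp] with x hx
    refine integral_congr_ae ?_
    filter_upwards [hx] with v' hv'
    rw [hv']
  have hgm := hg.measurable
  have hint : Integrable (uncurry fun (x v' : E) => pd i potential x * g (x - τ • (v - v')) * ν v')
      ((volume : Measure E).prod volume) := by
    have m3 : AEStronglyMeasurable (uncurry fun (x v' : E) =>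
        pd i potential x * g (x - τ • (v - v')) * ν v') ((volume : Measure E).prod volume) := by
      refine AEStronglyMeasurable.mul (AEStronglyMeasurable.mul (hm i).comp_fst ?_) hν.1.comp_snd
      exact (hgm.comp (by fun_prop : Measurable fun p : E × E => p.1 - τ • (v - p.2))).aestronglyMeasurable
    refine ⟨m3, ?_⟩
    rw [HasFiniteIntegral, lintegral_prod_symm _ m3.enorm]
    calc ∫⁻ v', ∫⁻ x, ‖pd i potential x * g (x - τ • (v - v')) * ν v'‖ₑ
        ≤ ∫⁻ v', (l2 volume (fun x => ‖pd i potential x‖ₑ) * l2 volume (fun x => ‖g x‖ₑ)) * ‖ν v'‖ₑ := by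
          refine lintegral_mono fun v' => ?_
          simp_rw [enorm_mul]
          rw [lintegral_mul_const' _ _ enorm_ne_top]
          gcongr
          refine (lintegral_mul_le_l2 (hm i).enorm
            (hgm.comp (measurable_id.sub_const _)).enorm.aemeasurable).trans (le_of_eq ?_)
          congr 1
          unfold l2
          congr 1
          exact lintegral_sub_right_eq_self (fun x => ‖g x‖ₑ ^ 2) _
      _ < ⊤ := by
          rw [lintegral_const_mul' _ _ (mul_lt_top (l2_pd_potential_lt_top i) hgl).ne]
          exact mul_lt_top (mul_lt_top (l2_pd_potential_lt_top i) hgl) hν.2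
  rw [hswap, integral_integral_swap hint]
  refine integral_congr_ae (of_forall fun v' => ?_)
  beta_reduce
  rw [integral_mul_const]
  congr 1
  have e3 : ∫ x, pd i potential x * g (x - τ • (v - v')) =
      ∫ x, pd i potential x * pd j potential (x - τ • (v - v')) := by
    refine integral_congr_ae ?_
    filter_upwards [hqmp (τ • (v - v'))] with x hx
    rw [hx]
  rw [e3, integral_pd_potential_mul, mixK]
  refine integral_congr_ae (of_forall fun b => ?_)
  simp only [pow_zero, one_mul, smul_smul]

/-! ### Partial derivatives and multi-indices -/

/-- Smooth compactly supported functions. -/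
def IsTest (ψ : E → ℝ) : Prop := ContDiff ℝ ∞ ψ ∧ HasCompactSupport ψ

/-- The multi-index of the `i`-th coordinate. -/
def unitM (i : Fin 3) : MIdx := Pi.single i 1

lemma abs_add (α β : MIdx) : (α + β).abs = α.abs + β.abs := by
  simp [MIdx.abs, Finset.sum_add_distrib]

@[simp] theorem abs_unitM (i : Fin 3) : (unitM i).abs = 1 := by
  simp [MIdx.abs, unitM, Finset.sum_pi_single']

@[simp] theorem abs_zero_midx : (0 : MIdx).abs = 0 := by simp [MIdx.abs]

lemma abs_nsmul_unitM (k : ℕ) (i : Fin 3) : (k • unitM i).abs = k := by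
  simp [MIdx.abs, unitM, ← mul_sum, Finset.sum_pi_single']

lemma sum_nsmul_unitM (μ : MIdx) : μ 2 • unitM 2 + μ 1 • unitM 1 + μ 0 • unitM 0 = μ := by
  ext i
  fin_cases i <;> simp [unitM]

lemma mem_midxLE : α ∈ midxLE n ↔ α.abs ≤ n := by
  simp only [midxLE, Finset.mem_filter, Finset.mem_Iic, and_iff_right_iff_imp]
  intro h i
  exact (single_le_sum (f := α) (fun _ _ => Nat.zero_le _) (Finset.mem_univ i)).trans h

lemma midxLE_mono {m : ℕ} (h : m ≤ n) : midxLE m ⊆ midxLE n := fun _ hα =>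
  mem_midxLE.2 ((mem_midxLE.1 hα).trans h)

lemma exists_unitM_le {μ : MIdx} (h : 0 < μ.abs) : ∃ l, μ - unitM l + unitM l = μ ∧ (μ - unitM l).abs + 1 = μ.abs := by
  have : ∃ l, 0 < μ l := by
    by_contra! hc
    simp only [MIdx.abs] at h
    rw [Finset.sum_eq_zero fun i _ => Nat.le_zero.1 (hc i)] at h
    exact lt_irrefl _ h
  obtain ⟨l, hl⟩ := this
  have e : μ - unitM l + unitM l = μ := by
    ext i
    simp only [Pi.add_apply, Pi.sub_apply, unitM]
    rcases eq_or_ne i l with rfl | hi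
    · simp; omega
    · simp [Pi.single_eq_of_ne hi]
  refine ⟨l, e, ?_⟩
  rw [← abs_unitM l, ← abs_add, e]

lemma pd_iterate_family (h : ∀ κ i, κ.abs + 1 ≤ n → pd i (G κ) = G (κ + unitM i)) (i : Fin 3) (k : ℕ) :
    ∀ κ : MIdx, κ.abs + k ≤ n → (pd i)^[k] (G κ) = G (κ + k • unitM i) := by
  induction k with
  | zero => intro κ _; simp
  | succ k ih =>
    intro κ hκ
    rw [Function.iterate_succ_apply', ih κ (by omega), h _ _ (by rw [abs_add, abs_nsmul_unitM]; omega),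
      add_assoc, ← succ_nsmul]

lemma mderiv_family_add (h : ∀ κ i, κ.abs + 1 ≤ n → pd i (G κ) = G (κ + unitM i)) (κ μ : MIdx) (hμ : κ.abs + μ.abs ≤ n) :
    mderiv μ (G κ) = G (κ + μ) := by
  have hs : μ.abs = μ 0 + μ 1 + μ 2 := by simp [MIdx.abs, Fin.sum_univ_three]
  rw [mderiv, pd_iterate_family h 2 _ _ (by omega), pd_iterate_family h 1 _ _
    (by rw [abs_add, abs_nsmul_unitM]; omega), pd_iterate_family h 0 _ _
    (by rw [abs_add, abs_add, abs_nsmul_unitM, abs_nsmul_unitM]; omega), add_assoc, add_assoc, ← add_assoc (_ • unitM 2), sum_nsmul_unitM]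

lemma mderiv_family (h : ∀ κ i, κ.abs + 1 ≤ n → pd i (G κ) = G (κ + unitM i)) (μ : MIdx) (hμ : μ.abs ≤ n) :
    mderiv μ (G 0) = G μ := by
  rw [mderiv_family_add h 0 μ (by simpa using hμ), zero_add]

lemma contDiff_pd (hg : ContDiff ℝ ∞ g) (i : Fin 3) : ContDiff ℝ ∞ (pd i g) := by
  have : ContDiff ℝ ∞ (fderiv ℝ g) := hg.fderiv_right (by norm_cast)
  exact this.clm_apply contDiff_const

lemma contDiff_pd_iterate (hg : ContDiff ℝ ∞ g) (i : Fin 3) (k : ℕ) :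
    ContDiff ℝ ∞ ((pd i)^[k] g) := by
  induction k with
  | zero => exact hg
  | succ k ih => rw [Function.iterate_succ_apply']; exact contDiff_pd ih i

lemma contDiff_mderiv (hg : ContDiff ℝ ∞ g) (α : MIdx) : ContDiff ℝ ∞ (mderiv α g) :=
  contDiff_pd_iterate (contDiff_pd_iterate (contDiff_pd_iterate hg _ _) _ _) _ _

lemma hasCompactSupport_pd (hg : HasCompactSupport g) (i : Fin 3) :
    HasCompactSupport (pd i g) := hg.fderiv_apply ℝ _

lemma IsTest.pd (h : IsTest ψ) (i : Fin 3) : IsTest (pd i ψ) :=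
  ⟨contDiff_pd h.1 i, hasCompactSupport_pd h.2 i⟩

lemma IsTest.iterate (h : IsTest ψ) (i : Fin 3) (k : ℕ) : IsTest ((WeakCoupling.pd i)^[k] ψ) := by
  induction k with
  | zero => exact h
  | succ k ih => rw [Function.iterate_succ_apply']; exact ih.pd i

lemma IsTest.mderiv (h : IsTest ψ) (α : MIdx) : IsTest (mderiv α ψ) :=
  ((h.iterate _ _).iterate _ _).iterate _ _

lemma pd_comm (hg : ContDiff ℝ ∞ g) (i j : Fin 3) : pd i (pd j g) = pd j (pd i g) := by
  funext v
  have hd : DifferentiableAt ℝ (fderiv ℝ g) v :=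
    ((hg.fderiv_right (m := ∞) (by norm_cast)).differentiable (by norm_num)).differentiableAt
  have e : ∀ a b : Fin 3, pd a (pd b g) v = fderiv ℝ (fderiv ℝ g) v (basisVec a) (basisVec b) := by
    intro a b
    have h1 : HasFDerivAt (fun w => fderiv ℝ g w (basisVec b))
      ((ContinuousLinearMap.apply ℝ ℝ (basisVec b)).comp (fderiv ℝ (fderiv ℝ g) v)) v :=
      (ContinuousLinearMap.apply ℝ ℝ (basisVec b)).hasFDerivAt.comp v hd.hasFDerivAt
    change fderiv ℝ (fun w => fderiv ℝ g w (basisVec b)) v (basisVec a) = _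
    rw [h1.fderiv]; rfl
  rw [e, e]
  exact (hg.contDiffAt.isSymmSndFDerivAt (by
    simp only [minSmoothness_of_isRCLikeNormedField]
    exact (WithTop.coe_le_coe.2 le_top : ((2 : ℕ∞) : WithTop ℕ∞) ≤ ((⊤ : ℕ∞) : WithTop ℕ∞)))) _ _

lemma pd_iterate_comm (hg : ContDiff ℝ ∞ g) (i j : Fin 3) (k : ℕ) :
    pd i ((pd j)^[k] g) = (pd j)^[k] (pd i g) := by
  induction k with
  | zero => rfl
  | succ k ih =>
    rw [Function.iterate_succ_apply', Function.iterate_succ_apply', pd_comm (contDiff_pd_iterate hg j k), ih]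

lemma pd_mderiv (hg : ContDiff ℝ ∞ g) (i : Fin 3) (κ : MIdx) :
    pd i (mderiv κ g) = mderiv (κ + unitM i) g := by
  have h2 := contDiff_pd_iterate hg 2 (κ 2)
  have h1 := contDiff_pd_iterate h2 1 (κ 1)
  fin_cases i
  · simp only [mderiv, unitM]
    simp [Function.iterate_succ_apply']
  · simp only [mderiv, unitM]
    change pd 1 ((pd 0)^[κ 0] ((pd 1)^[κ 1] ((pd 2)^[κ 2] g))) = _
    rw [pd_iterate_comm h1]
    simp [Function.iterate_succ_apply']
  · simp only [mderiv, unitM]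
    change pd 2 ((pd 0)^[κ 0] ((pd 1)^[κ 1] ((pd 2)^[κ 2] g))) = _
    rw [pd_iterate_comm h1, pd_iterate_comm h2]
    simp [Function.iterate_succ_apply']

@[simp] theorem mderiv_zero (g : E → ℝ) : mderiv 0 g = g := rfl

lemma mderiv_mderiv (hg : ContDiff ℝ ∞ g) (κ μ : MIdx) :
    mderiv μ (mderiv κ g) = mderiv (κ + μ) g :=
  mderiv_family_add (n := κ.abs + μ.abs) (G := fun κ => mderiv κ g) (fun κ i _ => pd_mderiv hg i κ) κ μ le_rfl

/-- The derivative assembled from partial derivatives. -/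
def gradCLM (p : Fin 3 → ℝ) : E →L[ℝ] ℝ := ∑ i, p i • (EuclideanSpace.proj i : E →L[ℝ] ℝ)

lemma gradCLM_basisVec (p : Fin 3 → ℝ) (i : Fin 3) : gradCLM p (basisVec i) = p i := by
  have : ∀ j, (EuclideanSpace.proj j : E →L[ℝ] ℝ) (basisVec i) = if j = i then (1 : ℝ) else 0 :=
    fun j => basisVec_apply i j
  simp [gradCLM, this]

lemma gradCLM_apply (p : Fin 3 → ℝ) (x : E) : gradCLM p x = ∑ i, p i * x i := by
  simp [gradCLM]

lemma norm_gradCLM_le (p : Fin 3 → ℝ) : ‖gradCLM p‖ ≤ ∑ i, |p i| := by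
  refine ContinuousLinearMap.opNorm_le_bound _ (Finset.sum_nonneg fun i _ => abs_nonneg _) fun x => ?_
  rw [gradCLM_apply, sum_mul]
  refine (norm_sum_le _ _).trans (sum_le_sum fun i _ => ?_)
  rw [norm_mul, norm_eq_abs]
  exact mul_le_mul_of_nonneg_left (PiLp.norm_apply_le x i) (abs_nonneg _)

lemma fderiv_eq_gradCLM (g : E → ℝ) (v : E) : fderiv ℝ g v = gradCLM fun i => pd i g v := by
  ext x
  rw [gradCLM_apply]
  conv_lhs => rw [← sum_coord_smul_basisVec x]
  rw [map_sum]
  refine sum_congr rfl fun i _ => ?_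
  rw [map_smul, smul_eq_mul, mul_comm]
  rfl

@[fun_prop]
lemma IsTest.continuous (h : IsTest ψ) : Continuous ψ := h.1.continuous

lemma IsTest.integrable (h : IsTest ψ) : Integrable ψ :=
  h.continuous.integrable_of_hasCompactSupport h.2

/-! ### Weights -/

lemma lamT_pos (v : E) : 0 < lamT v := by unfold lamT; positivity
lemma lam_pos (v : E) : 0 < lam v := exp_pos _

@[fun_prop]
lemma continuous_lamT : Continuous lamT := by
  unfold lamT
  exact Continuous.div (by fun_prop) (by fun_prop) fun v => by positivity

@[fun_prop]
lemma continuous_lam : Continuous lam := by unfold lam; fun_prop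

@[fun_prop]
lemma measurable_lam : Measurable lam := continuous_lam.measurable

@[fun_prop]
lemma measurable_lamT : Measurable lamT := continuous_lamT.measurable

lemma one_add_pow_le_lamT (m : ℕ) (v : E) :
    (1 + ‖v‖) ^ m ≤ ((m + 1).factorial * exp 1) * lamT v := by
  have h := Real.pow_div_factorial_le_exp (1 + ‖v‖) (by positivity) (m + 1)
  rw [div_le_iff₀ (by positivity), exp_add] at h
  rw [lamT, mul_div_assoc', le_div_iff₀ (by positivity), ← pow_succ]
  refine h.trans (le_of_eq ?_)
  ring

/-- Weights dominating `λ̃` that vary slowly. -/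
structure IsWt (ν : E → ℝ) : Prop where
  cont : Continuous ν
  low : ∀ v, lamT v ≤ ν v
  shift : ∃ C, 0 ≤ C ∧ ∀ v w, ‖v - w‖ ≤ 2 → ν v ≤ C * ν w

lemma IsWt.pos (h : IsWt ν) (v : E) : 0 < ν v := (lamT_pos v).trans_le (h.low v)

lemma lam_shift (h : ‖v - w‖ ≤ 2) : lam v ≤ exp 2 * lam w := by
  rw [lam, lam, ← exp_add, exp_le_exp]
  linarith [norm_sub_norm_le v w]

lemma isWt_lam : IsWt lam where
  cont := continuous_lam
  low v := div_le_self (exp_pos _).le (by linarith [norm_nonneg v])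
  shift := ⟨_, (exp_pos 2).le, fun _ _ h => lam_shift h⟩

lemma isWt_lamT : IsWt lamT where
  cont := continuous_lamT
  low v := le_rfl
  shift := by
    refine ⟨3 * exp 2, by positivity, fun v w h => ?_⟩
    have h1 := lam_shift h
    unfold lam at h1
    have h2 : 1 + ‖w‖ ≤ 3 * (1 + ‖v‖) := by
      have := norm_sub_norm_le w v
      rw [norm_sub_rev] at this
      linarith [norm_nonneg v]
    rw [lamT, lamT, mul_div_assoc', div_le_div_iff₀ (by positivity) (by positivity)]
    calc exp ‖v‖ * (1 + ‖w‖) ≤ (exp 2 * exp ‖w‖) * (3 * (1 + ‖v‖)) := by gcongr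
      _ = _ := by ring

/-- The norm of `L²(ν dv)`. -/
def wl2 (ν : E → ℝ) (g : E → ℝ) : ℝ≥0∞ := l2 volume fun v => ofReal (√(ν v)) * ‖g v‖ₑ

lemma wl2_sq (hν : ∀ v, 0 ≤ ν v) (g : E → ℝ) :
    wl2 ν g ^ 2 = ∫⁻ v, ofReal (ν v) * ‖g v‖ₑ ^ 2 := by
  rw [wl2, l2_sq]
  refine lintegral_congr fun v => ?_
  rw [mul_pow, ← ofReal_pow (by positivity), sq_sqrt (hν v)]

lemma hNorm_sq (n : ℕ) (hν : ∀ v, 0 ≤ ν v) (U : MIdx → E → ℝ) :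
    hNorm n ν U ^ 2 = ∑ α ∈ midxLE n, wl2 ν (U α) ^ 2 := by
  rw [hNorm, rpow_half_sq]
  exact sum_congr rfl fun α _ => (wl2_sq hν _).symm

lemma wl2_le_hNorm (hν : ∀ v, 0 ≤ ν v) (U : MIdx → E → ℝ) (hα : α.abs ≤ n) : wl2 ν (U α) ≤ hNorm n ν U := by
  rw [← pow_le_pow_left_iff (by norm_num : (2 : ℕ) ≠ 0), hNorm_sq n hν]
  exact single_le_sum (f := fun α => wl2 ν (U α) ^ 2) (fun _ _ => zero_le) (mem_midxLE.2 hα)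

lemma wl2_mono {ν' : E → ℝ} (h : ∀ v, ν v ≤ ν' v) (g : E → ℝ) : wl2 ν g ≤ wl2 ν' g :=
  l2_mono fun v => by gcongr; exact h v

lemma wl2_congr {g' : E → ℝ} (h : g =ᵐ[volume] g') : wl2 ν g = wl2 ν g' :=
  l2_congr (h.mono fun v hv => by simp only [hv])

lemma wl2_add_le (hν : Continuous ν) (hf : AEMeasurable f) (hg : AEMeasurable g) :
    wl2 ν (fun v => f v + g v) ≤ wl2 ν f + wl2 ν g := by
  have hs : Measurable fun v => ofReal (√(ν v)) := by fun_prop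
  refine le_trans (l2_mono fun v => ?_) (l2_add_le (by fun_prop) (by fun_prop))
  rw [← mul_add]
  gcongr
  exact enorm_add_le _ _

lemma wl2_neg (ν g : E → ℝ) : wl2 ν (fun v => -g v) = wl2 ν g := by simp [wl2]

lemma wl2_le_add (hν : Continuous ν) (hf : AEMeasurable f) (hg : AEMeasurable g) :
    wl2 ν f ≤ wl2 ν (fun v => f v - g v) + wl2 ν g := by
  have h := wl2_add_le hν (f := fun v => f v - g v) (hf.sub hg) hg
  simpa only [sub_add_cancel] using h

lemma IsTest.wl2_lt_top (h : IsTest ψ) (hν : Continuous ν) : wl2 ν ψ < ⊤ := by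
  have hc : Continuous fun v => √(ν v) * ψ v := by fun_prop
  have hs : HasCompactSupport fun v => √(ν v) * ψ v := h.2.mul_left
  have hm : MemLp (fun v => √(ν v) * ψ v) 2 volume := hc.memLp_of_hasCompactSupport hs
  have := hm.2
  rw [eLpNorm_eq_lintegral_rpow_enorm_toReal (by norm_num) (by norm_num)] at this
  simp only [toReal_ofNat, rpow_ofNat, enorm_mul, enorm_of_nonneg (sqrt_nonneg _)] at this
  exact this

/-! ### Sobolev families -/

/-- `V` is a family of derivatives up to order `n`, in the closure of the test functions. -/
structure Sob (n : ℕ) (ν : E → ℝ) (V : MIdx → E → ℝ) : Prop where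
  meas : ∀ α : MIdx, α.abs ≤ n → Measurable (V α)
  approx : ∃ ψ : ℕ → E → ℝ, (∀ k, IsTest (ψ k)) ∧ ∀ α : MIdx, α.abs ≤ n →
    Tendsto (fun k => wl2 ν fun v => V α v - mderiv α (ψ k) v) atTop (𝓝 0)

lemma Sob.mono {m : ℕ} {ν' : E → ℝ} (h : Sob n ν' V) (hmn : m ≤ n)
    (hν : ∀ v, ν v ≤ ν' v) : Sob m ν V := by
  obtain ⟨ψ, hψ, hl⟩ := h.approx
  refine ⟨fun α hα => h.meas α (hα.trans hmn), ψ, hψ, fun α hα => ?_⟩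
  exact tendsto_of_tendsto_of_tendsto_of_le_of_le tendsto_const_nhds (hl α (hα.trans hmn))
    (fun _ => zero_le) fun k => wl2_mono hν _

lemma Sob.finite (hν : Continuous ν) (h : Sob n ν V) (hα : α.abs ≤ n) : wl2 ν (V α) < ⊤ := by
  obtain ⟨ψ, hψ, hl⟩ := h.approx
  obtain ⟨k, hk⟩ := ((hl α hα).eventually (gt_mem_nhds (zero_lt_one' ℝ≥0∞))).exists
  refine (wl2_le_add hν (h.meas α hα).aemeasurable
    ((hψ k).mderiv α).continuous.measurable.aemeasurable).trans_lt ?_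
  exact add_lt_top.2 ⟨hk.trans one_lt_top, ((hψ k).mderiv α).wl2_lt_top hν⟩

lemma IsTest.sob (h : IsTest ψ) (n : ℕ) (ν : E → ℝ) : Sob n ν fun α => WeakCoupling.mderiv α ψ := by
  refine ⟨fun α _ => (h.mderiv α).continuous.measurable, fun _ => ψ, fun _ => h, fun α _ => ?_⟩
  simp [wl2, l2]

lemma Sob.shift {m : ℕ} (h : Sob n ν V) (κ : MIdx)
    (hm : κ.abs + m ≤ n) : Sob m ν fun α => V (κ + α) := by
  obtain ⟨ψ, hψ, hl⟩ := h.approx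
  refine ⟨fun α hα => h.meas _ (by rw [abs_add]; omega), fun k => mderiv κ (ψ k), fun k => (hψ k).mderiv κ,
    fun α hα => ?_⟩
  simp_rw [mderiv_mderiv (hψ _).1]
  exact hl _ (by rw [abs_add]; omega)

/-! ### Convolution operators -/

/-- The convolution `∫ k(v - v') g(v') dv'`. -/
def cv (k g : E → ℝ) (v : E) : ℝ := ∫ v', k (v - v') * g v'

lemma integrable_lamT_inv : ∫⁻ v, ofReal (√(lamT v))⁻¹ ^ 2 < ⊤ := by
  have h := (integrable_one_add_norm (E := E) (μ := volume) (r := 4) (by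
    simp; norm_num)).lintegral_lt_top
  have hle : ∀ v : E, ofReal (√(lamT v))⁻¹ ^ 2 ≤
      ofReal ((5).factorial * exp 1) * ofReal ((1 + ‖v‖) ^ (-4 : ℝ)) := by
    intro v
    have := one_add_pow_le_lamT 4 v
    rw [← ofReal_pow (by positivity), ← ofReal_mul (by positivity)]
    refine ofReal_le_ofReal ?_
    rw [inv_pow, sq_sqrt (lamT_pos v).le, rpow_neg (by positivity)]
    have e : (1 + ‖v‖) ^ (4 : ℝ) = (1 + ‖v‖) ^ 4 := by simp
    rw [e, ← div_eq_mul_inv, inv_eq_one_div, div_le_div_iff₀ (lamT_pos v) (by positivity)]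
    simpa using this
  refine (lintegral_mono hle).trans_lt ?_
  rw [lintegral_const_mul' _ _ ofReal_ne_top]
  exact mul_lt_top ofReal_lt_top h

lemma measurable_ofReal_sqrt (hν : Continuous ν) : Measurable fun v => ofReal (√(ν v)) := by fun_prop

/-- A constant bounding the `L¹` norm by the weighted `L²` norm. -/
def lamTC : ℝ≥0∞ := l2 volume fun v => ofReal (√(lamT v))⁻¹

lemma lamTC_ne_top : lamTC ≠ ⊤ :=
  (rpow_lt_top_of_nonneg (by norm_num) integrable_lamT_inv.ne).ne

lemma lintegral_enorm_le_wl2 (hg : AEMeasurable g) : ∫⁻ v, ‖g v‖ₑ ≤ lamTC * wl2 lamT g := by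
  have hm := measurable_ofReal_sqrt continuous_lamT
  have hmi : Measurable fun v => ofReal (√(lamT v))⁻¹ := by fun_prop
  refine le_trans (le_of_eq (lintegral_congr fun v => ?_))
    (lintegral_mul_le_l2 hmi.aemeasurable (by fun_prop))
  rw [← mul_assoc, ← ofReal_mul (by positivity),
    inv_mul_cancel₀ (sqrt_pos.2 (lamT_pos v)).ne', ofReal_one, one_mul]

lemma integrable_of_wl2 (hg : AEMeasurable g) (h : wl2 lamT g < ⊤) : Integrable g :=
  ⟨hg.aestronglyMeasurable, (lintegral_enorm_le_wl2 hg).trans_lt (mul_lt_top lamTC_ne_top.lt_top h)⟩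

/-- Kernels whose convolution operator maps `L²(λ̃ dv)` to bounded functions. -/
structure ConvBdd (k : E → ℝ) : Prop where
  meas : Measurable k
  loc : LocallyIntegrable k
  bound : ∃ C : ℝ≥0∞, C ≠ ⊤ ∧ ∀ g : E → ℝ, AEMeasurable g → ∀ v, ∫⁻ v', ‖k (v - v')‖ₑ * ‖g v'‖ₑ ≤ C * wl2 lamT g

lemma convBdd_of_bdd (hk : Measurable k) {B : ℝ} (h : ∀ x, ‖k x‖ ≤ B) : ConvBdd k where
  meas := hk
  loc := by
    refine (locallyIntegrable_const B).mono hk.aestronglyMeasurable (of_forall fun x => ?_)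
    exact (h x).trans (le_abs_self _)
  bound := by
    refine ⟨ofReal B * lamTC, mul_ne_top ofReal_ne_top lamTC_ne_top, fun g hg v => ?_⟩
    calc ∫⁻ v', ‖k (v - v')‖ₑ * ‖g v'‖ₑ ≤ ∫⁻ v', ofReal B * ‖g v'‖ₑ := by
          refine lintegral_mono fun v' => ?_
          gcongr
          rw [← ofReal_norm]
          exact ofReal_le_ofReal (h _)
      _ = ofReal B * ∫⁻ v', ‖g v'‖ₑ := lintegral_const_mul' _ _ ofReal_ne_top
      _ ≤ _ := by rw [mul_assoc]; gcongr; exact lintegral_enorm_le_wl2 hg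

lemma l2_le_wl2_lamT : ∃ C : ℝ≥0∞, C ≠ ⊤ ∧ ∀ g : E → ℝ, AEMeasurable g → l2 volume (fun v => ‖g v‖ₑ) ≤ C * wl2 lamT g := by
  refine ⟨ofReal (√((1).factorial * exp 1)), ofReal_ne_top, fun g hg => ?_⟩
  rw [wl2, ← l2_const_mul (f := fun v => ofReal (√(lamT v)) * ‖g v‖ₑ) (by fun_prop)]
  refine l2_mono fun v => ?_
  rw [← mul_assoc, ← ofReal_mul (by positivity), ← sqrt_mul (by positivity)]
  have := one_add_pow_le_lamT 0 v
  simp only [pow_zero, zero_add] at this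
  have h1 : (1 : ℝ≥0∞) ≤ ofReal (√((1).factorial * exp 1 * lamT v)) := by
    rw [← ofReal_one]
    exact ofReal_le_ofReal (one_le_sqrt.2 this)
  calc ‖g v‖ₑ = 1 * ‖g v‖ₑ := (one_mul _).symm
    _ ≤ _ := by gcongr

lemma convBdd_of_l2 (hk : Measurable k) (h : l2 volume (fun x => ‖k x‖ₑ) < ⊤) : ConvBdd k where
  meas := hk
  loc := by
    have : MemLp k 2 volume := by
      refine ⟨hk.aestronglyMeasurable, ?_⟩
      rw [eLpNorm_eq_lintegral_rpow_enorm_toReal (by norm_num) (by norm_num)]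
      simp only [toReal_ofNat, rpow_ofNat]
      exact h
    exact this.locallyIntegrable (by norm_num)
  bound := by
    obtain ⟨C, hC, hCg⟩ := l2_le_wl2_lamT
    refine ⟨l2 volume (fun x => ‖k x‖ₑ) * C, mul_ne_top h.ne hC, fun g hg v => ?_⟩
    refine (lintegral_mul_le_l2 (hk.comp (by fun_prop)).enorm.aemeasurable hg.enorm).trans ?_
    rw [mul_assoc]
    refine mul_le_mul' (le_of_eq ?_) (hCg g hg)
    unfold l2
    congr 1
    exact lintegral_sub_left_eq_self (fun x => ‖k x‖ₑ ^ 2) v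

lemma ConvBdd.integrable (hk : ConvBdd k) (hg : AEMeasurable g) (h : wl2 lamT g < ⊤) (v : E) :
    Integrable fun v' => k (v - v') * g v' := by
  obtain ⟨C, hC, hb⟩ := hk.bound
  refine ⟨((hk.meas.comp (by fun_prop)).aemeasurable.mul hg).aestronglyMeasurable, ?_⟩
  rw [HasFiniteIntegral]
  simp_rw [enorm_mul]
  exact (hb g hg v).trans_lt (mul_lt_top hC.lt_top h)

lemma cv_sub (hk : ConvBdd k) (hf : AEMeasurable f) (hf' : wl2 lamT f < ⊤)
    (hg : AEMeasurable g) (hg' : wl2 lamT g < ⊤) (v : E) :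
    cv k (fun w => f w - g w) v = cv k f v - cv k g v := by
  rw [cv, cv, cv, ← integral_sub (hk.integrable hf hf' v) (hk.integrable hg hg' v)]
  simp_rw [mul_sub]

lemma enorm_cv_le (hb : ∀ g : E → ℝ, AEMeasurable g → ∀ v, ∫⁻ v', ‖k (v - v')‖ₑ * ‖g v'‖ₑ ≤ C * wl2 lamT g)
    (hg : AEMeasurable g) (v : E) : ‖cv k g v‖ₑ ≤ C * wl2 lamT g := by
  refine (enorm_integral_le_lintegral_enorm _).trans ?_
  simp_rw [enorm_mul]
  exact hb g hg v

lemma cv_tendstoUniformly (hk : ConvBdd k) {f : ℕ → E → ℝ}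
    (hg : AEMeasurable g) (hg' : wl2 lamT g < ⊤) (hf : ∀ j, AEMeasurable (f j)) (hf' : ∀ j, wl2 lamT (f j) < ⊤)
    (h : Tendsto (fun j => wl2 lamT fun v => g v - f j v) atTop (𝓝 0)) :
    TendstoUniformly (fun j => cv k (f j)) (cv k g) atTop := by
  obtain ⟨C, hC, hb⟩ := hk.bound
  rw [EMetric.tendstoUniformly_iff]
  intro ε hε
  have h2 : Tendsto (fun j => C * wl2 lamT fun v => g v - f j v) atTop (𝓝 (C * 0)) :=
    ENNReal.Tendsto.const_mul h (Or.inr hC)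
  rw [mul_zero] at h2
  filter_upwards [h2.eventually (gt_mem_nhds hε)] with j hj v
  rw [edist_eq_enorm_sub, ← cv_sub hk hg hg' (hf j) (hf' j)]
  exact (enorm_cv_le hb (hg.sub (hf j)) v).trans_lt hj

lemma hasFDerivAt_cv_test (hk : LocallyIntegrable k) (hψ : IsTest ψ) (v : E) :
    HasFDerivAt (cv k ψ) (gradCLM fun i => cv k (pd i ψ) v) v := by
  have e : ∀ g : E → ℝ, cv k g = MeasureTheory.convolution k g (ContinuousLinearMap.mul ℝ ℝ) volume := by
    intro g
    funext w
    rw [cv, MeasureTheory.convolution, ← integral_sub_left_eq_self _ volume w]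
    simp
  have h := hψ.2.hasFDerivAt_convolution_right (ContinuousLinearMap.mul ℝ ℝ) hk (hψ.1.of_le (by exact_mod_cast le_top)) v
  rw [← e] at h
  refine h.congr_fderiv ?_
  rw [← h.fderiv, fderiv_eq_gradCLM]
  congr 1
  funext i
  rw [pd, h.fderiv, convolution_precompR_apply _ hk (hψ.2.fderiv ℝ) (hψ.1.continuous_fderiv (by simp)), e]
  rfl

lemma hasFDerivAt_cv (hk : ConvBdd k) (hV : Sob n lamT V) (hκ : κ.abs + 1 ≤ n) (v : E) :
    HasFDerivAt (cv k (V κ)) (gradCLM fun i => cv k (V (κ + unitM i)) v) v := by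
  obtain ⟨ψ, hψ, hl⟩ := hV.approx
  have hu : ∀ α : MIdx, α.abs ≤ n → TendstoUniformly (fun j => cv k (mderiv α (ψ j))) (cv k (V α)) atTop :=
    fun α hα => cv_tendstoUniformly hk (hV.meas α hα).aemeasurable (hV.finite continuous_lamT hα)
      (fun j => ((hψ j).mderiv α).continuous.measurable.aemeasurable)
      (fun j => ((hψ j).mderiv α).wl2_lt_top continuous_lamT) (hl α hα)
  refine hasFDerivAt_of_tendstoUniformly (l := atTop) (f := fun j => cv k (mderiv κ (ψ j)))
    (f' := fun j w => gradCLM fun i => cv k (mderiv (κ + unitM i) (ψ j)) w) (g' := fun w => gradCLM fun i => cv k (V (κ + unitM i)) w) ?_ ?_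
    (fun x => (hu κ (by omega)).tendsto_at x) v
  · rw [Metric.tendstoUniformly_iff]
    intro ε hε
    have h3 : ∀ᶠ j in atTop, ∀ i : Fin 3, ∀ w, dist (cv k (V (κ + unitM i)) w)
        (cv k (mderiv (κ + unitM i) (ψ j)) w) < ε / 4 := by
      rw [eventually_all]
      intro i
      exact Metric.tendstoUniformly_iff.1 (hu (κ + unitM i) (by rw [abs_add, abs_unitM]; exact hκ)) _ (by positivity)
    filter_upwards [h3] with j hj w
    have e : (gradCLM fun i => cv k (V (κ + unitM i)) w) - gradCLM (fun i => cv k (mderiv (κ + unitM i) (ψ j)) w)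
        = gradCLM fun i => cv k (V (κ + unitM i)) w - cv k (mderiv (κ + unitM i) (ψ j)) w := by
      simp only [gradCLM, sub_smul, Finset.sum_sub_distrib]
    rw [dist_eq_norm, e]
    refine (norm_gradCLM_le _).trans_lt ?_
    have := fun i => hj i w
    simp only [Real.dist_eq] at this
    rw [Fin.sum_univ_three]
    linarith [this 0, this 1, this 2]
  · intro j w
    simp_rw [← pd_mderiv (hψ j).1]
    exact hasFDerivAt_cv_test hk.loc ((hψ j).mderiv κ) w

lemma pd_of_hasFDerivAt {p : Fin 3 → ℝ} (h : HasFDerivAt g (gradCLM p) v) (i : Fin 3) :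
    pd i g v = p i := by
  rw [pd, h.fderiv, gradCLM_basisVec]

lemma mderiv_cv (hk : ConvBdd k) (hV : Sob n lamT V) {μ : MIdx}
    (hμ : μ.abs ≤ n) : mderiv μ (cv k (V 0)) = cv k (V μ) :=
  mderiv_family (G := fun κ => cv k (V κ))
    (fun _ _ hκ => funext fun v => pd_of_hasFDerivAt (hasFDerivAt_cv hk hV hκ v) _) μ hμ

/-! ### Radial integrals -/

lemma lintegral_radial_lt_top {p q : ℝ} (hp : p < 3) (_hq : 0 ≤ q) (hpq : 3 < p + q) :
    ∫⁻ w : E, ofReal (‖w‖ ^ (-p) * (1 + ‖w‖) ^ (-q)) < ⊤ := by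
  have h : Integrable (fun w : E => (fun r : ℝ => r ^ (-p) * (1 + r) ^ (-q)) ‖w‖) := by
    refine (integrable_fun_norm_addHaar (volume : Measure E) (f := fun r : ℝ => r ^ (-p) * (1 + r) ^ (-q))).2 ?_
    simp only [finrank_euclideanSpace, Fintype.card_fin, smul_eq_mul]
    have hm : Measurable fun y : ℝ => y ^ (3 - 1) * (y ^ (-p) * (1 + y) ^ (-q)) := by fun_prop
    have he : ∀ y : ℝ, 0 < y → y ^ (3 - 1) * (y ^ (-p) * (1 + y) ^ (-q)) = y ^ (2 - p) * (1 + y) ^ (-q) := by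
      intro y hy
      have h3 : ((3 - 1 : ℕ) : ℝ) + -p = 2 - p := by norm_num; ring
      rw [← mul_assoc, ← rpow_natCast, ← rpow_add hy, h3]
    rw [← Ioc_union_Ioi_eq_Ioi (zero_le_one' ℝ), integrableOn_union]
    constructor
    · have h1 : IntegrableOn (fun y : ℝ => y ^ (2 - p)) (Ioc 0 1) := by
        rw [← intervalIntegrable_iff_integrableOn_Ioc_of_le zero_le_one]
        exact intervalIntegral.intervalIntegrable_rpow' (by linarith)
      refine Integrable.mono' h1 hm.aestronglyMeasurable ?_
      filter_upwards [ae_restrict_mem measurableSet_Ioc] with y hy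
      have hy0 := hy.1
      rw [he y hy0, norm_of_nonneg (by positivity)]
      exact mul_le_of_le_one_right (by positivity) (rpow_le_one_of_one_le_of_nonpos (by linarith) (by linarith))
    · have h2 : IntegrableOn (fun y : ℝ => y ^ (2 - p - q)) (Ioi 1) :=
        integrableOn_Ioi_rpow_of_lt (by linarith) one_pos
      refine Integrable.mono' h2 hm.aestronglyMeasurable ?_
      filter_upwards [ae_restrict_mem measurableSet_Ioi] with y hy
      have hy0 : 0 < y := one_pos.trans hy
      rw [he y hy0, norm_of_nonneg (by positivity), sub_eq_add_neg (2 - p), rpow_add hy0]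
      exact mul_le_mul_of_nonneg_left (Real.rpow_le_rpow_of_nonpos hy0 (by linarith) (by linarith))
        (by positivity)
  exact h.lintegral_lt_top

lemma mixProfile_sq (hr : 0 ≤ r) :
    mixProfile a r ^ 2 = r ^ (-(2 * ((a : ℝ) - 3 / 4))) * (1 + r) ^ (-12 : ℝ) := by
  rw [mixProfile, mul_pow, ← rpow_natCast, ← rpow_mul hr, rpow_neg (show 0 ≤ 1 + r by positivity)]
  have : (1 + r) ^ (12 : ℝ) = (1 + r) ^ 12 := by simp
  rw [this, inv_pow, ← pow_mul]
  congr 2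
  push_cast; ring

@[fun_prop]
lemma measurable_mixProfile (a : ℕ) : Measurable (mixProfile a) := by unfold mixProfile; fun_prop

lemma mixProfile_nonneg (a : ℕ) (hr : 0 ≤ r) : 0 ≤ mixProfile a r := by
  unfold mixProfile; positivity

lemma l2_mixProfile_lt_top (ha : a ≤ 2) (ha' : 1 ≤ a) (hτ : 0 < τ) :
    l2 volume (fun w : E => ofReal (mixProfile a (τ * ‖w‖))) < ⊤ := by
  have ha1 : (a : ℝ) ≤ 2 := by exact_mod_cast ha
  have ha2 : (1 : ℝ) ≤ a := by exact_mod_cast ha'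
  refine rpow_lt_top_of_nonneg (by norm_num) (ne_of_lt ?_)
  have hm := measurable_mixProfile a
  have e : ∀ w : E, ofReal (mixProfile a (τ * ‖w‖)) ^ 2 =
      (fun w : E => ofReal (‖w‖ ^ (-(2 * ((a : ℝ) - 3 / 4))) * (1 + ‖w‖) ^ (-12 : ℝ))) (τ • w) := by
    intro w
    have : ‖τ • w‖ = τ * ‖w‖ := by rw [norm_smul, norm_of_nonneg hτ.le]
    simp only [this]
    rw [← ofReal_pow (mixProfile_nonneg a (by positivity)), mixProfile_sq (by positivity)]
  simp_rw [e]
  rw [lintegral_comp_smul_E (fun w : E => ofReal (‖w‖ ^ (-(2 * ((a : ℝ) - 3 / 4))) *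
    (1 + ‖w‖) ^ (-12 : ℝ))) (by fun_prop) hτ]
  exact mul_lt_top ofReal_lt_top
    (lintegral_radial_lt_top (by linarith) (by norm_num) (by linarith))

/-! ### Convolution with the mixed kernels -/

/-- The modulus of `mixK`, inside the mixing integral. -/
def mixAbs (m : Measure ℝ) (S : 𝓢(E, ℝ)) (a : ℕ) (τ : ℝ) (w : E) : ℝ≥0∞ :=
  ∫⁻ b, ‖(b * τ) ^ a * S ((b * τ) • w)‖ₑ ∂m

@[fun_prop]
lemma measurable_mixAbs [SFinite m] (S : 𝓢(E, ℝ)) (a : ℕ) (τ : ℝ) :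
    Measurable (mixAbs m S a τ) := by
  have h : Measurable fun p : E × ℝ => ‖(p.2 * τ) ^ a * S ((p.2 * τ) • p.1)‖ₑ := by fun_prop
  exact h.lintegral_prod_right'

lemma enorm_mixK_le_mixAbs (m : Measure ℝ) (S : 𝓢(E, ℝ)) (a : ℕ) (τ : ℝ) (w : E) :
    ‖mixK m S a τ w‖ₑ ≤ mixAbs m S a τ w := enorm_integral_le_lintegral_enorm _

lemma mixAbs_zero_le (S : 𝓢(E, ℝ)) (τ : ℝ) (w : E) :
    mixAbs m S 0 τ w ≤ ofReal (SchwartzMap.seminorm ℝ 0 0 S) * m univ := by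
  rw [mixAbs, ← lintegral_const]
  refine lintegral_mono fun b => ?_
  rw [pow_zero, one_mul, ← ofReal_norm]
  exact ofReal_le_ofReal (SchwartzMap.norm_le_seminorm ℝ S _)

lemma l2_mixAbs_lt_top (hm : IsMix m) (S : 𝓢(E, ℝ)) (ha : a ≤ 2) (ha' : 1 ≤ a)
    (hτ : 0 < τ) : l2 volume (mixAbs m S a τ) < ⊤ := by
  obtain ⟨C, hC, h⟩ := lintegral_mixK_le hm S ha'
  have hmp : Measurable fun w : E => ofReal (mixProfile a (τ * ‖w‖)) := by fun_prop
  calc l2 volume (mixAbs m S a τ)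
      ≤ l2 volume (fun w : E => ofReal (C * τ ^ a) * ofReal (mixProfile a (τ * ‖w‖))) := by
        refine l2_mono_ae ?_
        filter_upwards [ae_ne_zero] with w hw
        rw [← ofReal_mul (by positivity), mul_assoc]
        exact h τ hτ w hw
    _ < ⊤ := by
        rw [l2_const_mul hmp.aemeasurable]
        exact mul_lt_top ofReal_lt_top (l2_mixProfile_lt_top ha ha' hτ)

lemma lintegral_mixAbs_lt_top (hm : IsMix m) (S : 𝓢(E, ℝ)) (ha : a ≤ 2)
    (hτ : 0 < τ) (hg : AEMeasurable g) (hg' : wl2 lamT g < ⊤) (v : E) :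
    ∫⁻ v', mixAbs m S a τ (v - v') * ‖g v'‖ₑ < ⊤ := by
  have := hm.finite
  rcases Nat.eq_zero_or_pos a with rfl | ha'
  · refine (lintegral_mono fun v' => mul_le_mul_left (mixAbs_zero_le S τ (v - v')) ‖g v'‖ₑ).trans_lt ?_
    have hf : ofReal (SchwartzMap.seminorm ℝ 0 0 S) * m univ ≠ ⊤ :=
      mul_ne_top ofReal_ne_top (measure_ne_top _ _)
    rw [lintegral_const_mul' _ _ hf]
    exact mul_lt_top hf.lt_top ((lintegral_enorm_le_wl2 hg).trans_lt
      (mul_lt_top lamTC_ne_top.lt_top hg'))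
  · obtain ⟨C, hC, hCg⟩ := l2_le_wl2_lamT
    refine (lintegral_mul_le_l2 ((measurable_mixAbs S a τ).comp
      (by fun_prop)).aemeasurable hg.enorm).trans_lt (mul_lt_top ?_ ?_)
    · refine lt_of_eq_of_lt ?_ (l2_mixAbs_lt_top hm S ha ha' hτ)
      unfold l2
      congr 1
      exact lintegral_sub_left_eq_self (fun x => mixAbs m S a τ x ^ 2) v
    · exact (hCg g hg).trans_lt (mul_lt_top hC.lt_top hg')

lemma convBdd_mixK (hm : IsMix m) (S : 𝓢(E, ℝ)) (ha : a ≤ 2) (hτ : 0 < τ) :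
    ConvBdd (mixK m S a τ) := by
  have := hm.finite
  have hmeas : Measurable (mixK m S a τ) :=
    (measurable_mixK (m := m) S a).comp (measurable_prodMk_left (x := τ) : Measurable fun w : E => (τ, w))
  rcases Nat.eq_zero_or_pos a with rfl | ha'
  · refine convBdd_of_bdd hmeas (B := (ofReal (SchwartzMap.seminorm ℝ 0 0 S) * m univ).toReal) fun x => ?_
    rw [← toReal_enorm]
    exact toReal_mono (mul_ne_top ofReal_ne_top (measure_ne_top _ _))
      ((enorm_mixK_le_mixAbs _ _ _ _ _).trans (mixAbs_zero_le S τ x))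
  · refine convBdd_of_l2 hmeas (lt_of_le_of_lt (l2_mono fun w => enorm_mixK_le_mixAbs _ _ _ _ _)
      (l2_mixAbs_lt_top hm S ha ha' hτ))

/-- The convolution with `mixK`, with the mixing integral outside. -/
lemma cv_mixK_eq (hm : IsMix m) (S : 𝓢(E, ℝ)) (hg : AEMeasurable g) (v : E) (hfin : ∫⁻ v', mixAbs m S a τ (v - v') * ‖g v'‖ₑ < ⊤) :
    cv (mixK m S a τ) g v = ∫ b, (∫ v', (b * τ) ^ a * S ((b * τ) • (v - v')) * g v') ∂m := by
  have := hm.finite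
  have hc : Continuous fun p : E × ℝ => (p.2 * τ) ^ a * S ((p.2 * τ) • (v - p.1)) := by fun_prop
  have hint : Integrable (uncurry fun (v' : E) (b : ℝ) =>
      (b * τ) ^ a * S ((b * τ) • (v - v')) * g v') (volume.prod m) := by
    have hmm : AEStronglyMeasurable (uncurry fun (v' : E) (b : ℝ) =>
        (b * τ) ^ a * S ((b * τ) • (v - v')) * g v') (volume.prod m) :=
      hc.aestronglyMeasurable.mul hg.aestronglyMeasurable.comp_fst
    refine ⟨hmm, ?_⟩
    have e0 := lintegral_prod _ hmm.enorm
    refine lt_of_le_of_lt (le_of_eq e0) (lt_of_le_of_lt (le_of_eq ?_) hfin)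
    refine lintegral_congr fun v' => ?_
    simp only [uncurry]
    simp_rw [enorm_mul _ (g v')]
    rw [lintegral_mul_const' _ _ enorm_ne_top]
    rfl
  rw [← integral_integral_swap hint, cv]
  refine integral_congr_ae (of_forall fun v' => ?_)
  beta_reduce
  rw [integral_mul_const]
  rfl

lemma cv_mixK_pd_test (hm : IsMix m) (S : 𝓢(E, ℝ)) (ha : a ≤ 1) (hτ : 0 < τ)
    (hψ : IsTest ψ) (l : Fin 3) (v : E) :
    cv (mixK m S a τ) (pd l ψ) v = cv (mixK m (∂_{basisVec l} S) (a + 1) τ) ψ v := by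
  have h0 := (hψ.pd l).continuous.measurable.aemeasurable (μ := volume)
  have h1 := hψ.continuous.measurable.aemeasurable (μ := volume)
  rw [cv_mixK_eq hm S h0 v (lintegral_mixAbs_lt_top hm S (by omega) hτ h0 ((hψ.pd l).wl2_lt_top continuous_lamT) v),
    cv_mixK_eq hm _ h1 v (lintegral_mixAbs_lt_top hm _ (by omega) hτ h1 (hψ.wl2_lt_top continuous_lamT) v)]
  refine integral_congr_ae (of_forall fun b => ?_)
  beta_reduce
  simp_rw [mul_assoc]
  rw [integral_const_mul, integral_const_mul, pow_succ, mul_assoc]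
  congr 1
  set c := b * τ
  have hS := S.continuous
  have hd : ∀ w : E, HasFDerivAt (fun w => S (c • (v - w))) ((fderiv ℝ S (c • (v - w))).comp
      (c • (-(ContinuousLinearMap.id ℝ E)))) w := fun w =>
    (S.differentiable _).hasFDerivAt.comp w (((hasFDerivAt_id w).const_sub v).const_smul c)
  have hd' : ∀ w : E, fderiv ℝ (fun w => S (c • (v - w))) w (basisVec l) =
      -(c * (∂_{basisVec l} S) (c • (v - w))) := by
    intro w
    rw [(hd w).fderiv, SchwartzMap.lineDerivOp_apply_eq_fderiv]
    simp
  have hS' := (∂_{basisVec l} S : 𝓢(E, ℝ)).continuous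
  have hi : ∀ (F g : E → ℝ), Continuous F → IsTest g → Integrable fun w => F w * g w := fun F g hF hg =>
    (hF.mul hg.continuous).integrable_of_hasCompactSupport (hg.2.mul_left)
  have h := integral_mul_fderiv_eq_neg_fderiv_mul_of_integrable (μ := (volume : Measure E))
    (f := fun w => S (c • (v - w))) (g := ψ) (v := basisVec l)
    (by simp_rw [hd']; exact hi _ _ (by fun_prop) hψ) (hi _ _ (by fun_prop) (hψ.pd l))
    (hi _ _ (by fun_prop) hψ) (fun w _ => (hd w).differentiableAt)
    (fun w _ => hψ.1.differentiable (by simp) w)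
  have e : ∀ w, S (c • (v - w)) * pd l ψ w = S (c • (v - w)) * fderiv ℝ ψ w (basisVec l) := fun w => rfl
  simp_rw [e]
  rw [h, ← integral_neg, ← integral_const_mul]
  refine integral_congr_ae (of_forall fun w => ?_)
  beta_reduce
  rw [hd']; ring

/-- Integration by parts: a derivative is moved from the family to the kernel. -/
lemma cv_mixK_succ (hm : IsMix m) (S : 𝓢(E, ℝ)) (ha : a ≤ 1) (hτ : 0 < τ)
    (hV : Sob n lamT V) (hκ : κ.abs + 1 ≤ n) (l : Fin 3) :
    cv (mixK m S a τ) (V (κ + unitM l)) = cv (mixK m (∂_{basisVec l} S) (a + 1) τ) (V κ) := by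
  obtain ⟨ψ, hψ, hl⟩ := hV.approx
  have hu : ∀ {k : E → ℝ}, ConvBdd k → ∀ α : MIdx, α.abs ≤ n → ∀ v,
      Tendsto (fun j => cv k (mderiv α (ψ j)) v) atTop (𝓝 (cv k (V α) v)) :=
    fun hk α hα v => (cv_tendstoUniformly hk (hV.meas α hα).aemeasurable (hV.finite continuous_lamT hα)
      (fun j => ((hψ j).mderiv α).continuous.measurable.aemeasurable)
      (fun j => ((hψ j).mderiv α).wl2_lt_top continuous_lamT) (hl α hα)).tendsto_at v
  funext v
  have h1 := hu (convBdd_mixK hm S (by omega : a ≤ 2) hτ) (κ + unitM l) (by rw [abs_add, abs_unitM]; exact hκ) v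
  have h2 := hu (convBdd_mixK hm (∂_{basisVec l} S) (by omega : a + 1 ≤ 2) hτ) κ (by omega) v
  refine tendsto_nhds_unique h1 (h2.congr fun j => ?_)
  rw [← pd_mderiv (hψ j).1, cv_mixK_pd_test hm S ha hτ ((hψ j).mderiv κ)]

/-! ### Mollification -/

lemma cv_comm (k g : E → ℝ) (v : E) : cv k g v = cv g k v := by
  rw [cv, cv, ← integral_sub_left_eq_self _ volume v]
  refine integral_congr_ae (of_forall fun w => ?_)
  beta_reduce
  rw [sub_sub_cancel, mul_comm]

lemma cv_congr (h : f =ᵐ[volume] g) : cv k f = cv k g := by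
  funext v
  refine integral_congr_ae ?_
  filter_upwards [h] with w hw
  rw [hw]

lemma hasFDerivAt_cv_left (hρ : IsTest ρ) (hg : LocallyIntegrable g) (v : E) :
    HasFDerivAt (cv ρ g) (gradCLM fun i => cv (pd i ρ) g v) v := by
  have h := hasFDerivAt_cv_test hg hρ v
  simp_rw [cv_comm _ g]
  rw [funext (cv_comm ρ g)]
  exact h

lemma mderiv_cv_left (hρ : IsTest ρ) (hg : LocallyIntegrable g) (μ : MIdx) :
    mderiv μ (cv ρ g) = cv (mderiv μ ρ) g := by
  refine mderiv_family (n := μ.abs) (G := fun κ => cv (mderiv κ ρ) g) (fun κ i _ => funext fun v => ?_) μ le_rfl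
  rw [pd_of_hasFDerivAt (hasFDerivAt_cv_left (hρ.mderiv κ) hg v), pd_mderiv hρ.1]

lemma IsTest.bdd (h : IsTest ρ) : ∃ B, ∀ x, ‖ρ x‖ ≤ B := by
  obtain ⟨B, hB⟩ := h.continuous.bounded_above_of_compact_support h.2
  exact ⟨B, hB⟩

lemma IsTest.convBdd (h : IsTest ρ) : ConvBdd ρ :=
  let ⟨_, hB⟩ := h.bdd
  convBdd_of_bdd h.continuous.measurable hB

lemma IsTest.cv (hρ : IsTest ρ) (hψ : IsTest ψ) : IsTest (cv ρ ψ) := by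
  have e : WeakCoupling.cv ρ ψ = MeasureTheory.convolution ρ ψ (ContinuousLinearMap.mul ℝ ℝ) volume := by
    funext w
    rw [WeakCoupling.cv, MeasureTheory.convolution, ← integral_sub_left_eq_self _ volume w]
    simp
  rw [e]
  exact ⟨hψ.2.contDiff_convolution_right _ hρ.integrable.locallyIntegrable hψ.1,
    HasCompactSupport.convolution _ hρ.2 hψ.2⟩

@[fun_prop]
lemma measurable_cv (hk : Measurable k) (hg : Measurable g) : Measurable (cv k g) := by
  have h : StronglyMeasurable (uncurry fun v v' : E => k (v - v') * g v') := by fun_prop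
  exact h.integral_prod_right.measurable

lemma enorm_cv_le_lintegral (k g : E → ℝ) (v : E) : ‖cv k g v‖ₑ ≤ ∫⁻ v', ‖k (v - v')‖ₑ * ‖g v'‖ₑ :=
  (enorm_integral_le_lintegral_enorm _).trans_eq (by simp_rw [enorm_mul])

lemma IsWt.enorm_cv_le (hν : IsWt ν) : ∃ C : ℝ, 0 ≤ C ∧ ∀ k g : E → ℝ, (∀ x, 2 < ‖x‖ → k x = 0) → ∀ v,
    ofReal (√(ν v)) * ‖cv k g v‖ₑ ≤ ofReal C * ∫⁻ v', ‖k (v - v')‖ₑ * (ofReal (√(ν v')) * ‖g v'‖ₑ) := by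
  obtain ⟨C, hC, h⟩ := hν.shift
  refine ⟨√C, sqrt_nonneg _, fun k g hks v => (mul_le_mul' le_rfl (enorm_cv_le_lintegral k g v)).trans ?_⟩
  rw [← lintegral_const_mul' _ _ ofReal_ne_top, ← lintegral_const_mul' _ _ ofReal_ne_top]
  refine lintegral_mono fun v' => ?_
  by_cases hvv : 2 < ‖v - v'‖
  · simp [hks _ hvv]
  · have h1 : ofReal (√(ν v)) ≤ ofReal (√C) * ofReal (√(ν v')) := by
      rw [← ofReal_mul (by positivity), ← sqrt_mul hC]
      exact ofReal_le_ofReal (Real.sqrt_le_sqrt (h v v' (not_lt.1 hvv)))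
    calc _ ≤ (ofReal (√C) * ofReal (√(ν v'))) * (‖k (v - v')‖ₑ * ‖g v'‖ₑ) := by gcongr
      _ = _ := by ring

/-- Young's inequality with weights, for compactly supported kernels. -/
lemma wl2_cv_le (hν : IsWt ν) :
    ∃ C : ℝ, 0 ≤ C ∧ ∀ k g : E → ℝ, Measurable k → (∀ x, 2 < ‖x‖ → k x = 0) → Measurable g →
      wl2 ν (cv k g) ≤ ofReal C * (∫⁻ x, ‖k x‖ₑ) * wl2 ν g := by
  obtain ⟨C, hC, h⟩ := hν.enorm_cv_le
  refine ⟨C, hC, fun k g hk hks hg => ?_⟩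
  have hs := hν.cont.measurable
  have hm : Measurable fun v => ∫⁻ v', ‖k (v - v')‖ₑ * (ofReal (√(ν v')) * ‖g v'‖ₑ) :=
    Measurable.lintegral_prod_right' (f := fun p : E × E => ‖k (p.1 - p.2)‖ₑ * (ofReal (√(ν p.2)) * ‖g p.2‖ₑ)) (by fun_prop)
  rw [mul_assoc]
  exact (l2_mono (h k g hks)).trans ((l2_const_mul hm.aemeasurable _).trans_le (mul_le_mul' le_rfl (l2_conv_le hk.enorm (by fun_prop))))

/-- The mollifier `γ^{-3} η(x / γ)`. -/
def mollK (η : E → ℝ) (γ : ℝ) (x : E) : ℝ := γ⁻¹ ^ 3 * η (γ⁻¹ • x)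

lemma mgrad_eq (η : E → ℝ) (γ : ℝ) (i : Fin 3) (g : E → ℝ) : mgrad η γ i g = pd i (cv (mollK η γ) g) := rfl

lemma mollK_eq_zero (hη : IsMollifier η) (hγ : 0 < γ) (hx : γ < ‖x‖) :
    mollK η γ x = 0 := by
  have : γ⁻¹ • x ∉ tsupport η := fun hc => by
    have h1 := hη.support hc
    rw [mem_closedBall_zero_iff, norm_smul, norm_of_nonneg (by positivity), inv_mul_le_one₀ hγ] at h1
    linarith
  rw [mollK, image_eq_zero_of_notMem_tsupport this, mul_zero]

lemma isTest_mollK (hη : IsMollifier η) (hγ : 0 < γ) : IsTest (mollK η γ) := by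
  have h1 := hη.smooth
  refine ⟨by unfold mollK; fun_prop, ?_⟩
  refine HasCompactSupport.of_support_subset_isCompact (isCompact_closedBall (0 : E) γ) fun x hx => ?_
  rw [mem_closedBall_zero_iff]
  by_contra hc
  exact hx (mollK_eq_zero hη hγ (not_le.1 hc))

lemma mollK_nonneg (hη : IsMollifier η) (hγ : 0 < γ) (x : E) : 0 ≤ mollK η γ x :=
  mul_nonneg (by positivity) (hη.nonneg _)

lemma integral_mollK (hη : IsMollifier η) (hγ : 0 < γ) : ∫ x, mollK η γ x = 1 := by
  unfold mollK
  rw [integral_const_mul, integral_comp_smul, hη.mass]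
  simp only [finrank_euclideanSpace, Fintype.card_fin, smul_eq_mul, mul_one]
  rw [abs_of_pos (by positivity)]
  field_simp

lemma lintegral_mollK (hη : IsMollifier η) (hγ : 0 < γ) : ∫⁻ x, ‖mollK η γ x‖ₑ = 1 := by
  have h := ofReal_integral_eq_lintegral_ofReal (isTest_mollK hη hγ).integrable
    (of_forall (mollK_nonneg hη hγ))
  rw [integral_mollK hη hγ, ofReal_one] at h
  rw [h]
  exact lintegral_congr fun x => enorm_of_nonneg (mollK_nonneg hη hγ x)

lemma pd_eq_zero_of_far (h : ∀ x, r < ‖x‖ → ρ x = 0) (i : Fin 3) (hx : r < ‖x‖) :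
    pd i ρ x = 0 := by
  have : ρ =ᶠ[𝓝 x] fun _ => 0 := by
    filter_upwards [(isOpen_lt continuous_const continuous_norm).mem_nhds hx] with y hy using h y hy
  rw [pd, this.fderiv_eq]
  simp

lemma iterate_pd_eq_zero_of_far (h : ∀ x, r < ‖x‖ → ρ x = 0) (i : Fin 3) (k : ℕ) :
    ∀ x, r < ‖x‖ → (pd i)^[k] ρ x = 0 := by
  induction k with
  | zero => exact h
  | succ k ih => intro x hx; rw [Function.iterate_succ_apply']; exact pd_eq_zero_of_far ih i hx

lemma mderiv_eq_zero_of_far (h : ∀ x, r < ‖x‖ → ρ x = 0) (κ : MIdx) :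
    ∀ x, r < ‖x‖ → mderiv κ ρ x = 0 :=
  iterate_pd_eq_zero_of_far (iterate_pd_eq_zero_of_far (iterate_pd_eq_zero_of_far h _ _) _ _) _ _

lemma Sob.locallyIntegrable (hV : Sob n lamT V) (hκ : κ.abs ≤ n) :
    LocallyIntegrable (V κ) :=
  (integrable_of_wl2 (hV.meas κ hκ).aemeasurable (hV.finite continuous_lamT hκ)).locallyIntegrable

/-- The mollification of a Sobolev family has derivatives of every order. -/
lemma sob_mollify (hη : IsMollifier η) (hγ : 0 < γ) (hγ1 : γ ≤ 1) (hν : IsWt ν)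
    (hV : Sob n ν V) (m : ℕ) : Sob m ν fun κ => cv (mderiv κ (mollK η γ)) (V 0) := by
  obtain ⟨ψ, hψ, hl⟩ := hV.approx
  have hρ := isTest_mollK hη hγ
  have h0 : (0 : MIdx).abs ≤ n := by simp
  have hVT := hV.mono le_rfl hν.low
  refine ⟨fun κ _ => measurable_cv (hρ.mderiv κ).continuous.measurable (hV.meas 0 h0),
    fun j => cv (mollK η γ) (ψ j), fun j => hρ.cv (hψ j), fun κ _ => ?_⟩
  obtain ⟨C, hC, hb⟩ := wl2_cv_le hν
  have hfar : ∀ x, 2 < ‖x‖ → mderiv κ (mollK η γ) x = 0 :=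
    mderiv_eq_zero_of_far (fun x hx => mollK_eq_zero hη hγ (by linarith)) κ
  have e : ∀ j v, cv (mderiv κ (mollK η γ)) (V 0) v - mderiv κ (cv (mollK η γ) (ψ j)) v =
      cv (mderiv κ (mollK η γ)) (fun w => V 0 w - ψ j w) v := by
    intro j v
    rw [mderiv_cv_left hρ (hψ j).integrable.locallyIntegrable, cv_sub (hρ.mderiv κ).convBdd
      (hV.meas 0 h0).aemeasurable (hVT.finite continuous_lamT h0) (hψ j).continuous.measurable.aemeasurable
      ((hψ j).wl2_lt_top continuous_lamT)]
  simp_rw [e]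
  have hfin : ofReal C * ∫⁻ x, ‖mderiv κ (mollK η γ) x‖ₑ ≠ ⊤ :=
    mul_ne_top ofReal_ne_top (hρ.mderiv κ).integrable.2.ne
  have h2 := ENNReal.Tendsto.const_mul (hl 0 h0) (Or.inr hfin)
  rw [mul_zero] at h2
  exact tendsto_of_tendsto_of_tendsto_of_le_of_le tendsto_const_nhds h2 (fun _ => zero_le)
    fun j => hb _ _ (hρ.mderiv κ).continuous.measurable hfar ((hV.meas 0 h0).sub (hψ j).continuous.measurable)

lemma cv_mderiv_left (hρ : IsTest ρ) (hV : Sob n lamT V) (hκ : κ.abs ≤ n) : cv (mderiv κ ρ) (V 0) = cv ρ (V κ) := by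
  rw [← mderiv_cv_left hρ (hV.locallyIntegrable (by simp)), mderiv_cv hρ.convBdd hV hκ]

lemma mgrad_sob (hη : IsMollifier η) (hγ : 0 < γ) (hV : Sob n lamT V) (hκ : κ.abs + 1 ≤ n) (i : Fin 3) :
    mgrad η γ i (V κ) = cv (mollK η γ) (V (κ + unitM i)) :=
  funext fun v => pd_of_hasFDerivAt (hasFDerivAt_cv (isTest_mollK hη hγ).convBdd hV hκ v) i

lemma mgrad_of_locallyIntegrable (hη : IsMollifier η) (hγ : 0 < γ) (hg : LocallyIntegrable g) (i : Fin 3) : mgrad η γ i g = cv (pd i (mollK η γ)) g :=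
  funext fun v => pd_of_hasFDerivAt (hasFDerivAt_cv_left (isTest_mollK hη hγ) hg v) i

lemma mgrad_congr {i : Fin 3} (h : f =ᵐ[volume] g) :
    mgrad η γ i f = mgrad η γ i g := by
  rw [mgrad_eq, mgrad_eq, cv_congr h]

lemma cv_cv_comm {Φ : E → ℝ} (hρ : IsTest ρ) (hΦ : Measurable Φ) {B : ℝ} (hB : ∀ x, ‖Φ x‖ ≤ B)
    (hg : Integrable g) (v : E) : cv ρ (cv Φ g) v = cv Φ (cv ρ g) v := by
  have hρi := hρ.integrable
  have hint1 : Integrable (uncurry fun z y : E => ρ z * (Φ (v - z - y) * g y)) (volume.prod volume) := by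
    have h := (hρi.mul_prod hg).bdd_mul (c := B) (f := fun p : E × E => Φ (v - p.1 - p.2))
      (hΦ.comp (by fun_prop)).aestronglyMeasurable (of_forall fun p => hB _)
    refine h.congr (of_forall fun p => ?_)
    simp only [uncurry]; ring
  have hint2 : Integrable (uncurry fun x y : E => Φ (v - x) * (ρ (x - y) * g y)) (volume.prod volume) := by
    have h0 : Integrable (fun p : E × E => g p.2 * ρ (p.1 - p.2)) (volume.prod volume) := by
      have := hg.convolution_integrand (ContinuousLinearMap.mul ℝ ℝ) hρi
      simpa using this
    have h := h0.bdd_mul (c := B) (f := fun p : E × E => Φ (v - p.1))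
      (hΦ.comp (by fun_prop)).aestronglyMeasurable (of_forall fun p => hB _)
    refine h.congr (of_forall fun p => ?_)
    simp only [uncurry]; ring
  have e1 : cv ρ (cv Φ g) v = ∫ y, ∫ z, ρ z * (Φ (v - z - y) * g y) := by
    rw [← integral_integral_swap hint1, cv_comm]
    unfold cv
    refine integral_congr_ae (of_forall fun z => ?_)
    beta_reduce
    rw [integral_const_mul, mul_comm]
  have e2 : cv Φ (cv ρ g) v = ∫ y, ∫ x, Φ (v - x) * (ρ (x - y) * g y) := by
    rw [← integral_integral_swap hint2]
    unfold cv
    refine integral_congr_ae (of_forall fun x => ?_)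
    beta_reduce
    rw [integral_const_mul]
  rw [e1, e2]
  refine integral_congr_ae (of_forall fun y => ?_)
  beta_reduce
  rw [← integral_sub_right_eq_self _ y]
  refine integral_congr_ae (of_forall fun x => ?_)
  beta_reduce
  rw [show v - (x - y) - y = v - x by abel]
  ring

/-! ### Derivatives of the kernels -/

lemma mixK_zero_bdd (hm : IsMix m) (S : 𝓢(E, ℝ)) (τ : ℝ) : ∃ B : ℝ, ∀ x, ‖mixK m S 0 τ x‖ ≤ B := by
  have := hm.finite
  refine ⟨(ofReal (SchwartzMap.seminorm ℝ 0 0 S) * m univ).toReal, fun x => ?_⟩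
  rw [← toReal_enorm]
  exact toReal_mono (mul_ne_top ofReal_ne_top (measure_ne_top _ _))
    ((enorm_mixK_le_mixAbs _ _ _ _ _).trans (mixAbs_zero_le S τ x))

lemma kernelK_eq_cv (hN : Sob n lamT N) (hν : ν =ᵐ[volume] N 0) (τ : ℝ)
    (i j : Fin 3) : kernelK ν τ i j = cv (mixK mixM (hessG i j) 0 τ) (N 0) := by
  have hi : Integrable (N 0) := integrable_of_wl2 (hN.meas 0 (by simp)).aemeasurable
    (hN.finite continuous_lamT (by simp))
  rw [← cv_congr hν]
  exact funext fun v => kernelK_eq (hi.congr hν.symm) τ i j v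

lemma mderiv_kernelK (hN : Sob n lamT N) (hν : ν =ᵐ[volume] N 0)
    (hτ : 0 < τ) (i j l : Fin 3) {μ : MIdx} (hμ : μ.abs + 1 ≤ n) :
    mderiv (μ + unitM l) (kernelK ν τ i j) = cv (mixK mixM (∂_{basisVec l} (hessG i j)) 1 τ) (N μ) := by
  rw [kernelK_eq_cv hN hν, mderiv_cv (convBdd_mixK isMix_mixM _ (by omega) hτ) hN (by rw [abs_add, abs_unitM]; exact hμ),
    cv_mixK_succ isMix_mixM _ (by omega) hτ hN hμ]

lemma kernelP_eq (hη : IsMollifier η) (hγ : 0 < γ) (hγ1 : γ ≤ 1) (hN : Sob n lamT N) (hν : ν =ᵐ[volume] N 0) (hτ : 0 < τ) (j : Fin 3) :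
    kernelP η γ ν τ j = fun v => ∑ i, cv (mixK mixM (∂_{basisVec i} (hessG i j)) 1 τ) (cv (mollK η γ) (N 0)) v := by
  funext v
  refine sum_congr rfl fun i _ => ?_
  obtain ⟨B, hB⟩ := mixK_zero_bdd isMix_mixM (hessG i j) τ
  have hM := sob_mollify hη hγ hγ1 isWt_lamT hN 1
  have hk := convBdd_mixK isMix_mixM (hessG i j) (a := 0) (by omega) hτ
  have hi : Integrable (N 0) := integrable_of_wl2 (hN.meas 0 (by simp)).aemeasurable
    (hN.finite continuous_lamT (by simp))
  rw [mgrad_eq, kernelK_eq_cv hN hν, funext (cv_cv_comm (isTest_mollK hη hγ) hk.meas hB hi)]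
  have h1 := pd_of_hasFDerivAt (hasFDerivAt_cv hk hM (κ := 0) (by simp) v) i
  have h2 := congrFun (cv_mixK_succ isMix_mixM (hessG i j) (a := 0) (by omega) hτ hM (κ := 0) (by simp) i) v
  exact h1.trans h2

lemma mderiv_kernelP (hη : IsMollifier η) (hγ : 0 < γ) (hγ1 : γ ≤ 1) (hN : Sob n lamT N) (hν : ν =ᵐ[volume] N 0) (hτ : 0 < τ) (j : Fin 3) {μ : MIdx}
    (hμ : μ.abs ≤ n) (v : E) : mderiv μ (kernelP η γ ν τ j) v =
      ∑ i, cv (mixK mixM (∂_{basisVec i} (hessG i j)) 1 τ) (cv (mollK η γ) (N μ)) v := by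
  have hM := sob_mollify hη hγ hγ1 isWt_lamT hN (μ.abs)
  have h := mderiv_family (n := μ.abs) (G := fun κ v => ∑ i, cv (mixK mixM (∂_{basisVec i} (hessG i j)) 1 τ)
    (cv (mderiv κ (mollK η γ)) (N 0)) v) (fun κ l hκ => funext fun w => ?_) μ le_rfl
  · rw [kernelP_eq hη hγ hγ1 hN hν hτ]
    have := congrFun h v
    simp only [mderiv_zero] at this
    rw [this]
    refine sum_congr rfl fun i _ => ?_
    rw [cv_mderiv_left (isTest_mollK hη hγ) hN hμ]
  · have hd := HasFDerivAt.fun_sum (u := Finset.univ) (fun i _ => hasFDerivAt_cv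
      (convBdd_mixK isMix_mixM (∂_{basisVec i} (hessG i j)) (a := 1) (by omega) hτ) hM (κ := κ) hκ w)
    rw [pd, hd.fderiv, sum_apply]
    exact sum_congr rfl fun i _ => gradCLM_basisVec _ _

lemma mderiv_kernelP' (hη : IsMollifier η) (hγ : 0 < γ) (hγ1 : γ ≤ 1) (hN : Sob n lamT N) (hν : ν =ᵐ[volume] N 0) (hτ : 0 < τ) (j l : Fin 3) {μ : MIdx}
    (hμ : μ.abs + 1 ≤ n) (v : E) : mderiv (μ + unitM l) (kernelP η γ ν τ j) v =
      ∑ i, cv (mixK mixM (∂_{basisVec l} (∂_{basisVec i} (hessG i j))) 2 τ) (cv (mollK η γ) (N μ)) v := by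
  have hle : (μ + unitM l).abs ≤ n := by rw [abs_add, abs_unitM]; exact hμ
  rw [mderiv_kernelP hη hγ hγ1 hN hν hτ j hle]
  refine sum_congr rfl fun i _ => ?_
  have hM := sob_mollify hη hγ hγ1 isWt_lamT hN n
  have h := congrFun (cv_mixK_succ isMix_mixM (∂_{basisVec i} (hessG i j)) (a := 1) (by omega) hτ hM hμ l) v
  rw [cv_mderiv_left (isTest_mollK hη hγ) hN hle, cv_mderiv_left (isTest_mollK hη hγ) hN (by omega)] at h
  exact h

/-! ### Representation by derivatives on unit cubes -/

/-- The one-dimensional weights `1` and `x - 1` on the unit interval. -/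
def cubeW (a : ℕ) (x : ℝ) : ℝ := (Ioc (0 : ℝ) 1).indicator (fun x => if a = 0 then 1 else x - 1) x

@[fun_prop]
lemma measurable_cubeW (a : ℕ) : Measurable (cubeW a) := by
  unfold cubeW
  refine Measurable.indicator ?_ measurableSet_Ioc
  split_ifs <;> fun_prop

lemma abs_cubeW_le (a : ℕ) (x : ℝ) : |cubeW a x| ≤ 1 := by
  unfold cubeW
  by_cases hx : x ∈ Ioc (0 : ℝ) 1
  · rw [indicator_of_mem hx]
    split_ifs
    · simp
    · rw [abs_le]; constructor <;> linarith [hx.1, hx.2]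
  · rw [indicator_of_notMem hx]; simp

lemma cubeW_eq_zero {x : ℝ} (h : 1 < |x|) : cubeW a x = 0 := by
  refine indicator_of_notMem (fun hx => ?_) _
  rw [abs_of_pos hx.1] at h
  linarith [hx.2]

lemma integrable_cubeW (a : ℕ) : Integrable (cubeW a) := by
  refine IntegrableOn.integrable_indicator ?_ measurableSet_Ioc
  rw [← intervalIntegrable_iff_integrableOn_Ioc_of_le zero_le_one]
  refine Continuous.intervalIntegrable ?_ _ _
  split_ifs <;> fun_prop

lemma integrable_sum_cubeW (hψ : IsTest ψ) (i : Fin 3) (v : E) :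
    Integrable fun x => ∑ a ∈ Finset.range 2, cubeW a x * (pd i)^[a] ψ (v + x • basisVec i) := by
  refine integrable_finsetSum _ fun a _ => ?_
  obtain ⟨B, hB⟩ := (hψ.iterate i a).bdd
  have := (hψ.iterate i a).continuous
  exact (integrable_cubeW a).mul_bdd (c := B) (by fun_prop) (of_forall fun _ => hB _)

lemma eq_integral_cubeW (hψ : IsTest ψ) (i : Fin 3) (v : E) :
    ψ v = ∫ x, ∑ a ∈ Finset.range 2, cubeW a x * (pd i)^[a] ψ (v + x • basisVec i) := by
  have hd : ∀ x : ℝ, HasDerivAt (fun x : ℝ => (x - 1) * ψ (v + x • basisVec i))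
      (1 * ψ (v + x • basisVec i) + (x - 1) * pd i ψ (v + x • basisVec i)) x := fun x => by
    have h1 : HasDerivAt (fun x : ℝ => v + x • basisVec i) (basisVec i) x := by
      simpa using ((hasDerivAt_id x).smul_const (basisVec i)).const_add v
    exact ((hasDerivAt_id x).sub_const 1).mul ((hψ.1.differentiable (by simp) _).hasFDerivAt.comp_hasDerivAt x h1)
  have c1 := hψ.continuous
  have c2 := (hψ.pd i).continuous
  have h := intervalIntegral.integral_eq_sub_of_hasDerivAt (a := 0) (b := 1) (fun x _ => hd x)
    (Continuous.intervalIntegrable (by fun_prop) _ _)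
  rw [intervalIntegral.integral_of_le zero_le_one, ← integral_indicator measurableSet_Ioc] at h
  refine Eq.trans (by simp) (h.symm.trans (integral_congr_ae (of_forall fun x => ?_)))
  simp only [Finset.sum_range_succ, Finset.sum_range_zero, cubeW, indicator]
  split_ifs <;> simp_all

lemma sum_mul_eq_integral_cubeW {ι : Type*} (s : Finset ι) (k : ι → ℝ) {φ : ι → E → ℝ} (hφ : ∀ j, IsTest (φ j)) (i : Fin 3) (v : E) :
    ∑ j ∈ s, k j * φ j v =
      ∫ x, ∑ j ∈ s, k j * ∑ a ∈ Finset.range 2, cubeW a x * (pd i)^[a] (φ j) (v + x • basisVec i) := by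
  rw [integral_finsetSum _ fun j _ => (integrable_sum_cubeW (hφ j) i v).const_mul _]
  simp_rw [integral_const_mul, ← eq_integral_cubeW (hφ _)]

/-- The index set of the cube formula. -/
def cubeIdx : Finset (ℕ × ℕ × ℕ) := Finset.range 2 ×ˢ Finset.range 2 ×ˢ Finset.range 2

/-- The multi-index of a triple. -/
def cubeM (p : ℕ × ℕ × ℕ) : MIdx := ![p.1, p.2.1, p.2.2]

lemma abs_cubeM_le {p : ℕ × ℕ × ℕ} (hp : p ∈ cubeIdx) : (cubeM p).abs ≤ 3 := by
  simp only [cubeIdx, Finset.mem_product, Finset.mem_range] at hp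
  simp only [MIdx.abs, Fin.sum_univ_three, cubeM]
  change p.1 + p.2.1 + p.2.2 ≤ 3
  omega

/-- The weights on the unit cube. -/
def cubeK (p : ℕ × ℕ × ℕ) (x : E) : ℝ := cubeW p.1 (-x 0) * (cubeW p.2.1 (-x 1) * cubeW p.2.2 (-x 2))

@[fun_prop]
lemma measurable_cubeK (p : ℕ × ℕ × ℕ) : Measurable (cubeK p) := by
  have := measurable_cubeW
  unfold cubeK
  have h0 : ∀ i : Fin 3, Measurable fun x : E => -x i := by fun_prop
  fun_prop

lemma abs_cubeK_le (p : ℕ × ℕ × ℕ) (x : E) : ‖cubeK p x‖ ≤ 1 := by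
  rw [cubeK, norm_mul, norm_mul]
  exact mul_le_one₀ (abs_cubeW_le _ _) (by positivity) (mul_le_one₀ (abs_cubeW_le _ _) (by positivity) (abs_cubeW_le _ _))

lemma cubeK_eq_zero (p : ℕ × ℕ × ℕ) (hx : 2 < ‖x‖) : cubeK p x = 0 := by
  by_contra hne
  rw [cubeK] at hne
  have h0 : |x 0| ≤ 1 := by
    by_contra hc; exact hne (by rw [cubeW_eq_zero (x := -x 0) (by rw [abs_neg]; exact not_le.1 hc), zero_mul])
  have h1 : |x 1| ≤ 1 := by
    by_contra hc; exact hne (by rw [cubeW_eq_zero (x := -x 1) (by rw [abs_neg]; exact not_le.1 hc), zero_mul, mul_zero])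
  have h2 : |x 2| ≤ 1 := by
    by_contra hc; exact hne (by rw [cubeW_eq_zero (x := -x 2) (by rw [abs_neg]; exact not_le.1 hc), mul_zero, mul_zero])
  have h := EuclideanSpace.norm_sq_eq x
  rw [Fin.sum_univ_three] at h
  simp only [norm_eq_abs] at h
  nlinarith [abs_nonneg (x 0), abs_nonneg (x 1), abs_nonneg (x 2)]

/-- The coordinates as a measurable equivalence. -/
def coordEquiv : E ≃ᵐ ℝ × ℝ × ℝ :=
  (MeasurableEquiv.toLp 2 (Fin 3 → ℝ)).symm.trans
    ((MeasurableEquiv.piFinSuccAbove (fun _ : Fin 3 => ℝ) 0).trans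
      ((MeasurableEquiv.refl ℝ).prodCongr MeasurableEquiv.finTwoArrow))

lemma coordEquiv_apply (x : E) : coordEquiv x = (x 0, x 1, x 2) := rfl

lemma measurePreserving_coordEquiv : MeasurePreserving coordEquiv volume volume := by
  refine MeasurePreserving.trans (EuclideanSpace.volume_preserving_symm_measurableEquiv_toLp (Fin 3)) ?_
  refine MeasurePreserving.trans (volume_preserving_piFinSuccAbove (fun _ : Fin 3 => ℝ) 0) ?_
  exact (MeasurePreserving.id volume).prod (volume_preserving_finTwoArrow ℝ)

lemma eq_sum_cubeK (hψ : IsTest ψ) (v : E) :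
    ψ v = ∑ p ∈ cubeIdx, cv (cubeK p) (mderiv (cubeM p) ψ) v := by
  set G : ℕ × ℕ × ℕ → ℝ × ℝ × ℝ → ℝ := fun p q => cubeW p.1 q.1 * (cubeW p.2.1 q.2.1 * cubeW p.2.2 q.2.2) *
    mderiv (cubeM p) ψ (v + q.2.2 • basisVec 2 + q.2.1 • basisVec 1 + q.1 • basisVec 0) with hG
  have e1 : ∀ p, cv (cubeK p) (mderiv (cubeM p) ψ) v = ∫ q, G p q := fun p => by
    rw [← measurePreserving_coordEquiv.integral_comp' (G p), cv, ← integral_add_left_eq_self _ v]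
    refine integral_congr_ae (of_forall fun w => ?_)
    simp only [coordEquiv_apply, hG, cubeK, sub_add_cancel_left, PiLp.neg_apply, neg_neg]
    congr 2
    have := sum_coord_smul_basisVec w
    rw [Fin.sum_univ_three] at this
    nth_rewrite 1 [← this]
    abel
  have hGi : ∀ p, Integrable (G p) (volume.prod (volume.prod volume)) := fun p => by
    obtain ⟨B, hB⟩ := (hψ.mderiv (cubeM p)).bdd
    have hc := (hψ.mderiv (cubeM p)).continuous
    exact ((integrable_cubeW _).mul_prod ((integrable_cubeW _).mul_prod (integrable_cubeW _))).mul_bdd (c := B)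
      (by fun_prop) (of_forall fun _ => hB _)
  have hs := integrable_finsetSum cubeIdx fun p _ => hGi p
  rw [sum_congr rfl fun p _ => e1 p]
  refine Eq.symm ((integral_finsetSum _ fun p _ => hGi p).symm.trans ((integral_prod_symm _ hs).trans
    ((integral_prod_symm _ hs.integral_prod_right).trans ?_)))
  rw [eq_integral_cubeW hψ 2 v]
  congr 1 with z
  rw [sum_mul_eq_integral_cubeW _ (fun c => cubeW c z) (fun c => hψ.iterate 2 c) 1]
  congr 1 with y
  have e2 := sum_mul_eq_integral_cubeW (Finset.range 2 ×ˢ Finset.range 2) (fun d => cubeW d.1 z * cubeW d.2 y)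
    (fun d => (hψ.iterate 2 d.1).iterate 1 d.2) 0 (v + z • basisVec 2 + y • basisVec 1)
  rw [Finset.sum_product] at e2
  simp_rw [mul_sum, ← mul_assoc]
  rw [e2]
  congr 1 with x
  have hD : ∀ a b c, mderiv (cubeM (a, b, c)) ψ = (pd 0)^[a] ((pd 1)^[b] ((pd 2)^[c] ψ)) := fun _ _ _ => rfl
  simp only [hG, cubeIdx, Finset.sum_product, Finset.sum_range_succ, Finset.sum_range_zero, hD]
  ring

/-- Convergence of integrals to zero gives convergence almost everywhere along a subsequence. -/
lemma exists_subseq_ae_tendsto {X : Type*} [MeasurableSpace X] {μ : Measure X} {f : ℕ → X → ℝ≥0∞}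
    (hf : ∀ k, AEMeasurable (f k) μ) (h : Tendsto (fun k => ∫⁻ x, f k x ∂μ) atTop (𝓝 0)) :
    ∃ φ : ℕ → ℕ, StrictMono φ ∧ ∀ᵐ x ∂μ, Tendsto (fun j => f (φ j) x) atTop (𝓝 0) := by
  have hev : ∀ j : ℕ, ∀ᶠ k in atTop, ∫⁻ x, f k x ∂μ < (2⁻¹ : ℝ≥0∞) ^ j := fun j =>
    h.eventually (gt_mem_nhds (ENNReal.pow_pos (by simp) j))
  obtain ⟨φ, hφ, hb⟩ := extraction_forall_of_eventually hev
  refine ⟨φ, hφ, ?_⟩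
  have hs : ∫⁻ x, ∑' j, f (φ j) x ∂μ < ⊤ := by
    rw [lintegral_tsum fun j => hf (φ j)]
    refine (ENNReal.tsum_le_tsum fun j => (hb j).le).trans_lt ?_
    rw [ENNReal.tsum_geometric]
    exact ENNReal.inv_lt_top.2 (by simp)
  have hae := ae_lt_top' (by fun_prop) hs.ne
  filter_upwards [hae] with x hx
  exact ENNReal.tendsto_atTop_zero_of_tsum_ne_top hx.ne

/-- A Sobolev function is recovered from its derivatives by the cube formula. -/
lemma sob_repr (hV : Sob n lamT V) {b : MIdx} (hb : b.abs + 3 ≤ n) :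
    V b =ᵐ[volume] fun v => ∑ p ∈ cubeIdx, cv (cubeK p) (V (b + cubeM p)) v := by
  obtain ⟨ψ, hψ, hl⟩ := hV.approx
  have hbn : b.abs ≤ n := by omega
  have hk : ∀ p, ConvBdd (cubeK p) := fun p => convBdd_of_bdd (by fun_prop) (abs_cubeK_le p)
  have hR : ∀ v, Tendsto (fun j => mderiv b (ψ j) v) atTop (𝓝 (∑ p ∈ cubeIdx, cv (cubeK p) (V (b + cubeM p)) v)) := by
    intro v
    have h0 : ∀ j, mderiv b (ψ j) v = ∑ p ∈ cubeIdx, cv (cubeK p) (mderiv (b + cubeM p) (ψ j)) v := fun j => by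
      rw [eq_sum_cubeK ((hψ j).mderiv b) v]
      simp_rw [mderiv_mderiv (hψ j).1]
    simp_rw [h0]
    refine tendsto_finsetSum _ fun p hp => ?_
    have hbp : (b + cubeM p).abs ≤ n := by rw [abs_add]; have := abs_cubeM_le hp; omega
    exact (cv_tendstoUniformly (hk p) (hV.meas _ hbp).aemeasurable (hV.finite continuous_lamT hbp)
      (fun j => ((hψ j).mderiv _).continuous.measurable.aemeasurable)
      (fun j => ((hψ j).mderiv _).wl2_lt_top continuous_lamT) (hl _ hbp)).tendsto_at v
  have hm : ∀ j, Measurable fun v => V b v - mderiv b (ψ j) v := fun j =>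
    (hV.meas b hbn).sub ((hψ j).mderiv b).continuous.measurable
  have h1 : Tendsto (fun j => ∫⁻ v, ‖V b v - mderiv b (ψ j) v‖ₑ) atTop (𝓝 0) := by
    have h2 := ENNReal.Tendsto.const_mul (hl b hbn) (Or.inr lamTC_ne_top)
    rw [mul_zero] at h2
    exact tendsto_of_tendsto_of_tendsto_of_le_of_le tendsto_const_nhds h2 (fun _ => zero_le)
      fun j => lintegral_enorm_le_wl2 (hm j).aemeasurable
  obtain ⟨φ, hφ, hae⟩ := exists_subseq_ae_tendsto (fun j => (hm j).enorm.aemeasurable) h1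
  filter_upwards [hae] with v hv
  have h3 : Tendsto (fun j => mderiv b (ψ (φ j)) v) atTop (𝓝 (V b v)) := by
    rw [tendsto_iff_edist_tendsto_0]
    refine hv.congr fun j => ?_
    rw [edist_comm, edist_eq_enorm_sub]
  exact tendsto_nhds_unique h3 ((hR v).comp hφ.tendsto_atTop)

lemma l2_cubeK_le (p : ℕ × ℕ × ℕ) : l2 volume (fun x => ‖cubeK p x‖ₑ) ≤ (volume (Metric.closedBall (0 : E) 2)) ^ (1 / 2 : ℝ) := by
  unfold l2
  gcongr
  rw [← lintegral_indicator_one measurableSet_closedBall]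
  refine lintegral_mono fun x => ?_
  by_cases hx : x ∈ Metric.closedBall (0 : E) 2
  · have h1 : ‖cubeK p x‖ₑ ≤ 1 := by
      rw [← ofReal_norm]; exact ofReal_le_one.2 (abs_cubeK_le p x)
    rw [indicator_of_mem hx]
    exact pow_le_one₀ zero_le h1
  · rw [mem_closedBall_zero_iff, not_le] at hx
    simp [cubeK_eq_zero p hx]

lemma l2_cubeK_lt_top (p : ℕ × ℕ × ℕ) : l2 volume (fun x => ‖cubeK p x‖ₑ) < ⊤ :=
  (l2_cubeK_le p).trans_lt (rpow_lt_top_of_nonneg (by norm_num) measure_closedBall_lt_top.ne)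

/-- The pointwise weighted bound for Sobolev functions. -/
lemma sob_sup (hν : IsWt ν) :
    ∃ C : ℝ, 0 ≤ C ∧ ∀ (n : ℕ) (V : MIdx → E → ℝ), Sob n ν V → ∀ b : MIdx, b.abs + 3 ≤ n →
      ∀ᵐ v, ofReal (√(ν v)) * ‖V b v‖ₑ ≤ ofReal C * hNorm (b.abs + 3) ν V := by
  obtain ⟨C, hC, h⟩ := hν.enorm_cv_le
  set L := ∑ p ∈ cubeIdx, (l2 volume (fun x => ‖cubeK p x‖ₑ)) with hL
  have hLt : L ≠ ⊤ := (sum_lt_top.2 fun p _ => l2_cubeK_lt_top p).ne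
  refine ⟨C * L.toReal, by positivity, fun n V hV b hb => ?_⟩
  have hs := measurable_ofReal_sqrt hν.cont
  filter_upwards [sob_repr (hV.mono le_rfl hν.low) hb] with v hv
  rw [hv, ofReal_mul hC, ofReal_toReal hLt, hL, mul_assoc, sum_mul, mul_sum]
  refine (mul_le_mul' le_rfl (enorm_sum_le _ _)).trans ?_
  rw [mul_sum]
  refine sum_le_sum fun p hp => (h (cubeK p) (V (b + cubeM p)) (fun x => cubeK_eq_zero p) v).trans (mul_le_mul' le_rfl ?_)
  have hbp : (b + cubeM p).abs ≤ b.abs + 3 := by rw [abs_add]; have := abs_cubeM_le hp; omega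
  have hgm := hV.meas (b + cubeM p) (by omega)
  refine (lintegral_mul_le_l2 ((measurable_cubeK p).comp (by fun_prop)).enorm.aemeasurable (hs.mul hgm.enorm).aemeasurable).trans
    (mul_le_mul' (le_of_eq ?_) (wl2_le_hNorm (fun v => (hν.pos v).le) V hbp))
  unfold l2
  congr 1
  exact lintegral_sub_left_eq_self (fun x => ‖cubeK p x‖ₑ ^ 2) v

/-! ### Representatives -/

lemma SobH.rep (hν : IsWt ν) (u : SobH n ν) : ∃ V : MIdx → E → ℝ, (∀ α, Measurable (V α)) ∧
    Sob n ν V ∧ ∀ α : MIdx, α.abs ≤ n → u.D α =ᵐ[volume] V α := by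
  classical
  obtain ⟨ψ, hψ, hl⟩ := u.approx
  set V : MIdx → E → ℝ := fun α => if h : α.abs ≤ n then (u.measurable α h).mk else 0 with hV
  have hm : ∀ α, Measurable (V α) := fun α => by
    simp only [hV]
    split_ifs with h
    · exact (u.measurable α h).stronglyMeasurable_mk.measurable
    · fun_prop
  have he : ∀ α : MIdx, α.abs ≤ n → u.D α =ᵐ[volume] V α := fun α h => by
    simp only [hV, h, dif_pos]
    exact (u.measurable α h).ae_eq_mk
  refine ⟨V, hm, ⟨fun α _ => hm α, ψ, hψ, fun α hα => ?_⟩, he⟩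
  refine tendsto_of_tendsto_of_tendsto_of_le_of_le tendsto_const_nhds hl (fun _ => zero_le) fun k => ?_
  refine le_trans (le_of_eq (wl2_congr ?_)) (wl2_le_hNorm (fun v => (hν.pos v).le) _ hα)
  filter_upwards [he α hα] with v hv
  rw [hv]

/-- The partial derivative in the velocity variables of a function of time and velocity. -/
def pdx (i : Fin 3) (ψ : ℝ × E → ℝ) (p : ℝ × E) : ℝ := fderiv ℝ ψ p ((0 : ℝ), basisVec i)

lemma contDiff_pdx {ψ : ℝ × E → ℝ} (hψ : ContDiff ℝ ∞ ψ) (i : Fin 3) : ContDiff ℝ ∞ (pdx i ψ) := by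
  have : ContDiff ℝ ∞ (fderiv ℝ ψ) := by fun_prop
  exact this.clm_apply contDiff_const

lemma pd_slice {ψ : ℝ × E → ℝ} (hψ : ContDiff ℝ ∞ ψ) (i : Fin 3) (t : ℝ) :
    pd i (fun w => ψ (t, w)) = fun w => pdx i ψ (t, w) := by
  funext w
  have h1 : HasFDerivAt (fun w : E => (t, w)) (ContinuousLinearMap.inr ℝ ℝ E) w := by fun_prop
  have h2 : HasFDerivAt (fun w => ψ (t, w)) ((fderiv ℝ ψ (t, w)).comp (ContinuousLinearMap.inr ℝ ℝ E)) w :=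
    (hψ.differentiable (by simp) (t, w)).hasFDerivAt.comp w h1
  rw [pd, h2.fderiv]
  rfl

lemma iterate_pdx {ψ : ℝ × E → ℝ} (hψ : ContDiff ℝ ∞ ψ) (hc : HasCompactSupport ψ) (i : Fin 3) (k : ℕ) :
    ContDiff ℝ ∞ ((pdx i)^[k] ψ) ∧ HasCompactSupport ((pdx i)^[k] ψ) ∧
    ∀ t, (pd i)^[k] (fun w => ψ (t, w)) = fun w => (pdx i)^[k] ψ (t, w) := by
  induction k with
  | zero => exact ⟨hψ, hc, fun t => rfl⟩
  | succ k ih =>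
    simp only [Function.iterate_succ_apply']
    refine ⟨contDiff_pdx ih.1 i, ih.2.1.fderiv_apply ℝ _, fun t => ?_⟩
    rw [ih.2.2, pd_slice ih.1]

/-- The velocity derivatives of a test function on space-time. -/
lemma exists_mderiv_slice {ψ : ℝ × E → ℝ} (hψ : ContDiff ℝ ∞ ψ) (hc : HasCompactSupport ψ) (α : MIdx) :
    ∃ Ψ : ℝ × E → ℝ, ContDiff ℝ ∞ Ψ ∧ HasCompactSupport Ψ ∧ ∀ t, mderiv α (fun w => ψ (t, w)) = fun w => Ψ (t, w) := by
  obtain ⟨a1, a2, a3⟩ := iterate_pdx hψ hc 2 (α 2)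
  obtain ⟨b1, b2, b3⟩ := iterate_pdx a1 a2 1 (α 1)
  obtain ⟨c1, c2, c3⟩ := iterate_pdx b1 b2 0 (α 0)
  exact ⟨_, c1, c2, fun t => by rw [mderiv, a3, b3, c3]⟩

lemma isTest_slice {ψ : ℝ × E → ℝ} (hψ : ContDiff ℝ ∞ ψ) (hc : HasCompactSupport ψ) (t : ℝ) :
    IsTest fun w => ψ (t, w) := by
  refine ⟨hψ.comp (by fun_prop), ?_⟩
  refine HasCompactSupport.of_support_subset_isCompact (hc.image continuous_snd) fun w hw => ?_
  exact ⟨(t, w), subset_tsupport _ hw, rfl⟩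

lemma vNorm_sq (n : ℕ) (A : ℝ) (ν : E → ℝ) (U : MIdx → ℝ → E → ℝ) :
    vNorm n A ν U ^ 2 = ∫⁻ t in Ioi (0 : ℝ), ofReal (exp (-A * t)) * hNorm n ν (fun α => U α t) ^ 2 :=
  rpow_half_sq _

lemma hNorm_congr {U : MIdx → E → ℝ} (h : ∀ α : MIdx, α.abs ≤ n → U α =ᵐ[volume] V α) :
    hNorm n ν U = hNorm n ν V := by
  unfold hNorm
  congr 1
  refine sum_congr rfl fun α hα => lintegral_congr_ae ?_
  filter_upwards [h α (mem_midxLE.1 hα)] with v hv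
  rw [hv]

lemma measurable_wl2 (hν : Continuous ν) {g : ℝ → E → ℝ} (hg : Measurable (uncurry g)) :
    Measurable fun t => wl2 ν (g t) :=
  measurable_l2_right (f := fun t v => ofReal (√(ν v)) * ‖g t v‖ₑ)
    (by fun_prop)

lemma SobV.rep (hν : IsWt ν) (u : SobV n A ν) :
    ∃ V : MIdx → ℝ → E → ℝ, (∀ α, Measurable (uncurry (V α))) ∧ (∀ t, Sob n ν fun α => V α t) ∧
      ∀ᵐ t ∂μ₊, ∀ α : MIdx, α.abs ≤ n → u.D α t =ᵐ[volume] V α t := by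
  classical
  obtain ⟨ψ, hψ, hl⟩ := u.approx
  set W : MIdx → ℝ × E → ℝ := fun α => if h : α.abs ≤ n then (u.measurable α h).mk else 0 with hW
  have hWm : ∀ α, Measurable (W α) := fun α => by
    simp only [hW]
    split_ifs with h
    · exact (u.measurable α h).stronglyMeasurable_mk.measurable
    · fun_prop
  have hWe : ∀ᵐ t ∂μ₊, ∀ α : MIdx, α.abs ≤ n → u.D α t =ᵐ[volume] fun v => W α (t, v) := by
    have h1 : ∀ α : MIdx, ∀ᵐ t ∂μ₊, α.abs ≤ n → u.D α t =ᵐ[volume] fun v => W α (t, v) := by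
      intro α
      by_cases h : α.abs ≤ n
      · have h2 : ∀ᵐ p ∂timeSpace, uncurry (u.D α) p = W α p := by
          simp only [hW, h, dif_pos]
          exact (u.measurable α h).ae_eq_mk
        filter_upwards [ae_ae_of_ae_prod h2] with t ht _ using ht
      · exact of_forall fun t h' => absurd h' h
    exact ae_all_iff.2 h1
  choose Ψ hΨ1 hΨ2 hΨ3 using fun (k : ℕ) (α : MIdx) => exists_mderiv_slice (hψ k).1 (hψ k).2 α
  set F : ℕ → ℝ → ℝ≥0∞ := fun k t => ofReal (exp (-A * t)) *
    hNorm n ν (fun α v => W α (t, v) - mderiv α (fun w => ψ k (t, w)) v) ^ 2 with hF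
  have hFm : ∀ k, Measurable (F k) := by
    intro k
    simp only [hF]
    simp_rw [hNorm_sq n (fun v => (hν.pos v).le)]
    refine Measurable.mul (by fun_prop) (Finset.measurable_sum _ fun α _ => Measurable.pow_const ?_ 2)
    refine measurable_wl2 hν.cont (g := fun t v => W α (t, v) - mderiv α (fun w => ψ k (t, w)) v) ?_
    simp_rw [hΨ3]
    exact (hWm α).sub (hΨ1 k α).continuous.measurable
  have hFl : Tendsto (fun k => ∫⁻ t in Ioi (0 : ℝ), F k t) atTop (𝓝 0) := by
    have h1 : ∀ k, ∫⁻ t in Ioi (0 : ℝ), F k t =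
        vNorm n A ν (fun α t v => u.D α t v - mderiv α (fun w => ψ k (t, w)) v) ^ 2 := by
      intro k
      rw [vNorm_sq]
      refine lintegral_congr_ae ?_
      filter_upwards [hWe] with t ht
      simp only [hF]
      congr 2
      refine hNorm_congr fun α hα => ?_
      filter_upwards [ht α hα] with v hv
      rw [hv]
    simp_rw [h1]
    have := ((continuous_pow 2).tendsto 0).comp hl
    simpa [Function.comp_def] using this
  obtain ⟨φ, hφ, hae⟩ := exists_subseq_ae_tendsto (fun k => (hFm k).aemeasurable) hFl
  set G : Set ℝ := {t | Tendsto (fun j => F (φ j) t) atTop (𝓝 0)} with hG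
  have hGm : MeasurableSet G := measurableSet_tendsto _ fun j => hFm (φ j)
  refine ⟨fun α t v => (G ×ˢ univ).indicator (W α) (t, v), fun α => (hWm α).indicator (hGm.prod MeasurableSet.univ), fun t => ?_, ?_⟩
  · by_cases ht : t ∈ G
    · refine ⟨fun α _ => ((hWm α).indicator (hGm.prod MeasurableSet.univ)).comp measurable_prodMk_left,
        fun j w => ψ (φ j) (t, w), fun j => isTest_slice (hψ _).1 (hψ _).2 t, fun α hα => ?_⟩
      have e : ∀ v, (G ×ˢ univ).indicator (W α) (t, v) = W α (t, v) := fun v => indicator_of_mem (by simp [ht]) _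
      simp_rw [e]
      have h1 : Tendsto (fun j => ofReal (exp (A * t)) * F (φ j) t) atTop (𝓝 0) := by
        simpa using ENNReal.Tendsto.const_mul ht (Or.inr (ofReal_ne_top (r := exp (A * t))))
      have h2 : Tendsto (fun j => (ofReal (exp (A * t)) * F (φ j) t) ^ (1 / 2 : ℝ)) atTop (𝓝 0) := by
        simpa using h1.ennrpow_const (1 / 2)
      refine tendsto_of_tendsto_of_tendsto_of_le_of_le tendsto_const_nhds h2 (fun _ => zero_le) fun j => ?_
      simp only [hF]
      rw [← mul_assoc, ← ofReal_mul (exp_pos _).le, ← exp_add]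
      simp only [neg_mul, add_neg_cancel, Real.exp_zero, ofReal_one, one_mul]
      rw [sq_rpow_half]
      exact wl2_le_hNorm (fun v => (hν.pos v).le) (fun α v => W α (t, v) - mderiv α (fun w => ψ (φ j) (t, w)) v) hα
    · have e : (fun α v => (G ×ˢ univ).indicator (W α) (t, v)) = fun (α : MIdx) (v : E) => (0 : ℝ) := by
        funext α v; exact indicator_of_notMem (by simp [ht]) _
      rw [e]
      have h0 : IsTest (fun _ : E => (0 : ℝ)) := ⟨contDiff_const, HasCompactSupport.zero⟩
      refine ⟨fun _ _ => measurable_const, fun _ _ => 0, fun _ => h0, fun α _ => ?_⟩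
      have h1 : mderiv α (fun _ : E => (0 : ℝ)) = fun _ => 0 := by
        refine mderiv_family (n := α.abs) (G := fun _ _ => (0 : ℝ)) (fun κ i _ => ?_) α le_rfl
        funext v; simp [pd]
      simp [h1, wl2, l2]
  · filter_upwards [hWe, hae] with t h1 h2 α hα
    filter_upwards [h1 α hα] with v hv
    rw [hv]
    exact (indicator_of_mem (show (t, v) ∈ G ×ˢ univ from ⟨h2, mem_univ _⟩) _).symm

/-! ### Absolute bounds for the trilinear forms -/

/-- A majorant of the weighted kernels. -/
def glR (τ : ℝ) (w : E) : ℝ :=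
  if τ ≤ 1 then τ ^ (-(3 / 4) : ℝ) * (1 + ‖w‖ ^ (-(5 / 4) : ℝ))
  else τ * ((τ * ‖w‖) ^ (-(5 / 4) : ℝ) * (1 + τ * ‖w‖) ^ (-3 : ℝ))

/-- The decay in `τ` of the majorant `glR`. -/
def glN (τ : ℝ) : ℝ≥0∞ :=
  if τ ≤ 1 then ofReal (τ ^ (-(3 / 4) : ℝ)) else ofReal (τ ^ (-2 : ℝ))

@[fun_prop]
lemma measurable_glN : Measurable glN := by
  unfold glN
  exact Measurable.ite measurableSet_Iic (by fun_prop) (by fun_prop)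

lemma measurable_glR : Measurable (uncurry glR) := by
  unfold glR uncurry
  exact Measurable.ite (measurableSet_le measurable_fst measurable_const) (by fun_prop) (by fun_prop)

lemma lintegral_glN_lt_top : ∫⁻ τ in Ioi (0 : ℝ), glN τ < ⊤ := by
  rw [← Ioc_union_Ioi_eq_Ioi zero_le_one]
  refine lt_of_le_of_lt (lintegral_union_le _ _ _) (add_lt_top.2 ⟨?_, ?_⟩)
  · have h1 : IntegrableOn (fun τ : ℝ => τ ^ (-(3 / 4) : ℝ)) (Ioc 0 1) := by
      rw [← intervalIntegrable_iff_integrableOn_Ioc_of_le zero_le_one]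
      exact intervalIntegral.intervalIntegrable_rpow' (by norm_num)
    refine lt_of_le_of_lt (le_of_eq ?_) h1.lintegral_lt_top
    refine setLIntegral_congr_fun measurableSet_Ioc fun τ hτ => ?_
    simp only [glN, if_pos hτ.2]
  · have h1 : IntegrableOn (fun τ : ℝ => τ ^ (-2 : ℝ)) (Ioi 1) :=
      integrableOn_Ioi_rpow_of_lt (by norm_num) one_pos
    refine lt_of_le_of_lt (le_of_eq ?_) h1.lintegral_lt_top
    refine setLIntegral_congr_fun measurableSet_Ioi fun τ hτ => ?_
    simp only [glN, if_neg (not_le.2 (mem_Ioi.1 hτ))]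

lemma lintegral_glR_of_one_lt : ∃ C : ℝ≥0∞, C ≠ ⊤ ∧ ∀ τ : ℝ, 1 < τ →
    ∫⁻ w, ofReal (glR τ w) ≤ C * glN τ := by
  refine ⟨_, (lintegral_radial_lt_top (p := 5 / 4) (q := 3) (by norm_num) (by norm_num) (by norm_num)).ne,
    fun τ hτ => ?_⟩
  have hτ0 : 0 < τ := by linarith
  have e : ∀ w : E, ofReal (glR τ w) = ofReal τ *
      ofReal (‖τ • w‖ ^ (-(5 / 4) : ℝ) * (1 + ‖τ • w‖) ^ (-3 : ℝ)) := by
    intro w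
    rw [← ofReal_mul hτ0.le, glR, if_neg (not_le.2 hτ), norm_smul, norm_of_nonneg hτ0.le]
  simp_rw [e]
  rw [lintegral_const_mul _ (by fun_prop), lintegral_comp_smul_E
    (fun w => ofReal (‖w‖ ^ (-(5 / 4) : ℝ) * (1 + ‖w‖) ^ (-3 : ℝ))) (by fun_prop) hτ0, ← mul_assoc,
    ← ofReal_mul hτ0.le, mul_comm, glN, if_neg (not_le.2 hτ)]
  refine mul_le_mul_right (ofReal_le_ofReal (le_of_eq ?_)) _
  rw [rpow_neg hτ0.le, Real.rpow_two]
  field_simp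

lemma lintegral_glR_mul_le : ∃ C : ℝ≥0∞, C ≠ ⊤ ∧ ∀ τ : ℝ, 0 < τ → τ ≤ 1 → ∀ h : E → ℝ≥0∞, Measurable h → ∀ v,
    ∫⁻ v', ofReal (glR τ (v - v')) * h v' ≤ C * glN τ * ((∫⁻ v', h v') + l2 volume h) := by
  set κ : E → ℝ≥0∞ := fun w => ofReal (‖w‖ ^ (-(5 / 4) : ℝ) * (1 + ‖w‖) ^ (-1 : ℝ)) with hκ
  have hκ2 : l2 volume κ < ⊤ := by
    refine rpow_lt_top_of_nonneg (by norm_num) (ne_of_lt ?_)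
    refine lt_of_le_of_lt (le_of_eq (lintegral_congr fun w => ?_))
      (lintegral_radial_lt_top (p := 5 / 2) (q := 2) (by norm_num) (by norm_num) (by norm_num))
    rw [hκ, ← ofReal_pow (by positivity), mul_pow, ← rpow_natCast, ← rpow_natCast,
      ← rpow_mul (by positivity), ← rpow_mul (by positivity)]
    norm_num
  have hp : ∀ x : ℝ, 0 < x → 1 + x ^ (-(5 / 4) : ℝ) ≤ 2 * (1 + x ^ (-(5 / 4) : ℝ) * (1 + x) ^ (-1 : ℝ)) := by
    intro x hx
    have h0 : 0 < x ^ (-(5 / 4) : ℝ) := by positivity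
    rw [Real.rpow_neg_one]
    rcases le_total x 1 with h | h
    · have : (1 / 2 : ℝ) ≤ (1 + x)⁻¹ := by
        rw [one_div]; exact inv_anti₀ (by positivity) (by linarith)
      nlinarith
    · have h1 : x ^ (-(5 / 4) : ℝ) ≤ 1 := rpow_le_one_of_one_le_of_nonpos h (by norm_num)
      have : 0 < (1 + x)⁻¹ := by positivity
      nlinarith [mul_pos h0 this]
  refine ⟨2 * (1 + l2 volume κ), mul_ne_top (by simp) (by simp [hκ2.ne]), fun τ hτ hτ1 h hh v => ?_⟩
  have hb : ∀ᵐ v', ofReal (glR τ (v - v')) * h v' ≤ glN τ * 2 * (h v' + κ (v - v') * h v') := by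
    have : ∀ᵐ v' : E, v - v' ≠ 0 := by
      filter_upwards [(volume.measurePreserving_sub_left v).quasiMeasurePreserving.ae ae_ne_zero] with v' h
      exact h
    filter_upwards [this] with v' hv'
    have h1 := hp ‖v - v'‖ (by positivity)
    have h2 : ofReal (glR τ (v - v')) ≤ glN τ * 2 * (1 + κ (v - v')) := by
      have e2 : glN τ * 2 * (1 + κ (v - v')) = glN τ * ofReal 2 * (1 + κ (v - v')) := by simp
      rw [e2, glR, if_pos hτ1, glN, if_pos hτ1, hκ, ← ofReal_one, mul_assoc]
      beta_reduce
      rw [← ofReal_add (by norm_num) (by positivity), ← ofReal_mul (by norm_num),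
        ← ofReal_mul (by positivity)]
      exact ofReal_le_ofReal (mul_le_mul_of_nonneg_left h1 (by positivity))
    calc _ ≤ glN τ * 2 * (1 + κ (v - v')) * h v' := by gcongr
      _ = _ := by ring
  have hκm : Measurable κ := by fun_prop
  refine (lintegral_mono_ae hb).trans ?_
  rw [lintegral_const_mul _ (by fun_prop), lintegral_add_left hh]
  have h3 : ∫⁻ v', κ (v - v') * h v' ≤ l2 volume κ * l2 volume h := by
    refine (lintegral_mul_le_l2 (by fun_prop) hh.aemeasurable).trans (mul_le_mul_left (le_of_eq ?_) _)
    unfold l2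
    congr 1
    exact lintegral_sub_left_eq_self (fun w => κ w ^ 2) v
  calc _ ≤ glN τ * 2 * ((∫⁻ v', h v') + l2 volume κ * l2 volume h) := by gcongr
    _ ≤ glN τ * 2 * ((1 + l2 volume κ) * (∫⁻ v', h v') + (1 + l2 volume κ) * l2 volume h) := by
      gcongr
      · exact le_mul_of_one_le_left' (by simp)
      · simp
    _ = _ := by ring

/-- Spatial estimate at fixed times. -/
lemma lintegral_glR_trilinear_le : ∃ C : ℝ≥0∞, C ≠ ⊤ ∧ ∀ τ : ℝ, 0 < τ → ∀ G H h : E → ℝ≥0∞, Measurable G →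
    Measurable H → Measurable h → ∀ B y : ℝ≥0∞, ∫⁻ v, h v ≤ B → l2 volume h ≤ B → l2 volume H ≤ y →
    ((∀ᵐ v, h v ≤ B) ∨ ∀ᵐ v, H v ≤ y) →
    ∫⁻ v, G v * (H v * ∫⁻ v', ofReal (glR τ (v - v')) * h v') ≤
      C * (glN τ * (l2 volume G * (B * y))) := by
  obtain ⟨C₁, hC₁, h₁⟩ := lintegral_glR_of_one_lt
  obtain ⟨C₂, hC₂, h₂⟩ := lintegral_glR_mul_le
  refine ⟨C₁ + 2 * C₂, by simp [hC₁, hC₂, ENNReal.mul_eq_top], fun τ hτ G H h hG hH hh B y hB1 hB2 hy hor => ?_⟩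
  have hgm : Measurable fun w => ofReal (glR τ w) :=
    (measurable_glR.comp (measurable_const.prodMk measurable_id)).ennreal_ofReal
  have hsub : Measurable fun v => ∫⁻ v', ofReal (glR τ (v - v')) * h v' := by
    refine Measurable.lintegral_prod_right' (f := fun p : E × E => ofReal (glR τ (p.1 - p.2)) * h p.2) ?_
    exact (hgm.comp (by fun_prop)).mul (by fun_prop)
  have hGH : ∫⁻ v, G v * H v ≤ l2 volume G * y :=
    (lintegral_mul_le_l2 hG.aemeasurable hH.aemeasurable).trans (by gcongr)
  have key : ∀ D : ℝ≥0∞, (∀ᵐ v, ∫⁻ v', ofReal (glR τ (v - v')) * h v' ≤ D) →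
      ∫⁻ v, G v * (H v * ∫⁻ v', ofReal (glR τ (v - v')) * h v') ≤ D * (l2 volume G * y) := by
    intro D hD
    calc _ ≤ ∫⁻ v, D * (G v * H v) := by
          refine lintegral_mono_ae ?_
          filter_upwards [hD] with v hv
          calc _ ≤ G v * (H v * D) := by gcongr
            _ = _ := by ring
      _ ≤ _ := by rw [lintegral_const_mul _ (by fun_prop)]; gcongr
  rcases le_or_gt τ 1 with h1 | h1
  · refine (key (C₂ * glN τ * (B + B)) (of_forall fun v => (h₂ τ hτ h1 h hh v).trans (by gcongr))).trans ?_
    calc _ = 2 * C₂ * (glN τ * (l2 volume G * (B * y))) := by ring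
      _ ≤ _ := by gcongr; exact le_add_self
  · have hN := h₁ τ h1
    rcases hor with hor | hor
    · refine (key (C₁ * glN τ * B) (of_forall fun v => ?_)).trans ?_
      · calc _ ≤ ∫⁻ v', ofReal (glR τ (v - v')) * B := by
              refine lintegral_mono_ae ?_
              filter_upwards [hor] with v' hv'
              gcongr
          _ = (∫⁻ v', ofReal (glR τ (v - v'))) * B :=
              lintegral_mul_const _ (hgm.comp (by fun_prop))
          _ ≤ _ := by rw [lintegral_sub_left_eq_self (fun w => ofReal (glR τ w))]; gcongr
      · calc _ = C₁ * (glN τ * (l2 volume G * (B * y))) := by ring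
          _ ≤ _ := by gcongr; exact le_self_add
    · calc _ ≤ ∫⁻ v, y * (G v * ∫⁻ v', ofReal (glR τ (v - v')) * h v') := by
            refine lintegral_mono_ae ?_
            filter_upwards [hor] with v hv
            calc _ ≤ G v * (y * _) := by gcongr
              _ = _ := by ring
        _ = y * ∫⁻ v, (G v * ∫⁻ v', ofReal (glR τ (v - v')) * h v') :=
            lintegral_const_mul _ (by fun_prop)
        _ ≤ y * ((∫⁻ w, ofReal (glR τ w)) * (l2 volume G * l2 volume h)) := by
            gcongr; exact lintegral_conv_le hgm hG hh
        _ ≤ y * ((C₁ * glN τ) * (l2 volume G * B)) := by gcongr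
        _ = C₁ * (glN τ * (l2 volume G * (B * y))) := by ring
        _ ≤ _ := by gcongr; exact le_self_add

/-- The absolute trilinear bound. -/
lemma lintegral_form_le : ∃ C : ℝ≥0∞, C ≠ ⊤ ∧ ∀ ε : ℝ, 0 < ε → ∀ G H h : ℝ → E → ℝ≥0∞,
    Measurable (uncurry G) → (∀ s, Measurable (H s)) → (∀ s, Measurable (h s)) →
    ∀ (B : ℝ≥0∞) (y : ℝ → ℝ≥0∞), Measurable y →
    (∀ᵐ s ∂μ₊, ∫⁻ v, h s v ≤ B ∧ l2 volume (h s) ≤ B ∧ l2 volume (H s) ≤ y s ∧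
      ((∀ᵐ v, h s v ≤ B) ∨ ∀ᵐ v, H s v ≤ y s)) →
    ∀ J : ℝ → ℝ → E → ℝ≥0∞, (∀ t s v, 0 < s → s < t →
      J t s v ≤ ofReal ε⁻¹ * (G t v * (H s v * ∫⁻ v', ofReal (glR ((t - s) / ε) (v - v')) * h s v'))) →
    ∫⁻ t in Ioi (0 : ℝ), ∫⁻ s in Ioo 0 t, ∫⁻ v, J t s v ≤
      C * (B * (l2 (timeSpace) (uncurry G) * l2 μ₊ y)) := by
  obtain ⟨C, hC, hb⟩ := lintegral_glR_trilinear_le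
  refine ⟨C * ∫⁻ τ in Ioi (0 : ℝ), glN τ, mul_ne_top hC lintegral_glN_lt_top.ne,
    fun ε hε G H h hG hH hh B y hy hae J hJ => ?_⟩
  have hGt : ∀ t, Measurable (G t) := fun t => hG.comp measurable_prodMk_left
  have hn : Measurable fun τ => C * B * glN τ := measurable_glN.const_mul _
  have hw : Measurable fun t => l2 volume (G t) := measurable_l2_right hG
  have h1 := young_time hε hn hw hy
  rw [l2_prod (by fun_prop)] at h1
  refine le_trans ?_ (h1.trans (le_of_eq ?_))
  · refine lintegral_mono fun t => ?_
    have hae' : ∀ᵐ s ∂(volume.restrict (Ioo 0 t)), _ := ae_restrict_of_ae_restrict_of_subset Ioo_subset_Ioi_self hae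
    refine lintegral_mono_ae ?_
    filter_upwards [hae', ae_restrict_mem measurableSet_Ioo] with s hs hst
    obtain ⟨a1, a2, a3, a4⟩ := hs
    have hτ : 0 < (t - s) / ε := div_pos (by linarith [hst.2]) hε
    have hgm : Measurable fun w => ofReal (glR ((t - s) / ε) w) :=
      (measurable_glR.comp (measurable_const.prodMk measurable_id)).ennreal_ofReal
    calc ∫⁻ v, J t s v ≤ ∫⁻ v, ofReal ε⁻¹ * (G t v * (H s v *
            ∫⁻ v', ofReal (glR ((t - s) / ε) (v - v')) * h s v')) :=
          lintegral_mono fun v => hJ t s v hst.1 hst.2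
      _ = ofReal ε⁻¹ * ∫⁻ v, (G t v * (H s v *
            ∫⁻ v', ofReal (glR ((t - s) / ε) (v - v')) * h s v')) := by
          rw [lintegral_const_mul' _ _ ofReal_ne_top]
      _ ≤ _ := by
          gcongr
          refine (hb _ hτ (G t) (H s) (h s) (hGt t) (hH s) (hh s) B (y s) a1 a2 a3 a4).trans (le_of_eq ?_)
          ring
  · rw [lintegral_const_mul _ measurable_glN, timeSpace]
    ring

lemma one_add_sqrt_le {x : ℝ} (hx : 0 ≤ x) : (1 + x) * √(1 + x) ≤ 4 * (1 + x ^ (7 / 4 : ℝ)) := by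
  have h1 : (1 + x) * √(1 + x) ≤ (1 + x) ^ (7 / 4 : ℝ) := by
    rw [sqrt_eq_rpow, ← rpow_one_add' (by positivity) (by norm_num)]
    exact Real.rpow_le_rpow_of_exponent_le (by linarith) (by norm_num)
  refine h1.trans ?_
  have h2 : (2 : ℝ) ^ (7 / 4 : ℝ) ≤ 4 := by
    calc (2 : ℝ) ^ (7 / 4 : ℝ) ≤ 2 ^ (2 : ℝ) := Real.rpow_le_rpow_of_exponent_le (by norm_num) (by norm_num)
      _ = 4 := by norm_num
  rcases le_total x 1 with h | h
  · calc (1 + x) ^ (7 / 4 : ℝ) ≤ 2 ^ (7 / 4 : ℝ) := Real.rpow_le_rpow (by positivity) (by linarith) (by norm_num)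
      _ ≤ 4 := h2
      _ ≤ _ := by have : 0 ≤ x ^ (7 / 4 : ℝ) := by positivity
                  linarith
  · calc (1 + x) ^ (7 / 4 : ℝ) ≤ (2 * x) ^ (7 / 4 : ℝ) := Real.rpow_le_rpow (by positivity) (by linarith) (by norm_num)
      _ = 2 ^ (7 / 4 : ℝ) * x ^ (7 / 4 : ℝ) := mul_rpow (by norm_num) hx
      _ ≤ 4 * x ^ (7 / 4 : ℝ) := by gcongr
      _ ≤ _ := by simp

lemma mixProfile_le (r : ℝ) (hr : 0 < r) (ha : a = 1 ∨ a = 2) :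
    mixProfile a r ≤ r ^ (-(5 / 4) : ℝ) * (1 + r) ^ (-5 : ℝ) := by
  have e : (1 + r) ^ (-5 : ℝ) = ((1 + r) ^ 5)⁻¹ := by
    rw [rpow_neg (by positivity), ← rpow_natCast]; norm_num
  have h0 : 0 < r ^ (-(5 / 4) : ℝ) := by positivity
  rw [e, mixProfile, pow_succ _ 5, mul_inv, ← mul_assoc]
  rcases ha with rfl | rfl
  · have : r ^ (-(((1 : ℕ) : ℝ) - 3 / 4)) = r ^ (-(5 / 4) : ℝ) * r := by
      rw [← rpow_add_one hr.ne']; norm_num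
    rw [this]
    have h2 : r * (1 + r)⁻¹ ≤ 1 := by rw [← div_eq_mul_inv, div_le_one (by positivity)]; linarith
    calc _ = r ^ (-(5 / 4) : ℝ) * ((1 + r) ^ 5)⁻¹ * (r * (1 + r)⁻¹) := by ring
      _ ≤ _ := mul_le_of_le_one_right (by positivity) h2
  · have : r ^ (-(((2 : ℕ) : ℝ) - 3 / 4)) = r ^ (-(5 / 4) : ℝ) := by norm_num
    rw [this]
    exact mul_le_of_le_one_right (by positivity) (inv_le_one_of_one_le₀ (by linarith))

lemma weight_mul_le_glR (hτ : 0 < τ) (hw : w ≠ 0) :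
    (1 + ‖w‖) * √(1 + ‖w‖) * (τ * ((τ * ‖w‖) ^ (-(5 / 4) : ℝ) * (1 + τ * ‖w‖) ^ (-5 : ℝ))) ≤ 8 * glR τ w := by
  have hx : 0 < ‖w‖ := by positivity
  set x := ‖w‖
  have hr : 0 < τ * x := by positivity
  set r := τ * x with hrdef
  have h5 : (1 + r) ^ (-5 : ℝ) ≤ 1 := rpow_le_one_of_one_le_of_nonpos (by linarith) (by norm_num)
  rw [glR]
  split_ifs with h1
  · have e1 : τ * r ^ (-(5 / 4) : ℝ) = τ ^ (-(1 / 4) : ℝ) * x ^ (-(5 / 4) : ℝ) := by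
      rw [hrdef, mul_rpow hτ.le hx.le, ← mul_assoc, ← rpow_one_add' hτ.le (by norm_num)]; norm_num
    have e2 : x ^ (7 / 4 : ℝ) * (τ * r ^ (-(5 / 4) : ℝ)) = τ ^ (-(3 / 4) : ℝ) * r ^ (1 / 2 : ℝ) := by
      rw [e1, hrdef, mul_rpow hτ.le hx.le,
        show x ^ (7 / 4 : ℝ) * (τ ^ (-(1 / 4) : ℝ) * x ^ (-(5 / 4) : ℝ)) =
          τ ^ (-(1 / 4) : ℝ) * (x ^ (7 / 4 : ℝ) * x ^ (-(5 / 4) : ℝ)) by ring, ← rpow_add hx, ← mul_assoc,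
        ← rpow_add hτ]; norm_num
    have e3 : τ ^ (-(1 / 4) : ℝ) ≤ τ ^ (-(3 / 4) : ℝ) :=
      Real.rpow_le_rpow_of_exponent_ge hτ h1 (by norm_num)
    have e4 : r ^ (1 / 2 : ℝ) * (1 + r) ^ (-5 : ℝ) ≤ 1 := by
      calc r ^ (1 / 2 : ℝ) * (1 + r) ^ (-5 : ℝ) ≤ (1 + r) ^ (1 / 2 : ℝ) * (1 + r) ^ (-5 : ℝ) := by
            gcongr; linarith
        _ = (1 + r) ^ (1 / 2 + -5 : ℝ) := by rw [← rpow_add (by positivity)]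
        _ ≤ 1 := rpow_le_one_of_one_le_of_nonpos (by linarith) (by norm_num)
    calc _ ≤ 4 * (1 + x ^ (7 / 4 : ℝ)) * (τ * (r ^ (-(5 / 4) : ℝ) * (1 + r) ^ (-5 : ℝ))) :=
          mul_le_mul_of_nonneg_right (one_add_sqrt_le hx.le) (by positivity)
      _ = 4 * ((τ * r ^ (-(5 / 4) : ℝ)) * (1 + r) ^ (-5 : ℝ) +
          (x ^ (7 / 4 : ℝ) * (τ * r ^ (-(5 / 4) : ℝ))) * (1 + r) ^ (-5 : ℝ)) := by ring
      _ = 4 * (τ ^ (-(1 / 4) : ℝ) * x ^ (-(5 / 4) : ℝ) * (1 + r) ^ (-5 : ℝ) +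
          τ ^ (-(3 / 4) : ℝ) * (r ^ (1 / 2 : ℝ) * (1 + r) ^ (-5 : ℝ))) := by rw [e2, e1]; ring
      _ ≤ 4 * (τ ^ (-(3 / 4) : ℝ) * x ^ (-(5 / 4) : ℝ) * 1 + τ ^ (-(3 / 4) : ℝ) * 1) := by
          have hx0 : 0 < x ^ (-(5 / 4) : ℝ) := by positivity
          have hτ0 : 0 < τ ^ (-(3 / 4) : ℝ) := by positivity
          exact mul_le_mul_of_nonneg_left (add_le_add (mul_le_mul (mul_le_mul_of_nonneg_right e3 hx0.le) h5
            (by positivity) (by positivity)) (mul_le_mul_of_nonneg_left e4 hτ0.le)) (by norm_num)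
      _ ≤ _ := by
          have : 0 < τ ^ (-(3 / 4) : ℝ) * (1 + x ^ (-(5 / 4) : ℝ)) := by positivity
          linarith
  · have hxr : x ≤ r := by rw [hrdef]; nlinarith
    have h2 : (1 + x) * √(1 + x) ≤ (1 + r) ^ (2 : ℝ) := by
      have : √(1 + x) ≤ 1 + x := by
        rw [sqrt_le_left (by positivity)]; nlinarith
      calc (1 + x) * √(1 + x) ≤ (1 + x) * (1 + x) := by gcongr
        _ ≤ (1 + r) * (1 + r) := by gcongr
        _ = _ := by rw [Real.rpow_two]; ring
    calc _ ≤ (1 + r) ^ (2 : ℝ) * (τ * (r ^ (-(5 / 4) : ℝ) * (1 + r) ^ (-5 : ℝ))) :=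
          mul_le_mul_of_nonneg_right h2 (by positivity)
      _ = τ * (r ^ (-(5 / 4) : ℝ) * ((1 + r) ^ (2 : ℝ) * (1 + r) ^ (-5 : ℝ))) := by ring
      _ = τ * (r ^ (-(5 / 4) : ℝ) * (1 + r) ^ (-3 : ℝ)) := by
          rw [← rpow_add (by positivity)]; norm_num
      _ ≤ _ := by
          have : 0 < τ * (r ^ (-(5 / 4) : ℝ) * (1 + r) ^ (-3 : ℝ)) := by positivity
          linarith

lemma norm_weight_mul_le_glR (hτ : 0 < τ) (hw : w ≠ 0) :
    ‖w‖ * (1 + ‖w‖) * (τ ^ 2 * mixProfile 2 (τ * ‖w‖)) ≤ 2 * glR τ w := by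
  have hx : 0 < ‖w‖ := norm_pos_iff.2 hw
  set x := ‖w‖
  have hr : 0 < τ * x := by positivity
  set r := τ * x with hrdef
  have em : mixProfile 2 r = r ^ (-(5 / 4) : ℝ) * (1 + r) ^ (-6 : ℝ) := by
    rw [mixProfile, rpow_neg (by positivity : 0 ≤ 1 + r), ← rpow_natCast]; norm_num
  have e0 : x * (τ ^ 2 * mixProfile 2 r) = τ * (r ^ (-(1 / 4) : ℝ) * (1 + r) ^ (-6 : ℝ)) := by
    have : r ^ (-(1 / 4) : ℝ) = r ^ (-(5 / 4) : ℝ) * r := by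
      rw [← rpow_add_one hr.ne']; norm_num
    rw [em, this, hrdef]; ring
  have h6 : (1 + r) ^ (-6 : ℝ) ≤ 1 := rpow_le_one_of_one_le_of_nonpos (by linarith) (by norm_num)
  rw [show x * (1 + x) * (τ ^ 2 * mixProfile 2 r) = (1 + x) * (x * (τ ^ 2 * mixProfile 2 r)) by ring, e0, glR]
  split_ifs with h1
  · have hA : 1 ≤ τ ^ (-(3 / 4) : ℝ) := Real.one_le_rpow_of_pos_of_le_one_of_nonpos hτ h1 (by norm_num)
    have e1 : τ * r ^ (-(1 / 4) : ℝ) = τ ^ (3 / 4 : ℝ) * x ^ (-(1 / 4) : ℝ) := by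
      rw [hrdef, mul_rpow hτ.le hx.le, ← mul_assoc, ← rpow_one_add' hτ.le (by norm_num)]; norm_num
    have e2 : x * (τ * r ^ (-(1 / 4) : ℝ)) = r ^ (3 / 4 : ℝ) := by
      have : r ^ (3 / 4 : ℝ) = r ^ (-(1 / 4) : ℝ) * r := by rw [← rpow_add_one hr.ne']; norm_num
      rw [this, hrdef]; ring
    have e3 : τ ^ (3 / 4 : ℝ) ≤ 1 := Real.rpow_le_one hτ.le h1 (by norm_num)
    have e4 : x ^ (-(1 / 4) : ℝ) ≤ 1 + x ^ (-(5 / 4) : ℝ) := by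
      rcases le_total x 1 with h | h
      · have := Real.rpow_le_rpow_of_exponent_ge hx h (show (-(5 / 4) : ℝ) ≤ -(1 / 4) by norm_num)
        linarith
      · have := rpow_le_one_of_one_le_of_nonpos h (show (-(1 / 4) : ℝ) ≤ 0 by norm_num)
        have : 0 < x ^ (-(5 / 4) : ℝ) := by positivity
        linarith
    have e5 : r ^ (3 / 4 : ℝ) * (1 + r) ^ (-6 : ℝ) ≤ 1 := by
      calc r ^ (3 / 4 : ℝ) * (1 + r) ^ (-6 : ℝ) ≤ (1 + r) ^ (3 / 4 : ℝ) * (1 + r) ^ (-6 : ℝ) := by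
            gcongr; linarith
        _ = (1 + r) ^ (3 / 4 + -6 : ℝ) := by rw [← rpow_add (by positivity)]
        _ ≤ 1 := rpow_le_one_of_one_le_of_nonpos (by linarith) (by norm_num)
    have h0 : 0 < x ^ (-(5 / 4) : ℝ) := by positivity
    calc _ = (τ * r ^ (-(1 / 4) : ℝ)) * (1 + r) ^ (-6 : ℝ) + (x * (τ * r ^ (-(1 / 4) : ℝ))) * (1 + r) ^ (-6 : ℝ) := by ring
      _ ≤ 1 * (1 + x ^ (-(5 / 4) : ℝ)) * 1 + 1 := by
          rw [e2, e1]
          exact add_le_add (mul_le_mul (mul_le_mul e3 e4 (by positivity) (by norm_num)) h6 (by positivity)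
            (by positivity)) e5
      _ ≤ 2 * (1 * (1 + x ^ (-(5 / 4) : ℝ))) := by linarith
      _ ≤ _ := by gcongr
  · have hxr : x ≤ r := by rw [hrdef]; nlinarith
    have h4 : r ^ (-(1 / 4) : ℝ) = r ^ (-(5 / 4) : ℝ) * r := by
      rw [← rpow_add_one hr.ne']; norm_num
    have h5 : (1 + r) ^ (-4 : ℝ) ≤ (1 + r) ^ (-3 : ℝ) :=
      Real.rpow_le_rpow_of_exponent_le (by linarith) (by norm_num)
    have h7 : (1 + r) ^ (-4 : ℝ) = (1 + r) * (1 + r) * (1 + r) ^ (-6 : ℝ) := by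
      rw [← sq, ← rpow_natCast, ← rpow_add (by positivity)]; norm_num
    have h0 : 0 < r ^ (-(5 / 4) : ℝ) := by positivity
    have h8 : 0 < (1 + r) ^ (-6 : ℝ) := by positivity
    calc _ = τ * (r ^ (-(5 / 4) : ℝ) * ((1 + x) * r * (1 + r) ^ (-6 : ℝ))) := by rw [h4]; ring
      _ ≤ τ * (r ^ (-(5 / 4) : ℝ) * ((1 + r) * (1 + r) * (1 + r) ^ (-6 : ℝ))) := by
          gcongr; linarith
      _ ≤ τ * (r ^ (-(5 / 4) : ℝ) * (1 + r) ^ (-3 : ℝ)) := by rw [← h7]; gcongr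
      _ ≤ _ := by
          have : 0 < τ * (r ^ (-(5 / 4) : ℝ) * (1 + r) ^ (-3 : ℝ)) := by positivity
          linarith

/-! ### The bound that uses the cancellation of the kernel in Fourier space -/

/-- Square integrable and integrable functions. -/
def L12 (h : E → ℝ) : Prop := Integrable h ∧ l2 volume (fun v => ‖h v‖ₑ) < ⊤

lemma lintegral_conv_le_l2 {k g : E → ℝ≥0∞} (hk : Measurable k) (hg : Measurable g) (v : E) :
    ∫⁻ v', k (v - v') * g v' ≤ l2 volume k * l2 volume g :=
  (lintegral_mul_le_l2 (hk.comp (by fun_prop)).aemeasurable hg.aemeasurable).trans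
    (mul_le_mul' (congrArg (· ^ (1 / 2 : ℝ)) (lintegral_sub_left_eq_self (fun w => k w ^ 2) v)).le le_rfl)

lemma enorm_pairing_mixK_le (hm : IsMix m) (S : 𝓢(E, ℝ)) (hτ : 0 < τ) {Z h : E → ℝ}
    (hZm : Measurable Z) (hZ : Integrable Z) (hhm : Measurable h) (hh : L12 h) :
    ‖∫ v, Z v * cv (mixK m S 2 τ) h v‖ₑ ≤ ∫⁻ ξ, symb m S τ ξ * (‖fourierR Z ξ‖ₑ * ‖fourierR h ξ‖ₑ) := by
  have := hm.finite
  have hhi : Integrable h := hh.1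
  set F : E → ℝ → ℝ := fun v b => ∫ v', (b * τ) ^ 2 * S ((b * τ) • (v - v')) * h v' with hF
  have hSm : Measurable fun p : (E × ℝ) × E => (p.1.2 * τ) ^ 2 * S ((p.1.2 * τ) • (p.1.1 - p.2)) * h p.2 := by fun_prop
  have hFm : StronglyMeasurable (uncurry F) := hSm.stronglyMeasurable.integral_prod_right
  have hK2 := l2_mixAbs_lt_top hm S (a := 2) le_rfl (by norm_num) hτ
  have hbd : ∀ v, ∫⁻ b, ‖F v b‖ₑ ∂m ≤ l2 volume (mixAbs m S 2 τ) * l2 volume fun v => ‖h v‖ₑ := by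
    intro v
    calc ∫⁻ b, ‖F v b‖ₑ ∂m ≤ ∫⁻ b, (∫⁻ v', ‖(b * τ) ^ 2 * S ((b * τ) • (v - v'))‖ₑ * ‖h v'‖ₑ) ∂m := by
          refine lintegral_mono fun b => (enorm_integral_le_lintegral_enorm _).trans (le_of_eq ?_)
          simp_rw [enorm_mul]
      _ = ∫⁻ v', (∫⁻ b, ‖(b * τ) ^ 2 * S ((b * τ) • (v - v'))‖ₑ * ‖h v'‖ₑ ∂m) := by
          refine lintegral_lintegral_swap ?_
          have := S.continuous
          have h1 : Measurable fun q : ℝ × E => ‖(q.1 * τ) ^ 2 * S ((q.1 * τ) • (v - q.2))‖ₑ := by fun_prop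
          fun_prop
      _ = ∫⁻ v', mixAbs m S 2 τ (v - v') * ‖h v'‖ₑ := by
          refine lintegral_congr fun v' => ?_
          rw [lintegral_mul_const' _ _ (by simp)]; rfl
      _ ≤ _ := lintegral_conv_le_l2 (by fun_prop) hhm.enorm v
  have hint : Integrable (uncurry fun v b => Z v * F v b) ((volume : Measure E).prod m) := by
    refine ⟨((hZm.comp measurable_fst).mul hFm.measurable).aestronglyMeasurable, ?_⟩
    have e0 := lintegral_prod (μ := (volume : Measure E)) (ν := m) (fun p : E × ℝ => ‖Z p.1 * F p.1 p.2‖ₑ)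
      ((hZm.comp measurable_fst).mul hFm.measurable).enorm.aemeasurable
    refine lt_of_le_of_lt (le_of_eq e0) ?_
    calc _ ≤ ∫⁻ v, ‖Z v‖ₑ * (l2 volume (mixAbs m S 2 τ) * l2 volume fun v => ‖h v‖ₑ) := by
          refine lintegral_mono fun v => ?_
          simp_rw [enorm_mul]
          rw [lintegral_const_mul' _ _ (by simp)]
          gcongr
          exact hbd v
      _ < ⊤ := by
          rw [lintegral_mul_const _ hZm.enorm]
          exact mul_lt_top hZ.2 (mul_lt_top hK2 hh.2)
  have e1 : ∫ v, Z v * cv (mixK m S 2 τ) h v = ∫ b, (∫ v, Z v * F v b) ∂m := by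
    rw [← integral_integral_swap hint]
    refine integral_congr_ae (of_forall fun v => ?_)
    beta_reduce
    rw [cv_mixK_eq hm S hhm.aemeasurable v ((lintegral_conv_le_l2 (by fun_prop) hhm.enorm v).trans_lt
      (mul_lt_top hK2 hh.2)), integral_const_mul]
  rw [e1]
  calc _ ≤ ∫⁻ b, ‖∫ v, Z v * F v b‖ₑ ∂m := enorm_integral_le_lintegral_enorm _
    _ ≤ ∫⁻ b, (∫⁻ ξ, ofReal ((b * τ)⁻¹) * ‖(𝓕 (toC S)) ((b * τ)⁻¹ • ξ)‖ₑ *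
        (‖fourierR Z ξ‖ₑ * ‖fourierR h ξ‖ₑ)) ∂m := by
        refine lintegral_mono_ae ?_
        filter_upwards [hm.pos] with b hb
        have hbt : 0 < b * τ := by simp_all
        have e2 : ∫ v, Z v * F v b = (b * τ) ^ 2 * ∫ v, Z v * ∫ v', S ((b * τ) • (v - v')) * h v' := by
          rw [← integral_const_mul]
          refine integral_congr_ae (of_forall fun v => ?_)
          simp only [hF]
          simp_rw [mul_assoc, integral_const_mul]
          ring
        rw [e2, enorm_mul]
        refine (mul_le_mul_right (enorm_pairing_schwartz_le S hbt hZ hhi) _).trans (le_of_eq ?_)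
        simp_rw [mul_assoc]
        rw [lintegral_const_mul' _ _ ofReal_ne_top, ← mul_assoc]
        congr 1
        rw [enorm_eq_ofReal (by positivity), ← ofReal_mul (by positivity)]
        congr 1
        field_simp
    _ = ∫⁻ ξ, (∫⁻ b, ofReal ((b * τ)⁻¹) * ‖(𝓕 (toC S)) ((b * τ)⁻¹ • ξ)‖ₑ *
        (‖fourierR Z ξ‖ₑ * ‖fourierR h ξ‖ₑ) ∂m) := by
        refine lintegral_lintegral_swap ?_
        have h1 : Measurable fun p : ℝ × E => ofReal ((p.1 * τ)⁻¹) * ‖(𝓕 (toC S)) ((p.1 * τ)⁻¹ • p.2)‖ₑ :=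
          (measurable_symb_integrand S).comp
            (((measurable_const (a := τ)).prodMk measurable_snd).prodMk measurable_fst)
        have h2 : ∀ f : E → ℝ, Integrable f → Continuous (fourierR f) := fun f hf => by
          unfold fourierR
          exact VectorFourier.fourierIntegral_continuous Real.continuous_fourierChar
            (by exact continuous_inner) hf.ofReal
        refine (h1.mul (Measurable.mul ?_ ?_)).aemeasurable
        · exact ((h2 Z hZ).measurable.comp measurable_snd).enorm
        · exact ((h2 h hhi).measurable.comp measurable_snd).enorm
    _ = _ := by
        refine lintegral_congr fun ξ => ?_
        rw [lintegral_mul_const' _ _ (mul_ne_top (by simp) (by simp))]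
        rw [symb]

lemma l2_swap {X Y : Type*} [MeasurableSpace X] [MeasurableSpace Y] {μ : Measure X} {ν : Measure Y} [SFinite μ] [SFinite ν]
    {f : X → Y → ℝ≥0∞} (hf : Measurable (uncurry f)) : l2 μ (fun x => l2 ν (f x)) = l2 ν fun y => l2 μ fun x => f x y := by
  rw [l2, l2]
  simp_rw [l2_sq]
  rw [lintegral_lintegral_swap (by fun_prop)]

lemma young_time_param {P : Type*} [MeasurableSpace P] (π : Measure P) [SFinite π] {n w u : ℝ → P → ℝ≥0∞}
    (hn : Measurable (uncurry n)) (hw : Measurable (uncurry w))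
    (hu : Measurable (uncurry u)) (hC : ∀ p, ∫⁻ τ in Ioi (0 : ℝ), n τ p ≤ C) (hε : 0 < ε) :
    ∫⁻ t in Ioi (0 : ℝ), ∫⁻ s in Ioo 0 t, ofReal ε⁻¹ * ∫⁻ p, n ((t - s) / ε) p * (w t p * u s p) ∂π ≤
      C * (l2 μ₊ (fun t => l2 π (w t)) * l2 μ₊ fun s => l2 π (u s)) := by
  have hF : Measurable fun q : (ℝ × ℝ) × P => ofReal ε⁻¹ * (n ((q.1.1 - q.1.2) / ε) q.2 * (w q.1.1 q.2 * u q.1.2 q.2)) := by fun_prop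
  have hFi : Measurable fun q : (ℝ × P) × ℝ => (Ioo 0 q.1.1).indicator
      (fun s => ofReal ε⁻¹ * (n ((q.1.1 - s) / ε) q.1.2 * (w q.1.1 q.1.2 * u s q.1.2))) q.2 := by
    have hs : MeasurableSet {q : (ℝ × P) × ℝ | q.2 ∈ Ioo 0 q.1.1} :=
      (measurableSet_lt measurable_const measurable_snd).inter (measurableSet_lt measurable_snd (by fun_prop))
    exact (hF.comp (((measurable_fst.comp measurable_fst).prodMk measurable_snd).prodMk
      (by fun_prop))).indicator hs
  calc _ = ∫⁻ t in Ioi (0 : ℝ), (∫⁻ p, (∫⁻ s in Ioo 0 t, ofReal ε⁻¹ * (n ((t - s) / ε) p * (w t p * u s p))) ∂π) := by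
        refine lintegral_congr fun t => ?_
        rw [← lintegral_lintegral_swap
          (f := fun s p => ofReal ε⁻¹ * (n ((t - s) / ε) p * (w t p * u s p)))]
        · refine lintegral_congr fun s => ?_
          rw [lintegral_const_mul' _ _ ofReal_ne_top]
        · fun_prop
    _ = ∫⁻ p, (∫⁻ t in Ioi (0 : ℝ), ∫⁻ s in Ioo 0 t, ofReal ε⁻¹ * (n ((t - s) / ε) p * (w t p * u s p))) ∂π := by
        refine lintegral_lintegral_swap ?_
        have := hFi.lintegral_prod_right' (ν := volume)
        simp_rw [lintegral_indicator measurableSet_Ioo] at this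
        exact this.aemeasurable
    _ ≤ ∫⁻ p, C * (l2 μ₊ (fun t => w t p) * l2 μ₊ fun s => u s p) ∂π := by
        refine lintegral_mono fun p => (young_time hε (n := fun τ => n τ p) (w := fun t => w t p)
          (u := fun s => u s p) ?_ ?_ ?_).trans (by gcongr; exact hC p)
        · fun_prop
        · fun_prop
        · fun_prop
    _ ≤ C * (l2 π (fun p => l2 μ₊ fun t => w t p) *
          l2 π fun p => l2 μ₊ fun s => u s p) := by
        have m1 := measurable_l2_right (ν := μ₊) (f := fun p t => w t p) (by fun_prop)
        have m2 := measurable_l2_right (ν := μ₊) (f := fun p t => u t p) (by fun_prop)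
        rw [lintegral_const_mul _ (by fun_prop)]
        gcongr
        exact lintegral_mul_le_l2 m1.aemeasurable m2.aemeasurable
    _ = _ := by rw [l2_swap (f := w) (by fun_prop), l2_swap (f := u) (by fun_prop)]

lemma enorm_ofReal_complex (x : ℝ) : ‖(x : ℂ)‖ₑ = ‖x‖ₑ := by
  rw [← ofReal_norm, ← ofReal_norm, norm_real]

lemma plancherel_real (hm : Measurable f) (h : L12 f) :
    l2 volume (fun ξ => ‖fourierR f ξ‖ₑ) = l2 volume fun v => ‖f v‖ₑ := by
  have h2 : MemLp (fun v => (f v : ℂ)) 2 volume := by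
    refine ⟨(Complex.measurable_ofReal.comp hm).aestronglyMeasurable, ?_⟩
    rw [eLpNorm_eq_lintegral_rpow_enorm_toReal (by norm_num) (by norm_num)]
    simpa [l2, enorm_ofReal_complex] using h.2
  simpa [l2, fourierR, enorm_ofReal_complex] using congrArg (· ^ (1 / 2 : ℝ)) (plancherel h.1.ofReal h2)

/-- The function `v ↦ Y(v) c(v - x)` of the cube formula, with a weight. -/
def cubeCut (p : ℕ × ℕ × ℕ) (Y : E → ℝ) (x v : E) : ℝ := √(lam v) / √(lam x) * (cubeK p (v - x) * Y v)

section Cubes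

variable (p : ℕ × ℕ × ℕ) {Y : E → ℝ} (hY : Measurable Y)

lemma enorm_cubeCut_le (Y : E → ℝ) (x v : E) : ‖cubeCut p Y x v‖ₑ ≤ ofReal (exp 1) * (‖cubeK p (v - x)‖ₑ * ‖Y v‖ₑ) := by
  rcases lt_or_ge 2 ‖v - x‖ with h | h
  · simp [cubeCut, cubeK_eq_zero p h]
  · have := lam_pos x
    rw [cubeCut, enorm_mul, enorm_mul, enorm_of_nonneg (by positivity)]
    gcongr
    rw [div_le_iff₀ (sqrt_pos.2 this), sqrt_le_left (by positivity), mul_pow, sq_sqrt this.le, ← exp_nat_mul]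
    simpa using lam_shift h

include hY

lemma measurable_cubeCut (x : E) : Measurable (cubeCut p Y x) := by unfold cubeCut; fun_prop

lemma l2_cubeCut : l2 volume (fun x => l2 volume fun v => ‖cubeCut p Y x v‖ₑ) ≤
    ofReal (exp 1) * l2 volume (fun x => ‖cubeK p x‖ₑ) * l2 volume fun v => ‖Y v‖ₑ := by
  have h : ∀ v, l2 volume (fun x => ‖cubeK p (v - x)‖ₑ) = l2 volume fun x => ‖cubeK p x‖ₑ := fun v =>
    congrArg (· ^ (1 / 2 : ℝ)) (lintegral_sub_left_eq_self (fun x => ‖cubeK p x‖ₑ ^ 2) v)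
  calc _ ≤ l2 volume (fun x => l2 volume fun v => (ofReal (exp 1) * ‖Y v‖ₑ) * ‖cubeK p (v - x)‖ₑ) :=
        l2_mono fun x => l2_mono fun v => (enorm_cubeCut_le p Y x v).trans_eq (by ring)
    _ = l2 volume fun v => ofReal (exp 1) * l2 volume (fun x => ‖cubeK p x‖ₑ) * ‖Y v‖ₑ := by
        rw [l2_swap (by fun_prop)]
        congr 1; funext v
        rw [l2_const_mul (f := fun x => ‖cubeK p (v - x)‖ₑ) (by fun_prop), h, mul_right_comm]
    _ = _ := l2_const_mul (f := fun v => ‖Y v‖ₑ) (by fun_prop) _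

lemma l12_cubeCut (hY2 : l2 volume (fun v => ‖Y v‖ₑ) < ⊤) (x : E) : L12 (cubeCut p Y x) := by
  have hk : l2 volume (fun v => ‖cubeK p (v - x)‖ₑ) = l2 volume fun v => ‖cubeK p v‖ₑ :=
    congrArg (· ^ (1 / 2 : ℝ)) (lintegral_sub_right_eq_self (fun v => ‖cubeK p v‖ₑ ^ 2) x)
  refine ⟨⟨(measurable_cubeCut p hY x).aestronglyMeasurable, (lintegral_mono (enorm_cubeCut_le p Y x)).trans_lt ?_⟩,
    (l2_mono (g := fun v => ofReal (exp 1) * ‖Y v‖ₑ) fun v => (enorm_cubeCut_le p Y x v).trans ?_).trans_lt ?_⟩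
  · rw [lintegral_const_mul' _ _ ofReal_ne_top]
    refine mul_lt_top (by simp) ((lintegral_mul_le_l2 (by fun_prop) (by fun_prop)).trans_lt ?_)
    exact mul_lt_top (hk ▸ l2_cubeK_lt_top p) hY2
  · gcongr
    exact mul_le_of_le_one_left' ((ofReal_norm _).symm.le.trans (ofReal_le_one.2 (abs_cubeK_le p _)))
  · rw [l2_const_mul (f := fun v => ‖Y v‖ₑ) (by fun_prop)]
    exact mul_lt_top (by simp) hY2

end Cubes

lemma measurable_fourierR {T : Type*} [MeasurableSpace T] {f : T → E → ℝ} (hf : Measurable (uncurry f)) :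
    Measurable fun q : T × E => fourierR (f q.1) q.2 := by
  simp_rw [fourierR_eq]
  refine StronglyMeasurable.measurable (StronglyMeasurable.integral_prod_right'
    (f := fun q : (T × E) × E => Complex.exp (((-2 * Real.pi * inner ℝ q.2 q.1.2 : ℝ) : ℂ) * I) *
      (f q.1.1 q.2 : ℂ)) ?_)
  refine Measurable.stronglyMeasurable (Measurable.mul ?_ ?_)
  · have : Measurable fun q : (T × E) × E => inner ℝ q.2 q.1.2 := by fun_prop
    fun_prop
  · fun_prop

lemma measurable_fourierR_right (hf : Measurable f) : Measurable (fourierR f) :=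
  (measurable_fourierR (T := Unit) (f := fun _ => f) (by fun_prop)).comp
    ((measurable_const (a := ())).prodMk measurable_id)

lemma l2_tensor {f g : E → ℝ≥0∞} (hf : Measurable f) (hg : Measurable g) :
    l2 volume (fun q : E × E => f q.1 * g q.2) = l2 volume f * l2 volume g := by
  have h := l2_prod (μ := (volume : Measure E)) (ν := (volume : Measure E)) (f := fun x y => f x * g y)
    ((hf.comp measurable_fst).mul (by fun_prop)).aemeasurable
  rw [volume_eq_prod]
  refine h.symm.trans ?_
  simp_rw [fun x => l2_const_mul (μ := (volume : Measure E)) hg.aemeasurable (f x), mul_comm (f _)]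
  rw [l2_const_mul hf.aemeasurable, mul_comm]

/-- The left factor of the pairing in Fourier variables. -/
def cubeL (p : ℕ × ℕ × ℕ) (Y : E → ℝ) (q : E × E) : ℝ≥0∞ := ‖fourierR (cubeCut p Y q.1) q.2‖ₑ

/-- The right factor of the pairing in Fourier variables. -/
def cubeR (W h : E → ℝ) (q : E × E) : ℝ≥0∞ := ofReal (√(lam q.1)) * ‖W q.1‖ₑ * ‖fourierR h q.2‖ₑ

lemma measurable_cubeL (p : ℕ × ℕ × ℕ) {Y : ℝ → E → ℝ} (hY : Measurable (uncurry Y)) :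
    Measurable (uncurry fun t => cubeL p (Y t)) :=
  (Measurable.comp (f := fun z : ℝ × (E × E) => ((z.1, z.2.1), z.2.2)) (measurable_fourierR
    (f := fun (q : ℝ × E) => cubeCut p (Y q.1) q.2) (by unfold cubeCut; fun_prop)) (by fun_prop)).enorm

lemma measurable_cubeR {W : ℝ → E → ℝ} (hW : Measurable (uncurry W))
    (hh : Measurable (uncurry h)) : Measurable (uncurry fun s => cubeR (W s) (h s)) :=
  Measurable.mul (by fun_prop) (Measurable.comp (f := fun z : ℝ × (E × E) => (z.1, z.2.2)) (measurable_fourierR hh) (by fun_prop)).enorm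

lemma l2_cubeL_le (p : ℕ × ℕ × ℕ) {Y : E → ℝ} (hY : Measurable Y) (hY2 : l2 volume (fun v => ‖Y v‖ₑ) < ⊤) :
    l2 volume (cubeL p Y) ≤ ofReal (exp 1) * l2 volume (fun x => ‖cubeK p x‖ₑ) * l2 volume fun v => ‖Y v‖ₑ := by
  have hm : Measurable (uncurry fun x ξ => cubeL p Y (x, ξ)) := (measurable_fourierR (by unfold cubeCut; fun_prop)).enorm
  refine le_trans (le_of_eq ?_) (l2_cubeCut p hY)
  rw [volume_eq_prod]
  refine (l2_prod hm.aemeasurable).symm.trans (congrArg _ (funext fun x => ?_))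
  exact plancherel_real (measurable_cubeCut p hY x) (l12_cubeCut p hY hY2 x)

lemma l2_cubeR {W h : E → ℝ} (hW : Measurable W) (hm : Measurable h) (hh : L12 h) :
    l2 volume (cubeR W h) = wl2 lam W * l2 volume fun v => ‖h v‖ₑ := by
  rw [← plancherel_real hm hh]
  exact l2_tensor (f := fun x => ofReal (√(lam x)) * ‖W x‖ₑ) (g := fun ξ => ‖fourierR h ξ‖ₑ)
    (by fun_prop) (measurable_fourierR_right hm).enorm

lemma lintegral_cubeK_lt_top (p : ℕ × ℕ × ℕ) : ∫⁻ x, ‖cubeK p x‖ₑ < ⊤ := by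
  refine (lintegral_mono (g := (Metric.closedBall (0 : E) 2).indicator 1) fun x => ?_).trans_lt ?_
  · by_cases hx : x ∈ Metric.closedBall (0 : E) 2
    · rw [indicator_of_mem hx]
      exact (ofReal_norm _).symm.le.trans (ofReal_le_one.2 (abs_cubeK_le p x))
    · simp [cubeK_eq_zero p (by simpa using hx)]
  · rw [lintegral_indicator_one measurableSet_closedBall]
    exact measure_closedBall_lt_top

/-- The pairing at fixed times, with the smooth factor written through the cube formula. -/
lemma enorm_pairing_cube_le (hm : IsMix m) (S : 𝓢(E, ℝ)) (hτ : 0 < τ) {Y h : E → ℝ}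
    (hY : Measurable Y) (hY2 : l2 volume (fun v => ‖Y v‖ₑ) < ⊤) (hhm : Measurable h) (hh : L12 h)
    (hn : 3 ≤ n) (hV : Sob n lam V) :
    ‖∫ v, Y v * (√(lam v) * V 0 v * cv (mixK m S 2 τ) h v)‖ₑ ≤ ∑ p ∈ cubeIdx, ∫⁻ q : E × E, symb m S τ q.2 *
      (cubeL p Y q * cubeR (V (cubeM p)) h q) := by
  have := hm.finite
  set K := cv (mixK m S 2 τ) h
  have hKm : Measurable K := measurable_cv (measurable_mixK S 2 |>.comp measurable_prodMk_left) hhm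
  set CK : ℝ≥0∞ := l2 volume (mixAbs m S 2 τ) * l2 volume fun v => ‖h v‖ₑ
  have hCK : CK < ⊤ := mul_lt_top (l2_mixAbs_lt_top hm S le_rfl (by norm_num) hτ) hh.2
  have hKb : ∀ v, ‖K v‖ₑ ≤ CK := fun v => (enorm_integral_le_lintegral_enorm _).trans <| by
    simp_rw [enorm_mul]
    exact (lintegral_mono fun v' => mul_le_mul' (enorm_mixK_le_mixAbs m S 2 τ _) le_rfl).trans
      (lintegral_conv_le_l2 (measurable_mixAbs S 2 τ) hhm.enorm v)
  have hVl : Sob n lamT V := hV.mono le_rfl fun v => div_le_self (exp_pos _).le (by linarith [norm_nonneg v])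
  have hVm : ∀ p ∈ cubeIdx, Measurable (V (cubeM p)) := fun p hp => hV.meas _ ((abs_cubeM_le hp).trans hn)
  have hint : ∀ p ∈ cubeIdx, Integrable (uncurry fun v x => √(lam x) * V (cubeM p) x * (cubeCut p Y x v * K v))
      ((volume : Measure E).prod (volume : Measure E)) := by
    intro p hp
    have hVp := hVm p hp
    have hme : Measurable fun q : E × E => √(lam q.2) * V (cubeM p) q.2 * (cubeCut p Y q.2 q.1 * K q.1) := by
      unfold cubeCut; fun_prop
    refine ⟨hme.aestronglyMeasurable, ?_⟩
    rw [HasFiniteIntegral]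
    refine (lintegral_prod _ hme.enorm.aemeasurable).trans_lt ?_
    set g : E → ℝ≥0∞ := fun v => ofReal (√(lam v)) * ‖V (cubeM p) v‖ₑ
    set κ : E → ℝ≥0∞ := fun v => ‖cubeK p v‖ₑ
    have ne1 : ofReal (exp 1) * CK < ⊤ := mul_lt_top (by simp) hCK
    calc _ ≤ ∫⁻ v, ∫⁻ x, (ofReal (exp 1) * CK) * (‖Y v‖ₑ * (κ (v - x) * g x)) := by
          refine lintegral_mono fun v => lintegral_mono fun x => ?_
          simp only [enorm_mul, enorm_of_nonneg (sqrt_nonneg _)]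
          calc _ ≤ g x * ((ofReal (exp 1) * (κ (v - x) * ‖Y v‖ₑ)) * CK) :=
                mul_le_mul' le_rfl (mul_le_mul' (enorm_cubeCut_le p Y x v) (hKb v))
            _ = _ := by ring
      _ = (ofReal (exp 1) * CK) * ∫⁻ v, ‖Y v‖ₑ * ∫⁻ x, κ (v - x) * g x := by
          rw [← lintegral_const_mul' _ _ ne1.ne]
          refine lintegral_congr fun v => ?_
          rw [lintegral_const_mul' _ _ ne1.ne, lintegral_const_mul' _ _ (by simp)]
      _ < ⊤ := mul_lt_top ne1 ((lintegral_conv_le (by fun_prop) (by fun_prop) (by fun_prop)).trans_lt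
          (mul_lt_top (lintegral_cubeK_lt_top p) (mul_lt_top hY2 (hV.finite continuous_lam ((abs_cubeM_le hp).trans hn)))))
  have e1 : ∫ v, Y v * (√(lam v) * V 0 v * K v) = ∑ p ∈ cubeIdx, ∫ x, √(lam x) * V (cubeM p) x * ∫ v, cubeCut p Y x v * K v := by
    have hi : ∀ p ∈ cubeIdx, Integrable fun v => ∫ x, √(lam x) * V (cubeM p) x * (cubeCut p Y x v * K v) :=
      fun p hp => (hint p hp).integral_prod_left
    rw [integral_congr_ae (g := fun v => ∑ p ∈ cubeIdx, ∫ x, √(lam x) * V (cubeM p) x * (cubeCut p Y x v * K v)),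
      integral_finsetSum _ hi]
    · refine sum_congr rfl fun p hp => ?_
      rw [integral_integral_swap (hint p hp)]
      simp_rw [integral_const_mul]
    · filter_upwards [sob_repr hVl (b := 0) (by simpa [MIdx.abs] using hn)] with v hv
      rw [hv, mul_sum, sum_mul, mul_sum]
      refine sum_congr rfl fun p _ => ?_
      rw [cv, ← integral_const_mul, ← integral_mul_const, ← integral_const_mul, zero_add]
      refine integral_congr_ae (.of_forall fun x => ?_)
      have := sqrt_pos.2 (lam_pos x)
      simp only [cubeCut]
      field_simp
  rw [e1]
  refine (enorm_sum_le _ _).trans (sum_le_sum fun p hp => (enorm_integral_le_lintegral_enorm _).trans ?_)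
  have hsm : Measurable (symb m S τ) := (measurable_symb m S).comp measurable_prodMk_left
  have hLm : Measurable (cubeL p Y) := (measurable_fourierR (by unfold cubeCut; fun_prop)).enorm
  have hRm : Measurable (cubeR (V (cubeM p)) h) := Measurable.mul (by have := hVm p hp; fun_prop)
    ((measurable_fourierR_right hhm).comp measurable_snd).enorm
  rw [volume_eq_prod, lintegral_prod _ (by fun_prop)]
  refine lintegral_mono fun x => ?_
  simp only [enorm_mul, enorm_of_nonneg (sqrt_nonneg _)]
  refine (mul_le_mul_right (enorm_pairing_mixK_le hm S hτ (measurable_cubeCut p hY x) (l12_cubeCut p hY hY2 x).1 hhm hh) _).trans_eq ?_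
  rw [← lintegral_const_mul' _ _ (by simp [mul_ne_top])]
  refine lintegral_congr fun ξ => ?_
  simp only [cubeL, cubeR]; ring

lemma measurable_hNorm (hν : IsWt ν) {V : MIdx → ℝ → E → ℝ}
    (hV : ∀ α, Measurable (uncurry (V α))) : Measurable fun s => hNorm n ν fun α => V α s := by
  have : ∀ s, hNorm n ν (fun α => V α s) = (∑ α ∈ midxLE n, wl2 ν (V α s) ^ 2) ^ (1 / 2 : ℝ) := fun s => by
    rw [← hNorm_sq n (fun v => (hν.pos v).le), sq_rpow_half]
  simp_rw [this]
  exact (Finset.measurable_sum _ fun α _ => (measurable_wl2 hν.cont (hV α)).pow_const 2).pow_const _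

lemma ae_l2_lt_top {f : ℝ → E → ℝ≥0∞} (hf : Measurable (uncurry f))
    (h : l2 timeSpace (uncurry f) < ⊤) : ∀ᵐ t ∂μ₊, l2 volume (f t) < ⊤ := by
  have h1 := l2_prod (μ := μ₊) (ν := (volume : Measure E)) hf.aemeasurable
  have h2 : ∫⁻ t in Ioi (0 : ℝ), (l2 volume (f t)) ^ 2 < ⊤ := by
    rw [← l2_sq, h1]; exact pow_lt_top h
  filter_upwards [ae_lt_top ((measurable_l2_right hf).pow_const 2) h2.ne] with t ht
  exact (ENNReal.pow_lt_top_iff.1 ht).resolve_right (by norm_num)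

lemma cube_time_le [SFinite m] (hCs : ∀ ξ : E, ∫⁻ τ in Ioi (0 : ℝ), symb m S τ ξ ≤ C) (hε : 0 < ε) {Y : ℝ → E → ℝ}
    (hY : Measurable (uncurry Y)) (hh : Measurable (uncurry h)) {V : MIdx → ℝ → E → ℝ} (hn : 3 ≤ n) (hVm : ∀ α, Measurable (uncurry (V α))) {e : ℝ → ℝ≥0∞} (he : Measurable e) (hB : ∀ᵐ s ∂μ₊, L12 (h s) ∧ l2 volume (fun v => ‖h s v‖ₑ) ≤ B)
    (hY2 : ∀ᵐ t ∂μ₊, l2 volume (fun v => ‖Y t v‖ₑ) < ⊤) {p : ℕ × ℕ × ℕ} (hp : p ∈ cubeIdx) :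
    ∫⁻ t in Ioi (0 : ℝ), ∫⁻ s in Ioo 0 t, ofReal ε⁻¹ * ∫⁻ q : E × E,
      symb m S ((t - s) / ε) q.2 * (cubeL p (Y t) q * (e s * cubeR (V (cubeM p) s) (h s) q)) ≤
      C * (ofReal (exp 1) * l2 volume fun x => ‖cubeK p x‖ₑ) *
        (B * (l2 timeSpace (fun p => ‖Y p.1 p.2‖ₑ) * l2 μ₊ fun s => e s * hNorm n lam fun α => V α s)) := by
  have hYm : Measurable (uncurry fun t v => ‖Y t v‖ₑ) := hY.enorm
  have hRm : Measurable (uncurry fun s => cubeR (V (cubeM p) s) (h s)) := measurable_cubeR (hVm _) hh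
  have hnm : Measurable (uncurry fun τ (q : E × E) => symb m S τ q.2) :=
    Measurable.comp (f := fun z : ℝ × (E × E) => (z.1, z.2.2)) (measurable_symb m _) (by fun_prop)
  have hNm : Measurable fun s => hNorm n lam fun α => V α s := measurable_hNorm isWt_lam hVm
  refine (young_time_param (volume : Measure (E × E)) hnm (measurable_cubeL p hY)
    (u := fun s q => e s * cubeR (V (cubeM p) s) (h s) q) (by fun_prop) (fun q => hCs q.2) hε).trans ?_
  rw [mul_assoc C, mul_left_comm B, ← mul_assoc (ofReal (exp 1) * _)]
  refine mul_le_mul' le_rfl (mul_le_mul' ?_ ?_)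
  · refine le_trans ?_ (mul_le_mul_right (le_of_eq (l2_prod (μ := μ₊) (ν := (volume : Measure E)) hYm.aemeasurable)) _)
    rw [← l2_const_mul (measurable_l2_right hYm).aemeasurable]
    exact l2_mono_ae (hY2.mono fun t ht => l2_cubeL_le p (by fun_prop) ht)
  · rw [← l2_const_mul (f := fun s => e s * hNorm n lam fun α => V α s) (by fun_prop)]
    refine l2_mono_ae (hB.mono fun s hs => ?_)
    rw [l2_const_mul (f := cubeR (V (cubeM p) s) (h s)) (hRm.comp measurable_prodMk_left).aemeasurable, l2_cubeR (by fun_prop) (by fun_prop) hs.1, mul_left_comm B,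
      mul_comm B]
    gcongr
    · exact wl2_le_hNorm (fun v => (lam_pos v).le) (fun α => V α s) ((abs_cubeM_le hp).trans hn)
    · exact hs.2

lemma measurable_lintegral_Ioo {F : ℝ × ℝ → ℝ≥0∞} (hF : Measurable F) :
    Measurable fun t => ∫⁻ s in Ioo 0 t, F (t, s) := by
  have hs : MeasurableSet {q : ℝ × ℝ | q.2 ∈ Ioo 0 q.1} :=
    (measurableSet_lt measurable_const measurable_snd).inter (measurableSet_lt measurable_snd measurable_fst)
  have h1 := (hF.indicator hs).lintegral_prod_right' (ν := volume)
  have h2 : ∀ t s : ℝ, {q : ℝ × ℝ | q.2 ∈ Ioo 0 q.1}.indicator F (t, s) = (Ioo 0 t).indicator (fun s => F (t, s)) s :=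
    fun t s => by simp only [indicator_apply, mem_ofPred_eq]
  simp_rw [h2, lintegral_indicator measurableSet_Ioo] at h1
  exact h1

/-- The time-integrated bound with cancellation. -/
lemma lintegral_cancellation_le (hm : IsMix m) (S : 𝓢(E, ℝ)) (l : Fin 3) :
    ∃ C : ℝ≥0∞, C ≠ ⊤ ∧ ∀ ε : ℝ, 0 < ε → ∀ Y h : ℝ → E → ℝ, Measurable (uncurry Y) →
    Measurable (uncurry h) → ∀ (V : MIdx → ℝ → E → ℝ) (n : ℕ), 3 ≤ n → (∀ α, Measurable (uncurry (V α))) →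
    (∀ s, Sob n lam fun α => V α s) → ∀ e : ℝ → ℝ≥0∞, Measurable e → ∀ B : ℝ≥0∞,
    (∀ᵐ s ∂μ₊, L12 (h s) ∧ l2 volume (fun v => ‖h s v‖ₑ) ≤ B) → l2 timeSpace (fun p => ‖Y p.1 p.2‖ₑ) < ⊤ →
    ∫⁻ t in Ioi (0 : ℝ), ∫⁻ s in Ioo 0 t, ofReal ε⁻¹ * (e s *
      ‖∫ v, Y t v * (√(lam v) * V 0 s v * cv (mixK m (∂_{basisVec l} S) 2 ((t - s) / ε)) (h s) v)‖ₑ) ≤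
      C * (B * (l2 timeSpace (fun p => ‖Y p.1 p.2‖ₑ) * l2 μ₊ fun s => e s * hNorm n lam fun α => V α s)) := by
  have := hm.finite
  obtain ⟨C, hC, hCs⟩ := lintegral_symb_le hm S l
  generalize (∂_{basisVec l} S) = S' at *
  refine ⟨∑ p ∈ cubeIdx, ofReal C * (ofReal (exp 1) * l2 volume fun x => ‖cubeK p x‖ₑ), (sum_lt_top.2 fun p _ =>
    mul_lt_top (by simp) (mul_lt_top (by simp) (l2_cubeK_lt_top p))).ne,
    fun ε hε Y h hY hh V n hn hVm hV e he B hB hY2 => ?_⟩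
  have hY2' := ae_l2_lt_top (f := fun t v => ‖Y t v‖ₑ) hY.enorm hY2
  have hF : ∀ p, Measurable fun q : ℝ × ℝ => ofReal ε⁻¹ * ∫⁻ r : E × E, symb m S' ((q.1 - q.2) / ε) r.2 *
      (cubeL p (Y q.1) r * (e q.2 * cubeR (V (cubeM p) q.2) (h q.2) r)) := fun p => by
    have h1 : Measurable fun z : (ℝ × ℝ) × (E × E) => symb m S' ((z.1.1 - z.1.2) / ε) z.2.2 :=
      Measurable.comp (f := fun z : (ℝ × ℝ) × (E × E) => ((z.1.1 - z.1.2) / ε, z.2.2)) (measurable_symb m _) (by fun_prop)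
    have h2 : Measurable fun z : (ℝ × ℝ) × (E × E) => cubeL p (Y z.1.1) z.2 :=
      Measurable.comp (f := fun z : (ℝ × ℝ) × (E × E) => (z.1.1, z.2)) (measurable_cubeL p hY) (by fun_prop)
    have h3 : Measurable fun z : (ℝ × ℝ) × (E × E) => cubeR (V (cubeM p) z.1.2) (h z.1.2) z.2 :=
      Measurable.comp (f := fun z : (ℝ × ℝ) × (E × E) => (z.1.2, z.2)) (measurable_cubeR (hVm (cubeM p)) hh) (by fun_prop)
    have h4 := h1.mul (h2.mul ((he.comp (measurable_snd.comp measurable_fst)).mul h3))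
    exact h4.lintegral_prod_right'.const_mul _
  rw [sum_mul]
  refine le_trans ?_ (sum_le_sum fun p hp => cube_time_le hCs hε hY hh hn hVm he hB hY2' hp)
  rw [← lintegral_finsetSum _ fun p _ => measurable_lintegral_Ioo (hF p)]
  refine lintegral_mono_ae (hY2'.mono fun t ht => ?_)
  beta_reduce
  have hF' : ∀ p ∈ cubeIdx, Measurable fun s => ofReal ε⁻¹ * ∫⁻ r : E × E, symb m S' ((t - s) / ε) r.2 *
      (cubeL p (Y t) r * (e s * cubeR (V (cubeM p) s) (h s) r)) := fun p _ => (hF p).comp measurable_prodMk_left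
  rw [← lintegral_finsetSum _ hF']
  refine lintegral_mono_ae ?_
  filter_upwards [ae_restrict_of_ae_restrict_of_subset Ioo_subset_Ioi_self hB, ae_restrict_mem measurableSet_Ioo] with s hs hst
  have hτ : 0 < (t - s) / ε := div_pos (by linarith [hst.2]) hε
  rw [← mul_sum]
  refine mul_le_mul_right ((mul_le_mul_right (enorm_pairing_cube_le hm S' hτ (by fun_prop) ht (by fun_prop) hs.1 hn (hV s)) (e s)).trans ?_) _
  rw [mul_sum]
  refine sum_le_sum fun p _ => (lintegral_const_mul_le _ _).trans_eq (lintegral_congr fun q => ?_)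
  ring

/-! ### The Laplace transform of a scalar function of time -/

/-- The truncated Laplace integral. -/
def lapInt (a T : ℝ) (g : ℝ → ℝ) (ϖ : ℝ) : ℂ :=
  ∫ t in (0 : ℝ)..T, Complex.exp (-((a : ℂ) + ϖ * I) * t) * (g t : ℂ)

/-- The damped function on a bounded time interval. -/
def dampCut (a S T : ℝ) (g : ℝ → ℝ) : ℝ → ℂ :=
  (Ioc S T).indicator fun t => ((exp (-a * t) * g t : ℝ) : ℂ)

/-- The damped energy. -/
def dampE (a : ℝ) (g : ℝ → ℝ) : ℝ≥0∞ :=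
  ∫⁻ t in Ioi (0 : ℝ), ofReal (exp (-(2 * a) * t)) * ‖g t‖ₑ ^ 2

lemma measurable_dampCut (a S T : ℝ) {g : ℝ → ℝ} (hg : Measurable g) : Measurable (dampCut a S T g) :=
  (Complex.measurable_ofReal.comp (by fun_prop : Measurable fun t => exp (-a * t) * g t)).indicator measurableSet_Ioc

lemma enorm_damp_sq (a t x : ℝ) :
    ‖((exp (-a * t) * x : ℝ) : ℂ)‖ₑ ^ 2 = ofReal (exp (-(2 * a) * t)) * ‖x‖ₑ ^ 2 := by
  rw [enorm_ofReal_complex, enorm_mul, mul_pow, enorm_eq_ofReal (exp_pos _).le,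
    ← ofReal_pow (exp_pos _).le, ← exp_nat_mul]
  congr 3
  push_cast; ring

lemma lintegral_dampCut_sq (a S T : ℝ) (g : ℝ → ℝ) :
    ∫⁻ t, ‖dampCut a S T g t‖ₑ ^ 2 = ∫⁻ t in Ioc S T, ofReal (exp (-(2 * a) * t)) * ‖g t‖ₑ ^ 2 := by
  rw [← lintegral_indicator measurableSet_Ioc]
  refine lintegral_congr fun t => ?_
  by_cases h : t ∈ Ioc S T
  · rw [dampCut, indicator_of_mem h, indicator_of_mem h, enorm_damp_sq]
  · rw [dampCut, indicator_of_notMem h, indicator_of_notMem h]; simp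

lemma memLp_two_iff {X F : Type*} [MeasurableSpace X] [NormedAddCommGroup F] {μ : Measure X} {f : X → F}
    (hf : AEStronglyMeasurable f μ) : MemLp f 2 μ ↔ ∫⁻ x, ‖f x‖ₑ ^ 2 ∂μ < ⊤ := by
  rw [MemLp, eLpNorm_eq_lintegral_rpow_enorm_toReal (by norm_num) (by norm_num)]
  simp only [hf, true_and, toReal_ofNat, ENNReal.rpow_two]
  rw [ENNReal.rpow_lt_top_iff_of_pos (by norm_num)]

lemma dampCut_memLp {a S : ℝ} (hS : 0 ≤ S) {g : ℝ → ℝ} (hg : Measurable g) (hJ : dampE a g < ⊤) :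
    Integrable (dampCut a S T g) ∧ MemLp (dampCut a S T g) 2 volume := by
  have hm := (measurable_dampCut a S T hg).aestronglyMeasurable (μ := volume)
  have h2 : MemLp (dampCut a S T g) 2 volume := by
    rw [memLp_two_iff hm, lintegral_dampCut_sq]
    exact (lintegral_mono_set fun t ht => mem_Ioi.2 (hS.trans_lt ht.1)).trans_lt hJ
  refine ⟨?_, h2⟩
  have h3 : IntegrableOn (dampCut a S T g) (Ioc S T) :=
    (h2.restrict (Ioc S T)).integrable (by norm_num)
  have := (integrable_indicator_iff measurableSet_Ioc).2 h3
  rwa [dampCut, indicator_indicator, inter_self] at this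

lemma lapInt_sub {a S : ℝ} (hS : 0 ≤ S) (hST : S ≤ T) {g : ℝ → ℝ} (hg : Measurable g) (hJ : dampE a g < ⊤) (ϖ : ℝ) :
    lapInt a T g ϖ - lapInt a S g ϖ = 𝓕 (dampCut a S T g) (ϖ / (2 * Real.pi)) := by
  have e : ∀ t : ℝ, Complex.exp (-((a : ℂ) + ϖ * I) * t) * (g t : ℂ) =
      Complex.exp ((-2 * Real.pi * t * (ϖ / (2 * Real.pi)) : ℝ) * I) * ((exp (-a * t) * g t : ℝ) : ℂ) := by
    intro t
    have hpi : Real.pi ≠ 0 := by simp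
    have : (-2 * Real.pi * t * (ϖ / (2 * Real.pi)) : ℝ) = -ϖ * t := by field_simp
    rw [this]
    push_cast
    rw [← mul_assoc, ← Complex.exp_add]
    congr 2
    ring
  have hii : ∀ R, 0 ≤ R → IntervalIntegrable (fun t : ℝ => Complex.exp (-((a : ℂ) + ϖ * I) * t) * (g t : ℂ)) volume 0 R := by
    intro R hR
    rw [intervalIntegrable_iff_integrableOn_Ioc_of_le hR]
    have h1 : IntegrableOn (fun t => ((exp (-a * t) * g t : ℝ) : ℂ)) (Ioc 0 R) :=
      (integrable_indicator_iff measurableSet_Ioc).1 (dampCut_memLp le_rfl hg hJ).1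
    simp_rw [e]
    refine h1.bdd_mul (c := 1) (by fun_prop) (of_forall fun t => ?_)
    rw [norm_exp_ofReal_mul_I]
  rw [lapInt, lapInt, intervalIntegral.integral_interval_sub_left (hii T (hS.trans hST)) (hii S hS),
    intervalIntegral.integral_of_le hST, ← integral_indicator measurableSet_Ioc, Real.fourier_real_eq_integral_exp_smul]
  refine integral_congr_ae (of_forall fun t => ?_)
  beta_reduce
  by_cases h : t ∈ Ioc S T
  · rw [dampCut, indicator_of_mem h, indicator_of_mem h, e, smul_eq_mul]
  · rw [dampCut, indicator_of_notMem h, indicator_of_notMem h, smul_zero]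

lemma lintegral_comp_div_two_pi (f : ℝ → ℝ≥0∞) (hf : Measurable f) :
    ∫⁻ ϖ, f (ϖ / (2 * Real.pi)) = ofReal (2 * Real.pi) * ∫⁻ ξ, f ξ := by
  have hc : 0 < (2 * Real.pi)⁻¹ := by positivity
  have h := Measure.map_addHaar_smul (volume : Measure ℝ) hc.ne'
  have e : ∀ ϖ : ℝ, f (ϖ / (2 * Real.pi)) = f ((2 * Real.pi)⁻¹ • ϖ) := fun ϖ => by
    rw [smul_eq_mul, div_eq_inv_mul]
  simp_rw [e]
  rw [← lintegral_map hf (by fun_prop), h, lintegral_smul_measure]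
  simp [abs_of_pos pi_pos]

lemma continuous_fourier_real {f : ℝ → ℂ} (hf : Integrable f) : Continuous (𝓕 f) :=
  VectorFourier.fourierIntegral_continuous Real.continuous_fourierChar (by exact continuous_inner) hf

lemma lintegral_lapInt_sub {a S : ℝ} (hS : 0 ≤ S) (hST : S ≤ T) {g : ℝ → ℝ} (hg : Measurable g) (hJ : dampE a g < ⊤) :
    ∫⁻ ϖ, ‖lapInt a T g ϖ - lapInt a S g ϖ‖ₑ ^ 2 =
      ofReal (2 * Real.pi) * ∫⁻ t in Ioc S T, ofReal (exp (-(2 * a) * t)) * ‖g t‖ₑ ^ 2 := by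
  obtain ⟨h1, h2⟩ := dampCut_memLp (T := T) hS hg hJ
  simp_rw [lapInt_sub hS hST hg hJ]
  rw [lintegral_comp_div_two_pi (fun ξ => ‖𝓕 (dampCut a S T g) ξ‖ₑ ^ 2) ((continuous_fourier_real h1).enorm.measurable.pow_const 2),
    plancherel h1 h2, lintegral_dampCut_sq]

lemma lapInt_zero (a : ℝ) (g : ℝ → ℝ) (ϖ : ℝ) : lapInt a 0 g ϖ = 0 := by simp [lapInt]

lemma lapInt_eq {a : ℝ} (hT : 0 ≤ T) {g : ℝ → ℝ} (hg : Measurable g) (hJ : dampE a g < ⊤) (ϖ : ℝ) :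
    lapInt a T g ϖ = 𝓕 (dampCut a 0 T g) (ϖ / (2 * Real.pi)) := by
  rw [← lapInt_sub le_rfl hT hg hJ, lapInt_zero, sub_zero]

/-! ### The time average adapted to the kernel -/

/-- The anti-causal exponential kernel. -/
def expK (b κ : ℝ) : ℝ → ℂ := (Iio (0 : ℝ)).indicator fun r => ((κ * exp (b * r) : ℝ) : ℂ)

lemma integrable_expK {κ : ℝ} (hb : 0 < b) : Integrable (expK b κ) := by
  rw [expK, integrable_indicator_iff measurableSet_Iio]
  have := ((integrableOn_exp_mul_Iic hb 0).const_mul κ).ofReal (𝕜 := ℂ)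
  exact IntegrableOn.mono_set this Iio_subset_Iic_self

lemma fourier_expK {κ : ℝ} (hb : 0 < b) (ξ : ℝ) :
    𝓕 (expK b κ) ξ = (κ : ℂ) / ((b : ℂ) - (2 * Real.pi * ξ : ℝ) * I) := by
  have e : ∀ r : ℝ, Complex.exp ((-2 * Real.pi * r * ξ : ℝ) * I) • expK b κ r =
      (Iio (0 : ℝ)).indicator (fun r : ℝ => (κ : ℂ) * Complex.exp (((b : ℂ) - (2 * Real.pi * ξ : ℝ) * I) * r)) r := by
    intro r
    by_cases h : r ∈ Iio (0 : ℝ)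
    · rw [expK, indicator_of_mem h, indicator_of_mem h, smul_eq_mul]
      push_cast
      rw [mul_left_comm, ← Complex.exp_add]
      congr 2
      ring
    · rw [expK, indicator_of_notMem h, indicator_of_notMem h, smul_zero]
  rw [Real.fourier_real_eq_integral_exp_smul]
  simp_rw [e]
  rw [integral_indicator measurableSet_Iio, ← integral_Iic_eq_integral_Iio, integral_const_mul,
    integral_exp_mul_complex_Iic (by simpa using hb)]
  simp [div_eq_mul_inv]

lemma enorm_fourier_expK_sq_le {κ : ℝ} (hκ : 0 < κ) (hb : κ ≤ b) (ϖ : ℝ) :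
    ‖𝓕 (expK b κ) (ϖ / (2 * Real.pi))‖ₑ ^ 2 ≤ ofReal (2 / (1 + |ϖ| / κ) ^ 2) := by
  have hb0 : 0 < b := hκ.trans_le hb
  have hpi : Real.pi ≠ 0 := by simp
  rw [fourier_expK hb0, show 2 * Real.pi * (ϖ / (2 * Real.pi)) = ϖ by field_simp, ← ofReal_norm,
    ← ofReal_pow (norm_nonneg _)]
  refine ofReal_le_ofReal ?_
  rw [norm_div, div_pow, norm_real, Complex.sq_norm, Complex.normSq_apply, norm_of_nonneg hκ.le]
  simp only [Complex.sub_re, Complex.ofReal_re, Complex.mul_re, Complex.ofReal_im, I_re, I_im,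
    Complex.sub_im, Complex.mul_im, mul_zero, sub_zero, mul_one, add_zero, zero_sub]
  have e : (1 + |ϖ| / κ) ^ 2 = (κ + |ϖ|) ^ 2 / κ ^ 2 := by field_simp
  rw [e, div_div_eq_mul_div, div_le_div_iff₀ (by nlinarith [sq_nonneg ϖ, mul_pos hb0 hb0]) (by positivity)]
  have h1 : (κ + |ϖ|) ^ 2 ≤ 2 * (b * b + -ϖ * -ϖ) := by
    nlinarith [sq_nonneg (κ - |ϖ|), sq_abs ϖ]
  nlinarith [sq_nonneg κ]

/-- The time average of a function of time. -/
def timeAvg (A κ : ℝ) (g : ℝ → ℝ) (s : ℝ) : ℝ :=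
  ∫ t in Ioi s, κ * exp (-(A + κ) * (t - s)) * g t

/-- The multiplier bound for truncated functions. -/
lemma lintegral_conv_expK_le {κ : ℝ} (hκ : 0 < κ) (hb : κ ≤ b) {p : ℝ → ℂ} (hm : Measurable p) (h1 : Integrable p)
    (h2 : MemLp p 2 volume) :
    ofReal (2 * Real.pi) * ∫⁻ s, ‖∫ t, p t * expK b κ (s - t)‖ₑ ^ 2 ≤
      ∫⁻ ϖ, ofReal (2 / (1 + |ϖ| / κ) ^ 2) * ‖𝓕 p (ϖ / (2 * Real.pi))‖ₑ ^ 2 := by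
  have hb0 : 0 < b := hκ.trans_le hb
  have hk := integrable_expK (b := b) (κ := κ) hb0
  have hkm : Measurable (expK b κ) := Measurable.indicator (by fun_prop) measurableSet_Iio
  set q : ℝ → ℂ := fun s => ∫ t, p t * expK b κ (s - t) with hq
  have hqc : q = MeasureTheory.convolution p (expK b κ) (ContinuousLinearMap.mul ℂ ℂ) volume := rfl
  have hqi : Integrable q := h1.integrable_convolution (ContinuousLinearMap.mul ℂ ℂ) hk
  have hq2 : MemLp q 2 volume := by
    rw [memLp_two_iff hqi.1]
    have h3 : l2 volume (fun s => ‖q s‖ₑ) ≤ (∫⁻ r, ‖expK b κ r‖ₑ) * l2 volume fun t => ‖p t‖ₑ := by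
      refine (l2_mono fun s => (enorm_integral_le_lintegral_enorm _).trans (le_of_eq ?_)).trans
        (l2_conv_le hkm.enorm hm.enorm)
      simp_rw [enorm_mul, mul_comm]
    have h4 : l2 volume (fun s => ‖q s‖ₑ) < ⊤ := by
      refine h3.trans_lt (mul_lt_top hk.2 ?_)
      have := (memLp_two_iff hm.aestronglyMeasurable).1 h2
      exact rpow_lt_top_of_nonneg (by norm_num) this.ne
    have := pow_lt_top h4 (n := 2)
    rwa [l2_sq] at this
  rw [← plancherel hqi hq2, ← lintegral_comp_div_two_pi (fun ξ => ‖𝓕 q ξ‖ₑ ^ 2)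
    ((continuous_fourier_real hqi).enorm.measurable.pow_const 2)]
  refine lintegral_mono fun ϖ => ?_
  rw [hqc, Real.fourier_mul_convolution_eq h1 hk, enorm_mul, mul_pow, mul_comm]
  gcongr
  exact enorm_fourier_expK_sq_le hκ hb ϖ

/-- Bounds for the transform and for the time average in terms of the transform. -/
lemma scalar_laplace_bounds {a : ℝ} (ha : 0 < a) {g : ℝ → ℝ} (hg : Measurable g) (hJ : dampE a g < ⊤) {G : ℝ → ℂ}
    (hG : AEMeasurable G) {T : ℕ → ℝ} (hT0 : ∀ k, 0 ≤ T k) (hT : Tendsto T atTop atTop)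
    (hl : Tendsto (fun k => ∫⁻ ϖ, ‖G ϖ - lapInt a (T k) g ϖ‖ₑ ^ 2) atTop (𝓝 0)) :
    ∫⁻ ϖ, ‖G ϖ‖ₑ ^ 2 ≤ ofReal (2 * Real.pi) * dampE a g ∧
    ∀ κ : ℝ, 0 < κ → ofReal (2 * Real.pi) * dampE a (timeAvg (2 * a) κ g) ≤
      ∫⁻ ϖ, ofReal (2 / (1 + |ϖ| / κ) ^ 2) * ‖G ϖ‖ₑ ^ 2 := by
  have hlm : ∀ k, Measurable (lapInt a (T k) g) := fun k => by
    have : lapInt a (T k) g = fun ϖ => 𝓕 (dampCut a 0 (T k) g) (ϖ / (2 * Real.pi)) :=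
      funext fun ϖ => lapInt_eq (hT0 k) hg hJ ϖ
    rw [this]
    exact (continuous_fourier_real (dampCut_memLp le_rfl hg hJ).1).measurable.comp (by fun_prop)
  have hl2 : Tendsto (fun k => l2 volume fun ϖ => ‖G ϖ - lapInt a (T k) g ϖ‖ₑ) atTop (𝓝 0) := by
    simpa [l2] using hl.ennrpow_const (1 / 2)
  have hle : ∀ k, l2 volume (fun ϖ => ‖lapInt a (T k) g ϖ‖ₑ) ≤ (ofReal (2 * Real.pi) * dampE a g) ^ (1 / 2 : ℝ) := by
    intro k
    have := lintegral_lapInt_sub le_rfl (hT0 k) hg hJ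
    simp only [lapInt_zero, sub_zero] at this
    rw [l2, this]
    refine rpow_le_rpow (mul_le_mul_right (lintegral_mono_set fun t ht => ht.1) _) (by norm_num)
  constructor
  · rw [← rpow_half_sq (ofReal (2 * Real.pi) * dampE a g), ← l2_sq]
    gcongr
    have hlim : Tendsto (fun k => l2 volume (fun ϖ => ‖G ϖ - lapInt a (T k) g ϖ‖ₑ) +
      (ofReal (2 * Real.pi) * dampE a g) ^ (1 / 2 : ℝ)) atTop
        (𝓝 (0 + (ofReal (2 * Real.pi) * dampE a g) ^ (1 / 2 : ℝ))) := hl2.add_const _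
    rw [zero_add] at hlim
    refine ge_of_tendsto' hlim fun k => ?_
    have hd : AEMeasurable (fun ϖ => ‖G ϖ - lapInt a (T k) g ϖ‖ₑ) := by fun_prop
    refine le_trans (l2_mono (g := fun ϖ => ‖G ϖ - lapInt a (T k) g ϖ‖ₑ + ‖lapInt a (T k) g ϖ‖ₑ) fun ϖ => ?_)
      ((l2_add_le hd (hlm k).enorm.aemeasurable).trans (add_le_add le_rfl (hle k)))
    simpa using enorm_add_le (G ϖ - lapInt a (T k) g ϖ) (lapInt a (T k) g ϖ)
  · intro κ hκ
    set b := a + κ with hb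
    have hb0 : 0 < b := by positivity
    have hint : ∀ s ∈ Ioi (0 : ℝ), IntegrableOn (fun t => κ * exp (-(2 * a + κ) * (t - s)) * g t) (Ioi s) := by
      intro s hs
      have m1 : MemLp (fun t => exp (-a * t) * g t) 2 (volume.restrict (Ioi s)) := by
        rw [memLp_two_iff (by fun_prop)]
        simp_rw [← enorm_ofReal_complex, enorm_damp_sq]
        exact (lintegral_mono_set (Ioi_subset_Ioi (le_of_lt hs))).trans_lt hJ
      have m2 : MemLp (fun t => κ * exp ((2 * a + κ) * s) * exp (-b * t)) 2 (volume.restrict (Ioi s)) := by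
        refine ((memLp_two_iff_integrable_sq (by fun_prop)).2 ?_).const_mul _
        simp_rw [← exp_nat_mul, ← mul_assoc]
        exact integrableOn_exp_mul_Ioi (by push_cast; linarith) s
      refine (m2.integrable_mul m1).congr (.of_forall fun t => ?_)
      have : exp ((2 * a + κ) * s) * exp (-b * t) * exp (-a * t) = exp (-(2 * a + κ) * (t - s)) := by
        simp only [← exp_add, hb]; ring_nf
      simp only [Pi.mul_apply, ← this]; ring
    set qk : ℕ → ℝ → ℂ := fun k s => ∫ t, dampCut a 0 (T k) g t * expK b κ (s - t)
    have hqk : ∀ s ∈ Ioi (0 : ℝ), ∀ k, s ≤ T k →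
        qk k s = ((exp (-a * s) * ∫ t in s..(T k), κ * exp (-(2 * a + κ) * (t - s)) * g t : ℝ) : ℂ) := by
      intro s hs k hk
      rw [intervalIntegral.integral_of_le hk, ← integral_const_mul, ← integral_complex_ofReal, ← integral_indicator measurableSet_Ioc]
      refine integral_congr_ae (.of_forall fun t => ?_)
      by_cases h : t ∈ Ioc s (T k)
      · have : exp (-a * t) * exp (b * (s - t)) = exp (-a * s) * exp (-(2 * a + κ) * (t - s)) := by
          simp only [← exp_add, hb]; ring_nf
        simp only [dampCut, expK]
        rw [indicator_of_mem h, indicator_of_mem (show t ∈ Ioc 0 (T k) from ⟨lt_trans hs h.1, h.2⟩),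
          indicator_of_mem (mem_Iio.2 (by linarith [h.1])), ← Complex.ofReal_mul]
        congr 1
        linear_combination (κ * g t) * this
      · rw [indicator_of_notMem h]
        rcases le_or_gt t s with h' | h'
        · simp [expK, h']
        · simp [dampCut, not_le.1 fun h2 => h ⟨h', h2⟩]
    have hlim : ∀ s ∈ Ioi (0 : ℝ), Tendsto (fun k => ‖qk k s‖ₑ ^ 2) atTop
        (𝓝 (ofReal (exp (-(2 * a) * s)) * ‖timeAvg (2 * a) κ g s‖ₑ ^ 2)) := by
      intro s hs
      have h := ((intervalIntegral_tendsto_integral_Ioi s (hint s hs) hT).const_mul (exp (-a * s))).ofReal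
      rw [← enorm_damp_sq]
      refine ((continuous_pow 2).tendsto _).comp (h.congr' ?_).enorm
      filter_upwards [hT.eventually_ge_atTop s] with k hk
      exact (hqk s hs k hk).symm
    have hkm : Measurable (expK b κ) := Measurable.indicator (by fun_prop) measurableSet_Iio
    have hqkm : ∀ k, Measurable (qk k) := fun k => by
      have h := measurable_dampCut a 0 (T k) hg
      have : StronglyMeasurable fun z : ℝ × ℝ => dampCut a 0 (T k) g z.2 * expK b κ (z.1 - z.2) := by fun_prop
      exact this.integral_prod_right'.measurable
    set w : ℝ → ℝ≥0∞ := fun ϖ => ofReal (√(2 / (1 + |ϖ| / κ) ^ 2)) with hw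
    have hw2 : ∀ ϖ, w ϖ ^ 2 = ofReal (2 / (1 + |ϖ| / κ) ^ 2) := fun ϖ => by
      rw [hw, ← ofReal_pow (by positivity), sq_sqrt (by positivity)]
    have hwm : Measurable w := by fun_prop
    have hw1 : ∀ ϖ, w ϖ ≤ 2 := fun ϖ => by
      rw [show (2 : ℝ≥0∞) = ofReal 2 by simp, hw]
      refine ofReal_le_ofReal ?_
      rw [sqrt_le_left (by norm_num), div_le_iff₀ (by positivity)]
      have : 0 ≤ |ϖ| / κ := by positivity
      nlinarith
    have hqk2 : ∀ k, ofReal (2 * Real.pi) * ∫⁻ s, ‖qk k s‖ₑ ^ 2 ≤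
        (l2 volume (fun ϖ => w ϖ * ‖G ϖ‖ₑ) + 2 * l2 volume fun ϖ => ‖G ϖ - lapInt a (T k) g ϖ‖ₑ) ^ 2 := by
      intro k
      obtain ⟨i1, i2⟩ := dampCut_memLp (T := T k) le_rfl hg hJ
      refine (lintegral_conv_expK_le hκ (by linarith : κ ≤ b) (measurable_dampCut a 0 (T k) hg) i1 i2).trans ?_
      have e1 : ∀ ϖ, ofReal (2 / (1 + |ϖ| / κ) ^ 2) * ‖𝓕 (dampCut a 0 (T k) g) (ϖ / (2 * Real.pi))‖ₑ ^ 2 =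
          (w ϖ * ‖lapInt a (T k) g ϖ‖ₑ) ^ 2 := fun ϖ => by
        rw [mul_pow, hw2, lapInt_eq (hT0 k) hg hJ]
      simp_rw [e1]
      rw [← l2_sq]
      gcongr
      have hd : AEMeasurable (fun ϖ => ‖G ϖ - lapInt a (T k) g ϖ‖ₑ) := by fun_prop
      rw [← l2_const_mul hd]
      refine le_trans (l2_mono fun ϖ => ?_) (l2_add_le (by fun_prop) (by fun_prop))
      calc w ϖ * ‖lapInt a (T k) g ϖ‖ₑ ≤ w ϖ * (‖G ϖ‖ₑ + ‖G ϖ - lapInt a (T k) g ϖ‖ₑ) := by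
            gcongr
            have := enorm_sub_le (a := G ϖ) (b := G ϖ - lapInt a (T k) g ϖ)
            simpa using this
        _ ≤ _ := by rw [mul_add]; gcongr; exact hw1 ϖ
    have hfin : Tendsto (fun k => (l2 volume (fun ϖ => w ϖ * ‖G ϖ‖ₑ) +
        2 * l2 volume fun ϖ => ‖G ϖ - lapInt a (T k) g ϖ‖ₑ) ^ 2) atTop
        (𝓝 ((l2 volume (fun ϖ => w ϖ * ‖G ϖ‖ₑ) + 2 * 0) ^ 2)) :=
      ((continuous_pow 2).tendsto _).comp (tendsto_const_nhds.add (ENNReal.Tendsto.const_mul hl2 (by simp)))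
    have hgoal : ∫⁻ ϖ, ofReal (2 / (1 + |ϖ| / κ) ^ 2) * ‖G ϖ‖ₑ ^ 2 =
        (l2 volume (fun ϖ => w ϖ * ‖G ϖ‖ₑ) + 2 * 0) ^ 2 := by
      rw [mul_zero, add_zero, l2_sq]
      simp_rw [mul_pow, hw2]
    rw [hgoal, ← hfin.liminf_eq]
    refine le_trans ?_ (liminf_le_liminf (of_forall hqk2))
    rw [ENNReal.liminf_const_mul_of_ne_top ofReal_ne_top, dampE]
    gcongr
    calc _ = ∫⁻ s in Ioi (0 : ℝ), liminf (fun k => ‖qk k s‖ₑ ^ 2) atTop :=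
          setLIntegral_congr_fun measurableSet_Ioi fun s hs => (hlim s hs).liminf_eq.symm
      _ ≤ liminf (fun k => ∫⁻ s in Ioi (0 : ℝ), ‖qk k s‖ₑ ^ 2) atTop := lintegral_liminf_le fun k => (hqkm k).enorm.pow_const 2
      _ ≤ _ := liminf_le_liminf (.of_forall fun k => setLIntegral_le_lintegral _ _)

/-! ### The Laplace transform of functions of time and velocity -/

lemma eLpNorm_two_eq {X F : Type*} [MeasurableSpace X] [NormedAddCommGroup F] {μ : Measure X} (f : X → F) :
    eLpNorm f 2 μ = l2 μ fun x => ‖f x‖ₑ := by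
  rw [eLpNorm_eq_lintegral_rpow_enorm_toReal (by norm_num) (by norm_num)]
  simp [l2]

/-- The damped energy of a function of time and velocity. -/
def dampF (a : ℝ) (g : ℝ → E → ℝ) : ℝ≥0∞ :=
  ∫⁻ p, ofReal (exp (-(2 * a) * p.1)) * ‖g p.1 p.2‖ₑ ^ 2 ∂timeSpace

lemma measurable_damp (a : ℝ) {g : ℝ → E → ℝ} (hg : Measurable (uncurry g)) :
    Measurable fun p : ℝ × E => ofReal (exp (-(2 * a) * p.1)) * ‖g p.1 p.2‖ₑ ^ 2 :=
  Measurable.mul (by fun_prop) (hg.enorm.pow_const 2)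

lemma dampF_eq (a : ℝ) {g : ℝ → E → ℝ} (hg : Measurable (uncurry g)) :
    dampF a g = ∫⁻ v, dampE a fun t => g t v := by
  rw [dampF, timeSpace, lintegral_prod_symm' _ (measurable_damp a hg)]
  rfl

lemma measurable_dampE (a : ℝ) {g : ℝ → E → ℝ} (hg : Measurable (uncurry g)) :
    Measurable fun v => dampE a fun t => g t v :=
  (measurable_damp a hg).lintegral_prod_left'

lemma ae_dampE_lt_top {a : ℝ} {g : ℝ → E → ℝ} (hg : Measurable (uncurry g)) (hJ : dampF a g < ⊤) :
    ∀ᵐ v, dampE a (fun t => g t v) < ⊤ :=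
  ae_lt_top (measurable_dampE a hg) (by rw [← dampF_eq a hg]; exact hJ.ne)

lemma measurable_slice_time {g : ℝ → E → ℝ} (hg : Measurable (uncurry g)) (v : E) : Measurable fun t => g t v :=
  hg.comp measurable_prodMk_right

lemma measurable_lapInt (a T : ℝ) {g : ℝ → E → ℝ} (hg : Measurable (uncurry g)) :
    Measurable fun q : ℝ × E => lapInt a T (fun t => g t q.2) q.1 := by
  have h : StronglyMeasurable fun z : (ℝ × E) × ℝ => Complex.exp (-((a : ℂ) + z.1.1 * I) * z.2) * (g z.2 z.1.2 : ℂ) := by fun_prop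
  unfold lapInt intervalIntegral
  exact ((h.integral_prod_right' (ν := volume.restrict (Ioc 0 T))).sub
    (h.integral_prod_right' (ν := volume.restrict (Ioc T 0)))).measurable

/-- The energy of the truncation error. -/
lemma lintegral_lapInt_sub_le {a S : ℝ} (hS : 0 ≤ S) (hST : S ≤ T) {g : ℝ → E → ℝ} (hg : Measurable (uncurry g))
    (hJ : dampF a g < ⊤) :
    ∫⁻ q : ℝ × E, ‖lapInt a T (fun t => g t q.2) q.1 - lapInt a S (fun t => g t q.2) q.1‖ₑ ^ 2 ≤
      ofReal (2 * Real.pi) *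
        ∫⁻ p in Ioi S ×ˢ univ, ofReal (exp (-(2 * a) * p.1)) * ‖g p.1 p.2‖ₑ ^ 2 ∂timeSpace := by
  have hm := ((measurable_lapInt a T hg).sub (measurable_lapInt a S hg)).enorm.pow_const 2
  have e0 : ∫⁻ q : ℝ × E, ‖lapInt a T (fun t => g t q.2) q.1 - lapInt a S (fun t => g t q.2) q.1‖ₑ ^ 2 =
      ∫⁻ v, ∫⁻ ϖ, ‖lapInt a T (fun t => g t v) ϖ - lapInt a S (fun t => g t v) ϖ‖ₑ ^ 2 :=
    lintegral_prod_symm' _ hm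
  have e1 : timeSpace.restrict (Ioi S ×ˢ univ) = (volume.restrict (Ioi S)).prod (volume : Measure E) := by
    rw [timeSpace, ← prod_restrict, restrict_restrict measurableSet_Ioi, Measure.restrict_univ,
      inter_eq_left.2 (Ioi_subset_Ioi hS)]
  rw [e0, e1, lintegral_prod_symm' _ (measurable_damp a hg),
    ← lintegral_const_mul _ (measurable_damp a hg).lintegral_prod_left']
  refine lintegral_mono_ae ?_
  filter_upwards [ae_dampE_lt_top hg hJ] with v hv
  rw [lintegral_lapInt_sub hS hST (measurable_slice_time hg v) hv]
  exact mul_le_mul_right (lintegral_mono_set Ioc_subset_Ioi_self) _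

lemma exists_isLaplace {a : ℝ} {g : ℝ → E → ℝ} (hg : Measurable (uncurry g)) (hJ : dampF a g < ⊤) :
    ∃ G, IsLaplace a g G := by
  set L : ℝ → ℝ × E → ℂ := fun T q => lapInt a (max T 0) (fun t => g t q.2) q.1 with hL
  have hLm : ∀ T, Measurable (L T) := fun T => measurable_lapInt a _ hg
  set R : ℝ → ℝ≥0∞ := fun S => ofReal (2 * Real.pi) *
    ∫⁻ p in Ioi S ×ˢ univ, ofReal (exp (-(2 * a) * p.1)) * ‖g p.1 p.2‖ₑ ^ 2 ∂timeSpace with hR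
  have hb : ∀ S T, 0 ≤ S → S ≤ T → l2 volume (fun q => ‖L T q - L S q‖ₑ) ≤ R S ^ (1 / 2 : ℝ) := by
    intro S T hS hST
    have := lintegral_lapInt_sub_le hS hST hg hJ
    simp only [hL, l2, max_eq_left hS, max_eq_left (hS.trans hST)]
    exact rpow_le_rpow this (by norm_num)
  have hL0 : L 0 = 0 := by funext q; simp [hL, lapInt_zero]
  have hRtop : ∀ S, R S < ⊤ := fun S =>
    mul_lt_top ofReal_lt_top ((setLIntegral_le_lintegral _ _).trans_lt hJ)
  have hmem : ∀ T, MemLp (L T) 2 volume := by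
    intro T
    refine ⟨(hLm T).aestronglyMeasurable, ?_⟩
    rw [eLpNorm_two_eq]
    have h1 := hb 0 (max T 0) le_rfl (le_max_right _ _)
    simp only [hL0, Pi.zero_apply, sub_zero] at h1
    have e : L (max T 0) = L T := by funext q; simp [hL]
    rw [e] at h1
    exact h1.trans_lt (rpow_lt_top_of_nonneg (by norm_num) (hRtop 0).ne)
  have hR0 : Tendsto (fun S => R S ^ (1 / 2 : ℝ)) atTop (𝓝 0) := by
    have h1 : Tendsto R atTop (𝓝 0) := by
      have h2 : Tendsto (fun S : ℝ => ∫⁻ p, (Ioi S ×ˢ univ).indicator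
          (fun p : ℝ × E => ofReal (exp (-(2 * a) * p.1)) * ‖g p.1 p.2‖ₑ ^ 2) p ∂timeSpace) atTop
          (𝓝 (∫⁻ p : ℝ × E, 0 ∂timeSpace)) := by
        refine tendsto_lintegral_filter_of_dominated_convergence _ (of_forall fun S => ?_)
          (of_forall fun S => of_forall fun p => indicator_le_self _ _ p) hJ.ne
          (of_forall fun p => ?_)
        · exact (measurable_damp a hg).indicator (measurableSet_Ioi.prod MeasurableSet.univ)
        · refine tendsto_const_nhds.congr' ?_
          filter_upwards [eventually_ge_atTop p.1] with S hS
          rw [indicator_of_notMem]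
          simpa using hS
      rw [lintegral_zero] at h2
      have h3 := ENNReal.Tendsto.const_mul (a := ofReal (2 * Real.pi)) h2 (Or.inr ofReal_ne_top)
      rw [mul_zero] at h3
      refine h3.congr fun S => ?_
      rw [hR, lintegral_indicator (measurableSet_Ioi.prod MeasurableSet.univ)]
    simpa using h1.ennrpow_const (1 / 2)
  have hcau : CauchySeq fun T => (hmem T).toLp (L T) := by
    rw [EMetric.cauchySeq_iff]
    intro δ hδ
    obtain ⟨N, hN⟩ := (((tendsto_order.1 hR0).2 (δ / 2) (ENNReal.half_pos hδ.ne')).and (eventually_ge_atTop 0)).exists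
    have key : ∀ m, N ≤ m → edist ((hmem m).toLp (L m)) ((hmem N).toLp (L N)) < δ / 2 := fun m hm => by
      rw [Lp.edist_toLp_toLp, eLpNorm_two_eq]
      exact (hb N m hN.2 hm).trans_lt hN.1
    refine ⟨N, fun m hm k hk => (edist_triangle_right _ _ ((hmem N).toLp (L N))).trans_lt ?_⟩
    calc _ < δ / 2 + δ / 2 := ENNReal.add_lt_add (key m hm) (key k hk)
      _ = δ := ENNReal.add_halves δ
  obtain ⟨G, hG⟩ := cauchySeq_tendsto_of_complete hcau
  refine ⟨fun ϖ v => G (ϖ, v), hg.aestronglyMeasurable, hJ, (Lp.aestronglyMeasurable G), ?_⟩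
  rw [← Lp.toLp_coeFn G (Lp.memLp G), Lp.tendsto_Lp_iff_tendsto_eLpNorm''] at hG
  have h2 := (continuous_pow 2).tendsto 0 |>.comp hG
  rw [zero_pow (by norm_num)] at h2
  refine h2.congr' ?_
  filter_upwards [eventually_ge_atTop 0] with T hT
  simp only [Function.comp_def, eLpNorm_two_eq, l2_sq]
  refine lintegral_congr fun q => ?_
  rw [Pi.sub_apply, enorm_sub_rev]
  simp only [hL, max_eq_left hT]
  rfl

lemma IsLaplace.congr {a : ℝ} {g g' : ℝ → E → ℝ} {G : ℝ → E → ℂ} (h : IsLaplace a g G)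
    (hgg : uncurry g =ᵐ[timeSpace] uncurry g') : IsLaplace a g' G := by
  obtain ⟨h1, h2, h3, h4⟩ := h
  refine ⟨h1.congr hgg, ?_, h3, ?_⟩
  · refine lt_of_le_of_lt (le_of_eq (lintegral_congr_ae ?_)) h2
    filter_upwards [hgg] with p hp
    have : g p.1 p.2 = g' p.1 p.2 := hp
    rw [this]
  · have h5 : ∀ᵐ p : E × ℝ ∂((volume : Measure E).prod μ₊), g p.2 p.1 = g' p.2 p.1 :=
      measurePreserving_swap.quasiMeasurePreserving.ae hgg
    have h6 : ∀ᵐ q : ℝ × E, ∀ᵐ t ∂μ₊, g t q.2 = g' t q.2 :=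
      Measure.quasiMeasurePreserving_snd.ae (ae_ae_of_ae_prod h5)
    refine h4.congr' ?_
    filter_upwards [eventually_ge_atTop 0] with T hT
    refine lintegral_congr_ae ?_
    filter_upwards [h6] with q hq
    congr 3
    rw [intervalIntegral.integral_of_le hT, intervalIntegral.integral_of_le hT]
    refine setIntegral_congr_ae measurableSet_Ioc ?_
    filter_upwards [(ae_restrict_iff' measurableSet_Ioi).1 hq] with t ht htT
    rw [ht htT.1]

/-- Bounds for the Laplace transform along almost every velocity. -/
lemma IsLaplace.bounds {a : ℝ} (ha : 0 < a) {g : ℝ → E → ℝ} (hg : Measurable (uncurry g)) {G : ℝ → E → ℂ}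
    (h : IsLaplace a g G) : ∀ᵐ v, ∫⁻ ϖ, ‖G ϖ v‖ₑ ^ 2 ≤ ofReal (2 * Real.pi) * dampE a (fun t => g t v) ∧
      ∀ κ : ℝ, 0 < κ → ofReal (2 * Real.pi) * dampE a (timeAvg (2 * a) κ fun t => g t v) ≤
        ∫⁻ ϖ, ofReal (2 / (1 + |ϖ| / κ) ^ 2) * ‖G ϖ v‖ₑ ^ 2 := by
  obtain ⟨-, h2, h3, h4⟩ := h
  have hm : ∀ k : ℕ, AEMeasurable (fun q : ℝ × E => ‖G q.1 q.2 - lapInt a k (fun t => g t q.2) q.1‖ₑ ^ 2)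
      ((volume : Measure ℝ).prod (volume : Measure E)) := fun k =>
    (AEMeasurable.sub h3.aemeasurable (measurable_lapInt a k hg).aemeasurable).enorm.pow_const 2
  have h5 : Tendsto (fun k : ℕ => ∫⁻ v, ∫⁻ ϖ, ‖G ϖ v - lapInt a k (fun t => g t v) ϖ‖ₑ ^ 2) atTop (𝓝 0) := by
    refine (h4.comp tendsto_natCast_atTop_atTop).congr fun k => ?_
    exact lintegral_prod_symm _ (hm k)
  obtain ⟨φ, hφ, hae⟩ := exists_subseq_ae_tendsto (fun k => (hm k).lintegral_prod_left') h5
  have h3' : AEStronglyMeasurable (fun z : E × ℝ => G z.2 z.1) ((volume : Measure E).prod (volume : Measure ℝ)) :=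
    AEStronglyMeasurable.prod_swap (f := uncurry G) h3
  filter_upwards [hae, ae_dampE_lt_top hg h2, h3'.prodMk_left] with v hv hv2 hv3
  exact scalar_laplace_bounds ha (measurable_slice_time hg v) hv2 hv3.aemeasurable (T := fun k => (φ k : ℝ))
    (fun k => Nat.cast_nonneg _) (tendsto_natCast_atTop_atTop.comp hφ.tendsto_atTop) hv

lemma isLaplace_laplace {a : ℝ} {g g' : ℝ → E → ℝ} (hg : Measurable (uncurry g)) (hJ : dampF a g < ⊤)
    (hgg : ∀ᵐ t ∂μ₊, g t = g' t) : IsLaplace a g (laplace a g') := by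
  have h1 : uncurry g =ᵐ[timeSpace] uncurry g' := by
    have : ∀ᵐ p : ℝ × E ∂timeSpace, g p.1 = g' p.1 := quasiMeasurePreserving_fst.ae hgg
    filter_upwards [this] with p hp
    exact congrFun hp p.2
  obtain ⟨G, hG⟩ := exists_isLaplace hg hJ
  have h2 : ∃ G, IsLaplace a g' G := ⟨G, hG.congr h1⟩
  rw [laplace, dif_pos h2]
  exact h2.choose_spec.congr h1.symm

/-! ### The dissipation -/

lemma norm_proj_le (v : E) (W : EuclideanSpace ℂ (Fin 3)) : ‖proj v W‖ ≤ 3 * ‖W‖ := by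
  by_cases hv : v = 0
  · have : proj v W = 0 := by ext i; simp [proj, hv]
    rw [this, norm_zero]; positivity
  have hv0 : 0 < ‖v‖ := norm_pos_iff.2 hv
  set c : ℂ := (∑ j, (v j : ℂ) * W j) / ((‖v‖ ^ 2 : ℝ) : ℂ) with hc
  have h1 : ‖proj v W‖ = ‖c‖ * ‖v‖ := by
    rw [EuclideanSpace.norm_eq, EuclideanSpace.norm_eq]
    simp only [proj, ← hc, norm_mul, mul_pow, ← mul_sum, norm_real]
    rw [sqrt_mul (by positivity), Real.sqrt_sq (norm_nonneg _)]
  have h2 : ‖∑ j, (v j : ℂ) * W j‖ ≤ 3 * (‖v‖ * ‖W‖) := by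
    refine (norm_sum_le _ _).trans ?_
    refine (Finset.sum_le_card_nsmul _ _ (‖v‖ * ‖W‖) fun j _ => ?_).trans (by simp)
    rw [norm_mul, norm_real]
    exact mul_le_mul (PiLp.norm_apply_le v j) (PiLp.norm_apply_le W j) (norm_nonneg _) (norm_nonneg _)
  rw [h1, hc, norm_div, norm_real, norm_of_nonneg (by positivity), div_mul_eq_mul_div, div_le_iff₀ (by positivity)]
  nlinarith

lemma aniso_le (v : E) (W : EuclideanSpace ℂ (Fin 3)) : aniso v W ≤ 7 * ‖W‖ := by
  have h1 := norm_proj_le v W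
  have h2 := norm_sub_le W (proj v W)
  have h3 : ‖proj v W‖ / (1 + ‖v‖) ≤ ‖proj v W‖ := div_le_self (norm_nonneg _) (by linarith [norm_nonneg v])
  rw [aniso]; linarith

lemma le_aniso (v : E) (W : EuclideanSpace ℂ (Fin 3)) : ‖W‖ / (1 + ‖v‖) ≤ aniso v W := by
  have h1 : ‖W‖ ≤ ‖W - proj v W‖ + ‖proj v W‖ := by simpa using norm_add_le (W - proj v W) (proj v W)
  have h3 : ‖W - proj v W‖ / (1 + ‖v‖) ≤ ‖W - proj v W‖ := div_le_self (norm_nonneg _) (by linarith [norm_nonneg v])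
  have h4 : ‖W‖ / (1 + ‖v‖) ≤ (‖W - proj v W‖ + ‖proj v W‖) / (1 + ‖v‖) := by gcongr
  rw [add_div] at h4
  rw [aniso]; linarith

lemma wα_nonneg (z : ℂ) (v : E) : 0 ≤ wα z v := by unfold wα; positivity

lemma C₂_nonneg (z : ℂ) (v : E) : 0 ≤ C₂ z v := by unfold C₂ wα wβ; positivity

lemma B₁_nonneg (z : ℂ) (v : E) (W : EuclideanSpace ℂ (Fin 3)) : 0 ≤ B₁ z v W W := by
  have := C₂_nonneg z v
  have : 0 ≤ C₁ z v := by unfold C₁ wα; positivity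
  have : 0 ≤ aniso v W := by unfold aniso; positivity
  unfold B₁; positivity

lemma B₁_le (z : ℂ) (v : E) (W : EuclideanSpace ℂ (Fin 3)) : B₁ z v W W ≤ (58 + 9 * |z.re|) * ‖W‖ ^ 2 := by
  have ha := wα_nonneg z v
  have hv := norm_nonneg v
  have h1 : C₁ z v ≤ 1 := by
    rw [C₁, div_le_one (by positivity)]
    exact one_le_mul_of_one_le_of_one_le (by linarith) (one_le_pow₀ (by linarith))
  have h2 : C₂ z v ≤ 1 + |z.re| := by
    have hb : wβ z v ≤ |z.re| := div_le_self (abs_nonneg _) (by linarith)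
    rw [C₂, div_le_iff₀ (by positivity)]
    have h5 : (1 + wα z v) ^ 4 ≤ (1 + ‖v‖) * (1 + wα z v) ^ 4 := le_mul_of_one_le_left (by positivity) (by linarith)
    have h6 : 1 + wα z v ^ 2 ≤ (1 + wα z v) ^ 4 := by nlinarith [pow_nonneg ha 3, pow_nonneg ha 4, sq_nonneg (wα z v)]
    have h7 : 0 ≤ |z.re| := abs_nonneg _
    nlinarith [sq_nonneg (wα z v)]
  have h3 : aniso v W ^ 2 ≤ 49 * ‖W‖ ^ 2 := by
    have h0 : 0 ≤ aniso v W := by unfold aniso; positivity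
    nlinarith [aniso_le v W, norm_nonneg W]
  have h4 : ‖proj v W‖ ^ 2 ≤ 9 * ‖W‖ ^ 2 := by nlinarith [norm_proj_le v W, norm_nonneg W, norm_nonneg (proj v W)]
  have h7 : 0 ≤ |z.re| := abs_nonneg _
  calc B₁ z v W W = C₁ z v * aniso v W ^ 2 + C₂ z v * ‖proj v W‖ ^ 2 := by rw [B₁]; ring
    _ ≤ 1 * (49 * ‖W‖ ^ 2) + (1 + |z.re|) * (9 * ‖W‖ ^ 2) := by gcongr
    _ = _ := by ring

lemma le_B₁ (z : ℂ) (v : E) (W : EuclideanSpace ℂ (Fin 3)) :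
    ((1 + ‖v‖) ^ 3)⁻¹ * (((1 + wα z v) ^ 2)⁻¹ * ‖W‖ ^ 2) ≤ B₁ z v W W := by
  have ha := wα_nonneg z v
  have h1 : 0 ≤ C₂ z v * ‖proj v W‖ * ‖proj v W‖ := by have := C₂_nonneg z v; positivity
  have h2 : (‖W‖ / (1 + ‖v‖)) ^ 2 ≤ aniso v W ^ 2 := by gcongr; exact le_aniso v W
  have h3 : 0 ≤ C₁ z v := by unfold C₁; positivity
  calc _ = C₁ z v * (‖W‖ / (1 + ‖v‖)) ^ 2 := by rw [C₁]; field_simp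
    _ ≤ C₁ z v * aniso v W ^ 2 := by gcongr
    _ ≤ _ := by rw [B₁]; nlinarith

lemma measurable_proj : Measurable fun q : E × EuclideanSpace ℂ (Fin 3) => proj q.1 q.2 := by
  unfold proj
  refine (MeasurableEquiv.toLp 2 (Fin 3 → ℂ)).measurable.comp (measurable_pi_lambda _ fun i => ?_)
  have h1 : ∀ j : Fin 3, Measurable fun q : E × EuclideanSpace ℂ (Fin 3) => ((q.1 j : ℝ) : ℂ) := fun j => by fun_prop
  have h2 : ∀ j : Fin 3, Measurable fun q : E × EuclideanSpace ℂ (Fin 3) => q.2 j := fun j => by fun_prop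
  have h3 : Measurable fun q : E × EuclideanSpace ℂ (Fin 3) => ((‖q.1‖ ^ 2 : ℝ) : ℂ) := by fun_prop
  exact ((Finset.measurable_fun_sum _ fun j _ => (h1 j).mul (h2 j)).div h3).mul (h1 i)

lemma measurable_B₁ (ε a : ℝ) : Measurable fun q : (ℝ × E) × EuclideanSpace ℂ (Fin 3) =>
    B₁ ((ε : ℂ) * ((a : ℂ) + q.1.1 * I)) q.1.2 q.2 q.2 := by
  have h1 : Measurable fun q : (ℝ × E) × EuclideanSpace ℂ (Fin 3) => proj q.1.2 q.2 :=
    Measurable.comp (f := fun q : (ℝ × E) × EuclideanSpace ℂ (Fin 3) => (q.1.2, q.2)) measurable_proj (by fun_prop)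
  have h2 : Measurable fun q : (ℝ × E) × EuclideanSpace ℂ (Fin 3) => aniso q.1.2 q.2 := by
    unfold aniso
    exact ((measurable_snd.sub h1).norm).add (h1.norm.div (by fun_prop))
  unfold B₁ C₁ C₂ wα wβ
  fun_prop

section bound

variable {η : E → ℝ} {γ ε A : ℝ} {α : MIdx} {u : MIdx → ℝ → E → ℝ} {Z : Fin 3 → ℝ → E → ℝ}

lemma norm_gradLaplace_sq (ϖ : ℝ) (v : E) :
    ‖gradLaplace η γ A α u ϖ v‖ₑ ^ 2 = ∑ i, ‖laplace (A / 2) (fun t => mgrad η γ i (u α t)) ϖ v‖ₑ ^ 2 := by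
  have h := EuclideanSpace.norm_sq_eq (gradLaplace η γ A α u ϖ v)
  have e : ∀ {F : Type} [NormedAddCommGroup F] (x : F), ‖x‖ₑ ^ 2 = ofReal (‖x‖ ^ 2) := fun x => by
    rw [← ofReal_norm, ofReal_pow (norm_nonneg _)]
  rw [e, h, ENNReal.ofReal_sum_of_nonneg fun i _ => by positivity]
  simp only [e]
  rfl

/-- The time averages are controlled by the dissipation. -/
lemma timeAvg_le_dissipation (hε : 0 < ε) (hA : 0 < A) (hZ : ∀ i, Measurable (uncurry (Z i)))
    (hZu : ∀ i, ∀ᵐ t ∂μ₊, Z i t = mgrad η γ i (u α t))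
    (hfin : ∀ i, ∫⁻ v, ofReal (lam v) * dampE (A / 2) (fun t => Z i t v) < ⊤) :
    ∀ i, ∫⁻ v, ofReal (lam v * ((1 + ‖v‖) ^ 3)⁻¹) *
      dampE (A / 2) (timeAvg A ((1 + ‖v‖) / ε) fun t => Z i t v) ≤ ofReal (dissipation η γ ε A α u) := by
  set G : Fin 3 → ℝ → E → ℂ := fun i => laplace (A / 2) (fun t => mgrad η γ i (u α t)) with hG
  have hfin' : ∀ i, dampF (A / 2) (Z i) < ⊤ := fun i => by
    rw [dampF_eq _ (hZ i)]
    exact (lintegral_mono fun v => le_mul_of_one_le_left' (one_le_ofReal.2 (Real.one_le_exp (norm_nonneg v)))).trans_lt (hfin i)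
  have hLap : ∀ i, IsLaplace (A / 2) (Z i) (G i) := fun i => isLaplace_laplace (hZ i) (hfin' i) (hZu i)
  have hbd := fun i => (hLap i).bounds (half_pos hA) (hZ i)
  have hGm : ∀ i, AEMeasurable (fun q : ℝ × E => G i q.1 q.2) volume := fun i => (hLap i).2.2.1.aemeasurable
  have hWm : AEMeasurable (fun q : ℝ × E => gradLaplace η γ A α u q.1 q.2) volume :=
    (MeasurableEquiv.toLp 2 (Fin 3 → ℂ)).measurable.comp_aemeasurable (aemeasurable_pi_lambda _ hGm)
  set F : ℝ × E → ℝ := fun q => B₁ ((ε : ℂ) * (((A / 2 : ℝ) : ℂ) + q.1 * I)) q.2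
    (gradLaplace η γ A α u q.1 q.2) (gradLaplace η γ A α u q.1 q.2) * lam q.2 with hF
  have hF0 : ∀ q, 0 ≤ F q := fun q => mul_nonneg (B₁_nonneg _ _ _) (lam_pos _).le
  have hFm : AEMeasurable F volume :=
    ((measurable_B₁ ε (A / 2)).comp_aemeasurable (aemeasurable_id.prodMk hWm)).mul
      (continuous_lam.measurable.comp measurable_snd).aemeasurable
  have hwm : Measurable fun v : E => ofReal (lam v) := continuous_lam.measurable.ennreal_ofReal
  have hGfin : ∀ i, ∫⁻ q : ℝ × E, ofReal (lam q.2) * ‖G i q.1 q.2‖ₑ ^ 2 < ⊤ := fun i => by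
    have hm : AEMeasurable (fun q : ℝ × E => ofReal (lam q.2) * ‖G i q.1 q.2‖ₑ ^ 2)
      ((volume : Measure ℝ).prod (volume : Measure E)) := (hwm.comp measurable_snd).aemeasurable.mul ((hGm i).enorm.pow_const 2)
    rw [volume_eq_prod, lintegral_prod_symm _ hm]
    have h0 := mul_lt_top (ofReal_lt_top (r := 2 * Real.pi)) (hfin i)
    rw [← lintegral_const_mul' _ _ ofReal_ne_top] at h0
    refine (lintegral_mono_ae ((hbd i).mono fun v hv => ?_)).trans_lt h0
    dsimp only
    rw [lintegral_const_mul' _ _ ofReal_ne_top, mul_left_comm]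
    gcongr
    exact hv.1
  have hFi : Integrable F volume := by
    refine ⟨hFm.aestronglyMeasurable, ?_⟩
    have h1 : ∀ q, ‖F q‖ₑ ≤ ofReal (58 + 9 * |ε * (A / 2)|) * ∑ i, ofReal (lam q.2) * ‖G i q.1 q.2‖ₑ ^ 2 := by
      intro q
      have h2 := B₁_le ((ε : ℂ) * (((A / 2 : ℝ) : ℂ) + q.1 * I)) q.2 (gradLaplace η γ A α u q.1 q.2)
      rw [show ((ε : ℂ) * (((A / 2 : ℝ) : ℂ) + q.1 * I)).re = ε * (A / 2) by simp] at h2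
      rw [enorm_eq_ofReal (hF0 q), ← mul_sum, ← norm_gradLaplace_sq, ← ofReal_norm,
        ← ofReal_pow (norm_nonneg _), ← ofReal_mul (lam_pos _).le, ← ofReal_mul (by positivity)]
      exact ofReal_le_ofReal ((mul_le_mul_of_nonneg_right h2 (lam_pos q.2).le).trans_eq (by ring))
    refine (lintegral_mono h1).trans_lt ?_
    rw [lintegral_const_mul' _ _ ofReal_ne_top, lintegral_finsetSum' _ fun i _ => ?_]
    · exact mul_lt_top ofReal_lt_top (sum_lt_top.2 fun i _ => hGfin i)
    · exact (hwm.comp measurable_snd).aemeasurable.mul ((hGm i).enorm.pow_const 2)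
  have hD : dissipation η γ ε A α u = ∫ q, F q :=
    (integral_prod F (μ := (volume : Measure ℝ)) (ν := (volume : Measure E)) hFi).symm
  rw [hD, ofReal_integral_eq_lintegral_ofReal hFi (of_forall hF0), volume_eq_prod, lintegral_prod_symm _ hFm.ennreal_ofReal]
  refine fun i => lintegral_mono_ae ((hbd i).mono fun v hv => ?_)
  have hκ : 0 < (1 + ‖v‖) / ε := by positivity
  have h1 := hv.2 _ hκ
  rw [mul_div_cancel₀ A two_ne_zero] at h1
  have h2 : dampE (A / 2) (timeAvg A ((1 + ‖v‖) / ε) fun t => Z i t v) ≤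
      ∫⁻ ϖ, ofReal ((1 + |ϖ| / ((1 + ‖v‖) / ε)) ^ 2)⁻¹ * ‖G i ϖ v‖ₑ ^ 2 := by
    refine (ENNReal.mul_le_mul_iff_right (a := ofReal 2) (by simp) ofReal_ne_top).1
      ((mul_le_mul_left (ofReal_le_ofReal (by nlinarith [Real.pi_gt_three])) _).trans (h1.trans_eq ?_))
    rw [← lintegral_const_mul' _ _ ofReal_ne_top]
    congr 1 with ϖ
    rw [← mul_assoc, ← ofReal_mul (by norm_num), ← div_eq_mul_inv]
  refine (mul_le_mul_right h2 _).trans ?_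
  rw [← lintegral_const_mul' _ _ ofReal_ne_top]
  refine lintegral_mono fun ϖ => ?_
  have h4 : ‖G i ϖ v‖ₑ ^ 2 ≤ ofReal (‖gradLaplace η γ A α u ϖ v‖ ^ 2) := by
    rw [ofReal_pow (norm_nonneg _), ofReal_norm, norm_gradLaplace_sq]
    exact single_le_sum (f := fun i => ‖G i ϖ v‖ₑ ^ 2) (fun _ _ => bot_le) (Finset.mem_univ i)
  refine (mul_le_mul_right (mul_le_mul_right h4 _) _).trans ?_
  rw [← ofReal_mul (by positivity), ← ofReal_mul (by have := lam_pos v; positivity)]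
  refine ofReal_le_ofReal ?_
  have h5 := le_B₁ ((ε : ℂ) * (((A / 2 : ℝ) : ℂ) + ϖ * I)) v (gradLaplace η γ A α u ϖ v)
  have hw : wα ((ε : ℂ) * (((A / 2 : ℝ) : ℂ) + ϖ * I)) v = |ϖ| / ((1 + ‖v‖) / ε) := by
    rw [wα, show ((ε : ℂ) * (((A / 2 : ℝ) : ℂ) + ϖ * I)).im = ε * ϖ by simp, abs_mul, abs_of_pos hε]; field_simp
  rw [hw] at h5
  exact (mul_le_mul_of_nonneg_right h5 (lam_pos v).le).trans_eq' (by ring)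

end bound

/-! ### Functions of time with a weak derivative -/

/-- A function on the half line with an integrable weak derivative that vanishes for large times:
the square is the integral of the derivative of the square. -/
lemma sq_eq_of_weak_deriv {F G : ℝ → ℝ} (hT : 0 ≤ T) (hF : ∀ b, IntegrableOn F (Ioc 0 b)) (hG : ∀ b, IntegrableOn G (Ioc 0 b))
    (h0 : ∀ᵐ t, T < t → F t = 0)
    (hw : ∀ χ : ℝ → ℝ, ContDiff ℝ ∞ χ → HasCompactSupport χ → tsupport χ ⊆ Ioi 0 →
      ∫ t in Ioi (0 : ℝ), F t * deriv χ t = -∫ t in Ioi (0 : ℝ), G t * χ t) :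
    ∀ᵐ t, 0 < t → F t ^ 2 = -2 * ∫ s in Ioi t, F s * G s := by
  set b : ContDiffBump (0 : ℝ) := ⟨T + 1, T + 2, by positivity, by linarith⟩
  have hT2 : 0 ≤ T + 2 := by positivity
  have hζ0 : ∀ t, T + 2 ≤ t → b t = 0 := fun t ht =>
    b.zero_of_le_dist (by rw [Real.dist_eq, sub_zero]; exact ht.trans (le_abs_self t))
  have hζ1 : ∀ t ∈ Icc (0 : ℝ) (T + 1), b t = 1 := fun t ht =>
    b.one_of_mem_closedBall (by rw [Metric.mem_closedBall, Real.dist_eq, sub_zero, abs_of_nonneg ht.1]; exact ht.2)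
  have hcut : ∀ {h : ℝ → ℝ}, (∀ᵐ t, T + 2 < t → h t = 0) → ∀ t ≤ T + 2, ∫ s in Ioi t, h s = ∫ s in t..(T + 2), h s := by
    intro h hh t ht
    rw [intervalIntegral.integral_of_le ht]
    refine setIntegral_eq_of_subset_of_ae_sdiff_eq_zero nullMeasurableSet_Ioi Ioc_subset_Ioi_self ?_
    filter_upwards [hh] with s hs hst
    exact hs (not_le.1 fun h => hst.2 ⟨hst.1, h⟩)
  set g : ℝ → ℝ := (Ioc 0 (T + 2)).indicator fun t => G t * b t with hg
  have hgi : Integrable g := (integrable_indicator_iff measurableSet_Ioc).2 <|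
    (hG (T + 2)).mul_bdd (c := 1) b.continuous.aestronglyMeasurable (.of_forall fun t => by
      rw [norm_of_nonneg b.nonneg]; exact b.le_one)
  set f : ℝ → ℝ := fun x => ∫ s in (T + 2)..x, g s
  have hfc : Continuous f := intervalIntegral.continuous_primitive (fun _ _ => hgi.intervalIntegrable) _
  have hac : ∀ t, AbsolutelyContinuousOnInterval f t (T + 2) := fun t =>
    hgi.intervalIntegrable.absolutelyContinuousOnInterval_intervalIntegral right_mem_uIcc
  have hfd : ∀ᵐ t, deriv f t = g t := by
    filter_upwards [LocallyIntegrable.ae_hasDerivAt_integral hgi.locallyIntegrable] with t ht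
    exact (ht _).deriv
  have hf2 : f (T + 2) = 0 := intervalIntegral.integral_same
  have hf0 : ∀ t, T + 2 < t → f t = 0 := fun t ht => intervalIntegral.integral_zero_ae <| .of_forall fun s hs => by
    rw [uIoc_of_le ht.le] at hs
    simp [hg, hs.1]
  have hFf : ∀ᵐ t, t ∈ Ioi (0 : ℝ) → F t - f t = 0 := by
    refine isOpen_Ioi.ae_eq_zero_of_integral_contDiff_smul_eq_zero (LocallyIntegrableOn.sub ?_
      (hfc.locallyIntegrable.locallyIntegrableOn _)) fun φ hφ hφc hφs => ?_
    · rw [locallyIntegrableOn_iff isOpen_Ioi.isLocallyClosed]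
      intro K hK hKc
      obtain ⟨B, hB⟩ := hKc.bddAbove
      exact (hF B).mono_set fun t ht => ⟨hK ht, hB ht⟩
    set χ : ℝ → ℝ := fun t => ∫ s in (0 : ℝ)..t, φ s
    have hφI : ∀ x y, IntervalIntegrable φ volume x y := hφ.continuous.intervalIntegrable
    have hχd : ∀ t, HasDerivAt χ (φ t) t := fun t => intervalIntegral.integral_hasDerivAt_right (hφI _ _)
      (hφ.continuous.stronglyMeasurableAtFilter _ _) hφ.continuous.continuousAt
    have hχs : ContDiff ℝ ∞ χ := contDiff_infty_iff_deriv.2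
      ⟨fun t => (hχd t).differentiableAt, by rwa [show deriv χ = φ from funext fun t => (hχd t).deriv]⟩
    obtain ⟨a, ha, haφ⟩ : ∃ a > 0, ∀ t < a, φ t = 0 := by
      by_cases he : (tsupport φ).Nonempty
      · obtain ⟨a, ha, hmin⟩ := hφc.isCompact.exists_isMinOn he continuous_id.continuousOn
        exact ⟨a, hφs ha, fun t ht => image_eq_zero_of_notMem_tsupport fun h => absurd (hmin h) (not_le.2 ht)⟩
      · exact ⟨1, one_pos, fun t _ => image_eq_zero_of_notMem_tsupport fun h => he ⟨t, h⟩⟩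
    have hχa : ∀ t < a, χ t = 0 := fun t ht =>
      intervalIntegral.integral_zero_ae (.of_forall fun s hs => haφ s (hs.2.trans_lt (max_lt ha ht)))
    have h1 := hw (fun t => χ t * b t) (hχs.mul b.contDiff) b.hasCompactSupport.mul_left (by
      refine (closure_minimal (fun t ht => ?_) isClosed_Ici).trans (Ici_subset_Ioi.2 ha)
      by_contra hlt
      exact ht (by simp [hχa t (not_le.1 hlt)]))
    have h2 : ∫ t in Ioi (0 : ℝ), F t * deriv (fun t => χ t * b t) t = ∫ t in (0 : ℝ)..(T + 2), φ t * F t := by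
      rw [← hcut (h0.mono fun t ht h => by rw [ht (by linarith), mul_zero]) 0 hT2]
      refine setIntegral_congr_ae measurableSet_Ioi ?_
      filter_upwards [h0] with t ht ht0
      rcases le_or_gt t T with h | h
      · have hev : (fun t => χ t * b t) =ᶠ[𝓝 t] χ := by
          filter_upwards [isOpen_Ioo.mem_nhds (show t ∈ Ioo 0 (T + 1) from ⟨ht0, by linarith⟩)] with s hs
          rw [hζ1 s ⟨hs.1.le, hs.2.le⟩, mul_one]
        rw [hev.deriv_eq, (hχd t).deriv, mul_comm]
      · rw [ht h]; simp
    have h3 : ∫ t in Ioi (0 : ℝ), G t * (χ t * b t) = ∫ t in (0 : ℝ)..(T + 2), χ t * deriv f t := by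
      rw [hcut (.of_forall fun t ht => by rw [hζ0 t ht.le]; ring) 0 hT2]
      refine intervalIntegral.integral_congr_ae ?_
      filter_upwards [hfd] with t ht hts
      rw [uIoc_of_le hT2] at hts
      rw [ht, hg, indicator_of_mem hts]; ring
    have hχac : AbsolutelyContinuousOnInterval χ 0 (T + 2) :=
      (hφI _ _).absolutelyContinuousOnInterval_intervalIntegral left_mem_uIcc
    rw [h2, h3, hχac.integral_mul_deriv_eq_deriv_mul (hac 0), hf2, show χ 0 = 0 from intervalIntegral.integral_same] at h1
    have i1 : IntervalIntegrable (fun t => φ t * F t) volume 0 (T + 2) :=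
      ((intervalIntegrable_iff_integrableOn_Ioc_of_le hT2).2 (hF _)).continuousOn_mul hφ.continuous.continuousOn
    rw [← setIntegral_eq_integral_of_forall_compl_eq_zero (s := Ioi 0) fun t ht => by
        rw [haφ t ((not_lt.1 ht).trans_lt ha), zero_smul],
      hcut (h0.mono fun t ht h => by rw [ht (by linarith), hf0 t h]; simp) 0 hT2]
    simp only [smul_eq_mul, mul_sub, (hχd _).deriv] at h1 ⊢
    have i2 : IntervalIntegrable (fun t => φ t * f t) volume 0 (T + 2) := (hφ.continuous.mul hfc).intervalIntegrable _ _
    rw [intervalIntegral.integral_sub i1 i2, h1]; ring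
  filter_upwards [hFf] with t ht ht0
  rw [sub_eq_zero.1 (ht ht0)]
  rcases le_or_gt t (T + 2) with htT | htT
  · have h1 := (hac t).integral_deriv_mul_eq_sub (hac t)
    rw [hf2, intervalIntegral.integral_congr_ae (g := fun s => 2 * (F s * G s)), intervalIntegral.integral_const_mul,
      ← hcut (h0.mono fun t ht h => by rw [ht (by linarith), zero_mul]) t htT] at h1
    · linarith
    filter_upwards [hfd, hFf, h0] with s hs1 hs2 hs3 hts
    rw [uIoc_of_le htT] at hts
    have hs0 : 0 < s := ht0.trans hts.1
    rw [hs1, ← sub_eq_zero.1 (hs2 hs0)]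
    rcases le_or_gt s T with h | h
    · rw [hg, indicator_of_mem (show s ∈ Ioc 0 (T + 2) from ⟨hs0, hts.2⟩), hζ1 s ⟨hs0.le, by linarith⟩]; ring
    · rw [hs3 h]; ring
  · rw [hf0 t htT, setIntegral_congr_ae (g := fun _ => 0) measurableSet_Ioi]
    · simp
    · filter_upwards [h0] with s hs hst
      rw [hs (by linarith [mem_Ioi.1 hst]), zero_mul]

/-! ### A smooth weight and the pairing estimate -/

/-- A smooth weight comparable to `lamT`. -/
def wS (v : E) : ℝ := exp (√(1 + ‖v‖ ^ 2)) / √(1 + ‖v‖ ^ 2)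

lemma wS_bounds (v : E) : lamT v ≤ wS v ∧ wS v ≤ 4 * lamT v := by
  have hv := norm_nonneg v
  set r := √(1 + ‖v‖ ^ 2) with hr
  have hr2 : r ^ 2 = 1 + ‖v‖ ^ 2 := sq_sqrt (by positivity)
  have hr0 : 0 < r := sqrt_pos.2 (by positivity)
  have h1 : ‖v‖ ≤ r := by nlinarith
  have h2 : r ≤ 1 + ‖v‖ := by nlinarith
  have h3 : 1 + ‖v‖ ≤ 1.42 * r := by nlinarith [sq_nonneg (1 - ‖v‖)]
  unfold lamT wS
  constructor
  · exact div_le_div₀ (exp_pos _).le (exp_le_exp.2 h1) hr0 h2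
  · rw [← hr, div_le_iff₀ hr0, mul_div_assoc', div_mul_eq_mul_div, le_div_iff₀ (by positivity)]
    have h4 : exp r ≤ 2.7183 * exp ‖v‖ := by
      refine (exp_le_exp.2 h2).trans ?_
      rw [exp_add]
      exact mul_le_mul_of_nonneg_right (by linarith [Real.exp_one_lt_d9]) (exp_pos _).le
    have h5 := exp_pos ‖v‖
    calc exp r * (1 + ‖v‖) ≤ (2.7183 * exp ‖v‖) * (1.42 * r) := by gcongr
      _ ≤ _ := by nlinarith [mul_pos h5 hr0]

lemma wS_pos (v : E) : 0 < wS v := (lamT_pos v).trans_le (wS_bounds v).1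

lemma hasFDerivAt_wS (v : E) : ∃ c : ℝ, |c| ≤ wS v ∧ HasFDerivAt wS ((c / √(1 + ‖v‖ ^ 2)) • (innerSL ℝ v : E →L[ℝ] ℝ)) v := by
  have hr0 : 0 < √(1 + ‖v‖ ^ 2) := sqrt_pos.2 (by positivity)
  have hr1 : 1 ≤ √(1 + ‖v‖ ^ 2) := one_le_sqrt.2 (by nlinarith [sq_nonneg ‖v‖])
  have h1 : HasFDerivAt (fun w : E => √(1 + ‖w‖ ^ 2)) _ v :=
    (((hasFDerivAt_id v).norm_sq).const_add 1).sqrt (by positivity)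
  have h2 : HasDerivAt (fun r : ℝ => exp r / r)
      ((exp √(1 + ‖v‖ ^ 2) * √(1 + ‖v‖ ^ 2) - exp √(1 + ‖v‖ ^ 2) * 1) / √(1 + ‖v‖ ^ 2) ^ 2) √(1 + ‖v‖ ^ 2) :=
    (Real.hasDerivAt_exp _).div (hasDerivAt_id _) hr0.ne'
  refine ⟨(exp √(1 + ‖v‖ ^ 2) * √(1 + ‖v‖ ^ 2) - exp √(1 + ‖v‖ ^ 2) * 1) / √(1 + ‖v‖ ^ 2) ^ 2, ?_, ?_⟩
  · have h3 := exp_pos √(1 + ‖v‖ ^ 2)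
    rw [wS, abs_of_nonneg (div_nonneg (by nlinarith) (by positivity)), div_le_div_iff₀ (by positivity) hr0]
    nlinarith [mul_pos h3 hr0]
  · refine (h2.comp_hasFDerivAt v h1).congr_fderiv ?_
    ext w
    simp
    ring

lemma differentiable_wS : Differentiable ℝ wS := fun v =>
  let ⟨_, _, h⟩ := hasFDerivAt_wS v
  h.differentiableAt

@[fun_prop]
lemma continuous_wS : Continuous wS := differentiable_wS.continuous

lemma abs_pd_wS_le (l : Fin 3) (v : E) : |pd l wS v| ≤ wS v := by
  obtain ⟨c, hc, h⟩ := hasFDerivAt_wS v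
  have hr0 : 0 < √(1 + ‖v‖ ^ 2) := sqrt_pos.2 (by positivity)
  have e : pd l wS v = c * (v l / √(1 + ‖v‖ ^ 2)) := by
    rw [pd, h.fderiv]
    simp [inner_basisVec]; ring
  have h1 : |v l / √(1 + ‖v‖ ^ 2)| ≤ 1 := by
    rw [abs_div, abs_of_pos hr0, div_le_one hr0]
    refine (PiLp.norm_apply_le v l).trans (Real.le_sqrt_of_sq_le (by linarith))
  rw [e, abs_mul]
  calc |c| * _ ≤ |c| * 1 := by gcongr
    _ ≤ _ := by rw [mul_one]; exact hc

lemma lintegral_wS_mul_le (hp : Measurable p) (hq : Measurable q) {w : E → ℝ} (hw : ∀ v, |w v| ≤ wS v) :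
    ∫⁻ v, ‖w v * p v * q v‖ₑ ≤ 4 * (wl2 lamT p * wl2 lamT q) := by
  have hm := measurable_ofReal_sqrt continuous_lamT
  have h1 := lintegral_mul_le_l2 (μ := (volume : Measure E)) (hm.mul hp.enorm).aemeasurable (hm.mul hq.enorm).aemeasurable
  refine le_trans ?_ (mul_le_mul_right h1 4)
  rw [← lintegral_const_mul' _ _ (by norm_num)]
  refine lintegral_mono fun v => ?_
  have h2 : ‖w v‖ₑ ≤ 4 * (ofReal (√(lamT v)) * ofReal (√(lamT v))) := by
    rw [← ofReal_mul (sqrt_nonneg _), Real.mul_self_sqrt (lamT_pos v).le,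
      show (4 : ℝ≥0∞) = ofReal 4 by simp, ← ofReal_mul (by norm_num), ← ofReal_norm]
    exact ofReal_le_ofReal ((hw v).trans (wS_bounds v).2)
  rw [enorm_mul, enorm_mul]
  simp only [Pi.mul_apply]
  calc ‖w v‖ₑ * ‖p v‖ₑ * ‖q v‖ₑ ≤ 4 * (ofReal (√(lamT v)) * ofReal (√(lamT v))) * ‖p v‖ₑ * ‖q v‖ₑ := by gcongr
    _ = _ := by ring

lemma integrable_wS_mul (hp : Measurable p) (hq : Measurable q) {w : E → ℝ} (hwm : Measurable w)
    (hw : ∀ v, |w v| ≤ wS v) (hp2 : wl2 lamT p < ⊤) (hq2 : wl2 lamT q < ⊤) : Integrable fun v => w v * p v * q v :=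
  ⟨((hwm.mul hp).mul hq).aestronglyMeasurable,
    (lintegral_wS_mul_le hp hq hw).trans_lt (mul_lt_top (by norm_num) (mul_lt_top hp2 hq2))⟩

/-- Moving a derivative across the weighted pairing. -/
lemma enorm_integral_wS_pd_le (hp : ContDiff ℝ 1 p) (hq : ContDiff ℝ 1 q) (l : Fin 3) (hp2 : wl2 lamT p < ⊤)
    (hp3 : wl2 lamT (pd l p) < ⊤) (hq2 : wl2 lamT q < ⊤) (hq3 : wl2 lamT (pd l q) < ⊤) :
    ‖∫ v, wS v * p v * pd l q v‖ₑ ≤ 4 * ((wl2 lamT p + wl2 lamT (pd l p)) * wl2 lamT q) := by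
  have hpd : ∀ {g : E → ℝ}, ContDiff ℝ 1 g → Measurable (pd l g) := fun hg =>
    ((hg.continuous_fderiv (by norm_num)).clm_apply continuous_const).measurable
  have hwm := continuous_wS.measurable
  have hw0 : ∀ v, |wS v| ≤ wS v := fun v => (abs_of_pos (wS_pos v)).le
  have hwd : Measurable (pd l wS) := measurable_fderiv_apply_const ℝ wS (basisVec l)
  have hprod : ∀ v, fderiv ℝ (fun v => wS v * p v) v (basisVec l) = pd l wS v * p v + wS v * pd l p v := fun v => by
    rw [fderiv_fun_mul (differentiable_wS v) (hp.differentiable (by norm_num) v)]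
    simp [pd]; ring
  have i1 := integrable_wS_mul hp.continuous.measurable hq.continuous.measurable hwd (abs_pd_wS_le l) hp2 hq2
  have i2 := integrable_wS_mul (hpd hp) hq.continuous.measurable hwm hw0 hp3 hq2
  have h := integral_mul_fderiv_eq_neg_fderiv_mul_of_integrable (μ := (volume : Measure E)) (f := fun v => wS v * p v)
    (g := q) (v := basisVec l)
    (by simp_rw [hprod, add_mul]; exact i1.add i2)
    (integrable_wS_mul hp.continuous.measurable (hpd hq) hwm hw0 hp2 hq3)
    (integrable_wS_mul hp.continuous.measurable hq.continuous.measurable hwm hw0 hp2 hq2)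
    (fun v _ => (differentiable_wS v).mul (hp.differentiable (by norm_num) v))
    (fun v _ => hq.differentiable (by norm_num) v)
  have e : ∫ v, wS v * p v * pd l q v = -(∫ v, pd l wS v * p v * q v + wS v * pd l p v * q v) := by
    refine h.trans ?_
    simp_rw [hprod, add_mul]
  rw [e, enorm_neg, add_mul, mul_add]
  refine (enorm_integral_le_lintegral_enorm _).trans ((lintegral_mono fun v => enorm_add_le _ _).trans ?_)
  rw [lintegral_add_left' i1.1.enorm]
  exact add_le_add (lintegral_wS_mul_le hp.continuous.measurable hq.continuous.measurable (abs_pd_wS_le l))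
    (lintegral_wS_mul_le (hpd hp) hq.continuous.measurable hw0)

lemma contDiff_cv_left (hρ : IsTest ρ) (hg : LocallyIntegrable g) : ContDiff ℝ ∞ (cv ρ g) := by
  have h := hρ.2.contDiff_convolution_left (ContinuousLinearMap.mul ℝ ℝ) (μ := volume) hρ.1 hg
  have e : cv ρ g = MeasureTheory.convolution ρ g (ContinuousLinearMap.mul ℝ ℝ) volume := by
    funext v
    rw [convolution_eq_swap]; rfl
  rwa [e]

/-- The pairing estimate for mollified functions. -/
lemma enorm_integral_mollified_le : ∃ K : ℝ≥0∞, K ≠ ⊤ ∧ ∀ ρ : E → ℝ, IsTest ρ → (∀ x, 2 < ‖x‖ → ρ x = 0) → ∫⁻ x, ‖ρ x‖ₑ = 1 →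
    ∀ (n : ℕ) (V W : MIdx → E → ℝ), 2 ≤ n → Sob n lamT V → Sob (n - 2) lamT W → ∀ α : MIdx, α.abs ≤ n - 1 →
    ‖∫ v, wS v * cv (mderiv α ρ) (V 0) v * cv (mderiv α ρ) (W 0) v‖ₑ ≤ K * (hNorm n lamT V * hNorm (n - 2) lamT W) := by
  obtain ⟨C, hC, hcv⟩ := wl2_cv_le isWt_lamT
  refine ⟨4 * (2 * ofReal C ^ 2), mul_ne_top (by norm_num) (mul_ne_top (by norm_num) (by simp)),
    fun ρ hρ hfar hρ1 n V W hn hV hW α hα => ?_⟩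
  have hpos : ∀ v, 0 ≤ lamT v := fun v => (lamT_pos v).le
  have hb : ∀ g, Measurable g → wl2 lamT (cv ρ g) ≤ ofReal C * wl2 lamT g := fun g hg => by
    simpa [hρ1] using hcv ρ g hρ.continuous.measurable hfar hg
  have hbV : ∀ κ : MIdx, κ.abs ≤ n → wl2 lamT (cv ρ (V κ)) ≤ ofReal C * hNorm n lamT V := fun κ hκ =>
    (hb _ (hV.meas κ hκ)).trans (mul_le_mul_right (wl2_le_hNorm hpos V hκ) _)
  have hbW : ∀ κ : MIdx, κ.abs ≤ n - 2 → wl2 lamT (cv ρ (W κ)) ≤ ofReal C * hNorm (n - 2) lamT W := fun κ hκ =>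
    (hb _ (hW.meas κ hκ)).trans (mul_le_mul_right (wl2_le_hNorm hpos W hκ) _)
  have hfin : ∀ {m : ℕ} {U : MIdx → E → ℝ} (κ : MIdx), Sob m lamT U → wl2 lamT (cv (mderiv κ ρ) (U 0)) < ⊤ := by
    intro m U κ hU
    have h0 : (0 : MIdx).abs ≤ m := by simp [MIdx.abs]
    refine (hcv _ _ (hρ.mderiv κ).continuous.measurable (mderiv_eq_zero_of_far hfar κ) (hU.meas 0 h0)).trans_lt ?_
    exact mul_lt_top (mul_lt_top ofReal_lt_top (hρ.mderiv κ).integrable.2) (hU.finite continuous_lamT h0)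
  have hV0 : LocallyIntegrable (V 0) := hV.locallyIntegrable (by simp [MIdx.abs])
  have hW0 : LocallyIntegrable (W 0) := hW.locallyIntegrable (by simp [MIdx.abs])
  have hcd : ∀ {g : E → ℝ} (κ : MIdx), LocallyIntegrable g → ContDiff ℝ ∞ (cv (mderiv κ ρ) g) := fun κ hg =>
    contDiff_cv_left (hρ.mderiv κ) hg
  by_cases hα2 : α.abs ≤ n - 2
  · refine (enorm_integral_le_lintegral_enorm _).trans ((lintegral_wS_mul_le (hcd α hV0).continuous.measurable
      (hcd α hW0).continuous.measurable fun v => (abs_of_pos (wS_pos v)).le).trans ?_)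
    rw [cv_mderiv_left hρ hV (by omega), cv_mderiv_left hρ hW hα2]
    calc 4 * (wl2 lamT (cv ρ (V α)) * wl2 lamT (cv ρ (W α)))
        ≤ 4 * ((ofReal C * hNorm n lamT V) * (ofReal C * hNorm (n - 2) lamT W)) := by
          gcongr
          exacts [hbV α (by omega), hbW α hα2]
      _ = 4 * (1 * ofReal C ^ 2) * (hNorm n lamT V * hNorm (n - 2) lamT W) := by ring
      _ ≤ _ := by gcongr; norm_num
  · obtain ⟨l, hl1, hl2⟩ := exists_unitM_le (μ := α) (by omega)
    set κ := α - unitM l with hκ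
    have hpd : ∀ {g : E → ℝ} (μ : MIdx), LocallyIntegrable g → pd l (cv (mderiv μ ρ) g) = cv (mderiv (μ + unitM l) ρ) g := by
      intro g μ hg
      funext v
      rw [pd_of_hasFDerivAt (hasFDerivAt_cv_left (hρ.mderiv μ) hg v), pd_mderiv hρ.1]
    have e1 : cv (mderiv α ρ) (W 0) = pd l (cv (mderiv κ ρ) (W 0)) := by rw [hpd κ hW0, hl1]
    have h := enorm_integral_wS_pd_le ((hcd α hV0).of_le (by exact_mod_cast le_top)) ((hcd κ hW0).of_le (by exact_mod_cast le_top)) l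
      (hfin α hV) (by rw [hpd α hV0]; exact hfin _ hV) (hfin κ hW) (by rw [hpd κ hW0]; exact hfin _ hW)
    rw [e1]
    refine h.trans ?_
    have hαl : (α + unitM l).abs ≤ n := by rw [abs_add]; have := abs_nsmul_unitM 1 l; rw [one_smul] at this; omega
    rw [hpd α hV0, cv_mderiv_left hρ hV (by omega), cv_mderiv_left hρ hV hαl, cv_mderiv_left hρ hW (κ := κ) (by omega)]
    calc 4 * ((wl2 lamT (cv ρ (V α)) + wl2 lamT (cv ρ (V (α + unitM l)))) * wl2 lamT (cv ρ (W κ)))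
        ≤ 4 * ((ofReal C * hNorm n lamT V + ofReal C * hNorm n lamT V) * (ofReal C * hNorm (n - 2) lamT W)) := by
          gcongr
          exacts [hbV α (by omega), hbV _ hαl, hbW κ (by omega)]
      _ = _ := by ring

/-! ### Regularity in time -/

lemma measurable_cv_param {T : Type*} [MeasurableSpace T] {k g : T → E → ℝ} (hk : Measurable (uncurry k))
    (hg : Measurable (uncurry g)) : Measurable fun q : T × E => cv (k q.1) (g q.1) q.2 := by
  have h : StronglyMeasurable (uncurry fun (q : T × E) (w : E) => k q.1 (q.2 - w) * g q.1 w) := by fun_prop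
  exact h.integral_prod_right.measurable

lemma lintegral_damp_Ioc_le (hA : 0 < A) (f : ℝ → ℝ≥0∞) :
    ∫⁻ t in Ioc 0 T, f t ≤ ofReal (exp (A * T)) * ∫⁻ t in Ioi (0 : ℝ), ofReal (exp (-A * t)) * f t := by
  rw [← lintegral_const_mul' _ _ ofReal_ne_top]
  refine le_trans ?_ (lintegral_mono_set (Ioc_subset_Ioi_self : Ioc 0 T ⊆ Ioi 0))
  refine setLIntegral_mono' measurableSet_Ioc fun t ht => ?_
  rw [← mul_assoc, ← ofReal_mul (exp_pos _).le, ← exp_add]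
  refine le_mul_of_one_le_left' (one_le_ofReal.2 (Real.one_le_exp ?_))
  nlinarith [ht.2]

lemma lintegral_Ioc_lt_top (hA : 0 < A) {f : ℝ → ℝ≥0∞}
    (hfin : ∫⁻ t in Ioi (0 : ℝ), ofReal (exp (-A * t)) * f t ^ 2 < ⊤) (b : ℝ) : ∫⁻ t in Ioc 0 b, f t < ⊤ := by
  have h1 : ∀ x : ℝ≥0∞, x ≤ 1 + x ^ 2 := fun x => by
    rcases le_total x 1 with h | h
    · exact h.trans le_self_add
    · exact (le_self_pow₀ h (by norm_num)).trans le_add_self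
  refine (lintegral_mono fun t => h1 (f t)).trans_lt ?_
  rw [lintegral_add_left' aemeasurable_const]
  refine add_lt_top.2 ⟨by simp, (lintegral_damp_Ioc_le hA _).trans_lt (mul_lt_top ofReal_lt_top hfin)⟩

section

variable {T : ℝ} {V W : ℝ → E → ℝ} {N P : ℝ → ℝ≥0∞}

/-- The weak time derivative of a mollified function. -/
lemma weak_deriv_cv (hV : Measurable (uncurry V)) (hN : ∀ t, wl2 lamT (V t) ≤ N t) (hNf : ∀ b, ∫⁻ t in Ioc 0 b, N t < ⊤)
    (hρ : IsTest ρ) {χ : ℝ → ℝ} (hχ : Continuous χ) (hχc : HasCompactSupport χ) (v : E) :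
    ∫ p, V p.1 p.2 * (χ p.1 * ρ (v - p.2)) ∂timeSpace = ∫ t in Ioi (0 : ℝ), cv ρ (V t) v * χ t := by
  obtain ⟨D, hD⟩ := hχc.exists_bound_of_continuous hχ
  obtain ⟨B, hB⟩ := hχc.isCompact.bddAbove
  obtain ⟨C, hC, hc⟩ := hρ.convBdd.bound
  have hρm := hρ.continuous
  have hm : Measurable fun p : ℝ × E => V p.1 p.2 * (χ p.1 * ρ (v - p.2)) := by fun_prop
  have hi : Integrable (fun p : ℝ × E => V p.1 p.2 * (χ p.1 * ρ (v - p.2))) timeSpace := by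
    refine ⟨hm.aestronglyMeasurable, ?_⟩
    rw [HasFiniteIntegral, timeSpace, lintegral_prod _ hm.enorm.aemeasurable]
    have h1 : ∀ t ∈ Ioi (0 : ℝ), ∫⁻ w, ‖V t w * (χ t * ρ (v - w))‖ₑ ≤ (Ioc 0 B).indicator (fun t => ofReal D * (C * N t)) t := by
      intro t ht
      simp_rw [mul_left_comm (V t _), mul_comm (V t _), enorm_mul]
      rw [lintegral_const_mul' _ _ (by simp)]
      by_cases h : t ∈ Ioc 0 B
      · rw [indicator_of_mem h]
        exact mul_le_mul' ((ofReal_norm _).symm.le.trans (ofReal_le_ofReal (hD t)))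
          ((hc (V t) (by fun_prop) v).trans (mul_le_mul' le_rfl (hN t)))
      · simp [image_eq_zero_of_notMem_tsupport fun h' => h ⟨ht, hB h'⟩, h]
    refine (setLIntegral_mono' measurableSet_Ioi h1).trans_lt ((setLIntegral_le_lintegral _ _).trans_lt ?_)
    rw [lintegral_indicator measurableSet_Ioc, lintegral_const_mul' _ _ ofReal_ne_top, lintegral_const_mul' _ _ hC]
    exact mul_lt_top ofReal_lt_top (mul_lt_top hC.lt_top (hNf B))
  rw [timeSpace, integral_prod _ hi]
  simp only [cv, ← integral_mul_const]
  congr! 4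
  ring

/-- The energy identity for mollified functions, as an upper bound. -/
lemma wl2_cv_sq_le (hT : 0 ≤ T) (hV : Measurable (uncurry V)) (hW : Measurable (uncurry W))
    (hN : ∀ t, wl2 lamT (V t) ≤ N t) (hP : ∀ t, wl2 lamT (W t) ≤ P t) (hNf : ∀ b, ∫⁻ t in Ioc 0 b, N t < ⊤)
    (hPf : ∀ b, ∫⁻ t in Ioc 0 b, P t < ⊤) {M : ℝ≥0∞} (hM : ∫⁻ t in Ioc 0 T, N t * P t ≤ M) (hMt : M < ⊤) (hN0 : ∀ t, N t < ⊤)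
    (hd : IsTimeDeriv V W) (h0 : ∀ᵐ t, T < t → V t =ᵐ[volume] 0) (hρ : IsTest ρ) (hfar : ∀ x, 2 < ‖x‖ → ρ x = 0)
    {K : ℝ≥0∞} (hKt : K ≠ ⊤) (hK : ∀ t, ‖∫ v, wS v * cv ρ (V t) v * cv ρ (W t) v‖ₑ ≤ K * (N t * P t)) :
    ∀ᵐ t, 0 < t → wl2 lamT (cv ρ (V t)) ^ 2 ≤ 2 * (K * M) := by
  obtain ⟨C, hC, hcv⟩ := wl2_cv_le isWt_lamT
  obtain ⟨D, hD, hDb⟩ := hρ.convBdd.bound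
  have hρm := hρ.continuous.measurable
  set F : ℝ → E → ℝ := fun t => cv ρ (V t)
  set G : ℝ → E → ℝ := fun t => cv ρ (W t)
  have hcvm : ∀ {U : ℝ → E → ℝ}, Measurable (uncurry U) → Measurable (uncurry fun t => cv ρ (U t)) := fun hU =>
    measurable_cv_param (k := fun _ => ρ) (by fun_prop) hU
  have hFm : Measurable (uncurry F) := hcvm hV
  have hGm : Measurable (uncurry G) := hcvm hW
  have hloc : ∀ {U : ℝ → E → ℝ} {H : ℝ → ℝ≥0∞}, Measurable (uncurry U) → (∀ t, wl2 lamT (U t) ≤ H t) →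
      (∀ b, ∫⁻ t in Ioc 0 b, H t < ⊤) → ∀ v b, IntegrableOn (fun t => cv ρ (U t) v) (Ioc 0 b) := by
    intro U H hU hH hHf v b
    refine ⟨((hcvm hU).comp measurable_prodMk_right).aestronglyMeasurable,
      (lintegral_mono fun t => (enorm_cv_le hDb (by fun_prop) v).trans (mul_le_mul' le_rfl (hH t))).trans_lt ?_⟩
    rw [lintegral_const_mul' _ _ hD]
    exact mul_lt_top hD.lt_top (hHf b)
  have hF0 : ∀ᵐ t, T < t → ∀ v, F t v = 0 := by
    filter_upwards [h0] with t ht hTt v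
    exact (congrFun (cv_congr (ht hTt)) v).trans (by simp [cv])
  have hsq : ∀ v, ∀ᵐ t ∂μ₊, F t v ^ 2 = -2 * ∫ s in Ioi t, F s v * G s v := by
    refine fun v => (ae_restrict_iff' measurableSet_Ioi).2 <| sq_eq_of_weak_deriv hT (hloc hV hN hNf v) (hloc hW hP hPf v)
      (hF0.mono fun t ht h => ht h v) fun χ hχ hχc hχs => ?_
    have hκ : ContDiff ℝ ∞ fun p : ℝ × E => χ p.1 * ρ (v - p.2) :=
      (hχ.comp contDiff_fst).mul (hρ.1.comp (contDiff_const.sub contDiff_snd))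
    have hder : ∀ p : ℝ × E, fderiv ℝ (fun p : ℝ × E => χ p.1 * ρ (v - p.2)) p ((1 : ℝ), (0 : E)) = deriv χ p.1 * ρ (v - p.2) := by
      intro p
      have h := (hκ.differentiable (by simp) p).hasFDerivAt.comp_hasDerivAt p.1 ((hasDerivAt_id p.1).prodMk (hasDerivAt_const p.1 p.2))
      refine h.deriv.symm.trans ?_
      show deriv (fun s => χ s * ρ (v - p.2)) p.1 = _
      rw [deriv_mul_const (hχ.differentiable (by simp) _)]
    have hsupp : Function.support (fun p : ℝ × E => χ p.1 * ρ (v - p.2)) ⊆ tsupport χ ×ˢ ((fun w => v - w) '' tsupport ρ) := by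
      intro p hp
      exact ⟨subset_tsupport _ (left_ne_zero_of_mul hp), v - p.2, subset_tsupport _ (right_ne_zero_of_mul hp), by simp⟩
    have hcomp : IsCompact (tsupport χ ×ˢ ((fun w => v - w) '' tsupport ρ)) :=
      hχc.isCompact.prod (hρ.2.isCompact.image (by fun_prop))
    have h1 := hd _ hκ (HasCompactSupport.of_support_subset_isCompact hcomp hsupp)
      ((closure_minimal hsupp hcomp.isClosed).trans (prod_mono hχs (subset_univ _)))
    simp_rw [hder] at h1
    rwa [weak_deriv_cv hV hN hNf hρ ((contDiff_infty_iff_deriv.1 hχ).2.continuous) hχc.deriv v,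
      weak_deriv_cv hW hP hPf hρ hχ.continuous hχc v] at h1
  have hRm : Measurable fun p : E × ℝ => ∫ s in Ioi p.2, F s p.1 * G s p.1 := by
    simp_rw [← integral_indicator measurableSet_Ioi]
    have hs : MeasurableSet {z : (E × ℝ) × ℝ | z.1.2 < z.2} := measurableSet_lt (by fun_prop) (by fun_prop)
    have h2 : Measurable fun z : (E × ℝ) × ℝ => F z.2 z.1.1 * G z.2 z.1.1 := by fun_prop
    exact ((h2.indicator hs).stronglyMeasurable.integral_prod_right' (ν := volume)).measurable
  have hae : ∀ᵐ t ∂μ₊, ∀ᵐ v, F t v ^ 2 = -2 * ∫ s in Ioi t, F s v * G s v :=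
    (Measure.ae_ae_comm (measurableSet_eq_fun (f := fun p : E × ℝ => F p.2 p.1 ^ 2) (by fun_prop) (hRm.const_mul (-2)))).1 (.of_forall hsq)
  set c₀ := ofReal C * ∫⁻ x, ‖ρ x‖ₑ
  have hc₀t : c₀ < ⊤ := mul_lt_top ofReal_lt_top hρ.integrable.2
  have hFN : ∀ t, wl2 lamT (F t) ≤ c₀ * N t := fun t => (hcv ρ (V t) hρm hfar (by fun_prop)).trans (mul_le_mul' le_rfl (hN t))
  have hGP : ∀ t, wl2 lamT (G t) ≤ c₀ * P t := fun t => (hcv ρ (W t) hρm hfar (by fun_prop)).trans (mul_le_mul' le_rfl (hP t))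
  have hw0 : ∀ v, |wS v| ≤ wS v := fun v => (abs_of_pos (wS_pos v)).le
  have hm3 : Measurable fun p : ℝ × E => wS p.2 * F p.1 p.2 * G p.1 p.2 := by fun_prop
  refine (ae_restrict_iff' measurableSet_Ioi).1 ?_
  filter_upwards [hae, ae_restrict_mem measurableSet_Ioi] with t ht ht0
  have hzero : ∀ f : ℝ → ℝ≥0∞, (∀ᵐ s, T < s → f s = 0) → ∫⁻ s in Ioi t, f s ≤ ∫⁻ s in Ioc 0 T, f s := by
    intro f hf
    rw [← lintegral_indicator measurableSet_Ioi, ← lintegral_indicator measurableSet_Ioc]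
    refine lintegral_mono_ae (hf.mono fun s hs => ?_)
    by_cases h : t < s
    · rcases le_or_gt s T with h' | h'
      · simp [h, h', (mem_Ioi.1 ht0).trans h]
      · simp [indicator_apply, hs h']
    · simp [h]
  have hii : Integrable (fun p : ℝ × E => wS p.2 * F p.1 p.2 * G p.1 p.2) ((volume.restrict (Ioi t)).prod volume) := by
    refine ⟨hm3.aestronglyMeasurable, ?_⟩
    rw [HasFiniteIntegral, lintegral_prod _ hm3.enorm.aemeasurable]
    refine (hzero _ (hF0.mono fun s hs hTs => by simp [hs hTs])).trans_lt ?_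
    have h4 : 4 * (c₀ * c₀) < ⊤ := mul_lt_top (by norm_num) (mul_lt_top hc₀t hc₀t)
    refine lt_of_le_of_lt (b := ∫⁻ s in Ioc 0 T, (4 * (c₀ * c₀)) * (N s * P s)) (lintegral_mono fun s =>
      (lintegral_wS_mul_le (by fun_prop) (by fun_prop) hw0).trans ?_) ?_
    · calc _ ≤ 4 * ((c₀ * N s) * (c₀ * P s)) := mul_le_mul' le_rfl (mul_le_mul' (hFN s) (hGP s))
        _ = _ := by ring
    · rw [lintegral_const_mul' _ _ h4.ne]
      exact mul_lt_top h4 (hM.trans_lt hMt)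
  have e1 : ∫ v, wS v * F t v * F t v = -2 * ∫ s in Ioi t, (∫ v, wS v * F s v * G s v) := by
    rw [integral_integral_swap hii, ← integral_const_mul]
    refine integral_congr_ae (ht.mono fun v hv => ?_)
    simp only [mul_assoc, integral_const_mul] at hv ⊢
    rw [← sq, hv]; ring
  have hFt2 : wl2 lamT (F t) < ⊤ := (hFN t).trans_lt (mul_lt_top hc₀t (hN0 t))
  have hi2 := integrable_wS_mul (by fun_prop) (by fun_prop) continuous_wS.measurable hw0 hFt2 hFt2
  have hpos : ∀ v, 0 ≤ wS v * F t v * F t v := fun v => by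
    rw [mul_assoc]; exact mul_nonneg (wS_pos v).le (mul_self_nonneg _)
  calc wl2 lamT (F t) ^ 2 = ∫⁻ v, ofReal (lamT v) * ‖F t v‖ₑ ^ 2 := wl2_sq (fun v => (lamT_pos v).le) _
    _ ≤ ∫⁻ v, ofReal (wS v * F t v * F t v) := by
        refine lintegral_mono fun v => ?_
        rw [← ofReal_norm, ← ofReal_pow (norm_nonneg _), ← ofReal_mul (lamT_pos v).le, norm_eq_abs, sq_abs,
          mul_assoc, ← sq]
        exact ofReal_le_ofReal (mul_le_mul_of_nonneg_right (wS_bounds v).1 (sq_nonneg _))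
    _ = ‖∫ v, wS v * F t v * F t v‖ₑ := by
        rw [← ofReal_integral_eq_lintegral_ofReal hi2 (.of_forall hpos), enorm_eq_ofReal (integral_nonneg hpos)]
    _ ≤ 2 * ∫⁻ s in Ioi t, ‖∫ v, wS v * F s v * G s v‖ₑ := by
        rw [e1, enorm_mul]
        refine mul_le_mul' ?_ (enorm_integral_le_lintegral_enorm _)
        rw [enorm_neg, ← ofReal_norm]; simp
    _ ≤ 2 * ∫⁻ s in Ioc 0 T, K * (N s * P s) := mul_le_mul' le_rfl
        ((hzero _ (hF0.mono fun s hs hTs => by simp [hs hTs])).trans (lintegral_mono fun s => hK s))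
    _ ≤ _ := by
        rw [lintegral_const_mul' _ _ hKt]
        gcongr

end

/-- Functions with a weak time derivative are bounded in time with values in an intermediate space. -/
lemma ae_hNorm_le : ∃ K : ℝ≥0∞, K ≠ ⊤ ∧ ∀ (n : ℕ), 2 ≤ n → ∀ (A T : ℝ), 0 < A → 0 ≤ T → ∀ V W : MIdx → ℝ → E → ℝ,
    (∀ α, Measurable (uncurry (V α))) → (∀ α, Measurable (uncurry (W α))) →
    (∀ t, Sob n lamT fun α => V α t) → (∀ t, Sob (n - 2) lamT fun α => W α t) →
    vNorm n A lamT V ≤ 1 → vNorm (n - 2) A lamT W ≤ 1 → IsTimeDeriv (V 0) (W 0) → (∀ᵐ t, T < t → V 0 t =ᵐ[volume] 0) →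
    ∀ᵐ t, 0 < t → hNorm (n - 1) lamT (fun α => V α t) ^ 2 ≤ (midxLE (n - 1)).card * (K * ofReal (exp (A * T))) := by
  obtain ⟨K, hK, hKb⟩ := enorm_integral_mollified_le
  refine ⟨2 * K, mul_ne_top (by norm_num) hK, fun n hn A T hA hT V W hVm hWm hV hW hV1 hW1 hd h0 => ?_⟩
  have hpos : ∀ v, 0 ≤ lamT v := fun v => (lamT_pos v).le
  have hb : ∀ k : ℕ, (0:ℝ) < 1 / (k + 1) := fun k => by positivity
  set b : ℕ → ContDiffBump (0 : E) := fun k => ⟨1 / (k + 1) / 2, 1 / (k + 1), half_pos (hb k), half_lt_self (hb k)⟩ with hbdef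
  set ρ : ℕ → E → ℝ := fun k => (b k).normed volume with hρdef
  have hρ : ∀ k, IsTest (ρ k) := fun k => ⟨(b k).contDiff_normed, (b k).hasCompactSupport_normed⟩
  have hfar : ∀ k x, 2 < ‖x‖ → ρ k x = 0 := by
    intro k x hx
    by_contra h
    have h1 : x ∈ Function.support (ρ k) := h
    rw [hρdef, ContDiffBump.support_normed_eq, mem_ball_zero_iff] at h1
    have h2 : (1 : ℝ) / (k + 1) ≤ 1 := by rw [div_le_one (by positivity)]; linarith [Nat.cast_nonneg (α := ℝ) k]
    exact absurd (h1.trans_le h2) (by linarith)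
  have hρ1 : ∀ k, ∫⁻ x, ‖ρ k x‖ₑ = 1 := by
    intro k
    have h1 : ∀ x, ‖ρ k x‖ₑ = ofReal (ρ k x) := fun x => enorm_eq_ofReal ((b k).nonneg_normed x)
    simp_rw [h1]
    rw [← ofReal_integral_eq_lintegral_ofReal (hρ k).integrable (of_forall fun x => (b k).nonneg_normed x),
      (b k).integral_normed, ofReal_one]
  have h0n : ∀ m, (0 : MIdx).abs ≤ m := by simp
  have hNfin : ∀ t, hNorm n lamT (fun α => V α t) < ⊤ := by
    intro t
    have h1 := hNorm_sq n hpos (fun α => V α t)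
    have h2 : hNorm n lamT (fun α => V α t) ^ 2 < ⊤ := by
      rw [h1]
      exact sum_lt_top.2 fun α hα => pow_lt_top ((hV t).finite continuous_lamT (mem_midxLE.1 hα))
    by_contra h
    rw [not_lt, top_le_iff] at h
    simp [h] at h2
  have hsq : ∀ {m : ℕ} {U : MIdx → ℝ → E → ℝ}, vNorm m A lamT U ≤ 1 →
      ∫⁻ t in Ioi (0 : ℝ), ofReal (exp (-A * t)) * hNorm m lamT (fun α => U α t) ^ 2 ≤ 1 := fun h => by
    rw [← vNorm_sq]; exact pow_le_one' h 2
  have hNm : ∀ {U : MIdx → ℝ → E → ℝ} (m : ℕ), (∀ α, Measurable (uncurry (U α))) →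
      Measurable fun t : ℝ => ofReal (exp (-A * t / 2)) * hNorm m lamT fun α => U α t := fun m hU =>
    Measurable.mul (by fun_prop) (measurable_hNorm isWt_lamT hU)
  have he : ∀ t : ℝ, ofReal (exp (-A * t / 2)) ^ 2 = ofReal (exp (-A * t)) := fun t => by
    rw [← ofReal_pow (exp_pos _).le, ← exp_nat_mul]; congr 2; push_cast; ring
  have hl2 : ∀ {m : ℕ} {U : MIdx → ℝ → E → ℝ}, vNorm m A lamT U ≤ 1 →
      l2 μ₊ (fun t => ofReal (exp (-A * t / 2)) * hNorm m lamT fun α => U α t) ≤ 1 := fun h => by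
    rw [le_l2_iff, one_pow]
    simpa only [mul_pow, he] using hsq h
  have hNP : ∫⁻ t in Ioc 0 T, (hNorm n lamT fun α => V α t) * (hNorm (n - 2) lamT fun α => W α t) ≤ ofReal (exp (A * T)) := by
    refine (lintegral_damp_Ioc_le hA _).trans (mul_le_of_le_one_right' ?_)
    refine le_trans (le_of_eq (lintegral_congr fun t => ?_)) ((lintegral_mul_le_l2 (μ := μ₊) (hNm n hVm).aemeasurable
      (hNm (n - 2) hWm).aemeasurable).trans (mul_le_one' (hl2 hV1) (hl2 hW1)))
    rw [← he]; ring
  have hIoc : ∀ {m : ℕ} {U : MIdx → ℝ → E → ℝ}, vNorm m A lamT U ≤ 1 → ∀ b, ∫⁻ t in Ioc 0 b, (hNorm m lamT fun α => U α t) < ⊤ :=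
    fun h => lintegral_Ioc_lt_top hA ((hsq h).trans_lt one_lt_top)
  have key : ∀ k, ∀ α ∈ midxLE (n - 1), ∀ᵐ t, 0 < t →
      wl2 lamT (cv (mderiv α (ρ k)) (V 0 t)) ^ 2 ≤ 2 * (K * ofReal (exp (A * T))) := fun k α hα =>
    wl2_cv_sq_le hT (hVm 0) (hWm 0) (fun t => wl2_le_hNorm hpos (fun α => V α t) (h0n n))
      (fun t => wl2_le_hNorm hpos (fun α => W α t) (h0n _)) (hIoc hV1) (hIoc hW1) hNP ofReal_lt_top
      hNfin hd h0 ((hρ k).mderiv α) (mderiv_eq_zero_of_far (hfar k) α) hK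
      fun t => hKb (ρ k) (hρ k) (hfar k) (hρ1 k) n _ _ hn (hV t) (hW t) α (mem_midxLE.1 hα)
  have key' : ∀ᵐ t, ∀ k, ∀ α ∈ midxLE (n - 1), 0 < t →
      wl2 lamT (cv (mderiv α (ρ k)) (V 0 t)) ^ 2 ≤ 2 * (K * ofReal (exp (A * T))) :=
    ae_all_iff.2 fun k => (Finset.eventually_all _).2 fun α hα => key k α hα
  filter_upwards [key'] with t ht ht0
  rw [hNorm_sq _ hpos, mul_assoc 2 K, ← nsmul_eq_mul]
  refine Finset.sum_le_card_nsmul _ _ _ fun α hα => ?_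
  have hαn : α.abs ≤ n := (mem_midxLE.1 hα).trans (by omega)
  have hlim : ∀ᵐ v, Tendsto (fun k => cv (ρ k) (V α t) v) atTop (𝓝 (V α t v)) := by
    have h1 : Tendsto (fun k => (b k).rOut) atTop (𝓝 0) := tendsto_one_div_add_atTop_nhds_zero_nat
    have h2 := ContDiffBump.ae_convolution_tendsto_right_of_locallyIntegrable (φ := b) (l := atTop) (K := 2) (μ := (volume : Measure E)) h1
      (of_forall fun k => by simp only [hbdef]; linarith) ((hV t).locallyIntegrable hαn)
    filter_upwards [h2] with v hv
    refine hv.congr fun k => ?_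
    rw [convolution_eq_swap]; rfl
  rw [wl2_sq hpos]
  calc ∫⁻ v, ofReal (lamT v) * ‖V α t v‖ₑ ^ 2
      = ∫⁻ v, liminf (fun k => ofReal (lamT v) * ‖cv (ρ k) (V α t) v‖ₑ ^ 2) atTop := by
        refine lintegral_congr_ae ?_
        filter_upwards [hlim] with v hv
        refine (Tendsto.liminf_eq ?_).symm
        exact ENNReal.Tendsto.const_mul (((continuous_pow 2).tendsto _).comp hv.enorm) (Or.inr ofReal_ne_top)
    _ ≤ liminf (fun k => ∫⁻ v, ofReal (lamT v) * ‖cv (ρ k) (V α t) v‖ₑ ^ 2) atTop := by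
        refine lintegral_liminf_le fun k => ?_
        exact continuous_lamT.measurable.ennreal_ofReal.mul
          ((measurable_cv (hρ k).continuous.measurable ((hV t).meas α hαn)).enorm.pow_const 2)
    _ ≤ _ := by
        refine liminf_le_of_le (by isBoundedDefault) fun y hy => ?_
        obtain ⟨k, hk⟩ := hy.exists
        refine hk.trans ?_
        have h3 := ht k α hα ht0
        rw [cv_mderiv_left (hρ k) (hV t) hαn, wl2_sq hpos] at h3
        exact h3

/-! ### Trilinear forms -/

/-- The measure on triples `((t, v), s)`. -/
def tri : Measure ((ℝ × E) × ℝ) := timeSpace.prod μ₊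

instance : SFinite timeSpace := by unfold timeSpace; infer_instance

lemma measurePreserving_tri : MeasurePreserving (fun q : (ℝ × E) × ℝ => ((q.2, q.1.2), q.1.1)) tri tri := by
  have h1 := measurePreserving_prodAssoc μ₊ (volume : Measure E) μ₊
  have h2 : MeasurePreserving (Prod.swap : ℝ × (E × ℝ) → (E × ℝ) × ℝ) _ _ :=
    measurePreserving_swap (μ := μ₊) (ν := (volume : Measure E).prod μ₊)
  have h3 := (measurePreserving_swap (μ := (volume : Measure E)) (ν := μ₊)).prod (MeasurePreserving.id μ₊)
  exact h3.comp (h2.comp h1)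

/-- The integral operator with a kernel depending on time. -/
def opK (κ : ℝ → E → E → ℝ) (τ : ℝ) (g : E → ℝ) (v : E) : ℝ := ∫ v', κ τ v v' * g v'

/-- The integrand of the trilinear form with kernel `κ`. -/
def formI (A ε : ℝ) (X : ℝ → E → ℝ) (κ : ℝ → E → E → ℝ) (h U : ℝ → E → ℝ) (q : (ℝ × E) × ℝ) : ℝ :=
  if q.2 < q.1.1 then exp (-A * q.1.1) / ε * (X q.1.1 q.1.2 * (U q.2 q.1.2 * opK κ ((q.1.1 - q.2) / ε) (h q.2) q.1.2)) else 0

/-- The majorant of the integrand `formI`. -/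
def formAbs (A ε : ℝ) (X : ℝ → E → ℝ≥0∞) (κ : ℝ → E → E → ℝ) (h U : ℝ → E → ℝ) (q : (ℝ × E) × ℝ) : ℝ≥0∞ :=
  if q.2 < q.1.1 then ofReal (exp (-A * q.1.1) / ε) * (X q.1.1 q.1.2 * (‖U q.2 q.1.2‖ₑ *
    ∫⁻ v', ‖κ ((q.1.1 - q.2) / ε) q.1.2 v'‖ₑ * ‖h q.2 v'‖ₑ)) else 0

section Forms
variable {A ε : ℝ} {X h U : ℝ → E → ℝ} {Y : ℝ → E → ℝ≥0∞} {κ : ℝ → E → E → ℝ}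

lemma enorm_formI_le (hε : 0 < ε) (q : (ℝ × E) × ℝ) : ‖formI A ε X κ h U q‖ₑ ≤ formAbs A ε (fun t v => ‖X t v‖ₑ) κ h U q := by
  unfold formI formAbs
  split_ifs with hq
  · rw [enorm_mul, enorm_mul, enorm_mul, enorm_eq_ofReal (by positivity)]
    gcongr
    refine (enorm_integral_le_lintegral_enorm _).trans (le_of_eq ?_)
    simp_rw [enorm_mul]
  · simp

lemma measurable_uncurried (hκ : Measurable fun z : ℝ × E × E => κ z.1 z.2.1 z.2.2) (hh : Measurable (uncurry h)) (ε : ℝ) :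
    Measurable fun z : ((ℝ × E) × ℝ) × E => κ ((z.1.1.1 - z.1.2) / ε) z.1.1.2 z.2 * h z.1.2 z.2 :=
  (Measurable.comp (f := fun z : ((ℝ × E) × ℝ) × E => ((z.1.1.1 - z.1.2) / ε, z.1.1.2, z.2)) hκ (by fun_prop)).mul
    (Measurable.comp (f := fun z : ((ℝ × E) × ℝ) × E => (z.1.2, z.2)) hh (by fun_prop))

lemma measurable_U (hU : Measurable (uncurry U)) : Measurable fun q : (ℝ × E) × ℝ => U q.2 q.1.2 :=
  Measurable.comp (f := fun q : (ℝ × E) × ℝ => (q.2, q.1.2)) hU (by fun_prop)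

lemma measurableSet_lt_tri : MeasurableSet {q : (ℝ × E) × ℝ | q.2 < q.1.1} :=
  measurableSet_lt measurable_snd (measurable_fst.comp measurable_fst)

lemma measurable_formI (hX : Measurable (uncurry X)) (hκ : Measurable fun z : ℝ × E × E => κ z.1 z.2.1 z.2.2)
    (hh : Measurable (uncurry h)) (hU : Measurable (uncurry U)) : Measurable (formI A ε X κ h U) :=
  Measurable.ite measurableSet_lt_tri (Measurable.mul (by fun_prop) ((hX.comp measurable_fst).mul ((measurable_U hU).mul
    (measurable_uncurried hκ hh ε).stronglyMeasurable.integral_prod_right'.measurable))) measurable_const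

lemma measurable_formAbs (hY : Measurable (uncurry Y)) (hκ : Measurable fun z : ℝ × E × E => κ z.1 z.2.1 z.2.2)
    (hh : Measurable (uncurry h)) (hU : Measurable (uncurry U)) : Measurable (formAbs A ε Y κ h U) := by
  have h1 := (measurable_uncurried hκ hh ε).enorm.lintegral_prod_right' (ν := volume)
  simp_rw [enorm_mul] at h1
  exact Measurable.ite measurableSet_lt_tri (Measurable.mul (by fun_prop) ((hY.comp measurable_fst).mul
    ((measurable_U hU).enorm.mul h1))) measurable_const

lemma integrable_formI (hε : 0 < ε) (hX : Measurable (uncurry X)) (hκ : Measurable fun z : ℝ × E × E => κ z.1 z.2.1 z.2.2)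
    (hh : Measurable (uncurry h)) (hU : Measurable (uncurry U))
    (hf : ∫⁻ q, formAbs A ε (fun t v => ‖X t v‖ₑ) κ h U q ∂tri < ⊤) : Integrable (formI A ε X κ h U) tri :=
  ⟨(measurable_formI hX hκ hh hU).aestronglyMeasurable, (lintegral_mono (enorm_formI_le hε)).trans_lt hf⟩

/-- The weighted norm of the first argument of the forms. -/
def xN (A : ℝ) (q : E → ℝ) (Y : ℝ → E → ℝ≥0∞) : ℝ≥0∞ :=
  l2 timeSpace fun p => ofReal (exp (-(A / 2) * p.1) * (√(lam p.2))⁻¹ * (q p.2)⁻¹) * Y p.1 p.2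

/-- Bounds on the second and third arguments of the forms at a fixed time. -/
def Pair (B : ℝ≥0∞) (h U : E → ℝ) (y : ℝ≥0∞) : Prop :=
  ∫⁻ v, ofReal ((1 + ‖v‖) ^ 2) * ‖h v‖ₑ ≤ B ∧ l2 volume (fun v => ofReal ((1 + ‖v‖) ^ 2) * ‖h v‖ₑ) ≤ B ∧ wl2 lam U ≤ y ∧
    ((∀ᵐ v, ofReal ((1 + ‖v‖) ^ 2) * ‖h v‖ₑ ≤ B) ∨ ∀ᵐ v, ofReal (√(lam v)) * ‖U v‖ₑ ≤ y)

/-- Kernels with a majorant that allows the absolute bound. -/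
def KerLE (a : ℝ) (q : E → ℝ) (c : ℝ) (κ : ℝ → E → E → ℝ) : Prop := ∀ τ v v', 0 < τ → v ≠ v' →
  exp (-(a * τ)) * (q v * ‖κ τ v v'‖) ≤ c * (glR τ (v - v') * (1 + ‖v'‖) ^ 2)

lemma glR_nonneg (hτ : 0 < τ) (w : E) : 0 ≤ glR τ w := by unfold glR; split_ifs <;> positivity

lemma lintegral_formAbs_le : ∃ C : ℝ≥0∞, C ≠ ⊤ ∧ ∀ (A ε : ℝ), 0 < ε → ∀ (Y : ℝ → E → ℝ≥0∞) (κ : ℝ → E → E → ℝ) (h U : ℝ → E → ℝ)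
    (q : E → ℝ) (c : ℝ), Measurable (uncurry Y) → (Measurable fun z : ℝ × E × E => κ z.1 z.2.1 z.2.2) → Measurable (uncurry h) →
    Measurable (uncurry U) → Measurable q → (∀ v, 0 < q v) → 0 ≤ c → KerLE (A * ε / 2) q c κ →
    ∀ (B : ℝ≥0∞) (y : ℝ → ℝ≥0∞), Measurable y → (∀ᵐ s ∂μ₊, Pair B (h s) (U s) (y s)) →
    ∫⁻ z, formAbs A ε Y κ h U z ∂tri ≤ ofReal c * (C * (B * (xN A q Y * l2 μ₊ fun s => ofReal (exp (-(A / 2) * s)) * y s))) := by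
  obtain ⟨C, hC, hb⟩ := lintegral_form_le
  refine ⟨C, hC, fun A ε hε Y κ h U q c hY hκ hh hU hq hq0 hc hk B y hy hP => ?_⟩
  have hlm := continuous_lam.measurable
  have hXm : Measurable fun p : ℝ × E => ofReal (exp (-(A / 2) * p.1) * (√(lam p.2))⁻¹ * (q p.2)⁻¹) * Y p.1 p.2 :=
    Measurable.mul (by fun_prop) hY
  have hG : Measurable fun p : ℝ × E => ofReal c * (ofReal (exp (-(A / 2) * p.1) * (√(lam p.2))⁻¹ * (q p.2)⁻¹) * Y p.1 p.2) :=
    hXm.const_mul _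
  have hs : ∀ {g : ℝ → E → ℝ}, Measurable (uncurry g) → ∀ s, Measurable fun v => ‖g s v‖ₑ := fun hg s =>
    (Measurable.comp (f := fun v : E => (s, v)) hg (by fun_prop)).enorm
  have key := hb ε hε (fun t v => ofReal c * (ofReal (exp (-(A / 2) * t) * (√(lam v))⁻¹ * (q v)⁻¹) * Y t v))
    (fun s v => ofReal (exp (-(A / 2) * s)) * (ofReal (√(lam v)) * ‖U s v‖ₑ)) (fun s v => ofReal ((1 + ‖v‖) ^ 2) * ‖h s v‖ₑ) hG
    (fun s => ((measurable_ofReal_sqrt continuous_lam).mul (hs hU s)).const_mul _)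
    (fun s => Measurable.mul (by fun_prop) (hs hh s)) B (fun s => ofReal (exp (-(A / 2) * s)) * y s) (Measurable.mul (by fun_prop) hy) ?_
    (fun t s v => formAbs A ε Y κ h U ((t, v), s)) ?_
  · refine le_trans (le_of_eq ?_) (key.trans (le_of_eq ?_))
    · have hm := measurable_formAbs (A := A) (ε := ε) hY hκ hh hU
      rw [tri, lintegral_prod _ hm.aemeasurable, timeSpace, lintegral_prod _ hm.lintegral_prod_right'.aemeasurable]
      refine lintegral_congr fun t => ?_
      refine (lintegral_lintegral_swap (f := fun v s => formAbs A ε Y κ h U ((t, v), s))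
        (Measurable.comp (f := fun z : E × ℝ => ((t, z.1), z.2)) hm (by fun_prop)).aemeasurable).trans ?_
      rw [← Ioi_inter_Iio, inter_comm, ← restrict_restrict measurableSet_Iio, ← lintegral_indicator measurableSet_Iio]
      refine lintegral_congr fun s => ?_
      by_cases hs : s < t
      · rw [indicator_of_mem (mem_Iio.2 hs)]
      · rw [indicator_of_notMem (by simpa using hs)]; simp [formAbs, hs]
    · rw [show l2 timeSpace (uncurry fun t v => ofReal c * (ofReal (exp (-(A / 2) * t) * (√(lam v))⁻¹ * (q v)⁻¹) * Y t v)) =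
        ofReal c * xN A q Y from l2_const_mul hXm.aemeasurable _]
      ring
  · filter_upwards [hP] with s hP
    obtain ⟨p1, p2, p3, p4⟩ := hP
    refine ⟨p1, p2, ?_, p4.imp id fun h4 => h4.mono fun v hv => mul_le_mul' le_rfl hv⟩
    rw [l2_const_mul (f := fun v => ofReal (√(lam v)) * ‖U s v‖ₑ) ((measurable_ofReal_sqrt continuous_lam).mul (hs hU s)).aemeasurable]
    exact mul_le_mul' le_rfl p3
  · intro t s v h0 hst
    have hτ : 0 < (t - s) / ε := div_pos (by linarith) hε
    have hl := sqrt_pos.2 (lam_pos v)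
    simp only [formAbs, if_pos hst]
    have e1 : ofReal (exp (-A * t) / ε) = ofReal ε⁻¹ * (ofReal (exp (-(A / 2) * t) * (√(lam v))⁻¹ * (q v)⁻¹) *
        (ofReal (exp (-(A / 2) * s)) * (ofReal (√(lam v)) * (ofReal (exp (-(A * ε / 2 * ((t - s) / ε)))) * ofReal (q v))))) := by
      have := hq0 v
      rw [← ofReal_mul (by positivity), ← ofReal_mul (by positivity), ← ofReal_mul (by positivity),
        ← ofReal_mul (by positivity), ← ofReal_mul (by positivity)]
      congr 1
      rw [show -A * t = -(A / 2) * t + (-(A / 2) * s + -(A * ε / 2 * ((t - s) / ε))) by field_simp; ring, exp_add, exp_add]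
      field_simp
    have e2 : (ofReal (exp (-(A * ε / 2 * ((t - s) / ε)))) * ofReal (q v)) * ∫⁻ v', ‖κ ((t - s) / ε) v v'‖ₑ * ‖h s v'‖ₑ ≤
        ofReal c * ∫⁻ v', ofReal (glR ((t - s) / ε) (v - v')) * (ofReal ((1 + ‖v'‖) ^ 2) * ‖h s v'‖ₑ) := by
      rw [← lintegral_const_mul' _ _ ofReal_ne_top, ← lintegral_const_mul' _ _ (mul_ne_top ofReal_ne_top ofReal_ne_top)]
      refine lintegral_mono_ae ?_
      filter_upwards [(measure_singleton v : volume {v} = 0) |> compl_mem_ae_iff.2] with v' hv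
      have := hk _ v v' hτ fun e => hv (by simp [e])
      rw [← mul_assoc, ← mul_assoc, ← mul_assoc]
      gcongr ?_ * _
      rw [← ofReal_norm, mul_assoc, ← ofReal_mul (hq0 v).le, ← ofReal_mul (exp_pos _).le, ← ofReal_mul hc,
        ← ofReal_mul (mul_nonneg hc (glR_nonneg hτ _)), mul_assoc]
      exact ofReal_le_ofReal this
    rw [e1]
    calc _ = ofReal ε⁻¹ * (ofReal (exp (-(A / 2) * t) * (√(lam v))⁻¹ * (q v)⁻¹) * Y t v * (ofReal (exp (-(A / 2) * s)) *
          (ofReal (√(lam v)) * ‖U s v‖ₑ) * ((ofReal (exp (-(A * ε / 2 * ((t - s) / ε)))) * ofReal (q v)) *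
          ∫⁻ v', ‖κ ((t - s) / ε) v v'‖ₑ * ‖h s v'‖ₑ))) := by ring
      _ ≤ _ := by grw [e2]
      _ = _ := by ring

end Forms

/-- The time average of the absolute value. -/
def avgAbs (A K : ℝ) (Z : ℝ → ℝ) (s : ℝ) : ℝ≥0∞ := ∫⁻ t in Ioi s, ofReal (K * exp (-(A + K) * (t - s))) * ‖Z t‖ₑ

lemma integral_timeAvg_swap (hε : 0 < ε) (hK : 0 < K) {Z : ℝ → ℝ} {k k' : ℝ → E → ℝ} {h : E → ℝ}
    (hZ : Measurable Z) (hk' : Measurable (uncurry k')) (hh : Measurable h)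
    (hk : ∀ᵐ v', ∀ τ, 0 < τ → k τ v' = ∫ r in (0 : ℝ)..τ, K * ε * exp (-(τ - r) * (K * ε)) * k' r v')
    (hfin : ∫⁻ t in Ioi s, ofReal (exp (-A * t)) * (avgAbs A K Z t * ∫⁻ v', ‖k' ((t - s) / ε) v'‖ₑ * ‖h v'‖ₑ) < ⊤) :
    ∫ t in Ioi s, exp (-A * t) * (Z t * ∫ v', k ((t - s) / ε) v' * h v') =
      ∫ t in Ioi s, exp (-A * t) * (timeAvg A K Z t * ∫ v', k' ((t - s) / ε) v' * h v') := by
  set F : ℝ × (ℝ × E) → ℝ := fun z => if z.2.1 < z.1 then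
    exp (-A * z.1) * Z z.1 * (K * exp (-K * (z.1 - z.2.1))) * (k' ((z.2.1 - s) / ε) z.2.2 * h z.2.2) else 0 with hF
  set m := volume.restrict (Ioi s)
  have hFm : Measurable F := by
    refine Measurable.ite (measurableSet_lt (by fun_prop) (by fun_prop)) ?_ measurable_const
    have h1 : Measurable fun z : ℝ × (ℝ × E) => k' ((z.2.1 - s) / ε) z.2.2 :=
      Measurable.comp (f := fun z : ℝ × (ℝ × E) => ((z.2.1 - s) / ε, z.2.2)) hk' (by fun_prop)
    fun_prop
  have hsec : ∀ (t' : ℝ) (v' : E) (t : ℝ), F (t, (t', v')) = (Ioi t').indicator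
      (fun t => exp (-A * t') * (k' ((t' - s) / ε) v' * h v') * (K * exp (-(A + K) * (t - t')) * Z t)) t := by
    intro t' v' t
    simp only [hF, indicator_apply, mem_Ioi]
    split_ifs
    · rw [show -(A + K) * (t - t') = -A * t + A * t' + -K * (t - t') by ring, exp_add, exp_add]
      have : exp (-A * t') * exp (A * t') = 1 := by rw [← exp_add]; simp
      linear_combination (-(exp (-A * t) * Z t * (K * exp (-K * (t - t'))) * (k' ((t' - s) / ε) v' * h v'))) * this
    · rfl
  have hm : ∀ t' ∈ Ioi s, m.restrict (Ioi t') = volume.restrict (Ioi t') := fun t' ht => by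
    rw [restrict_restrict measurableSet_Ioi, inter_eq_left.2 (Ioi_subset_Ioi (le_of_lt ht))]
  have hint : Integrable F (m.prod (m.prod volume)) := by
    refine ⟨hFm.aestronglyMeasurable, ?_⟩
    refine lt_of_le_of_lt (le_of_eq ?_) hfin
    refine (lintegral_prod_symm' _ hFm.enorm).trans ((lintegral_prod _ hFm.enorm.lintegral_prod_left'.aemeasurable).trans ?_)
    refine setLIntegral_congr_fun measurableSet_Ioi fun t' ht => ?_
    have e : ∀ v', ∫⁻ t, ‖F (t, (t', v'))‖ₑ ∂m = ofReal (exp (-A * t')) * avgAbs A K Z t' * (‖k' ((t' - s) / ε) v'‖ₑ * ‖h v'‖ₑ) := by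
      intro v'
      simp_rw [hsec, enorm_indicator_eq_indicator_enorm]
      rw [lintegral_indicator measurableSet_Ioi, hm t' ht, avgAbs, ← lintegral_const_mul' _ _ ofReal_ne_top,
        ← lintegral_mul_const' _ _ (mul_ne_top enorm_ne_top enorm_ne_top)]
      refine lintegral_congr fun t => ?_
      rw [← enorm_of_nonneg (exp_pos _).le, ← enorm_of_nonneg (mul_pos hK (exp_pos _)).le]
      simp only [enorm_mul]; ring
    simp_rw [e]
    rw [lintegral_const_mul _ (by fun_prop), mul_assoc]
  have hL := integral_prod F hint
  have hR := integral_prod_symm F hint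
  rw [hL] at hR
  refine Eq.trans ?_ (hR.trans ?_)
  · refine integral_congr_ae ?_
    filter_upwards [hint.prod_right_ae, ae_restrict_mem measurableSet_Ioi] with t ht hts
    have hts : s < t := hts
    rw [integral_prod_symm _ ht, ← mul_assoc, ← integral_const_mul]
    refine integral_congr_ae ?_
    filter_upwards [hk] with v' hv
    rw [hv _ (div_pos (by linarith) hε)]
    have e1 : ∀ t', F (t, (t', v')) = (Iio t).indicator (fun t' => exp (-A * t) * Z t * h v' *
        (K * exp (-K * (t - t')) * k' ((t' - s) / ε) v')) t' := fun t' => by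
      simp only [hF, indicator_apply, mem_Iio]; split_ifs <;> ring
    simp_rw [e1]
    rw [integral_indicator measurableSet_Iio, restrict_restrict measurableSet_Iio, inter_comm, Ioi_inter_Iio,
      integral_const_mul, ← integral_Ioc_eq_integral_Ioo, ← intervalIntegral.integral_of_le hts.le]
    have e2 := intervalIntegral.integral_comp_div_sub (a := s) (b := t)
      (fun r => K * exp (-((t - s) / ε - r) * (K * ε)) * k' r v') hε.ne' (s / ε)
    rw [sub_self, ← sub_div] at e2
    have e3 : ∫ r in (0 : ℝ)..(t - s) / ε, K * ε * exp (-((t - s) / ε - r) * (K * ε)) * k' r v' =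
        ∫ t' in s..t, K * exp (-K * (t - t')) * k' ((t' - s) / ε) v' := by
      have e4 : ∀ t', K * exp (-K * (t - t')) * k' ((t' - s) / ε) v' =
          K * exp (-((t - s) / ε - (t' / ε - s / ε)) * (K * ε)) * k' (t' / ε - s / ε) v' := fun t' => by
        rw [← sub_div]; congr 3; field_simp; ring
      simp_rw [e4]
      rw [e2, smul_eq_mul, ← intervalIntegral.integral_const_mul]
      congr 1; funext r; ring
    rw [e3]; ring
  · rw [integral_prod _ hint.integral_prod_right]
    refine setIntegral_congr_fun measurableSet_Ioi fun t' ht => ?_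
    simp_rw [hsec, integral_indicator measurableSet_Ioi, hm t' ht, integral_const_mul, integral_mul_const, integral_const_mul]
    rw [timeAvg]; ring

section
variable {A ε : ℝ} {Z h U : ℝ → E → ℝ} {κ κ' : ℝ → E → E → ℝ}

lemma measurableSet_lt_triple : MeasurableSet {z : (ℝ × E) × ℝ | z.1.1 < z.2} :=
  measurableSet_lt (measurable_fst.comp measurable_fst) measurable_snd

lemma measurable_avg_integrand (hZ : Measurable (uncurry Z)) (A ε : ℝ) : Measurable fun z : (ℝ × E) × ℝ =>
    (1 + ‖z.1.2‖) / ε * exp (-(A + (1 + ‖z.1.2‖) / ε) * (z.2 - z.1.1)) * Z z.2 z.1.2 :=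
  Measurable.mul (by fun_prop) (Measurable.comp (f := fun z : (ℝ × E) × ℝ => (z.2, z.1.2)) hZ (by fun_prop))

lemma measurable_timeAvg (hZ : Measurable (uncurry Z)) (A ε : ℝ) :
    Measurable (uncurry fun s v => timeAvg A ((1 + ‖v‖) / ε) (fun t => Z t v) s) := by
  convert (((measurable_avg_integrand hZ A ε).indicator measurableSet_lt_triple).stronglyMeasurable.integral_prod_right'
    (ν := volume)).measurable using 1
  funext p
  rw [uncurry, timeAvg, ← integral_indicator measurableSet_Ioi]; rfl

lemma measurable_avgAbs (hZ : Measurable (uncurry Z)) (A : ℝ) (hε : 0 < ε) :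
    Measurable (uncurry fun s v => avgAbs A ((1 + ‖v‖) / ε) (fun t => Z t v) s) := by
  convert ((measurable_avg_integrand hZ A ε).indicator measurableSet_lt_triple).enorm.lintegral_prod_right' (ν := volume) using 1
  funext p
  rw [uncurry, avgAbs, ← lintegral_indicator measurableSet_Ioi]
  refine lintegral_congr fun t => ?_
  by_cases ht : p.1 < t <;> simp only [indicator_apply, mem_Ioi, mem_ofPred_eq, ht, if_true, if_false, enorm_zero]
  rw [enorm_mul _ (Z t p.2), enorm_of_nonneg (show 0 ≤ (1 + ‖p.2‖) / ε * exp _ by positivity)]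

lemma enorm_timeAvg_le (hK : 0 < K) (g : ℝ → ℝ) (s : ℝ) : ‖timeAvg A K g s‖ₑ ≤ avgAbs A K g s := by
  refine (enorm_integral_le_lintegral_enorm _).trans (le_of_eq (lintegral_congr fun t => ?_))
  rw [enorm_mul, enorm_of_nonneg (mul_pos hK (exp_pos _)).le]

lemma integral_tri_swap {f : (ℝ × E) × ℝ → ℝ} (hf : Integrable f tri) :
    ∫ q, f q ∂tri = ∫ p, (∫ t in Ioi (0 : ℝ), f ((t, p.2), p.1)) ∂timeSpace := by
  have hm := measurePreserving_tri
  refine Eq.trans ?_ (integral_prod _ (hm.integrable_comp_of_integrable hf))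
  conv_lhs => rw [← hm.map_eq, integral_map hm.measurable.aemeasurable (by rw [hm.map_eq]; exact hf.1)]
  rfl

lemma integral_formI_slice (hs : 0 < s) (v : E) : ∫ t in Ioi (0 : ℝ), formI A ε X κ h U ((t, v), s) =
    U s v / ε * ∫ t in Ioi s, exp (-A * t) * (X t v * ∫ v', κ ((t - s) / ε) v v' * h s v') := by
  have e : ∀ t, formI A ε X κ h U ((t, v), s) = (Ioi s).indicator (fun t => U s v / ε *
      (exp (-A * t) * (X t v * ∫ v', κ ((t - s) / ε) v v' * h s v'))) t := fun t => by
    simp only [formI, indicator_apply, mem_Ioi, opK]; split_ifs <;> ring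
  simp_rw [e]
  rw [integral_indicator measurableSet_Ioi, restrict_restrict measurableSet_Ioi, inter_eq_left.2 (Ioi_subset_Ioi hs.le),
    integral_const_mul]

/-- The time average can be moved from the kernel to the first argument. -/
lemma integral_formI_timeAvg (hε : 0 < ε) (hZ : Measurable (uncurry Z)) (hh : Measurable (uncurry h)) (hU : Measurable (uncurry U))
    (hκ : Measurable fun z : ℝ × E × E => κ z.1 z.2.1 z.2.2) (hκ' : Measurable fun z : ℝ × E × E => κ' z.1 z.2.1 z.2.2)
    (hk : ∀ τ v v', 0 < τ → v ≠ v' → κ τ v v' = ∫ r in (0 : ℝ)..τ, (1 + ‖v‖) * exp (-(τ - r) * (1 + ‖v‖)) * κ' r v v')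
    (hf : ∫⁻ q, formAbs A ε (fun t v => ‖lam v * Z t v‖ₑ) κ h U q ∂tri < ⊤)
    (hf' : ∫⁻ q, formAbs A ε (fun t v => ‖lam v‖ₑ * avgAbs A ((1 + ‖v‖) / ε) (fun t => Z t v) t) κ' h U q ∂tri < ⊤) :
    ∫ q, formI A ε (fun t v => lam v * Z t v) κ h U q ∂tri =
      ∫ q, formI A ε (fun t v => lam v * timeAvg A ((1 + ‖v‖) / ε) (fun t => Z t v) t) κ' h U q ∂tri := by
  have hl : Measurable fun p : ℝ × E => lam p.2 := continuous_lam.measurable.comp measurable_snd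
  have hK : ∀ v : E, 0 < (1 + ‖v‖) / ε := fun v => by positivity
  have i1 := integrable_formI hε (X := fun t v => lam v * Z t v) (hl.mul hZ) hκ hh hU hf
  have hav := measurable_avgAbs hZ A hε
  have i2 := integrable_formI hε (X := fun t v => lam v * timeAvg A ((1 + ‖v‖) / ε) (fun t => Z t v) t)
      (hl.mul (measurable_timeAvg hZ A ε)) hκ' hh hU <| by
    refine (lintegral_mono fun q => ?_).trans_lt hf'
    unfold formAbs
    split_ifs
    · gcongr
      beta_reduce
      rw [enorm_mul]
      gcongr
      exact enorm_timeAvg_le (hK _) _ _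
    · exact le_rfl
  rw [integral_tri_swap i1, integral_tri_swap i2]
  refine integral_congr_ae ?_
  have hm := measurable_formAbs (A := A) (ε := ε) (Y := fun t v => ‖lam v‖ₑ * avgAbs A ((1 + ‖v‖) / ε) (fun t => Z t v) t) (hl.enorm.mul hav) hκ' hh hU
  have hfin : ∀ᵐ p : ℝ × E ∂timeSpace, ∫⁻ t in Ioi (0 : ℝ), formAbs A ε (fun t v => ‖lam v‖ₑ * avgAbs A ((1 + ‖v‖) / ε)
      (fun t => Z t v) t) κ' h U ((t, p.2), p.1) < ⊤ := by
    have hm' := hm.comp measurePreserving_tri.measurable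
    refine ae_lt_top hm'.lintegral_prod_right' ?_
    rw [← measurePreserving_tri.lintegral_comp hm] at hf'
    exact ((lintegral_prod _ hm'.aemeasurable).symm.trans_lt hf').ne
  filter_upwards [hfin, quasiMeasurePreserving_fst.ae (ae_restrict_mem measurableSet_Ioi)] with p hp hs
  obtain ⟨s, v⟩ := p
  have hs : 0 < s := hs
  rw [integral_formI_slice hs, integral_formI_slice hs]
  by_cases hU0 : U s v = 0
  · simp [hU0]
  congr 1
  have h3 := integral_timeAvg_swap (A := A) (s := s) hε (hK v) (Z := fun t => Z t v) (k := fun τ v' => κ τ v v')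
    (k' := fun τ v' => κ' τ v v') (h := h s) (hZ.comp measurable_prodMk_right)
    (Measurable.comp (f := fun z : ℝ × E => (z.1, v, z.2)) hκ' (by fun_prop)) (hh.comp measurable_prodMk_left) ?_ ?_
  · have e : ∀ (a b c d : ℝ), a * (b * c * d) = b * (a * (c * d)) := fun a b c d => by ring
    simp_rw [e, integral_const_mul, h3]
  · filter_upwards [(measure_singleton v : volume {v} = 0) |> compl_mem_ae_iff.2] with v' hv τ hτ
    rw [hk τ v v' hτ fun e => hv (by simp [e]), div_mul_cancel₀ _ hε.ne']
  · have e1 : ∀ t, formAbs A ε (fun t v => ‖lam v‖ₑ * avgAbs A ((1 + ‖v‖) / ε) (fun t => Z t v) t) κ' h U ((t, v), s) =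
        (Ioi s).indicator (fun t => (ofReal ε⁻¹ * (‖lam v‖ₑ * ‖U s v‖ₑ)) * (ofReal (exp (-A * t)) * (avgAbs A ((1 + ‖v‖) / ε)
          (fun t => Z t v) t * ∫⁻ v', ‖κ' ((t - s) / ε) v v'‖ₑ * ‖h s v'‖ₑ))) t := fun t => by
      simp only [formAbs, indicator_apply, mem_Ioi, div_eq_mul_inv, ofReal_mul (exp_pos _).le]
      split_ifs
      · ring
      · rfl
    simp_rw [e1] at hp
    rw [lintegral_indicator measurableSet_Ioi, restrict_restrict measurableSet_Ioi, inter_eq_left.2 (Ioi_subset_Ioi hs.le),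
      lintegral_const_mul' _ _ (mul_ne_top ofReal_ne_top (mul_ne_top enorm_ne_top enorm_ne_top))] at hp
    refine ENNReal.lt_top_of_mul_ne_top_right hp.ne ?_
    simp [hU0, (lam_pos v).ne', hε]

end

/-! ### Weighted bounds for the kernels -/

/-- The weight `(1 + |v|)^{3/2}`. -/
def q3 (v : E) : ℝ := (1 + ‖v‖) * √(1 + ‖v‖)

/-- The kernel `mixK S a`, together with `b` times the correction from averaging in time. -/
def kerD (S : 𝓢(E, ℝ)) (a : ℕ) (b τ : ℝ) (v v' : E) : ℝ :=
  mixK mixM S a τ (v - v') + b * ((1 + ‖v‖)⁻¹ * (τ⁻¹ * mixK mixM (eulerS a S) a τ (v - v')))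

/-- The part of the kernel that remains after the weight `1 + |v|²` is moved to the last argument. -/
def kerC (S : 𝓢(E, ℝ)) (b τ : ℝ) (v v' : E) : ℝ :=
  kerD S 2 b τ v v' - (1 + ‖v‖ ^ 2)⁻¹ * ((1 + ‖v'‖ ^ 2) * mixK mixM S 2 τ (v - v'))

lemma norm_mixK_le (S : 𝓢(E, ℝ)) (ha : a = 1 ∨ a = 2) : ∃ C : ℝ, 0 ≤ C ∧ ∀ τ : ℝ, 0 < τ → ∀ w : E, w ≠ 0 →
    ‖mixK mixM S a τ w‖ ≤ C * (τ ^ a * mixProfile a (τ * ‖w‖)) ∧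
    (1 + ‖w‖) * √(1 + ‖w‖) * ‖mixK mixM S a τ w‖ ≤ C * (τ ^ (a - 1) * glR τ w) ∧
    √(1 + ‖w‖) * (τ⁻¹ * ‖mixK mixM S a τ w‖) ≤ C * glR τ w := by
  obtain ⟨C, hC, hb⟩ := enorm_mixK_le isMix_mixM S (a := a) (by omega)
  refine ⟨C * 8, by positivity, fun τ hτ w hw => ?_⟩
  have hx := norm_pos_iff.2 hw
  have hr : 0 < τ * ‖w‖ := by positivity
  have h1 : ‖mixK mixM S a τ w‖ ≤ C * (τ ^ a * mixProfile a (τ * ‖w‖)) := by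
    have h := hb τ hτ w hw
    rw [← ofReal_norm] at h
    exact (ENNReal.ofReal_le_ofReal_iff (mul_nonneg hC (mul_nonneg (by positivity) (mixProfile_nonneg a hr.le)))).1 h
  have h0 := mixProfile_nonneg a hr.le
  have hp := mixProfile_le (τ * ‖w‖) hr ha
  have hg := weight_mul_le_glR hτ hw
  set ρ := (τ * ‖w‖) ^ (-(5 / 4) : ℝ) * (1 + τ * ‖w‖) ^ (-5 : ℝ)
  have hs : 0 ≤ √(1 + ‖w‖) := sqrt_nonneg _
  refine ⟨h1.trans ?_, ?_, ?_⟩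
  · nlinarith [mul_nonneg hC (mul_nonneg (pow_nonneg hτ.le a) h0)]
  · have e : τ ^ a = τ ^ (a - 1) * τ := by rcases ha with rfl | rfl <;> simp [pow_succ]
    calc _ ≤ (1 + ‖w‖) * √(1 + ‖w‖) * (C * (τ ^ a * ρ)) := by
          gcongr; exact h1.trans (by gcongr)
      _ = C * τ ^ (a - 1) * ((1 + ‖w‖) * √(1 + ‖w‖) * (τ * ρ)) := by rw [e]; ring
      _ ≤ C * τ ^ (a - 1) * (8 * glR τ w) := by gcongr
      _ = _ := by ring
  · have h2 : τ⁻¹ * (τ ^ a * mixProfile a (τ * ‖w‖)) ≤ (1 + ‖w‖) * (τ * ρ) := by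
      rcases ha with rfl | rfl
      · have e : mixProfile 1 (τ * ‖w‖) = τ * ‖w‖ * mixProfile 2 (τ * ‖w‖) := by
          rw [mixProfile, mixProfile, ← mul_assoc, ← rpow_one_add' hr.le (by norm_num)]; norm_num
        have h3 := mixProfile_le (τ * ‖w‖) hr (Or.inr rfl)
        have h4 := mul_nonneg hτ.le (mixProfile_nonneg 2 hr.le)
        rw [e]
        calc _ = ‖w‖ * (τ * mixProfile 2 (τ * ‖w‖)) := by field_simp
          _ ≤ (1 + ‖w‖) * (τ * ρ) := by gcongr; linarith
      · calc _ = 1 * (τ * mixProfile 2 (τ * ‖w‖)) := by field_simp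
          _ ≤ (1 + ‖w‖) * (τ * ρ) := by gcongr; linarith
    calc _ ≤ √(1 + ‖w‖) * (τ⁻¹ * (C * (τ ^ a * mixProfile a (τ * ‖w‖)))) := by gcongr
      _ = C * (√(1 + ‖w‖) * (τ⁻¹ * (τ ^ a * mixProfile a (τ * ‖w‖)))) := by ring
      _ ≤ C * (√(1 + ‖w‖) * ((1 + ‖w‖) * (τ * ρ))) := by gcongr
      _ = C * ((1 + ‖w‖) * √(1 + ‖w‖) * (τ * ρ)) := by ring
      _ ≤ C * (8 * glR τ w) := by gcongr
      _ = _ := by ring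

lemma sqrt_weight_le (v v' : E) : √(1 + ‖v‖) ≤ √(1 + ‖v - v'‖) * (1 + ‖v'‖) := by
  have h1 : ‖v‖ ≤ ‖v - v'‖ + ‖v'‖ := by simpa using norm_add_le (v - v') v'
  have h2 := norm_nonneg v'
  have h3 := norm_nonneg (v - v')
  calc √(1 + ‖v‖) ≤ √((1 + ‖v - v'‖) * (1 + ‖v'‖) ^ 2) := Real.sqrt_le_sqrt (by nlinarith [mul_nonneg h2 h3, mul_nonneg h3 (sq_nonneg ‖v'‖)])
    _ = _ := by rw [sqrt_mul (by positivity), Real.sqrt_sq (by positivity)]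

lemma q3_le (v v' : E) : q3 v ≤ (1 + ‖v - v'‖) * √(1 + ‖v - v'‖) * (1 + ‖v'‖) ^ 2 := by
  have h1 : ‖v‖ ≤ ‖v - v'‖ + ‖v'‖ := by simpa using norm_add_le (v - v') v'
  have h2 := sqrt_weight_le v v'
  calc q3 v ≤ ((1 + ‖v - v'‖) * (1 + ‖v'‖)) * (√(1 + ‖v - v'‖) * (1 + ‖v'‖)) := by
        unfold q3; gcongr; nlinarith [mul_nonneg (norm_nonneg (v - v')) (norm_nonneg v')]
    _ = _ := by ring

lemma KerLE.add {x c' : ℝ} {κ κ' : ℝ → E → E → ℝ} (hq : ∀ v, 0 ≤ q v) (h : KerLE x q c κ) (h' : KerLE x q c' κ') :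
    KerLE x q (c + c') fun τ v v' => κ τ v v' + κ' τ v v' := fun τ v v' hτ hv => by
  have h1 := h τ v v' hτ hv
  have h2 := h' τ v v' hτ hv
  calc _ ≤ exp (-(x * τ)) * (q v * (‖κ τ v v'‖ + ‖κ' τ v v'‖)) := by
        have := hq v; gcongr; exact norm_add_le _ _
    _ ≤ _ := by linarith

lemma q3_pos (v : E) : 0 < q3 v := by unfold q3; positivity

lemma kerLE_kerD (S : 𝓢(E, ℝ)) (ha : a = 1 ∨ a = 2) : ∃ c : ℝ, 0 ≤ c ∧ ∀ b : ℝ, |b| ≤ 1 → ∀ x : ℝ, 0 < x →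
    KerLE x q3 (c * (1 + 1 / x) ^ (a - 1)) (kerD S a b) ∧ (a = 2 → KerLE x q3 c (kerC S b)) := by
  obtain ⟨C, hC, hb⟩ := norm_mixK_le S ha
  obtain ⟨C', hC', hb'⟩ := norm_mixK_le (eulerS a S) ha
  refine ⟨8 * C + C', by positivity, fun b hb1 x hx => ?_⟩
  have hT : KerLE x q3 C' fun τ v v' => b * ((1 + ‖v‖)⁻¹ * (τ⁻¹ * mixK mixM (eulerS a S) a τ (v - v'))) := by
    intro τ v v' hτ hv
    have h1 := (hb' τ hτ _ (sub_ne_zero.2 hv)).2.2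
    have h2 : exp (-(x * τ)) ≤ 1 := exp_le_one_iff.2 (by nlinarith)
    rw [norm_mul, norm_mul, norm_mul, norm_of_nonneg (by positivity : 0 ≤ τ⁻¹), norm_of_nonneg (by positivity : 0 ≤ (1 + ‖v‖)⁻¹),
      norm_eq_abs b]
    calc _ ≤ 1 * (q3 v * (1 * ((1 + ‖v‖)⁻¹ * (τ⁻¹ * ‖mixK mixM (eulerS a S) a τ (v - v')‖)))) := by
          have := (q3_pos v).le; gcongr
      _ = √(1 + ‖v‖) * (τ⁻¹ * ‖mixK mixM (eulerS a S) a τ (v - v')‖) := by unfold q3; field_simp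
      _ ≤ (√(1 + ‖v - v'‖) * (1 + ‖v'‖) ^ 2) * (τ⁻¹ * ‖mixK mixM (eulerS a S) a τ (v - v')‖) := by
          gcongr
          refine (sqrt_weight_le v v').trans ?_
          gcongr
          exact le_self_pow₀ (by linarith [norm_nonneg v']) (by norm_num)
      _ = (√(1 + ‖v - v'‖) * (τ⁻¹ * ‖mixK mixM (eulerS a S) a τ (v - v')‖)) * (1 + ‖v'‖) ^ 2 := by ring
      _ ≤ (C' * glR τ (v - v')) * (1 + ‖v'‖) ^ 2 := by gcongr
      _ = _ := by ring
  have hq : ∀ v, 0 ≤ q3 v := fun v => (q3_pos v).le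
  constructor
  · have hM : KerLE x q3 (8 * C * (1 + 1 / x) ^ (a - 1)) fun τ v v' => mixK mixM S a τ (v - v') := by
      intro τ v v' hτ hv
      have h1 := (hb τ hτ _ (sub_ne_zero.2 hv)).2.1
      have h2 : exp (-(x * τ)) * τ ^ (a - 1) ≤ (1 + 1 / x) ^ (a - 1) := by
        have h3 : exp (-(x * τ)) ≤ 1 := exp_le_one_iff.2 (by nlinarith)
        rcases ha with rfl | rfl
        · simpa using h3
        · have h4 := Real.mul_exp_neg_le_exp_neg_one (x * τ)
          have h5 : exp (-1) ≤ 1 := exp_le_one_iff.2 (by norm_num)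
          have h6 : exp (-(x * τ)) * τ = (1 / x) * (x * τ * exp (-(x * τ))) := by field_simp
          simp only [Nat.add_one_sub_one, pow_one]
          rw [h6]
          have : 0 < 1 / x := by positivity
          nlinarith
      have hg := glR_nonneg hτ (v - v')
      calc _ ≤ exp (-(x * τ)) * (((1 + ‖v - v'‖) * √(1 + ‖v - v'‖) * (1 + ‖v'‖) ^ 2) * ‖mixK mixM S a τ (v - v')‖) := by
            gcongr; exact q3_le v v'
        _ = exp (-(x * τ)) * (1 + ‖v'‖) ^ 2 * ((1 + ‖v - v'‖) * √(1 + ‖v - v'‖) * ‖mixK mixM S a τ (v - v')‖) := by ring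
        _ ≤ exp (-(x * τ)) * (1 + ‖v'‖) ^ 2 * (C * (τ ^ (a - 1) * glR τ (v - v'))) := by gcongr
        _ = C * (exp (-(x * τ)) * τ ^ (a - 1)) * (glR τ (v - v') * (1 + ‖v'‖) ^ 2) := by ring
        _ ≤ (8 * C) * (1 + 1 / x) ^ (a - 1) * (glR τ (v - v') * (1 + ‖v'‖) ^ 2) := by
            gcongr; linarith
    have h1 : 1 ≤ (1 + 1 / x) ^ (a - 1) := one_le_pow₀ (by have : 0 < 1 / x := by positivity
                                                           linarith)
    intro τ v v' hτ hv
    refine (hM.add hq hT τ v v' hτ hv).trans ?_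
    have hg := mul_nonneg (glR_nonneg hτ (v - v')) (sq_nonneg (1 + ‖v'‖))
    gcongr
    nlinarith
  · rintro rfl
    have hM : KerLE x q3 (8 * C) fun τ v v' => (1 + ‖v‖ ^ 2)⁻¹ * ((‖v‖ ^ 2 - ‖v'‖ ^ 2) * mixK mixM S 2 τ (v - v')) := by
      intro τ v v' hτ hv
      have h1 := (hb τ hτ _ (sub_ne_zero.2 hv)).1
      have h2 : exp (-(x * τ)) ≤ 1 := exp_le_one_iff.2 (by nlinarith)
      have h3 := norm_weight_mul_le_glR hτ (sub_ne_zero.2 hv)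
      have h4 : q3 v ≤ 2 * (1 + ‖v‖ ^ 2) := by
        have : √(1 + ‖v‖) ≤ 1 + ‖v‖ := sqrt_le_left (by positivity) |>.2 (by nlinarith [norm_nonneg v])
        calc q3 v ≤ (1 + ‖v‖) * (1 + ‖v‖) := by unfold q3; gcongr
          _ ≤ _ := by nlinarith [sq_nonneg (1 - ‖v‖)]
      have h5 : ‖‖v‖ ^ 2 - ‖v'‖ ^ 2‖ ≤ 2 * (‖v - v'‖ * (1 + ‖v - v'‖)) * (1 + ‖v'‖) ^ 2 := by
        have e1 := abs_norm_sub_norm_le v v'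
        have e2 : ‖v‖ ≤ ‖v - v'‖ + ‖v'‖ := by simpa using norm_add_le (v - v') v'
        rw [show ‖v‖ ^ 2 - ‖v'‖ ^ 2 = (‖v‖ - ‖v'‖) * (‖v‖ + ‖v'‖) by ring, norm_mul, norm_eq_abs, norm_of_nonneg (by positivity)]
        calc _ ≤ ‖v - v'‖ * (2 * ((1 + ‖v - v'‖) * (1 + ‖v'‖) ^ 2)) := by
              gcongr
              nlinarith [norm_nonneg v', norm_nonneg (v - v'), mul_nonneg (norm_nonneg (v - v')) (norm_nonneg v'),
                mul_nonneg (norm_nonneg (v - v')) (sq_nonneg ‖v'‖)]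
          _ = _ := by ring
      rw [norm_mul, norm_mul, norm_of_nonneg (by positivity : 0 ≤ (1 + ‖v‖ ^ 2)⁻¹)]
      have hp := mixProfile_nonneg 2 (by positivity : 0 ≤ τ * ‖v - v'‖)
      calc _ ≤ 1 * (2 * (1 + ‖v‖ ^ 2) * ((1 + ‖v‖ ^ 2)⁻¹ * ((2 * (‖v - v'‖ * (1 + ‖v - v'‖)) * (1 + ‖v'‖) ^ 2) *
            (C * (τ ^ 2 * mixProfile 2 (τ * ‖v - v'‖)))))) := by
            have := hq v; gcongr
        _ = 4 * C * (‖v - v'‖ * (1 + ‖v - v'‖) * (τ ^ 2 * mixProfile 2 (τ * ‖v - v'‖))) * (1 + ‖v'‖) ^ 2 := by field_simp; ring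
        _ ≤ 4 * C * (2 * glR τ (v - v')) * (1 + ‖v'‖) ^ 2 := by gcongr
        _ = _ := by ring
    have h := hM.add hq hT
    have e : kerC S b = fun τ v v' => (1 + ‖v‖ ^ 2)⁻¹ * ((‖v‖ ^ 2 - ‖v'‖ ^ 2) * mixK mixM S 2 τ (v - v')) +
        b * ((1 + ‖v‖)⁻¹ * (τ⁻¹ * mixK mixM (eulerS 2 S) 2 τ (v - v'))) := by
      funext τ v v'
      unfold kerC kerD
      field_simp
      ring
    rwa [e]

lemma kerD_eq_integral (S : 𝓢(E, ℝ)) (ha : 1 ≤ a) (τ : ℝ) (v v' : E) (hτ : 0 < τ) (hv : v ≠ v') :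
    kerD S a 0 τ v v' = ∫ r in (0 : ℝ)..τ, (1 + ‖v‖) * exp (-(τ - r) * (1 + ‖v‖)) * kerD S a 1 r v v' := by
  have h := mixK_eq_integral isMix_mixM S ha (θ := (1 + ‖v‖)⁻¹) (by positivity) hτ (sub_ne_zero.2 hv)
  simpa only [kerD, zero_mul, add_zero, one_mul, inv_inv, div_inv_eq_mul] using h

lemma measurable_kerD (S : 𝓢(E, ℝ)) (a : ℕ) (b : ℝ) : Measurable fun z : ℝ × E × E => kerD S a b z.1 z.2.1 z.2.2 := by
  have := isMix_mixM.finite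
  have h : ∀ S', Measurable fun z : ℝ × E × E => mixK mixM S' a z.1 (z.2.1 - z.2.2) := fun S' =>
    Measurable.comp (f := fun z : ℝ × E × E => (z.1, z.2.1 - z.2.2)) (measurable_mixK S' a) (by fun_prop)
  unfold kerD
  exact (h S).add ((Measurable.mul (by fun_prop) (Measurable.mul (by fun_prop) (h _))).const_mul b)

lemma integrable_mixK_mul (S : 𝓢(E, ℝ)) (hτ : 0 < τ) {h : E → ℝ} (hm : Measurable h) (hh : l2 volume (fun v => ‖h v‖ₑ) < ⊤) (v : E) :
    Integrable fun v' => mixK mixM S 2 τ (v - v') * h v' := by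
  have := isMix_mixM.finite
  have hk : Measurable (mixK mixM S 2 τ) := (measurable_mixK S 2).comp measurable_prodMk_left
  refine ⟨((hk.comp (by fun_prop)).mul hm).aestronglyMeasurable, ?_⟩
  simp_rw [HasFiniteIntegral, enorm_mul]
  exact (lintegral_mono fun v' => mul_le_mul' (enorm_mixK_le_mixAbs mixM S 2 τ _) le_rfl).trans_lt
    ((lintegral_conv_le_l2 (by fun_prop) hm.enorm v).trans_lt
    (mul_lt_top (l2_mixAbs_lt_top isMix_mixM S le_rfl (by norm_num) hτ) hh))

lemma integral_tri_le {G : (ℝ × E) × ℝ → ℝ} (hG : Integrable G tri) :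
    ‖∫ q, G q ∂tri‖ₑ ≤ ∫⁻ t in Ioi (0 : ℝ), ∫⁻ s in Ioi (0 : ℝ), ‖∫ v, G ((t, v), s)‖ₑ := by
  have hm := (measurePreserving_prodAssoc μ₊ (volume : Measure E) μ₊).symm
  have hi := hm.integrable_comp_of_integrable hG
  have e : ∫ q, G q ∂tri = ∫ t in Ioi (0 : ℝ), (∫ s in Ioi (0 : ℝ), ∫ v, G ((t, v), s)) := by
    refine (hm.integral_comp' G).symm.trans ((integral_prod _ hi).trans (integral_congr_ae ?_))
    filter_upwards [hi.prod_right_ae] with t ht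
    exact integral_prod_symm _ ht
  rw [e]
  exact (enorm_integral_le_lintegral_enorm _).trans (lintegral_mono fun t => enorm_integral_le_lintegral_enorm _)

/-- The weighted norm in time of a bound for the third argument. -/
def yN (A : ℝ) (y : ℝ → ℝ≥0∞) : ℝ≥0∞ := l2 μ₊ fun s => ofReal (exp (-(A / 2) * s)) * y s

/-- Second and third arguments for which the forms are bounded. -/
structure Adm (A : ℝ) (h U : ℝ → E → ℝ) (B : ℝ≥0∞) (y : ℝ → ℝ≥0∞) : Prop where
  mh : Measurable (uncurry h)
  mU : Measurable (uncurry U)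
  my : Measurable y
  pair : ∀ᵐ s ∂μ₊, Pair B (h s) (U s) (y s)
  hB : B ≠ ⊤
  hy : yN A y ≠ ⊤

@[fun_prop]
lemma measurable_q3 : Measurable q3 := by unfold q3; fun_prop

/-- The extra regularity of the third argument that the more singular kernels require. -/
def Ext (a : ℕ) (U : ℝ → E → ℝ) (y : ℝ → ℝ≥0∞) : Prop := a = 2 → ∃ (V : MIdx → ℝ → E → ℝ) (n : ℕ), 3 ≤ n ∧
  (∀ α, Measurable (uncurry (V α))) ∧ (∀ s, Sob n lam fun α => V α s) ∧ U = V 0 ∧ ∀ s, hNorm n lam (fun α => V α s) ≤ y s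

/-- The trilinear forms with kernels `kerD S a b` are bounded with constant `C`. -/
def FormBdd (C : ℝ≥0∞) (S : 𝓢(E, ℝ)) (a : ℕ) : Prop := ∀ A ε : ℝ, 0 < A → 0 < ε → ∀ b : ℝ, |b| ≤ 1 → ∀ X h U : ℝ → E → ℝ,
  Measurable (uncurry X) → ∀ (B : ℝ≥0∞) (y : ℝ → ℝ≥0∞), Adm A h U B y → Ext a U y → xN A q3 (fun t v => ‖X t v‖ₑ) ≠ ⊤ →
    ‖∫ q, formI A ε X (kerD S a b) h U q ∂tri‖ₑ ≤ C * (B * (xN A q3 (fun t v => ‖X t v‖ₑ) * yN A y))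

lemma FormBdd.mono {C' : ℝ≥0∞} (h : FormBdd C S a) (hC : C ≤ C') : FormBdd C' S a :=
  fun A ε hA hε b hb X g U hX B y hP hE hx => (h A ε hA hε b hb X g U hX B y hP hE hx).trans (mul_le_mul' hC le_rfl)

lemma exists_formBdd_one (S : 𝓢(E, ℝ)) : ∃ C : ℝ≥0∞, C ≠ ⊤ ∧ FormBdd C S 1 := by
  obtain ⟨C, hC, hb⟩ := lintegral_formAbs_le
  obtain ⟨c, hc, hk⟩ := kerLE_kerD S (a := 1) (Or.inl rfl)
  refine ⟨ofReal c * C, mul_ne_top ofReal_ne_top hC, fun A ε hA hε b hb1 X h U hX B y hP _ _ => ?_⟩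
  rw [mul_assoc]
  exact (enorm_integral_le_lintegral_enorm _).trans ((lintegral_mono (enorm_formI_le hε)).trans
    (hb A ε hε (fun t v => ‖X t v‖ₑ) (kerD S 1 b) h U q3 c hX.enorm (measurable_kerD S 1 b) hP.mh hP.mU measurable_q3 q3_pos hc
    (by simpa using (hk b hb1 (A * ε / 2) (by positivity)).1) B y hP.my hP.pair))

lemma formAbs_lt_top (S : 𝓢(E, ℝ)) (ha : a = 1 ∨ a = 2) (hA : 0 < A) (hε : 0 < ε) (hb : |b| ≤ 1) (hY : Measurable (uncurry Y)) (hP : Adm A h U B y)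
    (hx : xN A q3 Y ≠ ⊤) : ∫⁻ q, formAbs A ε Y (kerD S a b) h U q ∂tri < ⊤ := by
  obtain ⟨C, hC, hb'⟩ := lintegral_formAbs_le
  obtain ⟨c, hc, hk⟩ := kerLE_kerD S ha
  refine (hb' A ε hε Y (kerD S a b) h U q3 _ hY (measurable_kerD S a b) hP.mh hP.mU measurable_q3 q3_pos (by positivity)
    (hk b hb (A * ε / 2) (by positivity)).1 B y hP.my hP.pair).trans_lt ?_
  exact (mul_ne_top ofReal_ne_top (mul_ne_top hC (mul_ne_top hP.hB (mul_ne_top hx hP.hy)))).lt_top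

/-- The bound for the more singular kernels, which relies on the cancellation in Fourier space. -/
lemma exists_formBdd_two (S' : 𝓢(E, ℝ)) (l : Fin 3) : ∃ C : ℝ≥0∞, C ≠ ⊤ ∧ FormBdd C (∂_{basisVec l} S') 2 := by
  obtain ⟨C, hC, hb⟩ := lintegral_formAbs_le
  obtain ⟨c, hc, hk⟩ := kerLE_kerD (∂_{basisVec l} S') (a := 2) (Or.inr rfl)
  obtain ⟨C', hC', hb'⟩ := lintegral_cancellation_le isMix_mixM S' l
  generalize (∂_{basisVec l} S') = S at *
  refine ⟨ofReal c * C + C' * ofReal 2, add_ne_top.2 ⟨mul_ne_top ofReal_ne_top hC, mul_ne_top hC' ofReal_ne_top⟩,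
    fun A ε hA hε b hb1 X h U hX B y hAd hE hx => ?_⟩
  obtain ⟨V, n, hn, hV, hS, rfl, hVy⟩ := hE rfl
  obtain ⟨hh, -, hy, hP, hB, hyf⟩ := id hAd
  set h₁ : ℝ → E → ℝ := fun s v => (1 + ‖v‖ ^ 2) * h s v with hh₁
  set Y : ℝ → E → ℝ := fun t v => exp (-(A / 2) * t) * ((√(lam v))⁻¹ * (1 + ‖v‖ ^ 2)⁻¹) * X t v with hY
  have hh₁m : Measurable (uncurry h₁) := Measurable.mul (by fun_prop) hh
  have hCm : Measurable fun z : ℝ × E × E => kerC S b z.1 z.2.1 z.2.2 := by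
    have := isMix_mixM.finite
    refine (measurable_kerD S 2 b).sub (Measurable.mul (by fun_prop) (Measurable.mul (by fun_prop) ?_))
    exact Measurable.comp (f := fun z : ℝ × E × E => (z.1, z.2.1 - z.2.2)) (measurable_mixK S 2) (by fun_prop)
  have hle : ∀ s v, ‖h s v‖ₑ ≤ ofReal ((1 + ‖v‖) ^ 2) * ‖h s v‖ₑ ∧ ‖h₁ s v‖ₑ ≤ ofReal ((1 + ‖v‖) ^ 2) * ‖h s v‖ₑ := fun s v => by
    refine ⟨le_mul_of_one_le_left' (one_le_ofReal.2 (one_le_pow₀ (by linarith [norm_nonneg v]))), ?_⟩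
    rw [hh₁, enorm_mul, enorm_of_nonneg (by positivity)]
    gcongr
    nlinarith [norm_nonneg v]
  have hhs : ∀ s, Measurable (h s) := fun s => hh.comp measurable_prodMk_left
  have hL : ∀ᵐ s ∂μ₊, l2 volume (fun v => ‖h s v‖ₑ) < ⊤ ∧ L12 (h₁ s) ∧ l2 volume (fun v => ‖h₁ s v‖ₑ) ≤ B := by
    filter_upwards [hP] with s hs
    have h2 := (l2_mono fun v => (hle s v).2).trans hs.2.1
    exact ⟨((l2_mono fun v => (hle s v).1).trans hs.2.1).trans_lt hB.lt_top, ⟨⟨(hh₁m.comp measurable_prodMk_left).aestronglyMeasurable,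
      ((lintegral_mono fun v => (hle s v).2).trans hs.1).trans_lt hB.lt_top⟩, h2.trans_lt hB.lt_top⟩, h2⟩
  have b1 := hb A ε hε (fun t v => ‖X t v‖ₑ) (kerC S b) h (V 0) q3 c hX.enorm hCm hh (hV 0) measurable_q3 q3_pos hc
    ((hk b hb1 (A * ε / 2) (by positivity)).2 rfl) B y hy hP
  have i1 := integrable_formI hε hX hCm hh (hV 0) (b1.trans_lt (mul_ne_top ofReal_ne_top (mul_ne_top hC
    (mul_ne_top hB (mul_ne_top hx hyf)))).lt_top)
  have i2 := integrable_formI hε hX (measurable_kerD S 2 b) hh (hV 0) (formAbs_lt_top S (Or.inr rfl) hA hε hb1 hX.enorm hAd hx)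
  rw [← add_sub_cancel (∫ q, formI A ε X (kerC S b) h (V 0) q ∂tri) (∫ q, formI A ε X (kerD S 2 b) h (V 0) q ∂tri),
    ← integral_sub i2 i1, add_mul]
  refine (enorm_add_le _ _).trans (add_le_add (mul_assoc (ofReal c) C _ ▸ (enorm_integral_le_lintegral_enorm _).trans
    ((lintegral_mono (enorm_formI_le hε)).trans b1)) ?_)
  have hx1 : l2 timeSpace (fun p => ‖Y p.1 p.2‖ₑ) ≤ ofReal 2 * xN A q3 fun t v => ‖X t v‖ₑ := by
    have hq3 := measurable_q3
    have hxm : Measurable fun p : ℝ × E => ofReal (exp (-(A / 2) * p.1) * (√(lam p.2))⁻¹ * (q3 p.2)⁻¹) * ‖X p.1 p.2‖ₑ :=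
      Measurable.mul (by fun_prop) hX.enorm
    rw [xN, ← l2_const_mul hxm.aemeasurable]
    refine l2_mono fun p => ?_
    have hq := q3_pos p.2
    rw [hY, enorm_mul, enorm_of_nonneg (by positivity), ← mul_assoc, ← mul_assoc, ← ofReal_mul (by positivity)]
    have h4 : q3 p.2 ≤ 2 * (1 + ‖p.2‖ ^ 2) := by
      have : √(1 + ‖p.2‖) ≤ 1 + ‖p.2‖ := sqrt_le_left (by positivity) |>.2 (by nlinarith [norm_nonneg p.2])
      calc q3 p.2 ≤ (1 + ‖p.2‖) * (1 + ‖p.2‖) := by unfold q3; gcongr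
        _ ≤ _ := by nlinarith [sq_nonneg (1 - ‖p.2‖)]
    have h5 : (1 + ‖p.2‖ ^ 2)⁻¹ ≤ 2 * (q3 p.2)⁻¹ := by
      rw [← div_eq_mul_inv, inv_eq_one_div, div_le_div_iff₀ (by positivity) hq]; linarith
    gcongr ofReal ?_ * _
    calc _ ≤ exp (-(A / 2) * p.1) * (√(lam p.2))⁻¹ * (2 * (q3 p.2)⁻¹) := by gcongr
      _ = _ := by ring
  have b2 := hb' ε hε Y h₁ (Measurable.mul (by fun_prop) hX) hh₁m V n hn hV hS (fun s => ofReal (exp (-(A / 2) * s))) (by fun_prop) B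
    (hL.mono fun s hs => hs.2) (hx1.trans_lt (mul_ne_top ofReal_ne_top hx).lt_top)
  refine ((integral_tri_le (i2.sub i1)).trans ?_).trans (b2.trans ?_)
  · refine setLIntegral_mono' measurableSet_Ioi fun t ht => ?_
    rw [← Ioi_inter_Iio, inter_comm, ← restrict_restrict measurableSet_Iio, ← lintegral_indicator measurableSet_Iio]
    refine lintegral_mono_ae (hL.mono fun s hs => ?_)
    by_cases hst : s < t
    · have hτ : 0 < (t - s) / ε := div_pos (by linarith) hε
      rw [indicator_of_mem (mem_Iio.2 hst)]
      have e2 : ∀ v, (formI A ε X (kerD S 2 b) h (V 0) - formI A ε X (kerC S b) h (V 0)) ((t, v), s) = ε⁻¹ * exp (-(A / 2) * t) *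
          (Y t v * (√(lam v) * V 0 s v * cv (mixK mixM S 2 ((t - s) / ε)) (h₁ s) v)) := fun v => by
        have e3 : opK (kerD S 2 b) ((t - s) / ε) (h s) v - opK (kerC S b) ((t - s) / ε) (h s) v =
            (1 + ‖v‖ ^ 2)⁻¹ * cv (mixK mixM S 2 ((t - s) / ε)) (h₁ s) v := by
          have j3 : Integrable fun v' => mixK mixM S 2 ((t - s) / ε) (v - v') * h₁ s v' :=
            integrable_mixK_mul S hτ (by fun_prop) hs.2.1.2 v
          have j4 : Integrable fun v' => kerD S 2 b ((t - s) / ε) v v' * h s v' := by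
            refine ((integrable_mixK_mul S hτ (hhs s) hs.1 v).add ((integrable_mixK_mul (eulerS 2 S) hτ (hhs s) hs.1 v).const_mul
              (b * ((1 + ‖v‖)⁻¹ * ((t - s) / ε)⁻¹)))).congr (.of_forall fun v' => ?_)
            simp only [kerD, Pi.add_apply]; ring
          have j5 : ∀ v', kerC S b ((t - s) / ε) v v' * h s v' = kerD S 2 b ((t - s) / ε) v v' * h s v' -
              (1 + ‖v‖ ^ 2)⁻¹ * (mixK mixM S 2 ((t - s) / ε) (v - v') * h₁ s v') := fun v' => by
            simp only [kerC, hh₁]; ring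
          simp only [opK, cv, j5]
          rw [integral_sub j4 (by fun_prop), integral_const_mul]; ring
        simp only [formI, Pi.sub_apply, if_pos hst]
        have e4 : exp (-A * t) = exp (-(A / 2) * t) * exp (-(A / 2) * t) := by rw [← exp_add]; ring_nf
        have e5 : (√(lam v))⁻¹ * √(lam v) = 1 := inv_mul_cancel₀ (sqrt_pos.2 (lam_pos v)).ne'
        rw [← mul_sub, ← mul_sub, ← mul_sub, e3, e4, hY]
        linear_combination -(ε⁻¹ * exp (-(A / 2) * t) ^ 2 * ((1 + ‖v‖ ^ 2)⁻¹ * X t v * V 0 s v * cv (mixK mixM S 2 ((t - s) / ε)) (h₁ s) v)) * e5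
      simp_rw [e2]
      rw [integral_const_mul, enorm_mul, enorm_mul, enorm_of_nonneg (by positivity), enorm_of_nonneg (exp_pos _).le, mul_assoc]
      gcongr _ * (ofReal (exp ?_) * _)
      nlinarith
    · rw [indicator_of_notMem (by simpa using hst)]
      simp [formI, hst]
  · calc _ ≤ C' * (B * ((ofReal 2 * xN A q3 fun t v => ‖X t v‖ₑ) * yN A y)) := by
          gcongr
          exact l2_mono fun s => mul_le_mul' le_rfl (hVy s)
      _ = _ := by ring

lemma exists_uniform {ι : Type*} [Fintype ι] {Φ : ι → ℝ≥0∞ → Prop} (hm : ∀ i C C', C ≤ C' → Φ i C → Φ i C')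
    (h : ∀ i, ∃ C : ℝ≥0∞, C ≠ ⊤ ∧ Φ i C) : ∃ C : ℝ≥0∞, C ≠ ⊤ ∧ ∀ i, Φ i C := by
  choose C hC hΦ using h
  exact ⟨∑ i, C i, sum_ne_top.2 fun i _ => hC i,
    fun i => hm i _ _ (single_le_sum (f := C) (fun _ _ => zero_le) (Finset.mem_univ i)) (hΦ i)⟩

lemma exists_formBdd : ∃ C : ℝ≥0∞, C ≠ ⊤ ∧ ∀ i j l : Fin 3, FormBdd C (∂_{basisVec l} (hessG i j)) 1 ∧
    FormBdd C (∂_{basisVec l} (∂_{basisVec i} (hessG i j))) 2 := by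
  obtain ⟨C, hC, h⟩ := exists_uniform (ι := Fin 3 × Fin 3 × Fin 3) (Φ := fun q C => FormBdd C (∂_{basisVec q.2.2} (hessG q.1 q.2.1)) 1 ∧
    FormBdd C (∂_{basisVec q.2.2} (∂_{basisVec q.1} (hessG q.1 q.2.1))) 2) (fun q C C' hC h => ⟨h.1.mono hC, h.2.mono hC⟩) fun q => by
      obtain ⟨C, hC, h⟩ := exists_formBdd_one (∂_{basisVec q.2.2} (hessG q.1 q.2.1))
      obtain ⟨C', hC', h'⟩ := exists_formBdd_two (∂_{basisVec q.1} (hessG q.1 q.2.1)) q.2.2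
      exact ⟨C + C', add_ne_top.2 ⟨hC, hC'⟩, h.mono le_self_add, h'.mono le_add_self⟩
  exact ⟨C, hC, fun i j l => h (i, j, l)⟩

lemma xN_lam_sq (hq : Measurable q) (hq0 : ∀ v, 0 < q v) {Z : ℝ → E → ℝ≥0∞} (hZ : Measurable (uncurry Z)) :
    xN A q (fun t v => ofReal (lam v) * Z t v) ^ 2 =
      ∫⁻ v, ofReal (lam v * (q v ^ 2)⁻¹) * l2 μ₊ (fun t => ofReal (exp (-(A / 2) * t)) * Z t v) ^ 2 := by
  have hlm := continuous_lam.measurable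
  have hm : Measurable fun p : ℝ × E => (ofReal (exp (-(A / 2) * p.1) * (√(lam p.2))⁻¹ * (q p.2)⁻¹) * (ofReal (lam p.2) * Z p.1 p.2)) ^ 2 :=
    (Measurable.mul (by fun_prop) (Measurable.mul (by fun_prop) hZ)).pow_const _
  simp only [xN, l2_sq, timeSpace]
  rw [lintegral_prod_symm _ hm.aemeasurable]
  refine lintegral_congr fun v => ?_
  rw [← lintegral_const_mul' _ _ ofReal_ne_top]
  refine lintegral_congr fun t => ?_
  have := hq0 v
  have hl := sqrt_pos.2 (lam_pos v)
  simp only [mul_pow, ← ofReal_pow (lam_pos v).le, ← ofReal_pow (exp_pos _).le, ← mul_assoc]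
  rw [← ofReal_pow (by positivity), ← ofReal_mul (by positivity), ← ofReal_mul (by have := lam_pos v; positivity)]
  congr 2
  have e := sq_sqrt (lam_pos v).le
  field_simp
  rw [e]; ring

lemma l2_avgAbs_le (hA : 0 < A) (hK : 0 < K) {g : ℝ → ℝ} (hg : Measurable g) :
    l2 μ₊ (fun s => ofReal (exp (-(A / 2) * s)) * avgAbs A K g s) ≤ l2 μ₊ fun s => ofReal (exp (-(A / 2) * s)) * ‖g s‖ₑ := by
  set κ : ℝ → ℝ≥0∞ := (Iio 0).indicator fun x => ofReal (K * exp (K * x)) with hκ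
  set f : ℝ → ℝ≥0∞ := (Ioi 0).indicator fun s => ofReal (exp (-(A / 2) * s)) * ‖g s‖ₑ with hf
  have hκm : Measurable κ := Measurable.indicator (by fun_prop) measurableSet_Iio
  have hfm : Measurable f := Measurable.indicator (by fun_prop) measurableSet_Ioi
  have h1 : ∫⁻ x, κ x ≤ 1 := by
    rw [hκ, lintegral_indicator measurableSet_Iio, restrict_congr_set Iio_ae_eq_Iic, ← ofReal_integral_eq_lintegral_ofReal
      ((integrableOn_exp_mul_Iic hK 0).const_mul K) (of_forall fun x => by positivity), integral_const_mul, integral_exp_mul_Iic hK]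
    simp [hK.ne']
  have h2 := (l2_conv_le (m := (volume : Measure ℝ)) hκm hfm).trans (mul_le_of_le_one_left' h1)
  have h3 : ∀ F : ℝ → ℝ≥0∞, l2 volume ((Ioi 0).indicator F) = l2 μ₊ F := fun F => by
    simp only [l2, ← lintegral_indicator measurableSet_Ioi]
    congr 2 with x
    by_cases hx : x ∈ Ioi (0 : ℝ) <;> simp [hx]
  rw [hf, h3, ← hf] at h2
  refine le_trans ?_ h2
  rw [← h3]
  refine l2_mono fun s => ?_
  by_cases hs : s ∈ Ioi (0 : ℝ)
  · rw [indicator_of_mem hs, avgAbs, ← lintegral_const_mul' _ _ ofReal_ne_top, ← lintegral_indicator measurableSet_Ioi]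
    refine lintegral_mono fun t => ?_
    by_cases ht : t ∈ Ioi s
    · have ht0 : t ∈ Ioi (0 : ℝ) := lt_trans (mem_Ioi.1 hs) (mem_Ioi.1 ht)
      have ht' : s < t := ht
      rw [indicator_of_mem ht, hκ, indicator_of_mem (by simpa using ht'), hf, indicator_of_mem ht0, ← mul_assoc, ← mul_assoc,
        ← ofReal_mul (exp_pos _).le, ← ofReal_mul (by positivity)]
      gcongr ofReal ?_ * _
      rw [mul_left_comm, ← exp_add, mul_assoc, ← exp_add]
      gcongr K * exp ?_
      nlinarith
    · rw [indicator_of_notMem ht]; exact zero_le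
  · rw [indicator_of_notMem hs]; exact zero_le

lemma xN_mono {q' : E → ℝ} (hq : ∀ v, 0 < q v) (h : ∀ v, q v ≤ q' v) {Y' : ℝ → E → ℝ≥0∞} (hY : ∀ t v, Y t v ≤ Y' t v) :
    xN A q' Y ≤ xN A q Y' := l2_mono fun p => by
  have := hq p.2
  have := sqrt_pos.2 (lam_pos p.2)
  gcongr
  · exact h _
  · exact hY _ _

lemma one_le_q3 (v : E) : 1 ≤ q3 v := one_le_mul_of_one_le_of_one_le (by simp) (one_le_sqrt.2 (by simp))

lemma enorm_lam_mul (Z : ℝ → E → ℝ) : (fun t v => ‖lam v * Z t v‖ₑ) = fun t v => ofReal (lam v) * ‖Z t v‖ₑ := by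
  ext t v; rw [enorm_mul, enorm_of_nonneg (lam_pos v).le]

lemma formI_add {X' : ℝ → E → ℝ} {κ : ℝ → E → E → ℝ} (q : (ℝ × E) × ℝ) :
    formI A ε (fun t v => X t v + X' t v) κ h U q = formI A ε X κ h U q + formI A ε X' κ h U q := by
  unfold formI; split_ifs <;> ring

lemma xN_add_le {X' : ℝ → E → ℝ} (hX : Measurable (uncurry X)) (hX' : Measurable (uncurry X')) :
    xN A q3 (fun t v => ‖X t v + X' t v‖ₑ) ≤ xN A q3 (fun t v => ‖X t v‖ₑ) + xN A q3 fun t v => ‖X' t v‖ₑ := by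
  have hlm := continuous_lam.measurable
  have hq := measurable_q3
  refine le_trans (l2_mono fun p => ?_) (l2_add_le (Measurable.mul (by fun_prop) hX.enorm).aemeasurable
    (Measurable.mul (by fun_prop) hX'.enorm).aemeasurable)
  rw [← mul_add]
  exact mul_le_mul' le_rfl (enorm_add_le _ _)

/-- The norm of the time average that the dissipation controls. -/
def zN (A ε : ℝ) (Z : ℝ → E → ℝ) : ℝ≥0∞ := xN A q3 fun t v => ‖lam v * timeAvg A ((1 + ‖v‖) / ε) (fun t => Z t v) t‖ₑ

lemma FormBdd.timeAvg (hS : FormBdd C S a) (ha : a = 1 ∨ a = 2) (hA : 0 < A) (hε : 0 < ε)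
    {Z R : ℝ → E → ℝ} (hZ : Measurable (uncurry Z)) (hR : Measurable (uncurry R)) (hP : Adm A h U B y)
    (hE : Ext a U y) (hZf : xN A (fun _ => 1) (fun t v => ‖lam v * Z t v‖ₑ) ≠ ⊤) (hRf : xN A q3 (fun t v => ‖R t v‖ₑ) ≠ ⊤) :
    ∫⁻ q, formAbs A ε (fun t v => ‖lam v * Z t v + R t v‖ₑ) (kerD S a 0) h U q ∂tri < ⊤ ∧
    ‖∫ q, formI A ε (fun t v => lam v * Z t v + R t v) (kerD S a 0) h U q ∂tri‖ₑ ≤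
      C * (B * ((zN A ε Z + xN A q3 fun t v => ‖R t v‖ₑ) * yN A y)) := by
  have hlm := continuous_lam.measurable
  have hlZ : Measurable (uncurry fun t v => lam v * Z t v) := Measurable.mul (by fun_prop) hZ
  have hlT : Measurable (uncurry fun t v => lam v * WeakCoupling.timeAvg A ((1 + ‖v‖) / ε) (fun t => Z t v) t) :=
    Measurable.mul (by fun_prop) (measurable_timeAvg hZ A ε)
  have hav := measurable_avgAbs hZ A hε
  have x1 : xN A q3 (fun t v => ‖lam v * Z t v‖ₑ) ≠ ⊤ := ne_top_of_le_ne_top hZf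
    (xN_mono (fun v => one_pos) one_le_q3 fun t v => le_rfl)
  have x2 : xN A q3 (fun t v => ‖lam v‖ₑ * avgAbs A ((1 + ‖v‖) / ε) (fun t => Z t v) t) ≠ ⊤ := by
    refine ne_top_of_le_ne_top hZf ((xN_mono (fun v => one_pos) one_le_q3 fun t v => le_rfl).trans ?_)
    rw [← pow_le_pow_left_iff two_ne_zero, enorm_lam_mul]
    simp_rw [fun v => enorm_of_nonneg (lam_pos v).le]
    rw [xN_lam_sq measurable_const (fun _ => one_pos) hav, xN_lam_sq measurable_const (fun _ => one_pos) (Z := fun t v => ‖Z t v‖ₑ) hZ.enorm]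
    gcongr with v
    exact l2_avgAbs_le hA (by positivity) (measurable_slice_time hZ v)
  have x3 : zN A ε Z ≠ ⊤ := ne_top_of_le_ne_top x2 (xN_mono q3_pos (fun _ => le_rfl) fun t v => by
    rw [enorm_mul]; exact mul_le_mul' le_rfl (enorm_timeAvg_le (by positivity) _ _))
  have f1 := formAbs_lt_top S ha hA hε (b := 0) (by simp) (Y := fun t v => ‖lam v * Z t v‖ₑ) hlZ.enorm hP x1
  have f2 := formAbs_lt_top S ha hA hε (b := 0) (by simp) (Y := fun t v => ‖R t v‖ₑ) hR.enorm hP hRf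
  refine ⟨formAbs_lt_top S ha hA hε (b := 0) (by simp) (Y := fun t v => ‖lam v * Z t v + R t v‖ₑ) (hlZ.add hR).enorm hP (ne_top_of_le_ne_top (add_ne_top.2 ⟨x1, hRf⟩)
    (xN_add_le hlZ hR)), ?_⟩
  simp_rw [formI_add]
  rw [integral_add (integrable_formI hε hlZ (measurable_kerD S a 0) hP.mh hP.mU f1) (integrable_formI hε hR (measurable_kerD S a 0) hP.mh hP.mU f2),
    integral_formI_timeAvg hε hZ hP.mh hP.mU (measurable_kerD S a 0) (measurable_kerD S a 1)
      (fun τ v v' hτ hv => kerD_eq_integral S (by omega) τ v v' hτ hv) f1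
      (formAbs_lt_top S ha hA hε (b := 1) (by simp) (Y := fun t v => ‖lam v‖ₑ * avgAbs A ((1 + ‖v‖) / ε) (fun t => Z t v) t) (Measurable.mul (by fun_prop) hav) hP x2)]
  refine (enorm_add_le _ _).trans ((add_le_add (hS A ε hA hε 1 (by simp) _ h U hlT B y hP hE x3)
    (hS A ε hA hε 0 (by simp) R h U hR B y hP hE hRf)).trans (le_of_eq ?_))
  rw [zN]; ring

/-- Convergence of an iterated integral with inner integrand `F`, and a bound for it. -/
structure Good (A ε : ℝ) (X : ℝ → E → ℝ) (b : ℝ≥0∞) (F : ℝ × E → ℝ → ℝ) : Prop where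
  inner : ∀ᵐ p ∂timeSpace, IntervalIntegrable (F p) volume 0 p.1
  outer : Integrable (fun p => exp (-A * p.1) / ε * (X p.1 p.2 * ∫ s in (0 : ℝ)..p.1, F p s)) timeSpace
  bound : ‖∫ p, exp (-A * p.1) / ε * (X p.1 p.2 * ∫ s in (0 : ℝ)..p.1, F p s) ∂timeSpace‖ₑ ≤ b

lemma Good.sum {b : ℝ≥0∞} {F : Fin 3 → ℝ × E → ℝ → ℝ} (h : ∀ i, Good A ε X b (F i)) :
    Good A ε X (3 * b) fun p s => ∑ i, F i p s := by
  have e : (fun p : ℝ × E => exp (-A * p.1) / ε * (X p.1 p.2 * ∫ s in (0 : ℝ)..p.1, ∑ i, F i p s)) =ᵐ[timeSpace]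
      fun p => ∑ i, exp (-A * p.1) / ε * (X p.1 p.2 * ∫ s in (0 : ℝ)..p.1, F i p s) := by
    filter_upwards [ae_all_iff.2 fun i => (h i).inner] with p hp
    rw [intervalIntegral.integral_finsetSum fun i _ => hp i, mul_sum, mul_sum]
  refine ⟨?_, (integrable_finsetSum _ fun i _ => (h i).outer).congr e.symm, ?_⟩
  · filter_upwards [ae_all_iff.2 fun i => (h i).inner] with p hp
    rw [show (fun s => ∑ i, F i p s) = ∑ i, F i p by ext s; simp]
    exact IntervalIntegrable.sum Finset.univ fun i _ => hp i
  · rw [integral_congr_ae e, integral_finsetSum _ fun i _ => (h i).outer]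
    refine (enorm_sum_le _ _).trans ((sum_le_sum fun i _ => (h i).bound).trans (by simp))

lemma ae_pos_timeSpace : ∀ᵐ p ∂timeSpace, 0 < p.1 :=
  quasiMeasurePreserving_fst.ae (p := fun t : ℝ => 0 < t) (ae_restrict_mem measurableSet_Ioi)

lemma Good.congr {b : ℝ≥0∞} {F F' : ℝ × E → ℝ → ℝ} (h : Good A ε X b F)
    (hF : ∀ᵐ z ∂timeSpace, ∀ t, z.1 < t → F (t, z.2) z.1 = F' (t, z.2) z.1) : Good A ε X b F' := by
  have h1 : ∀ᵐ p ∂timeSpace, ∀ᵐ s ∂volume.restrict (Ioc 0 p.1), F p s = F' p s := by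
    have h2 : ∀ᵐ v : E, ∀ᵐ s ∂μ₊, ∀ t, s < t → F (t, v) s = F' (t, v) s :=
      ae_ae_of_ae_prod (measurePreserving_swap.quasiMeasurePreserving.ae hF)
    filter_upwards [Measure.quasiMeasurePreserving_snd.ae (p := fun v : E => ∀ᵐ s ∂μ₊, ∀ t, s < t → F (t, v) s = F' (t, v) s) h2] with p hp
    rw [restrict_congr_set Ioo_ae_eq_Ioc.symm]
    filter_upwards [ae_restrict_of_ae_restrict_of_subset Ioo_subset_Ioi_self hp, ae_restrict_mem measurableSet_Ioo] with s hs hs'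
    exact hs _ hs'.2
  have e : (fun p : ℝ × E => exp (-A * p.1) / ε * (X p.1 p.2 * ∫ s in (0 : ℝ)..p.1, F p s)) =ᵐ[timeSpace]
      fun p => exp (-A * p.1) / ε * (X p.1 p.2 * ∫ s in (0 : ℝ)..p.1, F' p s) := by
    filter_upwards [h1, ae_pos_timeSpace] with p hp hp0
    rw [intervalIntegral.integral_of_le hp0.le, intervalIntegral.integral_of_le hp0.le, integral_congr_ae hp]
  refine ⟨?_, h.outer.congr e, by rw [← integral_congr_ae e]; exact h.bound⟩
  filter_upwards [h1, h.inner, ae_pos_timeSpace] with p hp hi hp0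
  rw [intervalIntegrable_iff_integrableOn_Ioc_of_le hp0.le] at hi ⊢
  exact Integrable.congr hi hp

lemma exists_pos_xN (A : ℝ) : ∃ Y : ℝ → E → ℝ≥0∞, Measurable (uncurry Y) ∧ (∀ t v, Y t v ≠ 0) ∧ xN A q3 Y ≠ ⊤ := by
  have : SigmaFinite timeSpace := by unfold timeSpace; infer_instance
  obtain ⟨g, hg, hgm, hi⟩ := exists_pos_lintegral_lt_of_sigmaFinite timeSpace one_ne_zero
  have hlm := continuous_lam.measurable
  have hq := measurable_q3
  have hw : ∀ p : ℝ × E, 0 < exp (-(A / 2) * p.1) * (√(lam p.2))⁻¹ * (q3 p.2)⁻¹ := fun p => by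
    have := q3_pos p.2
    have := sqrt_pos.2 (lam_pos p.2)
    positivity
  refine ⟨fun t v => (ofReal (exp (-(A / 2) * t) * (√(lam v))⁻¹ * (q3 v)⁻¹))⁻¹ * (g (t, v) : ℝ≥0∞) ^ (1 / 2 : ℝ),
    Measurable.mul (by fun_prop) (hgm.coe_nnreal_ennreal.pow_const _), fun t v => ?_, ?_⟩
  · exact mul_ne_zero (ENNReal.inv_ne_zero.2 ofReal_ne_top) (ENNReal.rpow_pos (by simpa using hg (t, v)) ENNReal.coe_ne_top).ne'
  · refine (lt_of_le_of_lt (le_l2_iff.2 ?_) one_lt_top).ne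
    refine le_trans (lintegral_mono fun p => le_of_eq ?_) (hi.le.trans (by simp))
    rw [← mul_assoc, ENNReal.mul_inv_cancel (by simpa using hw p) ofReal_ne_top, one_mul, rpow_half_sq]

lemma good_of_form (hε : 0 < ε) {X₀ : ℝ → E → ℝ} {κ : ℝ → E → E → ℝ} {b : ℝ≥0∞}
    (hX : Measurable (uncurry X)) (hκ : Measurable fun z : ℝ × E × E => κ z.1 z.2.1 z.2.2) (hh : Measurable (uncurry h))
    (hU : Measurable (uncurry U)) (hY : Measurable (uncurry Y)) (hY0 : ∀ t v, Y t v ≠ 0)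
    (hYf : ∫⁻ q, formAbs A ε Y κ h U q ∂tri < ⊤) (hf : ∫⁻ q, formAbs A ε (fun t v => ‖X t v‖ₑ) κ h U q ∂tri < ⊤)
    (hb : ‖∫ q, formI A ε X κ h U q ∂tri‖ₑ ≤ b) (hXX : ∀ᵐ p ∂timeSpace, X₀ p.1 p.2 = X p.1 p.2) :
    Good A ε X₀ b fun p s => U s p.2 * opK κ ((p.1 - s) / ε) (h s) p.2 := by
  have hopm : ∀ p : ℝ × E, Measurable fun s => U s p.2 * opK κ ((p.1 - s) / ε) (h s) p.2 := fun p =>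
    (hU.comp (by fun_prop : Measurable fun s : ℝ => (s, p.2))).mul (((measurable_uncurried hκ hh ε).stronglyMeasurable.integral_prod_right'.measurable).comp
      (by fun_prop : Measurable fun s : ℝ => (p, s)))
  have hi := integrable_formI hε hX hκ hh hU hf
  have e : (fun p : ℝ × E => exp (-A * p.1) / ε * (X₀ p.1 p.2 * ∫ s in (0 : ℝ)..p.1, U s p.2 * opK κ ((p.1 - s) / ε) (h s) p.2)) =ᵐ[timeSpace]
      fun p => ∫ s, formI A ε X κ h U (p, s) ∂μ₊ := by
    filter_upwards [hXX, ae_pos_timeSpace] with p hp hp0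
    rw [hp, intervalIntegral.integral_of_le hp0.le, integral_Ioc_eq_integral_Ioo, ← integral_const_mul, ← integral_const_mul,
      ← Ioi_inter_Iio, inter_comm, ← restrict_restrict measurableSet_Iio, ← integral_indicator measurableSet_Iio]
    refine integral_congr_ae (of_forall fun s => ?_)
    simp only [formI, indicator, mem_Iio]
  refine ⟨?_, hi.integral_prod_left.congr e.symm, ?_⟩
  · have h1 := measurable_formAbs (A := A) (ε := ε) hY hκ hh hU
    rw [tri, lintegral_prod _ h1.aemeasurable] at hYf
    filter_upwards [ae_lt_top h1.lintegral_prod_right' hYf.ne, ae_pos_timeSpace] with p hp hp0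
    rw [intervalIntegrable_iff_integrableOn_Ioo_of_le hp0.le]
    refine ⟨(hopm p).aestronglyMeasurable, ?_⟩
    set c : ℝ≥0∞ := ofReal (exp (-A * p.1) / ε) * Y p.1 p.2 with hc
    have hc0 : c ≠ 0 := mul_ne_zero (by simpa using (by positivity : 0 < exp (-A * p.1) / ε)) (hY0 _ _)
    have h2 : c * ∫⁻ s in Ioo 0 p.1, ‖U s p.2 * opK κ ((p.1 - s) / ε) (h s) p.2‖ₑ ≤ ∫⁻ s, formAbs A ε Y κ h U (p, s) ∂μ₊ := by
      refine (lintegral_const_mul_le _ _).trans ?_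
      rw [← Ioi_inter_Iio, inter_comm, ← restrict_restrict measurableSet_Iio, ← lintegral_indicator measurableSet_Iio]
      refine lintegral_mono fun s => ?_
      by_cases hs : s < p.1
      · rw [indicator_of_mem (mem_Iio.2 hs), formAbs, if_pos hs, hc, mul_assoc, enorm_mul]
        gcongr
        refine (enorm_integral_le_lintegral_enorm _).trans (le_of_eq ?_)
        simp_rw [enorm_mul]
      · rw [indicator_of_notMem (by simpa using hs)]; exact zero_le
    exact ENNReal.lt_top_of_mul_ne_top_right (h2.trans_lt hp).ne hc0
  · rw [integral_congr_ae e, ← integral_prod _ hi]; exact hb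

lemma FormBdd.good (hS : FormBdd C S a) (ha : a = 1 ∨ a = 2) (hA : 0 < A) (hε : 0 < ε)
    {Z R : ℝ → E → ℝ} (hZ : Measurable (uncurry Z)) (hR : Measurable (uncurry R)) (hP : Adm A h U B y)
    (hE : Ext a U y) (hZf : xN A (fun _ => 1) (fun t v => ‖lam v * Z t v‖ₑ) ≠ ⊤) (hRf : xN A q3 (fun t v => ‖R t v‖ₑ) ≠ ⊤)
    (hX : ∀ᵐ p ∂timeSpace, X p.1 p.2 = lam p.2 * Z p.1 p.2 + R p.1 p.2) :
    Good A ε X (C * (B * ((zN A ε Z + xN A q3 fun t v => ‖R t v‖ₑ) * yN A y)))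
      fun p s => U s p.2 * cv (mixK mixM S a ((p.1 - s) / ε)) (h s) p.2 := by
  have hlm := continuous_lam.measurable
  obtain ⟨Y, hY, hY0, hYf⟩ := exists_pos_xN A
  obtain ⟨h1, h2⟩ := hS.timeAvg ha hA hε hZ hR hP hE hZf hRf
  have := good_of_form hε (Measurable.add (Measurable.mul (by fun_prop) hZ) hR) (measurable_kerD S a 0) hP.mh hP.mU hY hY0
    (formAbs_lt_top S ha hA hε (b := 0) (by simp) hY hP hYf) h1 h2 hX
  simpa only [opK, cv, kerD, zero_mul, add_zero] using this

lemma hNorm_mono {m : ℕ} (h : m ≤ n) (hν : ∀ v, 0 ≤ ν v) (U : MIdx → E → ℝ) : hNorm m ν U ≤ hNorm n ν U := by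
  rw [← pow_le_pow_left_iff two_ne_zero, hNorm_sq m hν, hNorm_sq n hν]
  exact Finset.sum_le_sum_of_subset fun α hα => mem_midxLE.2 ((mem_midxLE.1 hα).trans h)

lemma exists_weight_le : ∃ C : ℝ≥0∞, C ≠ ⊤ ∧ ∀ h : E → ℝ, Measurable h → ∫⁻ v, ofReal ((1 + ‖v‖) ^ 2) * ‖h v‖ₑ ≤ C * wl2 lamT h ∧
    l2 volume (fun v => ofReal ((1 + ‖v‖) ^ 2) * ‖h v‖ₑ) ≤ C * wl2 lamT h ∧
    ∀ v, ofReal ((1 + ‖v‖) ^ 2) * ‖h v‖ₑ ≤ C * (ofReal (√(lamT v)) * ‖h v‖ₑ) := by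
  obtain ⟨c, hc, hle⟩ : ∃ c : ℝ, 0 ≤ c ∧ ∀ v : E, (1 + ‖v‖) ^ 4 ≤ c * √(lamT v) :=
    ⟨√((8 + 1).factorial * exp 1), sqrt_nonneg _, fun v => by
      rw [← sqrt_mul (by positivity)]
      exact Real.le_sqrt_of_sq_le (by rw [← pow_mul]; exact one_add_pow_le_lamT 8 v)⟩
  have hle2 : ∀ v : E, (1 + ‖v‖) ^ 2 ≤ c * √(lamT v) := fun v =>
    (pow_le_pow_right₀ (by linarith [norm_nonneg v]) (by norm_num)).trans (hle v)
  have hle3 : ∀ v : E, (1 + ‖v‖) ^ 2 ≤ ((1 + ‖v‖) ^ 2)⁻¹ * (c * √(lamT v)) := fun v => by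
    rw [← div_eq_inv_mul, le_div_iff₀ (by positivity)]
    exact (le_of_eq (by ring)).trans (hle v)
  set k := l2 volume fun v : E => ofReal ((1 + ‖v‖) ^ 2)⁻¹ with hk
  have hkt : k ≠ ⊤ := by
    refine (rpow_lt_top_of_nonneg (by norm_num) (lt_of_le_of_lt (lintegral_mono fun v => le_of_eq ?_)
      (integrable_one_add_norm (E := E) (μ := volume) (r := 4) (by simp; norm_num)).lintegral_lt_top).ne).ne
    rw [← ofReal_pow (by positivity), rpow_neg (by positivity), inv_pow, ← pow_mul]
    congr 2; exact_mod_cast (rpow_natCast (1 + ‖v‖) 4).symm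
  have hs : ∀ (h : E → ℝ) v, ofReal ((1 + ‖v‖) ^ 2) * ‖h v‖ₑ ≤ ofReal c * (ofReal (√(lamT v)) * ‖h v‖ₑ) := fun h v => by
    rw [← mul_assoc, ← ofReal_mul hc]
    gcongr
    exact hle2 v
  refine ⟨ofReal c + k * ofReal c, by finiteness, fun h hh => ?_⟩
  have hm : AEMeasurable fun v => ofReal (√(lamT v)) * ‖h v‖ₑ := ((measurable_ofReal_sqrt continuous_lamT).mul hh.enorm).aemeasurable
  refine ⟨?_, ?_, fun v => (hs h v).trans (mul_le_mul' le_self_add le_rfl)⟩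
  · refine le_trans ?_ (mul_le_mul' le_add_self le_rfl)
    rw [mul_assoc, wl2, ← l2_const_mul hm]
    refine le_trans (lintegral_mono fun v => ?_) (lintegral_mul_le_l2 (by fun_prop) (hm.const_mul _))
    rw [← mul_assoc, ← mul_assoc, mul_assoc (ofReal _), ← ofReal_mul hc, ← ofReal_mul (by positivity)]
    gcongr
    exact hle3 v
  · refine le_trans ?_ (mul_le_mul' le_self_add le_rfl)
    rw [wl2, ← l2_const_mul hm]
    exact l2_mono (hs h)

lemma exists_pair : ∃ C : ℝ≥0∞, 1 ≤ C ∧ C ≠ ⊤ ∧ ∀ n : ℕ, 12 ≤ n → ∀ (P W : MIdx → E → ℝ) (κ b : MIdx), Sob (n - 1) lamT P → Sob n lam W →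
    κ.abs ≤ n - 1 → b.abs ≤ n → κ.abs + b.abs ≤ n → ∀ m y : ℝ≥0∞, hNorm (n - 1) lamT P ≤ m → hNorm n lam W ≤ y →
    Pair (C * m) (P κ) (W b) (C * y) := by
  obtain ⟨C₁, h1, hw⟩ := exists_weight_le
  obtain ⟨C₂, -, h2⟩ := sob_sup isWt_lamT
  obtain ⟨C₃, -, h3⟩ := sob_sup isWt_lam
  refine ⟨1 + C₁ + C₁ * ofReal C₂ + ofReal C₃, le_add_right (le_add_right le_self_add), by finiteness,
    fun n hn P W κ b hP hW hκ hb hκb m y hm hy => ?_⟩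
  have hl : ∀ v, 0 ≤ lamT v := fun v => (lamT_pos v).le
  have hl' : ∀ v, 0 ≤ lam v := fun v => (lam_pos v).le
  obtain ⟨w1, w2, w3⟩ := hw (P κ) (hP.meas κ hκ)
  have i1 : C₁ * wl2 lamT (P κ) ≤ (1 + C₁ + C₁ * ofReal C₂ + ofReal C₃) * m :=
    mul_le_mul' (le_add_right (le_add_right le_add_self)) ((wl2_le_hNorm hl P hκ).trans hm)
  refine ⟨w1.trans i1, w2.trans i1, (wl2_le_hNorm hl' W hb).trans (hy.trans (le_mul_of_one_le_left' (le_add_right (le_add_right le_self_add)))), ?_⟩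
  by_cases hb3 : b.abs + 3 ≤ n
  · refine Or.inr ((h3 n W hW b hb3).mono fun v hv => hv.trans ?_)
    exact mul_le_mul' le_add_self ((hNorm_mono hb3 hl' W).trans hy)
  · refine Or.inl ((h2 (n - 1) P hP κ (by omega)).mono fun v hv => (w3 v).trans ?_)
    calc _ ≤ C₁ * (ofReal C₂ * m) := by
          refine mul_le_mul' le_rfl (hv.trans (mul_le_mul' le_rfl ((hNorm_mono (by omega) hl P).trans hm)))
      _ = C₁ * ofReal C₂ * m := by ring
      _ ≤ _ := mul_le_mul' (le_add_right le_add_self) le_rfl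

/-- Mollification of a function with its derivatives. -/
def moll (η : E → ℝ) (γ : ℝ) (V : MIdx → E → ℝ) (κ : MIdx) : E → ℝ := cv (mollK η γ) (V κ)

lemma exists_moll (hν : IsWt ν) : ∃ C : ℝ≥0∞, 1 ≤ C ∧ C ≠ ⊤ ∧ ∀ η : E → ℝ, IsMollifier η → ∀ γ : ℝ, 0 < γ → γ ≤ 1 →
    ∀ (n : ℕ) (V : MIdx → E → ℝ), Sob n ν V → Sob n ν (moll η γ V) ∧ hNorm n ν (moll η γ V) ≤ C * hNorm n ν V := by
  obtain ⟨C, hC, hb⟩ := wl2_cv_le hν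
  refine ⟨1 + ofReal C, le_self_add, by finiteness, fun η hη γ hγ hγ1 n V hV => ⟨?_, ?_⟩⟩
  · have h := sob_mollify hη hγ hγ1 hν hV n
    have e : ∀ κ : MIdx, κ.abs ≤ n → cv (mderiv κ (mollK η γ)) (V 0) = moll η γ V κ :=
      fun κ hκ => cv_mderiv_left (isTest_mollK hη hγ) (hV.mono le_rfl hν.low) hκ
    exact ⟨fun κ hκ => by rw [← e κ hκ]; exact h.meas κ hκ, h.approx.imp fun ψ hψ => ⟨hψ.1, fun κ hκ => by
      simpa only [e κ hκ] using hψ.2 κ hκ⟩⟩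
  · have hp : ∀ v, 0 ≤ ν v := fun v => (hν.pos v).le
    rw [← pow_le_pow_left_iff two_ne_zero, mul_pow, hNorm_sq n hp, hNorm_sq n hp, mul_sum]
    refine sum_le_sum fun κ hκ => ?_
    rw [← mul_pow]
    gcongr
    refine (hb _ _ (isTest_mollK hη hγ).continuous.measurable (fun x hx => mollK_eq_zero hη hγ (by linarith))
      (hV.meas κ (mem_midxLE.1 hκ))).trans ?_
    rw [lintegral_mollK hη hγ, mul_one]
    exact mul_le_mul' le_add_self le_rfl

lemma norm_lam_sub_le (h : ‖v - w‖ ≤ 2) : |lam w - lam v| ≤ exp 1 * ‖v - w‖ * (√(lam v) * √(lam w)) := by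
  have key : ∀ a b d : ℝ, a ≤ b → b - a ≤ d → d ≤ 2 → exp b - exp a ≤ exp 1 * d * (exp (a / 2) * exp (b / 2)) := fun a b d hab hd hd2 => by
    have h1 : exp b - exp a ≤ exp b * (b - a) := by
      have := Real.add_one_le_exp (a - b)
      have e : exp a = exp b * exp (a - b) := by rw [← exp_add, add_sub_cancel]
      rw [e]; nlinarith [exp_pos b]
    have h2 : exp b ≤ exp 1 * (exp (a / 2) * exp (b / 2)) := by
      rw [← exp_add, ← exp_add]; exact exp_le_exp.2 (by linarith)
    calc _ ≤ exp b * (b - a) := h1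
      _ ≤ exp 1 * (exp (a / 2) * exp (b / 2)) * d := by gcongr
      _ = _ := by ring
  have hd := abs_norm_sub_norm_le v w
  rw [abs_le] at hd
  simp only [lam, ← Real.exp_half, abs_le]
  rcases le_total ‖v‖ ‖w‖ with hvw | hvw
  · have := key _ _ _ hvw (by linarith) h
    have := exp_le_exp.2 hvw
    exact ⟨by have : 0 ≤ exp 1 * ‖v - w‖ * (exp (‖v‖ / 2) * exp (‖w‖ / 2)) := by positivity
              linarith, by linarith⟩
  · have h1 := key _ _ _ hvw (by linarith) h
    have := exp_le_exp.2 hvw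
    rw [mul_comm (exp (‖w‖ / 2))] at h1
    exact ⟨by linarith, by have : 0 ≤ exp 1 * ‖v - w‖ * (exp (‖v‖ / 2) * exp (‖w‖ / 2)) := by positivity
                           linarith⟩

lemma lintegral_norm_mul_pd_mollK (hη : IsMollifier η) (hγ : 0 < γ) (i : Fin 3) :
    ∫⁻ x, ‖x‖ₑ * ‖pd i (mollK η γ) x‖ₑ = ∫⁻ x, ‖x‖ₑ * ‖pd i η x‖ₑ := by
  have h1 : IsTest η := by
    convert isTest_mollK hη one_pos using 1
    ext x; simp [mollK]
  have e : ∀ x, pd i (mollK η γ) x = γ⁻¹ ^ 3 * (γ⁻¹ * pd i η (γ⁻¹ • x)) := fun x => by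
    have hd : DifferentiableAt ℝ η (γ⁻¹ • x) := (h1.1.differentiable (by simp)).differentiableAt
    have h2 := ((hd.hasFDerivAt.comp x ((hasFDerivAt_id x).const_smul γ⁻¹)).const_mul (γ⁻¹ ^ 3)).fderiv
    have h3 : fderiv ℝ (mollK η γ) x = _ := h2
    rw [pd, h3]; simp [pd]
  have hc : ∀ {ρ : E → ℝ}, IsTest ρ → Integrable fun x => ‖x‖ * ‖pd i ρ x‖ := fun hρ =>
    (continuous_norm.mul (hρ.pd i).continuous.norm).integrable_of_hasCompactSupport ((hρ.pd i).2.norm.mul_left)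
  have e2 : ∀ {ρ : E → ℝ}, IsTest ρ → ∫⁻ x, ‖x‖ₑ * ‖pd i ρ x‖ₑ = ofReal (∫ x, ‖x‖ * ‖pd i ρ x‖) := fun hρ => by
    rw [ofReal_integral_eq_lintegral_ofReal (hc hρ) (of_forall fun x => by positivity)]
    exact lintegral_congr fun x => by rw [ofReal_mul (norm_nonneg _), ofReal_norm, ofReal_norm]
  rw [e2 (isTest_mollK hη hγ), e2 h1]
  have e3 : ∀ x : E, ‖x‖ * ‖pd i (mollK η γ) x‖ = γ⁻¹ ^ 3 * (fun y : E => ‖y‖ * ‖pd i η y‖) (γ⁻¹ • x) := fun x => by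
    beta_reduce
    rw [e, norm_mul, norm_mul, norm_smul, norm_of_nonneg (by positivity), norm_of_nonneg (by positivity)]; ring
  rw [funext e3, integral_const_mul, integral_comp_smul volume (fun y : E => ‖y‖ * ‖pd i η y‖)]
  simp only [finrank_euclideanSpace, Fintype.card_fin, smul_eq_mul]
  rw [abs_of_pos (by positivity)]
  field_simp

lemma yN_const_mul (hy : Measurable y) (c : ℝ≥0∞) : yN A (fun s => c * y s) = c * yN A y := by
  rw [yN, yN, ← l2_const_mul (f := fun s => ofReal (exp (-(A / 2) * s)) * y s) (Measurable.mul (by fun_prop) hy).aemeasurable]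
  congr 1 with s; ring

lemma yN_mono {y' : ℝ → ℝ≥0∞} (h : ∀ s, y s ≤ y' s) : yN A y ≤ yN A y' := l2_mono fun s => mul_le_mul' le_rfl (h s)

lemma xN_one_le_yN (hX : Measurable (uncurry X)) (h : ∀ t, l2 volume (fun v => ofReal (√(lam v))⁻¹ * ‖X t v‖ₑ) ≤ y t) : xN A (fun _ => 1) (fun t v => ‖X t v‖ₑ) ≤ yN A y := by
  have hlm := continuous_lam.measurable
  have hm : Measurable (uncurry fun (t : ℝ) (v : E) => ofReal (exp (-(A / 2) * t) * (√(lam v))⁻¹ * 1⁻¹) * ‖X t v‖ₑ) := by fun_prop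
  refine (l2_prod (μ := μ₊) (ν := (volume : Measure E)) hm.aemeasurable).symm.le.trans (l2_mono fun t => ?_)
  refine le_trans (le_of_eq ?_) (mul_le_mul' le_rfl (h t))
  have hs : Measurable fun v => ‖X t v‖ₑ := by fun_prop
  rw [← l2_const_mul (f := fun v => ofReal (√(lam v))⁻¹ * ‖X t v‖ₑ) (Measurable.mul (by fun_prop) hs).aemeasurable]
  congr 1 with v
  rw [inv_one, mul_one, ofReal_mul (exp_pos _).le, mul_assoc]

/-- The norm in `V^n_{A,λ}`. -/
def vN (A : ℝ) (n : ℕ) (V : MIdx → ℝ → E → ℝ) : ℝ≥0∞ := yN A fun s => hNorm n lam fun α => V α s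

/-- The gradient of `V λ` splits into `λ` times the gradient of `V` and a remainder without derivatives. -/
lemma exists_commutator (hη : IsMollifier η) : ∃ C : ℝ≥0∞, C ≠ ⊤ ∧ ∀ γ : ℝ, 0 < γ → γ ≤ 1 → ∀ (i : Fin 3) (A : ℝ) (n : ℕ)
    (V : MIdx → ℝ → E → ℝ), (∀ α, Measurable (uncurry (V α))) → (∀ t, Sob n lam fun α => V α t) → vN A n V ≠ ⊤ → ∀ α : MIdx, α.abs ≤ n →
    ∃ Z R : ℝ → E → ℝ, Measurable (uncurry Z) ∧ Measurable (uncurry R) ∧ (∀ t, Z t = mgrad η γ i (V α t)) ∧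
      (∀ t v, mgrad η γ i (fun w => V α t w * lam w) v = lam v * Z t v + R t v) ∧
      xN A (fun _ => 1) (fun t v => ‖lam v * Z t v‖ₑ) ≠ ⊤ ∧ xN A q3 (fun t v => ‖R t v‖ₑ) ≤ C * vN A n V := by
  obtain ⟨c, hc, hb⟩ := wl2_cv_le isWt_lam
  set D : ℝ≥0∞ := ∑ i, ∫⁻ x, ‖x‖ₑ * ‖pd i η x‖ₑ with hD
  have h1 : IsTest η := by
    convert isTest_mollK hη one_pos using 1
    ext x; simp [mollK]
  have hDt : D ≠ ⊤ := sum_ne_top.2 fun i _ => by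
    have : Integrable fun x => ‖x‖ * ‖pd i η x‖ :=
      (continuous_norm.mul (h1.pd i).continuous.norm).integrable_of_hasCompactSupport ((h1.pd i).2.norm.mul_left)
    simpa [HasFiniteIntegral, enorm_mul] using this.2.ne
  refine ⟨ofReal (exp 1) * D, by finiteness, fun γ hγ hγ1 i A n V hV hS hf α hα => ?_⟩
  have hlm := continuous_lam.measurable
  have hl : ∀ v, 0 ≤ lam v := fun v => (lam_pos v).le
  have hρ : IsTest (pd i (mollK η γ)) := (isTest_mollK hη hγ).pd i
  have hfar : ∀ x, 2 < ‖x‖ → pd i (mollK η γ) x = 0 := fun x hx => pd_eq_zero_of_far (fun x hx => mollK_eq_zero hη hγ (by linarith)) i hx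
  have hk : ∫⁻ x, ‖x‖ₑ * ‖pd i (mollK η γ) x‖ₑ ≤ D := (lintegral_norm_mul_pd_mollK hη hγ i).trans_le
    (single_le_sum (f := fun i => ∫⁻ x, ‖x‖ₑ * ‖pd i η x‖ₑ) (fun _ _ => zero_le) (Finset.mem_univ i))
  have hST : ∀ t, Sob n lamT fun α => V α t := fun t => (hS t).mono le_rfl isWt_lam.low
  have hloc : ∀ t, LocallyIntegrable (V α t) := fun t => (hST t).locallyIntegrable hα
  have hloc2 : ∀ t, LocallyIntegrable fun w => V α t w * lam w := fun t => by
    have := ((locallyIntegrableOn_univ.2 (hloc t)).mul_continuousOn continuous_lam.continuousOn isOpen_univ.isLocallyClosed)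
    exact locallyIntegrableOn_univ.1 this
  have hNm : Measurable fun t => hNorm n lam fun α => V α t := measurable_hNorm isWt_lam hV
  generalize hρe : pd i (mollK η γ) = ρ at *
  have hZm : Measurable (uncurry fun t => cv ρ (V α t)) :=
    measurable_cv_param (k := fun _ => ρ) (hρ.continuous.measurable.comp measurable_snd) (hV α)
  have hXm : Measurable (uncurry fun t => cv ρ fun w => V α t w * lam w) :=
    measurable_cv_param (k := fun _ => ρ) (g := fun t w => V α t w * lam w) (hρ.continuous.measurable.comp measurable_snd) (by fun_prop)
  have hlZ : Measurable (uncurry fun t v => lam v * cv ρ (V α t) v) := Measurable.mul (by fun_prop) hZm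
  have hRm : Measurable (uncurry fun t v => cv ρ (fun w => V α t w * lam w) v - lam v * cv ρ (V α t) v) := hXm.sub hlZ
  have hVs : ∀ t, Measurable (V α t) := fun t => (hV α).comp measurable_prodMk_left
  refine ⟨fun t => cv ρ (V α t), fun t v => cv ρ (fun w => V α t w * lam w) v - lam v * cv ρ (V α t) v, hZm, hRm,
    fun t => by rw [mgrad_of_locallyIntegrable hη hγ (hloc t), hρe], fun t v => by
      rw [mgrad_of_locallyIntegrable hη hγ (hloc2 t), hρe]; ring, ?_, ?_⟩
  · refine ne_top_of_le_ne_top ?_ (xN_one_le_yN hlZ (y := fun t => ofReal c * (∫⁻ x, ‖ρ x‖ₑ) * hNorm n lam fun α => V α t) fun t => ?_)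
    · rw [yN_const_mul hNm]
      exact mul_ne_top (mul_ne_top ofReal_ne_top hρ.integrable.2.ne) hf
    · refine le_trans (le_of_eq ?_) ((hb ρ (V α t) hρ.continuous.measurable hfar (hVs t)).trans
        (mul_le_mul' le_rfl (wl2_le_hNorm hl _ hα)))
      rw [wl2]
      congr 1 with v
      rw [enorm_mul, enorm_of_nonneg (hl v), ← mul_assoc, ← ofReal_mul (by positivity)]
      congr 2
      rw [inv_mul_eq_div, Real.div_sqrt]
  · refine (xN_mono (fun v => one_pos) one_le_q3 fun t v => le_rfl).trans ((xN_one_le_yN hRm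
      (y := fun t => ofReal (exp 1) * D * hNorm n lam fun α => V α t) fun t => ?_).trans_eq (yN_const_mul hNm _))
    have hwm : Measurable fun w => ofReal (√(lam w)) * ‖V α t w‖ₑ := (measurable_ofReal_sqrt continuous_lam).mul (hVs t).enorm
    have hkm : Measurable fun x => ‖x‖ₑ * ‖ρ x‖ₑ := Measurable.mul (by fun_prop) hρ.continuous.measurable.enorm
    refine le_trans (l2_mono (g := fun v => ofReal (exp 1) * ∫⁻ w, (‖v - w‖ₑ * ‖ρ (v - w)‖ₑ) * (ofReal (√(lam w)) * ‖V α t w‖ₑ)) fun v => ?_) ?_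
    · have e : cv ρ (fun w => V α t w * lam w) v - lam v * cv ρ (V α t) v = ∫ w, ρ (v - w) * V α t w * (lam w - lam v) := by
        have hi : ∀ g : E → ℝ, Continuous g → Integrable fun w => g w * ρ (v - w) * V α t w := fun g hg =>
          (hloc t).integrable_smul_left_of_hasCompactSupport (by fun_prop)
            ((hρ.2.comp_homeomorph (Homeomorph.subLeft v)).mul_left)
        rw [cv, cv, ← integral_const_mul, ← integral_sub ((hi lam continuous_lam).congr (of_forall fun w => by ring_nf))
          ((hi (fun _ => lam v) continuous_const).congr (of_forall fun w => by ring_nf))]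
        exact integral_congr_ae (of_forall fun w => by ring_nf)
      have hs := sqrt_pos.2 (lam_pos v)
      rw [e, ← lintegral_const_mul' _ _ ofReal_ne_top]
      refine (mul_le_mul' le_rfl (enorm_integral_le_lintegral_enorm _)).trans ?_
      rw [← lintegral_const_mul' _ _ ofReal_ne_top]
      refine lintegral_mono fun w => ?_
      rw [enorm_mul, enorm_mul]
      by_cases hw : 2 < ‖v - w‖
      · simp [hfar _ hw]
      · have h3 : ofReal (√(lam v))⁻¹ * ‖lam w - lam v‖ₑ ≤ ofReal (exp 1) * ‖v - w‖ₑ * ofReal (√(lam w)) := by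
          rw [← ofReal_norm, ← ofReal_norm, ← ofReal_mul (by positivity), ← ofReal_mul (by positivity),
            ← ofReal_mul (by positivity)]
          refine ofReal_le_ofReal ?_
          rw [inv_mul_le_iff₀ hs]
          exact (norm_lam_sub_le (not_lt.1 hw)).trans (le_of_eq (by ring))
        calc _ = ofReal (√(lam v))⁻¹ * ‖lam w - lam v‖ₑ * (‖ρ (v - w)‖ₑ * ‖V α t w‖ₑ) := by ring
          _ ≤ ofReal (exp 1) * ‖v - w‖ₑ * ofReal (√(lam w)) * (‖ρ (v - w)‖ₑ * ‖V α t w‖ₑ) := mul_le_mul' h3 le_rfl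
          _ = _ := by ring
    · have hcm : Measurable fun v => ∫⁻ w, (‖v - w‖ₑ * ‖ρ (v - w)‖ₑ) * (ofReal (√(lam w)) * ‖V α t w‖ₑ) := by
        refine Measurable.lintegral_prod_right' (f := fun q : E × E => (‖q.1 - q.2‖ₑ * ‖ρ (q.1 - q.2)‖ₑ) * (ofReal (√(lam q.2)) * ‖V α t q.2‖ₑ)) ?_
        exact (hkm.comp (by fun_prop : Measurable fun q : E × E => q.1 - q.2)).mul (by fun_prop)
      rw [l2_const_mul hcm.aemeasurable, mul_assoc]
      refine mul_le_mul' le_rfl ((l2_conv_le hkm hwm).trans (mul_le_mul' hk ?_))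
      exact wl2_le_hNorm hl (fun α => V α t) hα

/-- Representatives of the density and of the solution together with their derivatives. -/
structure Ctx (n : ℕ) (A : ℝ) (m : ℝ≥0∞) (N V : MIdx → ℝ → E → ℝ) : Prop where
  mN : ∀ κ, Measurable (uncurry (N κ))
  mV : ∀ κ, Measurable (uncurry (V κ))
  sN : ∀ s, Sob n lamT fun κ => N κ s
  sV : ∀ s, Sob n lam fun κ => V κ s
  bN : ∀ᵐ s ∂μ₊, hNorm (n - 1) lamT (fun κ => N κ s) ≤ m
  hm : m ≠ ⊤
  hV : vN A n V ≠ ⊤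

/-- Mollification at each time. -/
def mollT (η : E → ℝ) (γ : ℝ) (V : MIdx → ℝ → E → ℝ) (κ : MIdx) (s : ℝ) : E → ℝ := moll η γ (fun κ => V κ s) κ

lemma measurable_mollT (hη : IsMollifier η) (hγ : 0 < γ) {V : MIdx → ℝ → E → ℝ} (hV : ∀ κ, Measurable (uncurry (V κ)))
    (κ : MIdx) : Measurable (uncurry (mollT η γ V κ)) :=
  measurable_cv_param (k := fun _ => mollK η γ) ((isTest_mollK hη hγ).continuous.measurable.comp measurable_snd) (hV κ)

lemma exists_ctx_moll : ∃ C : ℝ≥0∞, C ≠ ⊤ ∧ ∀ η : E → ℝ, IsMollifier η → ∀ γ : ℝ, 0 < γ → γ ≤ 1 → ∀ (n : ℕ) (A : ℝ) (m : ℝ≥0∞)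
    (N V : MIdx → ℝ → E → ℝ), Ctx n A m N V →
    Ctx n A (C * m) (mollT η γ N) V ∧ Ctx n A m N (mollT η γ V) ∧ vN A n (mollT η γ V) ≤ C * vN A n V := by
  obtain ⟨C₁, -, h1, hb1⟩ := exists_moll isWt_lam
  obtain ⟨C₂, -, h2, hb2⟩ := exists_moll isWt_lamT
  refine ⟨C₁ + C₂, by finiteness, fun η hη γ hγ hγ1 n A m N V h => ?_⟩
  have hv : vN A n (mollT η γ V) ≤ (C₁ + C₂) * vN A n V := by
    refine (yN_mono fun s => (hb1 η hη γ hγ hγ1 n _ (h.sV s)).2).trans ((yN_const_mul (measurable_hNorm isWt_lam h.mV) _).le.trans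
      (mul_le_mul' le_self_add le_rfl))
  have h12 : C₁ + C₂ ≠ ⊤ := by finiteness
  refine ⟨⟨measurable_mollT hη hγ h.mN, h.mV, fun s => (hb2 η hη γ hγ hγ1 n _ (h.sN s)).1, h.sV, ?_, mul_ne_top h12 h.hm, h.hV⟩,
    ⟨h.mN, measurable_mollT hη hγ h.mV, h.sN, fun s => (hb1 η hη γ hγ hγ1 n _ (h.sV s)).1, h.bN, h.hm,
      ne_top_of_le_ne_top (mul_ne_top h12 h.hV) hv⟩, hv⟩
  filter_upwards [h.bN] with s hs
  exact ((hb2 η hη γ hγ hγ1 (n - 1) _ ((h.sN s).mono (Nat.sub_le _ _) fun _ => le_rfl)).2.trans (mul_le_mul' le_add_self hs))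

lemma exists_adm : ∃ C : ℝ≥0∞, C ≠ ⊤ ∧ ∀ n : ℕ, 12 ≤ n → ∀ (A : ℝ) (m : ℝ≥0∞) (N V : MIdx → ℝ → E → ℝ), Ctx n A m N V → ∀ κ b : MIdx,
    κ.abs ≤ n - 1 → b.abs ≤ n → κ.abs + b.abs ≤ n → Adm A (N κ) (V b) (C * m) (fun s => C * hNorm n lam fun α => V α s) ∧
    Ext 2 (V 0) (fun s => C * hNorm n lam fun α => V α s) := by
  obtain ⟨C, h1, hC, hp⟩ := exists_pair
  refine ⟨C, hC, fun n hn A m N V h κ b hκ hb hκb => ⟨⟨h.mN κ, h.mV b, (measurable_hNorm isWt_lam h.mV).const_mul _, ?_,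
    mul_ne_top hC h.hm, ?_⟩, fun _ => ⟨V, n, by omega, h.mV, h.sV, rfl, fun s => le_mul_of_one_le_left' h1⟩⟩⟩
  · filter_upwards [h.bN] with s hs
    exact hp n hn _ _ κ b ((h.sN s).mono (Nat.sub_le _ _) fun _ => le_rfl) (h.sV s) hκ hb hκb m _ hs le_rfl
  · rw [yN_const_mul (measurable_hNorm isWt_lam h.mV)]
    exact mul_ne_top hC h.hV

/-- The decomposition of the first argument of the forms. -/
structure Dec (A : ℝ) (X Z R : ℝ → E → ℝ) : Prop where
  mZ : Measurable (uncurry Z)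
  mR : Measurable (uncurry R)
  fZ : xN A (fun _ => 1) (fun t v => ‖lam v * Z t v‖ₑ) ≠ ⊤
  fR : xN A q3 (fun t v => ‖R t v‖ₑ) ≠ ⊤
  eq : ∀ᵐ p ∂timeSpace, X p.1 p.2 = lam p.2 * Z p.1 p.2 + R p.1 p.2

lemma Good.mono {b b' : ℝ≥0∞} {F : ℝ × E → ℝ → ℝ} (h : Good A ε X b F) (hb : b ≤ b') : Good A ε X b' F :=
  ⟨h.inner, h.outer, h.bound.trans hb⟩

lemma exists_good : ∃ K : ℝ≥0∞, K ≠ ⊤ ∧ ∀ η : E → ℝ, IsMollifier η → ∀ γ : ℝ, 0 < γ → γ ≤ 1 → ∀ n : ℕ, 12 ≤ n → ∀ A ε : ℝ, 0 < A → 0 < ε →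
    ∀ (m : ℝ≥0∞) (N V : MIdx → ℝ → E → ℝ), Ctx n A m N V → ∀ (ν : ℝ → E → ℝ) (u : MIdx → ℝ → E → ℝ), (∀ᵐ s ∂μ₊, ν s =ᵐ[volume] N 0 s) →
    (∀ α : MIdx, α.abs ≤ n → ∀ᵐ p ∂timeSpace, u α p.1 p.2 = V α p.1 p.2) →
    ∀ α β : MIdx, α.abs ≤ n → β < α → ∀ X Z R : ℝ → E → ℝ, Dec A X Z R →
    (∀ i j, Good A ε X (K * (m * ((zN A ε Z + xN A q3 fun t v => ‖R t v‖ₑ) * vN A n V))) fun p s => kInner η γ ε α β ν u i j p.1 p.2 s) ∧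
    ∀ j, Good A ε X (K * (m * ((zN A ε Z + xN A q3 fun t v => ‖R t v‖ₑ) * vN A n V))) fun p s => pInner η γ ε α β ν u j p.1 p.2 s := by
  obtain ⟨C₁, h1, hF⟩ := exists_formBdd
  obtain ⟨C₂, h2, hM⟩ := exists_ctx_moll
  obtain ⟨C₃, h3, hA⟩ := exists_adm
  refine ⟨3 * (C₁ * C₃ * C₃ * C₂), by finiteness, fun η hη γ hγ hγ1 n hn A ε hA0 hε m N V h ν u hν hu α β hα hβ X Z R hX => ?_⟩
  obtain ⟨cN, cV, hvV⟩ := hM η hη γ hγ hγ1 n A m N V h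
  set x := zN A ε Z + xN A q3 fun t v => ‖R t v‖ₑ
  have hy : ∀ {W}, Ctx n A m N W ∨ W = V → yN A (fun s => C₃ * hNorm n lam fun α => W α s) = C₃ * vN A n W := fun hW =>
    yN_const_mul (measurable_hNorm isWt_lam (by rcases hW with hW | rfl; exacts [hW.mV, h.mV])) _
  have hβα : β.abs + (α - β).abs = α.abs := by rw [← abs_add, add_tsub_cancel_of_le hβ.le]
  have hpos : 0 < (α - β).abs := by
    rcases Nat.eq_zero_or_pos (α - β).abs with h0 | h0
    · refine absurd (le_antisymm hβ.le fun i => ?_) hβ.ne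
      have := (Finset.sum_eq_zero_iff.1 h0) i (Finset.mem_univ i)
      exact tsub_eq_zero_iff_le.1 this
    · exact h0
  obtain ⟨l, hl, hl'⟩ := exists_unitM_le hpos
  generalize α - β - unitM l = μ at hl hl'
  have hνz : ∀ᵐ z ∂timeSpace, ν z.1 =ᵐ[volume] N 0 z.1 := quasiMeasurePreserving_fst.ae (p := fun s : ℝ => ν s =ᵐ[volume] N 0 s) hν
  have huz : ∀ᵐ z ∂timeSpace, u β z.1 =ᵐ[volume] V β z.1 :=
    quasiMeasurePreserving_fst.ae (p := fun s : ℝ => u β s =ᵐ[volume] V β s) (ae_ae_of_ae_prod (hu β (by omega)))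
  have hb1 : C₁ * (C₃ * m * (x * (C₃ * vN A n (mollT η γ V)))) ≤ C₁ * C₃ * C₃ * C₂ * (m * (x * vN A n V)) :=
    (mul_le_mul' le_rfl (mul_le_mul' le_rfl (mul_le_mul' le_rfl (mul_le_mul' le_rfl hvV)))).trans (le_of_eq (by ring))
  have hb2 : C₁ * (C₃ * (C₂ * m) * (x * (C₃ * vN A n V))) ≤ C₁ * C₃ * C₃ * C₂ * (m * (x * vN A n V)) := le_of_eq (by ring)
  constructor
  · intro i j
    obtain ⟨ad, -⟩ := hA n hn A m N _ cV μ (β + unitM j) (by omega) (by rw [abs_add, abs_unitM]; omega)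
      (by rw [abs_add, abs_unitM]; omega)
    have g := (hF i j l).1.good (Or.inl rfl) hA0 hε hX.mZ hX.mR ad (fun h => absurd h (by norm_num)) hX.fZ hX.fR hX.eq
    rw [hy (Or.inl cV)] at g
    refine (g.congr ?_).mono (hb1.trans (by rw [mul_assoc 3]; exact le_mul_of_one_le_left' (by norm_num)))
    filter_upwards [hνz, huz] with z hz hz' t ht
    rw [kInner, ← hl, mderiv_kernelK (h.sN z.1) hz (div_pos (by linarith) hε) i j l (by omega), mgrad_congr hz',
      mgrad_sob hη hγ ((h.sV z.1).mono le_rfl isWt_lam.low) (by omega) j, mul_comm]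
    rfl
  · intro j
    have hux := hu β (by omega)
    rw [mul_assoc 3]
    by_cases hn1 : (α - β).abs ≤ n - 1
    · obtain ⟨ad, -⟩ := hA n hn A _ _ V cN (α - β) β hn1 (by omega) (by omega)
      have g := Good.sum fun i => ((hF i j i).1.good (Or.inl rfl) hA0 hε hX.mZ hX.mR ad (fun h => absurd h (by norm_num)) hX.fZ hX.fR hX.eq)
      rw [hy (Or.inr rfl)] at g
      refine (g.congr ?_).mono (mul_le_mul' le_rfl hb2)
      filter_upwards [hνz, hux] with z hz hz' t ht
      rw [pInner, mderiv_kernelP hη hγ hγ1 (h.sN z.1) hz (div_pos (by linarith) hε) j (by omega), hz', mul_comm, mul_sum]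
      rfl
    · have hβ0 : β = 0 := funext fun i => (Finset.sum_eq_zero_iff.1 (by omega : β.abs = 0)) i (Finset.mem_univ i)
      subst hβ0
      obtain ⟨ad, ex⟩ := hA n hn A _ _ V cN μ 0 (by omega) (by simp) (by simp only [abs_zero_midx]; omega)
      have g := Good.sum fun i => ((hF i j l).2.good (Or.inr rfl) hA0 hε hX.mZ hX.mR ad ex hX.fZ hX.fR hX.eq)
      rw [hy (Or.inr rfl)] at g
      refine (g.congr ?_).mono (mul_le_mul' le_rfl hb2)
      filter_upwards [hνz, hux] with z hz hz' t ht
      rw [pInner, ← hl, mderiv_kernelP' hη hγ hγ1 (h.sN z.1) hz (div_pos (by linarith) hε) j l (by omega), hz', mul_comm, mul_sum]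
      rfl

lemma vN_eq (A : ℝ) (n : ℕ) (V : MIdx → ℝ → E → ℝ) : vN A n V = vNorm n A lam V := by
  simp only [vN, yN, l2, vNorm, mul_pow, ← ofReal_pow (exp_pos _).le, ← exp_nat_mul]
  congr 2 with t; congr 3; push_cast; ring

lemma vNorm_congr {U V : MIdx → ℝ → E → ℝ}
    (h : ∀ᵐ t ∂μ₊, ∀ α : MIdx, α.abs ≤ n → U α t =ᵐ[volume] V α t) : vNorm n A ν U = vNorm n A ν V := by
  rw [vNorm, vNorm, lintegral_congr_ae (h.mono fun t ht => by rw [hNorm_congr ht])]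

lemma vNorm_lt_top (u : SobV n A lam) {V : MIdx → ℝ → E → ℝ} (hV : ∀ α, Measurable (uncurry (V α)))
    (hu : ∀ᵐ t ∂μ₊, ∀ α : MIdx, α.abs ≤ n → u.D α t =ᵐ[volume] V α t) : vN A n V ≠ ⊤ := by
  have hl : ∀ v, 0 ≤ lam v := fun v => (lam_pos v).le
  obtain ⟨ψ, hψ, hlim⟩ := u.approx
  obtain ⟨k, hk⟩ := (hlim.eventually (gt_mem_nhds (zero_lt_one (α := ℝ≥0∞)))).exists
  choose Ψ hΨ1 hΨ2 hΨ3 using fun α : MIdx => exists_mderiv_slice (hψ k).1 (hψ k).2 α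
  simp_rw [hΨ3] at hk
  rw [vNorm_congr (V := fun α t v => V α t v - Ψ α (t, v)) (hu.mono fun t ht α hα => (ht α hα).mono fun v hv => by rw [hv]), ← vN_eq] at hk
  have hm : ∀ α, Measurable (uncurry fun t v => V α t v - Ψ α (t, v)) := fun α => (hV α).sub (hΨ1 α).continuous.measurable
  have hy : ∀ {g : ℝ → E → ℝ}, Measurable (uncurry g) → Measurable fun t => ofReal (exp (-(A / 2) * t)) * wl2 lam (g t) := fun hg =>
    Measurable.mul (by fun_prop) (measurable_wl2 continuous_lam hg)
  have hΨf : ∀ α, yN A (fun t => wl2 lam fun v => Ψ α (t, v)) ≠ ⊤ := fun α => by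
    have hc : Continuous fun p : ℝ × E => exp (-(A / 2) * p.1) * √(lam p.2) * Ψ α p := by
      have := continuous_lam
      have := (hΨ1 α).continuous
      fun_prop
    have hc2 : Integrable fun p : ℝ × E => (exp (-(A / 2) * p.1) * √(lam p.2) * Ψ α p) ^ 2 :=
      (hc.pow 2).integrable_of_hasCompactSupport ((hΨ2 α).mono fun p hp h0 => hp (by simp [h0]))
    have e : yN A (fun t => wl2 lam fun v => Ψ α (t, v)) = l2 timeSpace fun p => ‖exp (-(A / 2) * p.1) * √(lam p.2) * Ψ α p‖ₑ := by
      refine Eq.trans ?_ (l2_prod (μ := μ₊) (ν := (volume : Measure E))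
        (f := fun t v => ‖exp (-(A / 2) * t) * √(lam v) * Ψ α (t, v)‖ₑ) hc.measurable.enorm.aemeasurable)
      unfold yN wl2
      congr 1 with t
      rw [← l2_const_mul (f := fun v => ofReal (√(lam v)) * ‖Ψ α (t, v)‖ₑ) ((measurable_ofReal_sqrt continuous_lam).mul
        ((hΨ1 α).continuous.measurable.comp measurable_prodMk_left).enorm).aemeasurable]
      congr 1 with v
      rw [enorm_mul, enorm_mul, enorm_of_nonneg (exp_pos _).le, enorm_of_nonneg (sqrt_nonneg _), mul_assoc]
    rw [e, l2]
    refine (rpow_lt_top_of_nonneg (by norm_num) (ne_top_of_le_ne_top hc2.2.ne ?_)).ne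
    simp_rw [← enorm_pow]
    refine lintegral_mono' ?_ le_rfl
    rw [timeSpace, volume_eq_prod]
    exact Measure.prod_mono Measure.restrict_le_self le_rfl
  have hα : ∀ α : MIdx, α.abs ≤ n → yN A (fun t => wl2 lam (V α t)) ≠ ⊤ := fun α hα => by
    refine ne_top_of_le_ne_top (add_ne_top.2 ⟨(hk.trans one_lt_top).ne, hΨf α⟩) (le_trans (l2_mono fun t => ?_)
      ((l2_add_le (hy (hm α)).aemeasurable (hy (g := fun t v => Ψ α (t, v)) (hΨ1 α).continuous.measurable).aemeasurable).trans
        (add_le_add_left (yN_mono fun t => wl2_le_hNorm hl (fun α v => V α t v - Ψ α (t, v)) hα) _)))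
    rw [← mul_add]
    exact mul_le_mul' le_rfl (wl2_le_add continuous_lam ((hV α).comp measurable_prodMk_left).aemeasurable
      ((hΨ1 α).continuous.measurable.comp measurable_prodMk_left).aemeasurable)
  have e : vN A n V ^ 2 = ∑ α ∈ midxLE n, yN A (fun t => wl2 lam (V α t)) ^ 2 := by
    simp only [vN, yN, l2_sq]
    rw [← lintegral_finsetSum _ fun α _ => (hy (hV α)).pow_const 2]
    refine lintegral_congr fun t => ?_
    simp only [mul_pow, hNorm_sq n hl, mul_sum]
  have h2 : vN A n V ^ 2 ≠ ⊤ := e ▸ sum_ne_top.2 fun α h => ENNReal.pow_ne_top (hα α (mem_midxLE.1 h))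
  exact fun h => h2 (by rw [h]; rfl)

lemma ae_timeSpace_of_slices {F G : ℝ → E → ℝ} (hF : AEStronglyMeasurable (uncurry F) timeSpace) (hG : Measurable (uncurry G))
    (h : ∀ᵐ t ∂μ₊, F t =ᵐ[volume] G t) : ∀ᵐ p ∂timeSpace, F p.1 p.2 = G p.1 p.2 := by
  have h1 := hF.ae_eq_mk
  refine Filter.EventuallyEq.trans (f := uncurry F) (h := uncurry G) h1 ?_
  have hs := measurableSet_eq_fun hF.stronglyMeasurable_mk.measurable hG
  refine (Measure.ae_prod_iff_ae_ae (μ := μ₊) (ν := (volume : Measure E)) hs).2 ?_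
  filter_upwards [h, ae_ae_of_ae_prod h1] with t h2 h3
  filter_upwards [h2, h3] with v h4 h5
  exact h5.symm.trans h4

lemma dissipation_nonneg (η : E → ℝ) (γ ε A : ℝ) (α : MIdx) (u : MIdx → ℝ → E → ℝ) : 0 ≤ dissipation η γ ε A α u :=
  integral_nonneg fun _ => integral_nonneg fun v => mul_nonneg (B₁_nonneg _ _ _) (lam_pos v).le

/-- A density with a representative of its derivatives. -/
structure Dens (n : ℕ) (m : ℝ≥0∞) (ν : ℝ → E → ℝ) (N : MIdx → ℝ → E → ℝ) : Prop where
  mN : ∀ κ, Measurable (uncurry (N κ))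
  sN : ∀ s, Sob n lamT fun κ => N κ s
  bN : ∀ᵐ s ∂μ₊, hNorm (n - 1) lamT (fun κ => N κ s) ≤ m
  hm : m ≠ ⊤
  eq : ∀ᵐ s ∂μ₊, ν s =ᵐ[volume] N 0 s

lemma zN_le {u : MIdx → ℝ → E → ℝ} {Z : Fin 3 → ℝ → E → ℝ} (hε : 0 < ε) (hA : 0 < A)
    (hZ : ∀ i, Measurable (uncurry (Z i))) (hZu : ∀ i, ∀ᵐ t ∂μ₊, Z i t = mgrad η γ i (u α t))
    (hfin : ∀ i, xN A (fun _ => 1) (fun t v => ‖lam v * Z i t v‖ₑ) ≠ ⊤) :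
    ∀ i, zN A ε (Z i) ≤ ofReal (√(dissipation η γ ε A α u)) := by
  have hd : ∀ g : ℝ → ℝ, l2 μ₊ (fun t => ofReal (exp (-(A / 2) * t)) * ‖g t‖ₑ) ^ 2 = dampE (A / 2) g := fun g => by
    rw [l2_sq, dampE]
    refine lintegral_congr fun t => ?_
    rw [mul_pow, ← ofReal_pow (exp_pos _).le, ← exp_nat_mul]
    congr 3; push_cast; ring
  have hf : ∀ i, ∫⁻ v, ofReal (lam v) * dampE (A / 2) (fun t => Z i t v) < ⊤ := fun i => by
    have h := hfin i
    rw [enorm_lam_mul, ← lt_top_iff_ne_top] at h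
    have h2 := pow_lt_top (n := 2) h
    rw [xN_lam_sq measurable_const (fun _ => one_pos) (Z := fun t v => ‖Z i t v‖ₑ) (hZ i).enorm] at h2
    simpa only [hd, one_pow, inv_one, mul_one] using h2
  have h1 := timeAvg_le_dissipation hε hA hZ hZu hf
  intro i
  rw [← pow_le_pow_left_iff two_ne_zero, ← ofReal_pow (sqrt_nonneg _), sq_sqrt (dissipation_nonneg _ _ _ _ _ _), zN, enorm_lam_mul,
    xN_lam_sq measurable_q3 q3_pos (Z := fun t v => ‖timeAvg A ((1 + ‖v‖) / ε) (fun t => Z i t v) t‖ₑ) (measurable_timeAvg (hZ i) A ε).enorm]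
  refine le_trans (le_of_eq (lintegral_congr fun v => ?_)) (h1 i)
  rw [hd, q3, mul_pow, sq_sqrt (by positivity), ← pow_succ]

lemma exists_Q_le (hη : IsMollifier η) : ∃ K : ℝ, 0 ≤ K ∧ ∀ n : ℕ, 12 ≤ n → ∀ A ε γ : ℝ, 0 < A → 0 < ε → 0 < γ → γ ≤ 1 →
    ∀ (m : ℝ≥0∞) (ν : ℝ → E → ℝ) (N : MIdx → ℝ → E → ℝ), Dens n m ν N → ∀ (u : SobV n A lam) (α β : MIdx), α.abs ≤ n → β < α →
    QConverges η γ ε A α β ν u.D ∧ |Q η γ ε A α β ν u.D| ≤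
      K * (m.toReal * ((√(dissipation η γ ε A α u.D) + K * (vNorm n A lam u.D).toReal) * (vNorm n A lam u.D).toReal)) := by
  obtain ⟨K, hK, hG⟩ := exists_good
  obtain ⟨C, hC, hcomm⟩ := exists_commutator hη
  refine ⟨12 * K.toReal + C.toReal, by positivity, fun n hn A ε γ hA hε hγ hγ1 m ν N hN u α β hα hβ => ?_⟩
  obtain ⟨V, hVm, hVs, hVu⟩ := SobV.rep isWt_lam u
  have hVf := vNorm_lt_top u hVm hVu
  choose Z R hZm hRm hZe hXe hZf hRb using fun i => hcomm γ hγ hγ1 i A n V hVm hVs hVf α hα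
  have hVα : ∀ᵐ t ∂μ₊, u.D α t =ᵐ[volume] V α t := hVu.mono fun t ht => ht α hα
  have hz := zN_le (α := α) (u := u.D) hε hA hZm (fun i => hVα.mono fun t ht => by rw [hZe, mgrad_congr ht]) hZf
  have hUV : vN A n V = vNorm n A lam u.D := by rw [vN_eq, vNorm_congr hVu]
  set D := dissipation η γ ε A α u.D
  set U := (vNorm n A lam u.D).toReal with hU
  have hUe : vN A n V = ofReal U := by rw [hU, ofReal_toReal (hUV ▸ hVf), hUV]
  set b : ℝ := K.toReal * (m.toReal * ((√D + C.toReal * U) * U)) with hb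
  have hU0 : 0 ≤ U := toReal_nonneg
  have hb0 : 0 ≤ b := by positivity
  set X : Fin 3 → ℝ → E → ℝ := fun i t => mgrad η γ i fun w => u.D α t w * lam w with hX
  have hdec : ∀ i, Dec A (X i) (Z i) (R i) := fun i => ⟨hZm i, hRm i, hZf i,
    ne_top_of_le_ne_top (mul_ne_top hC hVf) (hRb i), by
    refine (quasiMeasurePreserving_fst.ae (p := fun t : ℝ => u.D α t =ᵐ[volume] V α t) hVα).mono fun p hp => ?_
    rw [← hXe, hX]
    exact congrFun (mgrad_congr (hp.mono fun w hw => by rw [hw])) p.2⟩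
  have hle : ∀ i, K * (m * ((zN A ε (Z i) + xN A q3 fun t v => ‖R i t v‖ₑ) * vN A n V)) ≤ ofReal b := fun i => by
    rw [hb, ofReal_mul toReal_nonneg, ofReal_mul toReal_nonneg, ofReal_mul (by positivity),
      ofReal_add (sqrt_nonneg _) (by positivity), ofReal_mul toReal_nonneg, ofReal_toReal hK,
      ofReal_toReal hN.hm, ofReal_toReal hC, ← hUe]
    gcongr
    exacts [hz i, hRb i]
  have hg := fun i => hG η hη γ hγ hγ1 n hn A ε hA hε m N V ⟨hN.mN, hVm, hN.sN, hVs, hN.bN, hN.hm, hVf⟩ ν u.D hN.eq (fun κ hκ =>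
    ae_timeSpace_of_slices (u.measurable κ hκ) (hVm κ) (hVu.mono fun t ht => ht κ hκ)) α β hα hβ (X i) (Z i) (R i) (hdec i)
  have hk : ∀ i j, Good A ε (X i) (ofReal b) fun p s => kInner η γ ε α β ν u.D i j p.1 p.2 s := fun i j => ((hg i).1 i j).mono (hle i)
  have hp : ∀ j, Good A ε (X j) (ofReal b) fun p s => pInner η γ ε α β ν u.D j p.1 p.2 s := fun j => ((hg j).2 j).mono (hle j)
  have ek : kTerm η γ ε A α β ν u.D = fun p => ∑ i, ∑ j, exp (-A * p.1) / ε * (X i p.1 p.2 *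
      ∫ s in (0 : ℝ)..p.1, kInner η γ ε α β ν u.D i j p.1 p.2 s) := by
    funext p; simp only [kTerm, mul_sum, hX]
  have ep : pTerm η γ ε A α β ν u.D = fun p => ∑ j, exp (-A * p.1) / ε * (X j p.1 p.2 *
      ∫ s in (0 : ℝ)..p.1, pInner η γ ε α β ν u.D j p.1 p.2 s) := by
    funext p; simp only [pTerm, mul_sum, hX]
  have habs : ∀ {F : ℝ × E → ℝ → ℝ} {i}, Good A ε (X i) (ofReal b) F →
      |∫ p, exp (-A * p.1) / ε * (X i p.1 p.2 * ∫ s in (0 : ℝ)..p.1, F p s) ∂timeSpace| ≤ b := fun h => by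
    have := h.bound
    rw [Real.enorm_eq_ofReal_abs] at this
    exact (ENNReal.ofReal_le_ofReal_iff hb0).1 this
  refine ⟨⟨ae_all_iff.2 fun i => ae_all_iff.2 fun j => (hk i j).inner, ae_all_iff.2 fun j => (hp j).inner, ?_, ?_⟩, ?_⟩
  · rw [ek]; exact integrable_finsetSum _ fun i _ => integrable_finsetSum _ fun j _ => (hk i j).outer
  · rw [ep]; exact integrable_finsetSum _ fun j _ => (hp j).outer
  · have h1 : |Q η γ ε A α β ν u.D| ≤ 12 * b := by
      rw [Q, ek, ep, integral_finsetSum _ fun i _ => integrable_finsetSum _ fun j _ => (hk i j).outer,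
        integral_finsetSum _ fun j _ => (hp j).outer]
      simp_rw [fun i => integral_finsetSum Finset.univ fun j _ => (hk i j).outer]
      refine (abs_sub _ _).trans ((add_le_add ((Finset.abs_sum_le_sum_abs _ _).trans (sum_le_sum fun i _ =>
        (Finset.abs_sum_le_sum_abs _ _).trans (sum_le_sum fun j _ => habs (hk i j)))) ((Finset.abs_sum_le_sum_abs _ _).trans
          (sum_le_sum fun j _ => habs (hp j)))).trans (le_of_eq ?_))
      simp; ring
    have hK0 : 0 ≤ K.toReal := toReal_nonneg
    have hC0 : 0 ≤ C.toReal := toReal_nonneg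
    have hm0 : 0 ≤ m.toReal := toReal_nonneg
    calc _ ≤ 12 * K.toReal * (m.toReal * ((√D + C.toReal * U) * U)) := h1.trans (le_of_eq (by rw [hb]; ring))
      _ ≤ _ := by gcongr <;> linarith

lemma lamT_le_lam (v : E) : lamT v ≤ lam v := isWt_lam.low v

lemma SobH.dens {M : ℝ} (u₀ : SobH n lam) (h : hNorm n lam u₀.D ≤ ofReal M) : ∃ N, Dens n (ofReal M) (fun _ => u₀.D 0) N := by
  obtain ⟨V, hm, hS, he⟩ := SobH.rep isWt_lam u₀
  refine ⟨fun κ _ => V κ, fun κ => (hm κ).comp measurable_snd, fun _ => hS.mono le_rfl lamT_le_lam, of_forall fun s => ?_,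
    ofReal_ne_top, of_forall fun s => he 0 (by simp)⟩
  refine (hNorm_mono (Nat.sub_le n 1) (fun v => (lamT_pos v).le) _).trans (le_trans ?_ h)
  rw [hNorm_congr he, ← pow_le_pow_left_iff two_ne_zero, hNorm_sq n fun v => (lamT_pos v).le, hNorm_sq n fun v => (lam_pos v).le]
  gcongr
  exact wl2_mono lamT_le_lam _

lemma exists_dens_of_mem_Omega (hn : 12 ≤ n) : ∃ m : ℝ≥0∞, m ≠ ⊤ ∧ ∀ A δ Rt δ₁ R ε : ℝ, 1 ≤ A → 0 < δ₁ → δ₁ ≤ 1 / A →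
    ∀ f ∈ Omega n A δ Rt δ₁ R ε, ∃ N, Dens n m (f.D 0) N := by
  obtain ⟨K, hK, hb⟩ := ae_hNorm_le
  refine ⟨((midxLE (n - 1)).card * (K * ofReal (exp 2))) ^ (1 / 2 : ℝ), ENNReal.rpow_ne_top_of_nonneg (by norm_num) (by finiteness),
    fun A δ Rt δ₁ R ε hA hδ hδA f hf => ?_⟩
  obtain ⟨⟨-, hsupp⟩, ⟨g, hd, hfg, -⟩, -, -⟩ := hf
  obtain ⟨N, hNm, hNs, hNe⟩ := SobV.rep isWt_lamT f
  obtain ⟨W, hWm, hWs, hWe⟩ := SobV.rep isWt_lamT g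
  have e1 := ae_timeSpace_of_slices (f.measurable 0 (by simp)) (hNm 0) (hNe.mono fun t ht => ht 0 (by simp))
  have e2 := ae_timeSpace_of_slices (g.measurable 0 (by simp)) (hWm 0) (hWe.mono fun t ht => ht 0 (by simp))
  have h0 : ∀ᵐ t, 2 * δ₁ < t → N 0 t =ᵐ[volume] 0 := by
    have h1 : ∀ᵐ p ∂timeSpace, 2 * δ₁ < p.1 → N 0 p.1 p.2 = 0 := by
      filter_upwards [hsupp, e1] with p hp hp1 hlt
      rw [← hp1, hp hlt]
    have h2 := (ae_restrict_iff' measurableSet_Ioi).1 (ae_ae_of_ae_prod h1)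
    filter_upwards [h2] with t ht hlt
    filter_upwards [ht (mem_Ioi.2 (by linarith))] with v hv using hv hlt
  have hd' : IsTimeDeriv (N 0) (W 0) := fun ψ h1 h2 h3 => by
    have := hd ψ h1 h2 h3
    exact (integral_congr_ae (e1.mono fun p hp => by beta_reduce; rw [hp])).symm.trans (this.trans (congrArg _
      (integral_congr_ae (e2.mono fun p hp => by beta_reduce; rw [hp]))))
  have hle := hb n (by omega) A (2 * δ₁) (by linarith) (by linarith) N W hNm hWm hNs hWs
    ((vNorm_congr hNe).symm.trans_le (le_self_add.trans hfg)) ((vNorm_congr hWe).symm.trans_le (le_add_self.trans hfg)) hd' h0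
  refine ⟨N, hNm, hNs, ?_, ENNReal.rpow_ne_top_of_nonneg (by norm_num) (by finiteness), hNe.mono fun t ht => ht 0 (by simp)⟩
  filter_upwards [ae_restrict_of_ae hle, ae_restrict_mem measurableSet_Ioi] with t ht ht0
  rw [← pow_le_pow_left_iff two_ne_zero, rpow_half_sq]
  refine (ht ht0).trans ?_
  gcongr
  rw [le_div_iff₀ (by linarith)] at hδA
  linarith

lemma le_of_mul_sqrt {P D U : ℝ} (hc : 0 < c) (hD : 0 ≤ D) : P * ((√D + K * U) * U) ≤ c * D + (P ^ 2 / (4 * c) + P * K) * U ^ 2 := by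
  have h := sq_sqrt hD
  have : 0 ≤ (2 * c * √D - P * U) ^ 2 / (4 * c) := by positivity
  have e : (2 * c * √D - P * U) ^ 2 / (4 * c) = c * √D ^ 2 - P * √D * U + P ^ 2 / (4 * c) * U ^ 2 := by field_simp; ring
  rw [e, h] at this
  linarith

/-- The sum of the binomial coefficients in the estimates. -/
def binomSum (n : ℕ) : ℝ := ∑ α ∈ midxLE n, ∑ β ∈ Finset.Iio α, (α.binom β : ℝ)

lemma exists_sum_Q_le (hη : IsMollifier η) (hn : 12 ≤ n) (hc : 0 < c) {m : ℝ≥0∞} : ∃ C : ℝ, 0 ≤ C ∧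
    ∀ A ε γ : ℝ, 0 < A → 0 < ε → 0 < γ → γ ≤ 1 → ∀ (ν : ℝ → E → ℝ) (N : MIdx → ℝ → E → ℝ), Dens n m ν N → ∀ (u : SobV n A lam) (α : MIdx),
    α.abs ≤ n → (∀ β < α, QConverges η γ ε A α β ν u.D) ∧ ∀ C', C ≤ C' → ∑ β ∈ Finset.Iio α, (α.binom β : ℝ) * |Q η γ ε A α β ν u.D|
      ≤ c * dissipation η γ ε A α u.D + C' * (vNorm n A lam u.D).toReal ^ 2 := by
  obtain ⟨K, hK, h⟩ := exists_Q_le hη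
  set P := binomSum n * K * m.toReal
  have hm : 0 ≤ m.toReal := toReal_nonneg
  have hB : 0 ≤ binomSum n := by unfold binomSum; positivity
  refine ⟨P ^ 2 / (4 * c) + P * K + c, by positivity, fun A ε γ hA hε hγ hγ1 ν N hN u α hα =>
    ⟨fun β hβ => (h n hn A ε γ hA hε hγ hγ1 m ν N hN u α β hα hβ).1, fun C' hC' => ?_⟩⟩
  have hD := dissipation_nonneg η γ ε A α u.D
  set D := dissipation η γ ε A α u.D
  set U := (vNorm n A lam u.D).toReal
  have hU : 0 ≤ U := toReal_nonneg
  calc _ ≤ ∑ β ∈ Finset.Iio α, (α.binom β : ℝ) * (K * (m.toReal * ((√D + K * U) * U))) := by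
        refine sum_le_sum fun β hβ => mul_le_mul_of_nonneg_left ?_ (by positivity)
        exact (h n hn A ε γ hA hε hγ hγ1 m ν N hN u α β hα (Finset.mem_Iio.1 hβ)).2
    _ = (∑ β ∈ Finset.Iio α, (α.binom β : ℝ)) * (K * (m.toReal * ((√D + K * U) * U))) := (sum_mul _ _ _).symm
    _ ≤ binomSum n * (K * (m.toReal * ((√D + K * U) * U))) := by
        gcongr
        exact single_le_sum (f := fun α : MIdx => ∑ β ∈ Finset.Iio α, (α.binom β : ℝ)) (fun _ _ => by positivity) (mem_midxLE.2 hα)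
    _ = P * ((√D + K * U) * U) := by ring
    _ ≤ _ := (le_of_mul_sqrt hc hD).trans (by gcongr; linarith)

end WeakCoupling

end

theorem mainTheorem3 (η : E → ℝ) (hη : IsMollifier η) (n : ℕ) (hn : 12 ≤ n)
    (c : ℝ) (hc : 0 < c) (M : ℝ) (hM : 0 < M) :
    ∃ C : ℝ, 0 < C ∧ ∀ A : ℝ, 1 ≤ A →
      ∃ δ₀ : ℝ, 0 < δ₀ ∧ ∀ δ δ₁ : ℝ, 0 < δ → δ ≤ δ₀ → 0 < δ₁ → δ₁ ≤ δ₀ →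
        ∀ Rt R : ℝ, 0 < Rt → 0 < R →
          ∃ ε₀ : ℝ, 0 < ε₀ ∧ ∀ ε γ : ℝ, 0 < ε → ε ≤ ε₀ → 0 < γ → γ ≤ 1 →
            ∀ α : MIdx, α.abs ≤ n →
            ∀ u₀ : SobH n lam, hNorm n lam u₀.D ≤ ENNReal.ofReal M →
            ∀ f ∈ Omega n A δ Rt δ₁ R ε, ∀ u : SobV n A lam,
              (∀ β < α, QConverges η γ ε A α β (fun _ => u₀.D 0) u.D ∧
                QConverges η γ ε A α β (f.D 0) u.D) ∧
              ∑ β ∈ Finset.Iio α,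
                  (α.binom β : ℝ) * |Q η γ ε A α β (fun _ => u₀.D 0) u.D|
                ≤ c * dissipation η γ ε A α u.D + C * (vNorm n A lam u.D).toReal ^ 2 ∧
              ∑ β ∈ Finset.Iio α, (α.binom β : ℝ) * |Q η γ ε A α β (f.D 0) u.D|
                ≤ c * dissipation η γ ε A α u.D + C * (vNorm n A lam u.D).toReal ^ 2 := by
  obtain ⟨m, hm, hf⟩ := exists_dens_of_mem_Omega hn
  obtain ⟨C₁, h1, hC₁⟩ := exists_sum_Q_le hη hn hc (m := ENNReal.ofReal M)
  obtain ⟨C₂, h2, hC₂⟩ := exists_sum_Q_le hη hn hc (m := m)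
  refine ⟨C₁ + C₂ + 1, by linarith, fun A hA => ⟨1 / A, by positivity, fun δ δ₁ _ _ h4 h5 Rt R _ _ => ⟨1, one_pos,
    fun ε γ hε _ hγ hγ1 α hα u₀ hu₀ f hfΩ u => ?_⟩⟩⟩
  obtain ⟨N₀, hN₀⟩ := u₀.dens hu₀
  obtain ⟨N, hN⟩ := hf A δ Rt δ₁ R ε hA h4 h5 f hfΩ
  obtain ⟨a1, a2⟩ := hC₁ A ε γ (by linarith) hε hγ hγ1 _ N₀ hN₀ u α hα
  obtain ⟨b1, b2⟩ := hC₂ A ε γ (by linarith) hε hγ hγ1 _ N hN u α hα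
  exact ⟨fun β hβ => ⟨a1 β hβ, b1 β hβ⟩, a2 _ (by linarith), b2 _ (by linarith)⟩
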